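/- **Setting.** A signature of length $m$ is a tuple of integers $\lambda=(\lambda_1\ge\dots\ge\lambda_m)$; $\mathbb{GT}_m$ is the set of these, and $s_\lambda(x_1,\dots,x_m)=\det[x_i^{\lambda_j+m-j}]/\prod_{i<j}(x_i-x_j)$ is the Schur function. The Schur generating function of a probability measure $\rho$ on $\mathbb{GT}_m$ is $S_\rho(x)=\sum_{\lambda}\rho(\lambda)\,s_\lambda(x)/s_\lambda(1^m)$; it is assumed that this series converges uniformly in an open neighbourhood of $(1^m)=(1,\dots,1)$. Let $m_N\to\infty$. A sequence of symmetric functions $F_N$ of $m_N$ variables is *appropriate* if there are reals $\mathbf c_k,\mathbf d_{k,l}$ ($k,l\ge1$) such that (i) $F_N$ does not vanish and $\log F_N$ is holomorphic in a neighbourhood of $(1^{m_N})$ for every $N$; (ii) $\frac1{m_N}\partial_i^k\log F_N\big|_{x=1}\to\mathbf c_k$ for every fixed index $i$ and $k\ge1$; (iii) $\partial_i^k\partial_j^l\log F_N\big|_{x=1}\to\mathbf d_{k,l}$ for all fixed $i\ne j$ and $k,l\ge1$; (iv) $\partial_{i_1}\cdots\partial_{i_s}\log F_N\big|_{x=1}\to0$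 for all fixed $i_1,\dots,i_s$ with at least three distinct values among them; (v) the series $$F(x)=\sum_{k\ge1}\frac{\mathbf c_k}{(k-1)!}(x-1)^{k-1},\qquad G(x,y)=\sum_{k,l\ge1}\frac{\mathbf d_{k,l}}{(k-1)!\,(l-1)!}(x-1)^{k-1}(y-1)^{l-1}$$ converge near $x=1$ and $(x,y)=(1,1)$. Put $Q(x,y)=G(1+x,1+y)+\frac1{(x-y)^2}$. A sequence of probability measures on $\mathbb{GT}_{m_N}$ is appropriate if its sequence of Schur generating functions is. Let $n\ge1$, let $0<a_1\le\dots\le a_n$ be reals, and write $[\,\cdot\,]$ for the integer part. For $t=1,\dots,n$ let $\{\rho^{(t)}_N\}_N$ be an appropriate sequence of probability measures, $\rho^{(t)}_N$ on $\mathbb{GT}_{[a_tN]}$, with Schur generating functions $g_t^{(N)}$. For $1\le r\le n-1$ the expansion, near $x=(1^{[a_rN]})$, $$g_r^{(N)}(x)\,\frac{s_\lambda(x_1,\dots,x_{[a_rN]},1^{[a_{r+1}N]-[a_rN]})}{s_\lambda(1^{[a_{r+1}N]})}=\sum_{\mu\in\mathbb{GT}_{[a_rN]}}\mathrm{st}^{(N)}_r(\lambda\to\mu)\,\frac{s_\mu(x)}{s_\mu(1^{[a_rN]})},\qquad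 \lambda\in\mathbb{GT}_{[a_{r+1}N]},$$ determines coefficients $\mathrm{st}^{(N)}_r(\lambda\to\mu)$. Let $(\lambda^{(1)},\dots,\lambda^{(n)})\in\mathbb{GT}_{[a_1N]}\times\dots\times\mathbb{GT}_{[a_nN]}$ have the law $$\mathrm{Prob}(\lambda^{(1)},\dots,\lambda^{(n)})=\rho^{(n)}_N(\lambda^{(n)})\prod_{r=1}^{n-1}\mathrm{st}^{(N)}_r(\lambda^{(r+1)}\to\lambda^{(r)}),$$ put $p_{k;t}^{[a_tN]}=\sum_{i=1}^{[a_tN]}(\lambda^{(t)}_i+[a_tN]-i)^k$, and let $H^{(N)}_n=g^{(N)}_n$, $H^{(N)}_t(x)=H^{(N)}_{t+1}(x,1^{[a_{t+1}N]-[a_tN]})\,g^{(N)}_t(x)$ for $t<n$. **Theorem 2.6.** For every $r$, $N$ and $\lambda$ the coefficients $\mathrm{st}^{(N)}_r(\lambda\to\cdot)$ exist and form a probability distribution, so that $\mathrm{Prob}$ is a probability measure; and for every $t$ the sequence $\{H_t^{(N)}\}_N$ of functions of $[a_tN]$ variables is appropriate. Let $F_{\rho,(t)}$ and $Q_{\rho,(t)}$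 be its limit functions $F$ and $Q$. Then the collection $$\Big\{N^{-k}\big(p_{k;t}^{[a_tN]}-\mathbf E\,p_{k;t}^{[a_tN]}\big)\Big\}_{t=1,\dots,n;\;k\ge1}$$ converges, as $N\to\infty$, in the sense of moments (all mixed moments are finite and converge) to a Gaussian vector with zero mean and the covariance $$\lim_{N\to\infty}\frac{\mathrm{cov}\big(p_{k_1;t_1}^{[a_{t_1}N]},p_{k_2;t_2}^{[a_{t_2}N]}\big)}{N^{k_1+k_2}}=\frac{a_{t_1}^{k_1}a_{t_2}^{k_2}}{(2\pi\mathbf i)^2}\oint_{|z|=\epsilon}\oint_{|w|=2\epsilon}\Big(\frac1z+1+(1+z)F_{\rho,(t_1)}(1+z)\Big)^{k_1}\Big(\frac1w+1+(1+w)F_{\rho,(t_2)}(1+w)\Big)^{k_2}Q_{\rho,(t_2)}(z,w)\,dz\,dw$$ for all $1\le t_1\le t_2\le n$, $k_1,k_2\ge1$ and all sufficiently small $\epsilon>0$, with counter-clockwise contours. -/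

import Mathlib

open MeasureTheory ProbabilityTheory Filter Topology

noncomputable section

namespace SchurCLT

/-! ### Signatures and Schur functions -/

/-- Signatures of length `N`: weakly decreasing `N`-tuples of integers (the coordinate `λ_{i+1}` of
the mathematics is `l i`, `i = 0, …, N - 1`). -/
abbrev Signature (N : ℕ) : Type := {l : Fin N → ℤ // Antitone l}

/-- The alternant `det [x_i ^ (α_j)]` as a polynomial. -/
def alternant {N : ℕ} (α : Fin N → ℕ) : MvPolynomial (Fin N) ℂ :=
  (Matrix.of fun i j => (MvPolynomial.X i : MvPolynomial (Fin N) ℂ) ^ α j).det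

/-- The Vandermonde product `∏_{i < j} (x_i - x_j)` as a polynomial. -/
def vandermondePoly (N : ℕ) : MvPolynomial (Fin N) ℂ :=
  ∏ p : Fin N × Fin N with p.1 < p.2, (MvPolynomial.X p.1 - MvPolynomial.X p.2)

/-- Substitution of `x_j` for `x_i`. -/
def substHom {N : ℕ} (i j : Fin N) : MvPolynomial (Fin N) ℂ →ₐ[ℂ] MvPolynomial (Fin N) ℂ :=
  MvPolynomial.aeval fun k => MvPolynomial.X (if k = i then j else k)

theorem dvd_iff_substHom {N : ℕ} (i j : Fin N) (q : MvPolynomial (Fin N) ℂ) :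
    (MvPolynomial.X i - MvPolynomial.X j) ∣ q ↔ substHom i j q = 0 := by
  constructor
  · rintro ⟨r, rfl⟩
    by_cases h : j = i <;> simp [substHom, h]
  · intro h
    rw [← Ideal.mem_span_singleton, ← Ideal.Quotient.eq_zero_iff_mem]
    set I := Ideal.span {(MvPolynomial.X i - MvPolynomial.X j : MvPolynomial (Fin N) ℂ)}
    have key : (Ideal.Quotient.mkₐ ℂ I).comp (substHom i j) = Ideal.Quotient.mkₐ ℂ I := by
      apply MvPolynomial.algHom_ext
      intro k
      by_cases hk : k = i
      · subst hk
        simp only [substHom, AlgHom.comp_apply, MvPolynomial.aeval_X, if_true]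
        symm
        rw [Ideal.Quotient.mkₐ_eq_mk, Ideal.Quotient.eq]
        exact Ideal.mem_span_singleton_self _
      · simp [substHom, hk]
    have h2 := congrArg (fun f => f q) key
    simp only [AlgHom.comp_apply, h, map_zero] at h2
    exact h2.symm

theorem prime_X_sub_X {N : ℕ} {i j : Fin N} (hij : i ≠ j) :
    Prime (MvPolynomial.X i - MvPolynomial.X j : MvPolynomial (Fin N) ℂ) := by
  refine ⟨?_, ?_, ?_⟩
  · rw [sub_ne_zero]
    exact fun h => hij (MvPolynomial.X_injective h)
  · intro h
    have h1 := (dvd_iff_substHom i j 1).1 h.dvd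
    simp at h1
  · intro a b h
    rw [dvd_iff_substHom, map_mul, mul_eq_zero] at h
    rwa [dvd_iff_substHom, dvd_iff_substHom]

theorem vandermondePoly_dvd_alternant {N : ℕ} (α : Fin N → ℕ) :
    vandermondePoly N ∣ alternant α := by
  unfold vandermondePoly
  apply Finset.prod_dvd_of_isRelPrime
  · rintro ⟨i, j⟩ hij ⟨k, l⟩ hkl hne
    simp only [Finset.coe_filter, Finset.mem_univ, true_and, Set.mem_ofPred_eq] at hij hkl
    rw [Function.onFun, (prime_X_sub_X hij.ne).irreducible.isRelPrime_iff_not_dvd,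
      dvd_iff_substHom]
    simp only [substHom, map_sub, MvPolynomial.aeval_X, sub_eq_zero]
    intro h
    have h := MvPolynomial.X_injective h
    apply hne
    rw [Prod.mk.injEq]
    split_ifs at h <;> (simp_all; try omega)
  · rintro ⟨i, j⟩ hij
    simp only [Finset.mem_filter, Finset.mem_univ, true_and] at hij
    rw [dvd_iff_substHom, alternant, AlgHom.map_det]
    apply Matrix.det_zero_of_row_eq hij.ne
    funext k
    simp [substHom, hij.ne']

/-- The polynomial `det [x_i ^ (α_j)] / ∏_{i < j} (x_i - x_j)`. -/
def alternantQuotient {N : ℕ} (α : Fin N → ℕ) : MvPolynomial (Fin N) ℂ :=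
  (vandermondePoly_dvd_alternant α).choose

theorem vandermondePoly_mul_alternantQuotient {N : ℕ} (α : Fin N → ℕ) :
    vandermondePoly N * alternantQuotient α = alternant α :=
  (vandermondePoly_dvd_alternant α).choose_spec.symm

/-- A nonnegative integer `K` with `λ_j + K ≥ 0` for all `j`. -/
def shift {N : ℕ} (l : Signature N) : ℕ := ∑ j, (l.1 j).natAbs

/-- The Schur function `s_λ(x_1, …, x_N)`, a symmetric Laurent polynomial. To make sense of
`det [x_i ^ (λ_j + N - j)] / ∏_{i < j} (x_i - x_j)` also where some variables coincide, the
division is carried out for polynomials, after multiplication of the numerator by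
`(x_1 ⋯ x_N) ^ K`. See `schur_mul_vandermonde`. -/
def schur {N : ℕ} (l : Signature N) (x : Fin N → ℂ) : ℂ :=
  (∏ i, x i) ^ (-(shift l : ℤ)) *
    MvPolynomial.eval x
      (alternantQuotient fun j => (l.1 j + shift l + ((N : ℤ) - 1 - (j : ℕ))).toNat)

/-- `s_λ(x) ∏_{i < j} (x_i - x_j) = det [x_i ^ (λ_j + N - j)]` for nonzero `x_1, …, x_N`. -/
theorem schur_mul_vandermonde {N : ℕ} (l : Signature N) (x : Fin N → ℂ) (hx : ∀ i, x i ≠ 0) :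
    schur l x * ∏ p : Fin N × Fin N with p.1 < p.2, (x p.1 - x p.2) =
      (Matrix.of fun i j => x i ^ (l.1 j + ((N : ℤ) - 1 - (j : ℕ)))).det := by
  have h := congrArg (MvPolynomial.eval x) (vandermondePoly_mul_alternantQuotient
    fun j => (l.1 j + shift l + ((N : ℤ) - 1 - (j : ℕ))).toNat)
  rw [map_mul, vandermondePoly, map_prod, alternant, RingHom.map_det] at h
  simp only [map_sub, MvPolynomial.eval_X] at h
  rw [schur, mul_assoc, mul_comm (MvPolynomial.eval x _), h, ← Finset.prod_zpow,
    ← Matrix.det_mul_column]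
  congr 1
  ext i j
  have hj : 0 ≤ l.1 j + shift l := by
    have h1 : (l.1 j).natAbs ≤ shift l :=
      Finset.single_le_sum (f := fun j => (l.1 j).natAbs) (fun _ _ => Nat.zero_le _)
        (Finset.mem_univ j)
    omega
  have hj2 := j.2
  simp only [RingHom.mapMatrix_apply, Matrix.map_apply, Matrix.of_apply, map_pow,
    MvPolynomial.eval_X]
  rw [← zpow_natCast, Int.toNat_of_nonneg (by omega), ← zpow_add₀ (hx i)]
  congr 1
  ring

/-- The point `(x_1, …, x_m, 1, …, 1)` with `M` coordinates. -/
def padOnes {m M : ℕ} (x : Fin m → ℂ) : Fin M → ℂ :=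
  fun i => if h : (i : ℕ) < m then x ⟨i, h⟩ else 1

/-! ### Schur generating functions -/

/-- The summand of the Schur generating function of the measure `ρ` that belongs to `λ`. -/
def schurTerm {N : ℕ} (ρ : PMF (Signature N)) (l : Signature N) (x : Fin N → ℂ) : ℂ :=
  ((ρ l).toReal : ℂ) * (schur l x / schur l 1)

/-- The Schur generating function `S_ρ(x) = ∑_λ ρ(λ) s_λ(x) / s_λ(1, …, 1)`. -/
def schurGen {N : ℕ} (ρ : PMF (Signature N)) (x : Fin N → ℂ) : ℂ := ∑' l, schurTerm ρ l x

/-- The series that defines the Schur generating function converges uniformly in an open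
neighbourhood of `(1, …, 1)`. -/
def SchurConvergent {N : ℕ} (ρ : PMF (Signature N)) : Prop :=
  ∃ U : Set (Fin N → ℂ), IsOpen U ∧ 1 ∈ U ∧ SummableUniformlyOn (schurTerm ρ) U

/-! ### Appropriate sequences -/

/-- The partial derivative `∂ f / ∂ x_i` (variables are numbered from `0`; it is `0` by convention
if there is no variable with number `i`). -/
def partialDeriv {m : ℕ} (i : ℕ) (f : (Fin m → ℂ) → ℂ) : (Fin m → ℂ) → ℂ :=
  fun x => lineDeriv ℂ f x fun j => if (j : ℕ) = i then 1 else 0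

/-- The iterated partial derivative `∂_{i_1} ⋯ ∂_{i_s} f`. -/
def mixedPartial {m : ℕ} (is : List ℕ) (f : (Fin m → ℂ) → ℂ) : (Fin m → ℂ) → ℂ :=
  is.foldr partialDeriv f

/-- The sequence of symmetric functions `F_N`, where `F_N` has `m N` variables, is appropriate, with
limits `c_k` and `d_{k,l}` (`k, l ≥ 1`). The functions of interest have `F_N(1, …, 1) = 1`, so that
the principal branch is the right branch of the logarithm near `(1, …, 1)`. -/
structure HasLimits (m : ℕ → ℕ) (F : ∀ N, (Fin (m N) → ℂ) → ℂ) (c : ℕ → ℝ) (d : ℕ → ℕ → ℝ) :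
    Prop where
  symm : ∀ N (σ : Equiv.Perm (Fin (m N))) (x : Fin (m N) → ℂ), F N (x ∘ σ) = F N x
  ne_zero : ∀ N, ∀ᶠ x in 𝓝 (1 : Fin (m N) → ℂ), F N x ≠ 0
  holomorphic : ∀ N, AnalyticAt ℂ (fun x => Complex.log (F N x)) 1
  one_index : ∀ i k : ℕ, 1 ≤ k →
    Tendsto (fun N => mixedPartial (List.replicate k i) (fun x => Complex.log (F N x)) 1 / (m N : ℂ))
      atTop (𝓝 (c k : ℂ))
  two_indices : ∀ i j k l : ℕ, i ≠ j → 1 ≤ k → 1 ≤ l →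
    Tendsto (fun N => mixedPartial (List.replicate k i ++ List.replicate l j)
      (fun x => Complex.log (F N x)) 1) atTop (𝓝 (d k l : ℂ))
  many_indices : ∀ is : List ℕ, 3 ≤ is.toFinset.card →
    Tendsto (fun N => mixedPartial is (fun x => Complex.log (F N x)) 1) atTop (𝓝 0)
  summable_one : ∀ᶠ x in 𝓝 (1 : ℂ),
    Summable fun k : ℕ => (c (k + 1) : ℂ) / (k.factorial : ℂ) * (x - 1) ^ k
  summable_two : ∀ᶠ p in 𝓝 ((1, 1) : ℂ × ℂ),
    Summable fun q : ℕ × ℕ => (d (q.1 + 1) (q.2 + 1) : ℂ) /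
      ((q.1.factorial : ℂ) * (q.2.factorial : ℂ)) * (p.1 - 1) ^ q.1 * (p.2 - 1) ^ q.2

/-- The sequence of functions `F_N` of `m N` variables is (CLT-)appropriate. -/
def IsAppropriate (m : ℕ → ℕ) (F : ∀ N, (Fin (m N) → ℂ) → ℂ) : Prop :=
  ∃ (c : ℕ → ℝ) (d : ℕ → ℕ → ℝ), HasLimits m F c d

/-- The sequence of probability measures `ρ_N` on signatures of length `m N` is appropriate. -/
def IsAppropriateMeasure (m : ℕ → ℕ) (ρ : ∀ N, PMF (Signature (m N))) : Prop :=
  (∀ N, SchurConvergent (ρ N)) ∧ IsAppropriate m fun N => schurGen (ρ N)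

/-- `F(x) = ∑_{k ≥ 1} c_k / (k - 1)! (x - 1) ^ (k - 1)`. -/
def limitF (c : ℕ → ℝ) (x : ℂ) : ℂ :=
  ∑' k : ℕ, (c (k + 1) : ℂ) / (k.factorial : ℂ) * (x - 1) ^ k

/-- `G(x, y) = ∑_{k, l ≥ 1} d_{k,l} / ((k - 1)! (l - 1)!) (x - 1) ^ (k - 1) (y - 1) ^ (l - 1)`. -/
def limitG (d : ℕ → ℕ → ℝ) (x y : ℂ) : ℂ :=
  ∑' q : ℕ × ℕ, (d (q.1 + 1) (q.2 + 1) : ℂ) /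
    ((q.1.factorial : ℂ) * (q.2.factorial : ℂ)) * (x - 1) ^ q.1 * (y - 1) ^ q.2

/-- `Q(x, y) = G(1 + x, 1 + y) + 1 / (x - y) ^ 2`. -/
def limitQ (d : ℕ → ℕ → ℝ) (x y : ℂ) : ℂ := limitG d (1 + x) (1 + y) + 1 / (x - y) ^ 2

/-! ### The multilevel Markov chain -/

/-- `q` is the family of coefficients `st(λ → μ)` in the expansion
`g(x) s_λ(x, 1, …, 1) / s_λ(1, …, 1) = ∑_μ st(λ → μ) s_μ(x) / s_μ(1, …, 1)` near `(1, …, 1)`. -/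
def IsTransition {m M : ℕ} (g : (Fin m → ℂ) → ℂ) (l : Signature M) (q : PMF (Signature m)) :
    Prop :=
  ∀ᶠ x in 𝓝 (1 : Fin m → ℂ),
    HasSum (fun μ => schurTerm q μ x) (g x * (schur l (padOnes x) / schur l 1))

open Classical in
/-- The transition probabilities `st(λ → ·)`, determined by the expansion in `IsTransition`. (The
second case of the definition does not occur for the chains considered here.) -/
def transition {m M : ℕ} (g : (Fin m → ℂ) → ℂ) (l : Signature M) : PMF (Signature m) :=
  if h : ∃ q, IsTransition g l q then h.choose else PMF.pure ⟨0, fun _ _ _ => le_rfl⟩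

/-- The number `[a_t N]` of particles on level `t` (integer part). -/
abbrev levelSize {n : ℕ} (a : Fin (n + 1) → ℝ) (N : ℕ) (t : Fin (n + 1)) : ℕ := ⌊a t * (N : ℝ)⌋₊

/-- `Prob(λ⁽⁰⁾, …, λ⁽ⁿ⁾) = ρ_n(λ⁽ⁿ⁾) ∏_{i < n} st_{g_i}(λ⁽ⁱ⁺¹⁾ → λ⁽ⁱ⁾)`, where `g_i` is the Schur
generating function of `ρ_i`. -/
def jointWeight {n : ℕ} {m : Fin (n + 1) → ℕ} (ρ : ∀ t, PMF (Signature (m t)))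
    (l : ∀ t, Signature (m t)) : ENNReal :=
  ρ (Fin.last n) (l (Fin.last n)) *
    ∏ i : Fin n, transition (schurGen (ρ i.castSucc)) (l i.succ) (l i.castSucc)

/-- The joint law of `(λ⁽⁰⁾, …, λ⁽ⁿ⁾)`. -/
def jointLaw {n : ℕ} {m : Fin (n + 1) → ℕ} (ρ : ∀ t, PMF (Signature (m t))) :
    Measure (∀ t, Signature (m t)) :=
  Measure.sum fun l => jointWeight ρ l • Measure.dirac l

/-- The functions `H_n = g_n` and `H_t(x) = H_{t+1}(x, 1, …, 1) g_t(x)` for `t < n`. -/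
def levelFun {n : ℕ} {m : Fin (n + 1) → ℕ} (ρ : ∀ t, PMF (Signature (m t))) (t : Fin (n + 1)) :
    (Fin (m t) → ℂ) → ℂ :=
  Fin.reverseInduction (motive := fun t => (Fin (m t) → ℂ) → ℂ) (schurGen (ρ (Fin.last n)))
    (fun i H x => H (padOnes x) * schurGen (ρ i.castSucc) x) t

/-- The shifted power sum `∑_{i=1}^{m} (λ_i + m - i) ^ k` of the signature on level `t`. -/
def powerSum {n : ℕ} {m : Fin (n + 1) → ℕ} (t : Fin (n + 1)) (k : ℕ)
    (l : ∀ t, Signature (m t)) : ℝ :=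
  ∑ i : Fin (m t), (((l t).1 i : ℝ) + (m t : ℝ) - ((i : ℕ) + 1 : ℝ)) ^ k

/-! ### Gaussian limits -/

/-- The centred random variables `X_N(i)`, `i : ι`, converge jointly, as `N → ∞`, in the sense of
moments to a Gaussian vector with mean zero and covariance `C`: all mixed moments (with repetitions
among `idx 0, …, idx (s - 1)` allowed) exist and converge to those of the Gaussian vector. -/
def AsymptoticallyGaussian {ι : Type} {Ω : ℕ → Type} [∀ N, MeasurableSpace (Ω N)]
    (P : ∀ N, Measure (Ω N)) (X : ∀ N, ι → Ω N → ℝ) (C : ι → ι → ℝ) : Prop :=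
  ∀ (s : ℕ) (idx : Fin s → ι),
    (Matrix.of fun i j => C (idx i) (idx j)).PosSemidef ∧
    (∀ N, Integrable (fun ω => ∏ j, X N (idx j) ω) (P N)) ∧
    Tendsto (fun N => ∫ ω, ∏ j, X N (idx j) ω ∂(P N)) atTop
      (𝓝 (∫ x, ∏ j, x j ∂(multivariateGaussian 0 (Matrix.of fun i j => C (idx i) (idx j)))))

/-- The contour integral
`a₁^k₁ a₂^k₂ / (2πi)² ∮_{|z|=ε} ∮_{|w|=2ε} (1/z + 1 + (1+z) F₁(1+z))^k₁
  (1/w + 1 + (1+w) F₂(1+w))^k₂ Q(z, w) dz dw`. -/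
def contourCov (a₁ a₂ : ℝ) (k₁ k₂ : ℕ) (F₁ F₂ : ℂ → ℂ) (Q : ℂ → ℂ → ℂ) (ε : ℝ) : ℂ :=
  (a₁ : ℂ) ^ k₁ * (a₂ : ℂ) ^ k₂ / (2 * Real.pi * Complex.I) ^ 2 *
    ∮ z in C(0, ε), ∮ w in C(0, 2 * ε),
      (1 / z + 1 + (1 + z) * F₁ (1 + z)) ^ k₁ * (1 / w + 1 + (1 + w) * F₂ (1 + w)) ^ k₂ * Q z w

end SchurCLT

end

open SchurCLT

noncomputable section

namespace SchurCLT

/-! ### Tableaux, column by column -/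

section Tableaux

variable {M : ℕ}

/-! Multiplication of every Schur function s_λ by Σ (λ_i + m - i)^k is a combination, with Stirling
numbers, of the operators V⁻¹ ∘ Σ x_i^j ∂_i^j ∘ V, where V is the Vandermonde product
(`schurOp_taylor_normSchur`). Applied to a Schur generating function, such an operator inserts a
power sum under the expectation. Setting superfluous variables to 1 and multiplying by g_r performs
one step of the chain. Every mixed moment is therefore the value at (1, …, 1) of the function
obtained from g_n by alternating these two moves from the top level down (`exists_hasSum_prod`). All
of this happens in formal power series in y_i = x_i - 1, where the operators are continuous and act
termwise on infinite Schur expansions.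

The transition coefficients are probabilities because s_ν(x) s_λ(x, 1, …, 1) is a nonnegative
integral combination of Schur functions (`exists_schur_mul_schur`). This is seen on tableaux: s_λ is
built column by column, the product with a monomial is antisymmetrized, and whenever the exponents
stop being strictly decreasing the rest of the generating function is symmetric in the two letters
concerned, so that the term vanishes. The symmetry is the statement that tableau sums are related by
Demazure operators (`tableauSum_symm`).

For the asymptotics, symmetric series are written as polynomials in the power sums p_r = Σ y_i^r. On
functions H_t · P(p_1, p_2, …) the operators act through P alone, up to terms of high order that do
not affect the constant coefficient (`schurOp_mul_seriesEval`). The action depends on the derivative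
of log H_t and on the expansion of V⁻¹ Σ y_i^n ∂_i^s V in power sums (`sum_pow_mul_nodalResidue`).
Passing to the next level leaves P unchanged, so all levels and all N share one polynomial ring and
N enters through scalars only. Appropriateness says that log H_t is, up to a constant, N times a
linear form in the power sums, plus a bounded part coming from pairs of variables, plus a part that
tends to zero. Counting powers of N, the operator of degree k is a scalar plus N^k (ψ + Γ) plus
lower order terms, with ψ an affine form in the power sums and Γ a derivation with constant
coefficients (`finTendsto_symbolOp`).

Centring removes the scalars. The derivations Γ commute with each other and have scalar commutators
with the ψ, so the limit moments satisfy Wick's recursion with these commutators as covariances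
(`isWick_levelOp`). Gaussian moments satisfy the same recursion by integration by parts
(`isWick_multivariateGaussian`). The operators must be applied from the top level down, hence the
asymmetric role of t₁ ≤ t₂ in the covariance. The commutator is a finite sum of products of Taylor
coefficients, and these are the residues of the double contour integral (`contourCov_eq_limitCov`):
1 / (z - w)² records the Vandermonde part and G the mixed second derivatives of log H_t. -/

/-- The number of entries smaller than `v` of a column. -/
def countBelow (c : Finset (Fin M)) (v : ℕ) : ℕ := (c.filter fun i : Fin M => (i : ℕ) < v).card

/-- The column `c` may stand to the left of the column `C` in a semistandard tableau. -/
def ColumnLE (c C : Finset (Fin M)) : Prop := ∀ v, countBelow C v ≤ countBelow c v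

/-- The weight of a column. -/
def columnMonomial (c : Finset (Fin M)) : MvPolynomial (Fin M) ℂ := ∏ i ∈ c, MvPolynomial.X i

open Classical in
/-- The generating function of the semistandard fillings of columns of the given heights, listed
from right to left, that can stand to the left of the column `C`. -/
def tableauSum : List ℕ → Finset (Fin M) → MvPolynomial (Fin M) ℂ
  | [], _ => 1
  | h :: hs, C => ∑ c : Finset (Fin M),
      if ColumnLE c C then (if c.card = h then columnMonomial c * tableauSum hs c else 0) else 0

theorem countBelow_succ (c : Finset (Fin M)) {v : ℕ} (hv : v < M) [Decidable (⟨v, hv⟩ ∈ c)] :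
    countBelow c (v + 1) = countBelow c v + if ⟨v, hv⟩ ∈ c then 1 else 0 := by
  unfold countBelow
  have h : (c.filter fun i : Fin M => (i : ℕ) < v + 1) =
      (c.filter fun i : Fin M => (i : ℕ) < v) ∪ (c.filter fun i : Fin M => (i : ℕ) = v) := by
    ext i; simp only [Finset.mem_filter, Finset.mem_union]; grind
  rw [h, Finset.card_union_of_disjoint]
  · congr 1
    split_ifs with h1
    · rw [Finset.card_eq_one]
      refine ⟨⟨v, hv⟩, ?_⟩
      ext i; simp only [Finset.mem_filter, Finset.mem_singleton, Fin.ext_iff]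
      constructor
      · exact fun h => h.2
      · intro h
        have : i = ⟨v, hv⟩ := Fin.ext h
        subst this; exact ⟨h1, rfl⟩
    · rw [Finset.card_eq_zero, Finset.filter_eq_empty_iff]
      intro i hi h2
      have : i = ⟨v, hv⟩ := Fin.ext h2
      subst this; exact h1 hi
  · rw [Finset.disjoint_left]
    intro i; simp only [Finset.mem_filter]; grind

variable {k : ℕ} (hk : k + 1 < M)

/-- The transposition of the letters `k` and `k + 1`. -/
def adjSwap : Equiv.Perm (Fin M) := Equiv.swap ⟨k, by omega⟩ ⟨k + 1, hk⟩

theorem adjSwap_val_lt {v : ℕ} (hv : v ≠ k + 1) (i : Fin M) :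
    ((adjSwap hk i : Fin M) : ℕ) < v ↔ (i : ℕ) < v := by
  unfold adjSwap
  rw [Equiv.swap_apply_def]
  split_ifs with h1 h2
  · subst h1; simp; omega
  · subst h2; simp; omega
  · rfl

theorem countBelow_map_adjSwap (c : Finset (Fin M)) {v : ℕ} (hv : v ≠ k + 1) :
    countBelow (c.map (adjSwap hk).toEmbedding) v = countBelow c v := by
  unfold countBelow
  rw [Finset.filter_map, Finset.card_map]
  congr 1
  ext i
  simp [adjSwap_val_lt hk hv]

theorem mem_map_adjSwap (c : Finset (Fin M)) (i : Fin M) :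
    i ∈ c.map (adjSwap hk).toEmbedding ↔ adjSwap hk i ∈ c := by
  have h : (adjSwap hk).symm = adjSwap hk := Equiv.symm_swap _ _
  rw [Finset.mem_map_equiv, h]

theorem map_adjSwap_map_adjSwap (c : Finset (Fin M)) :
    (c.map (adjSwap hk).toEmbedding).map (adjSwap hk).toEmbedding = c := by
  ext i
  rw [mem_map_adjSwap, mem_map_adjSwap]
  simp [adjSwap]

theorem map_adjSwap_of_iff (c : Finset (Fin M))
    (h : (⟨k, by omega⟩ : Fin M) ∈ c ↔ (⟨k + 1, hk⟩ : Fin M) ∈ c) :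
    c.map (adjSwap hk).toEmbedding = c := by
  ext i
  rw [mem_map_adjSwap, adjSwap, Equiv.swap_apply_def]
  split_ifs with h1 h2
  · subst h1; exact h.symm
  · subst h2; exact h
  · rfl

-- Exchanging `k` and `k + 1` in a column leaves all counts unchanged except the one at `k + 1`.
-- That inequality is split off and expressed by membership of the letter `k`.
open Classical in
theorem columnLE_iff (c C : Finset (Fin M)) :
    ColumnLE c C ↔ (∀ v, v ≠ k + 1 → countBelow C v ≤ countBelow c v) ∧
      countBelow C k + (if (⟨k, by omega⟩ : Fin M) ∈ C then 1 else 0) ≤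
        countBelow c k + (if (⟨k, by omega⟩ : Fin M) ∈ c then 1 else 0) := by
  rw [← countBelow_succ, ← countBelow_succ]
  constructor
  · exact fun h => ⟨fun v _ => h v, h _⟩
  · rintro ⟨h1, h2⟩ v
    by_cases hv : v = k + 1
    · rw [hv]; exact h2
    · exact h1 v hv

theorem rename_columnMonomial (c : Finset (Fin M)) :
    MvPolynomial.rename (adjSwap hk) (columnMonomial c) =
      columnMonomial (c.map (adjSwap hk).toEmbedding) := by
  unfold columnMonomial
  rw [map_prod, Finset.prod_map]
  simp

theorem columnMonomial_pair (c : Finset (Fin M)) (ha : (⟨k, by omega⟩ : Fin M) ∉ c)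
    (hb : (⟨k + 1, hk⟩ : Fin M) ∈ c) :
    ∃ m, MvPolynomial.rename (adjSwap hk) m = m ∧
      columnMonomial c = MvPolynomial.X ⟨k + 1, hk⟩ * m ∧
      columnMonomial (c.map (adjSwap hk).toEmbedding) = MvPolynomial.X ⟨k, by omega⟩ * m := by
  classical
  refine ⟨columnMonomial (c.erase ⟨k + 1, hk⟩), ?_, ?_, ?_⟩
  · rw [rename_columnMonomial, map_adjSwap_of_iff]
    simp [ha]
  · unfold columnMonomial
    rw [Finset.mul_prod_erase _ _ hb]
  · rw [← rename_columnMonomial]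
    conv_lhs => rw [columnMonomial, ← Finset.mul_prod_erase _ _ hb, map_mul]
    have h : MvPolynomial.rename (adjSwap hk) (columnMonomial (c.erase ⟨k + 1, hk⟩)) =
        columnMonomial (c.erase ⟨k + 1, hk⟩) := by
      rw [rename_columnMonomial, map_adjSwap_of_iff]
      simp [ha]
    unfold columnMonomial at h
    rw [h]
    simp [adjSwap, columnMonomial]

/-- The relation that makes `f` symmetric in the letters `k` and `k + 1`. -/
theorem rename_eq_of_divided {f g : MvPolynomial (Fin M) ℂ}
    (h : (MvPolynomial.X ⟨k, by omega⟩ - MvPolynomial.X ⟨k + 1, hk⟩) * f =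
      MvPolynomial.X ⟨k, by omega⟩ * g -
        MvPolynomial.X ⟨k + 1, hk⟩ * MvPolynomial.rename (adjSwap hk) g) :
    MvPolynomial.rename (adjSwap hk) f = f := by
  have h2 := congrArg (MvPolynomial.rename (adjSwap hk)) h
  have h3 : MvPolynomial.rename (adjSwap hk) (MvPolynomial.rename (adjSwap hk) g) = g := by
    rw [MvPolynomial.rename_rename]
    have : (adjSwap hk : Fin M → Fin M) ∘ adjSwap hk = id := by
      funext i; simp [adjSwap]
    rw [this, MvPolynomial.rename_id_apply]
  simp only [map_mul, map_sub, MvPolynomial.rename_X, h3] at h2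
  have ea : adjSwap hk ⟨k, by omega⟩ = ⟨k + 1, hk⟩ := by simp [adjSwap]
  have eb : adjSwap hk ⟨k + 1, hk⟩ = ⟨k, by omega⟩ := by simp [adjSwap]
  rw [ea, eb] at h2
  have hne : (MvPolynomial.X ⟨k, by omega⟩ - MvPolynomial.X ⟨k + 1, hk⟩ :
      MvPolynomial (Fin M) ℂ) ≠ 0 := by
    rw [sub_ne_zero]
    intro h
    have := MvPolynomial.X_injective h
    simp at this
  apply mul_left_cancel₀ hne
  linear_combination -h2 - h

/-- With s the exchange of the two letters, the second clause says that the sum for `C` is the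
Demazure operator f ↦ (x_k f - x_{k+1} s f) / (x_k - x_{k+1}) applied to the sum for sC. The two
clauses have to be proved together: in the induction over the columns, the admissible next columns
are paired by the exchange, and each pair sums to a Demazure image. -/
theorem tableauSum_symm (hs : List ℕ) : ∀ C : Finset (Fin M),
    (((⟨k, by omega⟩ : Fin M) ∈ C ↔ (⟨k + 1, hk⟩ : Fin M) ∈ C) →
      MvPolynomial.rename (adjSwap hk) (tableauSum hs C) = tableauSum hs C) ∧
    ((⟨k, by omega⟩ : Fin M) ∉ C → (⟨k + 1, hk⟩ : Fin M) ∈ C →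
      (MvPolynomial.X ⟨k, by omega⟩ - MvPolynomial.X ⟨k + 1, hk⟩) * tableauSum hs C =
      MvPolynomial.X ⟨k, by omega⟩ * tableauSum hs (C.map (adjSwap hk).toEmbedding) -
        MvPolynomial.X ⟨k + 1, hk⟩ * MvPolynomial.rename (adjSwap hk)
          (tableauSum hs (C.map (adjSwap hk).toEmbedding))) := by
  classical
  induction hs with
  | nil => intro C; simp [tableauSum]
  | cons h hs ih =>
    set a : Fin M := ⟨k, by omega⟩ with ha
    set b : Fin M := ⟨k + 1, hk⟩ with hb
    set s := adjSwap hk with hs'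
    have sa : s a = b := by simp [hs', adjSwap, ha, hb]
    have sb : s b = a := by simp [hs', adjSwap, ha, hb]
    set e := (fun c : Finset (Fin M) => c.map s.toEmbedding) with he
    set t := (fun c : Finset (Fin M) => if c.card = h then columnMonomial c * tableauSum hs c
      else 0) with ht
    have t1 : ∀ c, (a ∈ c ↔ b ∈ c) → MvPolynomial.rename s (t c) = t c ∧ e c = c := by
      intro c hc
      have h1 := map_adjSwap_of_iff hk c hc
      refine ⟨?_, h1⟩
      simp only [ht]
      split_ifs
      · rw [map_mul, (ih c).1 hc, rename_columnMonomial, h1]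
      · simp
    -- The monomials of `c` and of its exchange are x_b m and x_a m with m symmetric. Multiplying
    -- the induction hypothesis for `c` by x_b m and adding (x_a - x_b) x_a m times the other sum
    -- gives the Demazure relation for the pair.
    have t2 : ∀ c, a ∉ c → b ∈ c → (MvPolynomial.X a - MvPolynomial.X b) * (t c + t (e c)) =
        MvPolynomial.X a * t (e c) - MvPolynomial.X b * MvPolynomial.rename s (t (e c)) := by
      intro c hac hbc
      obtain ⟨m, hm, hm1, hm2⟩ := columnMonomial_pair hk c hac hbc
      rw [← hs'] at hm
      have h2 := (ih c).2 hac hbc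
      have h3 : (e c).card = c.card := Finset.card_map _
      simp only [ht, h3]
      split_ifs
      · simp only [he] at *
        rw [hm1, hm2]
        simp only [map_mul, MvPolynomial.rename_X, hm, ← ha, ← hb, sa] at h2 ⊢
        linear_combination (MvPolynomial.X b * m) * h2
      · simp
    have t3 : ∀ c, a ∉ c → b ∈ c →
        MvPolynomial.rename s (t c + t (e c)) = t c + t (e c) :=
      fun c h1 h2 => rename_eq_of_divided hk (t2 c h1 h2)
    have ee : ∀ c, e (e c) = c := map_adjSwap_map_adjSwap hk
    have memea : ∀ c, a ∈ e c ↔ b ∈ c := fun c => by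
      rw [he]; simp only; rw [mem_map_adjSwap, ← hs', sa]
    have memeb : ∀ c, b ∈ e c ↔ a ∈ c := fun c => by
      rw [he]; simp only; rw [mem_map_adjSwap, ← hs', sb]
    have cnte : ∀ c v, v ≠ k + 1 → countBelow (e c) v = countBelow c v :=
      fun c v hv => countBelow_map_adjSwap hk c hv
    have cnt2 : ∀ c : Finset (Fin M), countBelow c (k + 2) = countBelow c k +
        (if a ∈ c then 1 else 0) + (if b ∈ c then 1 else 0) := by
      intro c
      rw [countBelow_succ c hk, countBelow_succ c (show k < M by omega)]
    have hF : ∀ C : Finset (Fin M), tableauSum (h :: hs) C =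
        ∑ c, if ColumnLE c C then t c else 0 := fun C => rfl
    -- Adding the sum to its reindexing by the exchange pairs the columns without a choice of
    -- representatives. The factor 2 is cancelled at the end.
    have hdouble : ∀ C : Finset (Fin M), tableauSum (h :: hs) C + tableauSum (h :: hs) C =
        ∑ c, ((if ColumnLE c C then t c else 0) + (if ColumnLE (e c) C then t (e c) else 0)) := by
      intro C
      rw [Finset.sum_add_distrib]
      congr 1
      rw [hF]
      exact (Equiv.sum_comp (⟨e, e, ee, ee⟩ : Finset (Fin M) ≃ Finset (Fin M))
        (fun c => if ColumnLE c C then t c else 0)).symm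
    intro C
    refine ⟨fun hC => ?_, fun haC hbC => ?_⟩
    · have h1 : ∀ c, ColumnLE (e c) C ↔ ColumnLE c C := by
        intro c
        rw [columnLE_iff hk, columnLE_iff hk]
        have h0 : (∀ v, v ≠ k + 1 → countBelow C v ≤ countBelow (e c) v) ↔
            (∀ v, v ≠ k + 1 → countBelow C v ≤ countBelow c v) :=
          forall₂_congr fun v hv => by rw [cnte c v hv]
        rw [h0, cnte c k (by omega)]
        apply and_congr_right
        intro h3
        have h4 := h3 k (by omega)
        have h5 := h3 (k + 2) (by omega)
        rw [cnt2, cnt2] at h5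
        simp only [← ha, memea]
        clear h0 h3
        split_ifs at * <;> first | omega | simp_all
      have h2 : MvPolynomial.rename s (tableauSum (h :: hs) C + tableauSum (h :: hs) C) =
          tableauSum (h :: hs) C + tableauSum (h :: hs) C := by
        rw [hdouble, map_sum]
        refine Finset.sum_congr rfl fun c _ => ?_
        simp only [h1]
        split_ifs
        · by_cases hac : a ∈ c <;> by_cases hbc : b ∈ c
          · obtain ⟨h3, h4⟩ := t1 c (by simp [hac, hbc])
            rw [h4, map_add, h3]
          · have h3 := t3 (e c) (by rwa [memea]) (by rwa [memeb])
            rw [ee] at h3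
            rw [add_comm, h3]
          · exact t3 c hac hbc
          · obtain ⟨h3, h4⟩ := t1 c (by simp [hac, hbc])
            rw [h4, map_add, h3]
        · simp
      rw [map_add, ← two_mul, ← two_mul] at h2
      exact mul_left_cancel₀ two_ne_zero h2
    · have hC' : a ∈ e C ∧ b ∉ e C := by rw [memea, memeb]; exact ⟨hbC, haC⟩
      -- Next to `C` a column and its exchange are admissible together. Next to the exchanged `C`,
      -- which is smaller, `c` may be excluded while its exchange survives. If both survive, the
      -- pair is already symmetric; if one does, the relation is `t2`.
      have key : ∀ c, a ∉ c → b ∈ c → (ColumnLE (e c) C ↔ ColumnLE c C) ∧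
          (ColumnLE (e c) (e C) ↔ ColumnLE c C) ∧ (ColumnLE c (e C) → ColumnLE c C) := by
        intro c hac hbc
        rw [columnLE_iff hk, columnLE_iff hk, columnLE_iff hk, columnLE_iff hk]
        have h0 : (∀ v, v ≠ k + 1 → countBelow C v ≤ countBelow (e c) v) ↔
            (∀ v, v ≠ k + 1 → countBelow C v ≤ countBelow c v) :=
          forall₂_congr fun v hv => by rw [cnte c v hv]
        have h0' : (∀ v, v ≠ k + 1 → countBelow (e C) v ≤ countBelow (e c) v) ↔
            (∀ v, v ≠ k + 1 → countBelow C v ≤ countBelow c v) :=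
          forall₂_congr fun v hv => by rw [cnte c v hv, cnte C v hv]
        have h0'' : (∀ v, v ≠ k + 1 → countBelow (e C) v ≤ countBelow c v) ↔
            (∀ v, v ≠ k + 1 → countBelow C v ≤ countBelow c v) :=
          forall₂_congr fun v hv => by rw [cnte C v hv]
        rw [h0, h0', h0'', cnte c k (by omega), cnte C k (by omega)]
        simp only [← ha, memea, haC, hbC, hac, hbc, if_true, if_false]
        refine ⟨and_congr_right fun h3 => ?_, and_congr_right fun h3 => ?_, fun h3 => ⟨h3.1, ?_⟩⟩
        · have h4 := h3 k (by omega)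
          omega
        · have h4 := h3 k (by omega)
          omega
        · have h4 := h3.1 k (by omega)
          omega
      have key2 : ∀ c, (a ∈ c ↔ b ∈ c) → (ColumnLE c (e C) ↔ ColumnLE c C) := by
        intro c hc
        rw [columnLE_iff hk, columnLE_iff hk]
        have h0'' : (∀ v, v ≠ k + 1 → countBelow (e C) v ≤ countBelow c v) ↔
            (∀ v, v ≠ k + 1 → countBelow C v ≤ countBelow c v) :=
          forall₂_congr fun v hv => by rw [cnte C v hv]
        rw [h0'', cnte C k (by omega)]
        apply and_congr_right
        intro h3
        have h4 := h3 k (by omega)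
        have h5 := h3 (k + 2) (by omega)
        rw [cnt2, cnt2] at h5
        simp only [← ha, memea, haC, hbC, ← hc, if_true, if_false] at h5 ⊢
        clear h0'' h3
        split_ifs at * <;> omega
      have main : ∀ c, a ∉ c → b ∈ c → (MvPolynomial.X a - MvPolynomial.X b) *
          ((if ColumnLE c C then t c else 0) + (if ColumnLE (e c) C then t (e c) else 0)) =
          MvPolynomial.X a * ((if ColumnLE c (e C) then t c else 0) +
            (if ColumnLE (e c) (e C) then t (e c) else 0)) -
          MvPolynomial.X b * MvPolynomial.rename s ((if ColumnLE c (e C) then t c else 0) +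
            (if ColumnLE (e c) (e C) then t (e c) else 0)) := by
        intro c hac hbc
        obtain ⟨k1, k2, k3⟩ := key c hac hbc
        simp only [k1, k2]
        by_cases hp : ColumnLE c C
        · by_cases hq : ColumnLE c (e C)
          · simp only [hp, hq, if_true]
            rw [t3 c hac hbc]
            ring
          · simp only [hp, hq, if_true, if_false, zero_add]
            exact t2 c hac hbc
        · have hq : ¬ ColumnLE c (e C) := fun h => hp (k3 h)
          simp [hp, hq]
      have h2 : (MvPolynomial.X a - MvPolynomial.X b) *
          (tableauSum (h :: hs) C + tableauSum (h :: hs) C) =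
          MvPolynomial.X a * (tableauSum (h :: hs) (e C) + tableauSum (h :: hs) (e C)) -
          MvPolynomial.X b *
            MvPolynomial.rename s (tableauSum (h :: hs) (e C) + tableauSum (h :: hs) (e C)) := by
        rw [hdouble, hdouble, map_sum, Finset.mul_sum, Finset.mul_sum, Finset.mul_sum,
          ← Finset.sum_sub_distrib]
        refine Finset.sum_congr rfl fun c _ => ?_
        by_cases hac : a ∈ c <;> by_cases hbc : b ∈ c
        · obtain ⟨h3, h4⟩ := t1 c (by simp [hac, hbc])
          have h5 := key2 c (by simp [hac, hbc])
          simp only [h4, h5]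
          split_ifs
          · rw [map_add, h3]; ring
          · simp
        · have h3 := main (e c) (by rwa [memea]) (by rwa [memeb])
          rw [ee] at h3
          rw [add_comm, h3, add_comm (if ColumnLE (e c) (e C) then t (e c) else 0)]
        · exact main c hac hbc
        · obtain ⟨h3, h4⟩ := t1 c (by simp [hac, hbc])
          have h5 := key2 c (by simp [hac, hbc])
          simp only [h4, h5]
          split_ifs
          · rw [map_add, h3]; ring
          · simp
      rw [map_add] at h2
      apply mul_left_cancel₀ (two_ne_zero : (2 : MvPolynomial (Fin M) ℂ) ≠ 0)
      linear_combination h2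

/-- Images of the Demazure operator are symmetric in the two letters, so only columns with `k` and
without `k + 1` can spoil the symmetry. -/
theorem tableauSum_rename_of_descent (hs : List ℕ) (C : Finset (Fin M))
    (h : (⟨k, by omega⟩ : Fin M) ∈ C → (⟨k + 1, hk⟩ : Fin M) ∈ C) :
    MvPolynomial.rename (adjSwap hk) (tableauSum hs C) = tableauSum hs C := by
  by_cases ha : (⟨k, by omega⟩ : Fin M) ∈ C
  · exact (tableauSum_symm hk hs C).1 (by simp [ha, h ha])
  · by_cases hb : (⟨k + 1, hk⟩ : Fin M) ∈ C
    · exact rename_eq_of_divided hk ((tableauSum_symm hk hs C).2 ha hb)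
    · exact (tableauSum_symm hk hs C).1 (by simp [ha, hb])

theorem tableauSum_eq_map (hs : List ℕ) : ∀ C : Finset (Fin M),
    ∃ P : MvPolynomial (Fin M) ℕ, tableauSum hs C = MvPolynomial.map (Nat.castRingHom ℂ) P := by
  classical
  induction hs with
  | nil => exact fun C => ⟨1, by simp [tableauSum]⟩
  | cons h hs ih =>
    intro C
    choose P hP using ih
    refine ⟨∑ c : Finset (Fin M), if ColumnLE c C then (if c.card = h then
      (∏ i ∈ c, MvPolynomial.X i) * P c else 0) else 0, ?_⟩
    rw [map_sum, tableauSum]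
    refine Finset.sum_congr rfl fun c _ => ?_
    split_ifs
    · simp [hP, columnMonomial, map_prod]
    · simp
    · simp

end Tableaux

/-! ### Antisymmetrization and positivity -/

section Antisymmetrization

variable {m M : ℕ}

/-- Permute the first `m` variables and put `1` for the others. -/
def permSubst (σ : Equiv.Perm (Fin m)) : MvPolynomial (Fin M) ℂ →ₐ[ℂ] MvPolynomial (Fin m) ℂ :=
  MvPolynomial.aeval fun i => if h : (i : ℕ) < m then MvPolynomial.X (σ ⟨i, h⟩) else 1

/-- Antisymmetrization in the first `m` variables; the others are replaced by `1`. -/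
def antisym : MvPolynomial (Fin M) ℂ →+ MvPolynomial (Fin m) ℂ :=
  ∑ σ : Equiv.Perm (Fin m), ((Equiv.Perm.sign σ : ℤˣ) : ℤ) • (permSubst σ).toRingHom.toAddMonoidHom

theorem antisym_apply (f : MvPolynomial (Fin M) ℂ) :
    antisym (m := m) f = ∑ σ : Equiv.Perm (Fin m), ((Equiv.Perm.sign σ : ℤˣ) : ℤ) • permSubst σ f := by
  simp [antisym, AddMonoidHom.finsetSum_apply]

/-- The monomial in the first `m` variables. -/
def initialMonomial (h : m ≤ M) (α : Fin m → ℕ) : MvPolynomial (Fin M) ℂ :=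
  ∏ i : Fin m, MvPolynomial.X (Fin.castLE h i) ^ α i

theorem permSubst_initialMonomial (h : m ≤ M) (σ : Equiv.Perm (Fin m)) (α : Fin m → ℕ) :
    permSubst σ (initialMonomial h α) = ∏ i, MvPolynomial.X (σ i) ^ α i := by
  simp [permSubst, initialMonomial, map_prod]

theorem antisym_initialMonomial (h : m ≤ M) (α : Fin m → ℕ) :
    antisym (initialMonomial h α) = alternant α := by
  rw [antisym_apply, alternant, Matrix.det_apply]
  refine Finset.sum_congr rfl fun σ _ => ?_
  rw [permSubst_initialMonomial]
  rfl

theorem permSubst_mul_adjSwap (h : m ≤ M) {k : ℕ} (hk : k + 1 < m) (σ : Equiv.Perm (Fin m))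
    (f : MvPolynomial (Fin M) ℂ) :
    permSubst (σ * adjSwap hk) f =
      permSubst σ (MvPolynomial.rename (adjSwap (hk.trans_le h)) f) := by
  have : (permSubst σ : MvPolynomial (Fin M) ℂ →ₐ[ℂ] _).comp
      (MvPolynomial.rename (adjSwap (hk.trans_le h))) = permSubst (σ * adjSwap hk) := by
    apply MvPolynomial.algHom_ext
    intro i
    simp only [AlgHom.comp_apply, MvPolynomial.rename_X, permSubst, MvPolynomial.aeval_X]
    by_cases hi : (i : ℕ) < m
    · have h1 : ((adjSwap (hk.trans_le h) i : Fin M) : ℕ) = (adjSwap hk ⟨i, hi⟩ : Fin m) := by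
        simp only [adjSwap, Equiv.swap_apply_def, Fin.ext_iff]
        split_ifs <;> rfl
      have h2 : ((adjSwap (hk.trans_le h) i : Fin M) : ℕ) < m := by rw [h1]; exact Fin.is_lt _
      rw [dif_pos h2, dif_pos hi, Equiv.Perm.mul_apply]
      congr 2
      exact Fin.ext h1
    · have h1 : adjSwap (hk.trans_le h) i = i := by
        simp only [adjSwap]
        apply Equiv.swap_apply_of_ne_of_ne <;> (intro h3; rw [h3] at hi; simp at hi; omega)
      rw [h1]
      simp [hi]
  rw [← this]; rfl

theorem antisym_eq_zero (h : m ≤ M) {k : ℕ} (hk : k + 1 < m) {f : MvPolynomial (Fin M) ℂ}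
    (hf : MvPolynomial.rename (adjSwap (hk.trans_le h)) f = f) : antisym (m := m) f = 0 := by
  have h1 : antisym (m := m) f = - antisym (m := m) f := by
    conv_lhs => rw [antisym_apply, ← Equiv.sum_comp (Equiv.mulRight (adjSwap hk))]
    rw [antisym_apply, ← Finset.sum_neg_distrib]
    refine Finset.sum_congr rfl fun σ _ => ?_
    rw [Equiv.coe_mulRight, permSubst_mul_adjSwap h hk, hf, Equiv.Perm.sign_mul, adjSwap,
      Equiv.Perm.sign_swap]
    · simp
    · simp [Fin.ext_iff]
  have h2 : (2 : MvPolynomial (Fin m) ℂ) * antisym (m := m) f = 0 := by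
    rw [two_mul]; nth_rewrite 1 [h1]; simp
  simpa using h2

open Classical in
theorem permSubst_columnMonomial (h : m ≤ M) (σ : Equiv.Perm (Fin m)) (c : Finset (Fin M)) :
    permSubst σ (columnMonomial c) =
      ∏ i, (MvPolynomial.X (σ i) : MvPolynomial (Fin m) ℂ) ^
        (if Fin.castLE h i ∈ c then 1 else 0) := by
  have h1 : columnMonomial c = ∏ i, (if i ∈ c then MvPolynomial.X i else 1 :
      MvPolynomial (Fin M) ℂ) := by
    rw [columnMonomial, Finset.prod_ite_mem, Finset.univ_inter]
  rw [h1, map_prod]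
  have h2 : ∀ i : Fin M, i ∉ (Finset.univ.map (Fin.castLEEmb h)) →
      permSubst σ (if i ∈ c then MvPolynomial.X i else 1 : MvPolynomial (Fin M) ℂ) = 1 := by
    intro i hi
    have h3 : ¬ (i : ℕ) < m := by
      intro h3
      apply hi
      rw [Finset.mem_map]
      exact ⟨⟨i, h3⟩, Finset.mem_univ _, Fin.ext rfl⟩
    split_ifs
    · simp [permSubst, h3]
    · simp
  rw [← Finset.prod_subset (Finset.subset_univ (Finset.univ.map (Fin.castLEEmb h)))
    fun i _ hi => h2 i hi, Finset.prod_map]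
  refine Finset.prod_congr rfl fun i _ => ?_
  simp only [Fin.castLEEmb_apply]
  split_ifs <;> simp [permSubst]

open Classical in
theorem antisym_mul_columnMonomial (h : m ≤ M) (α : Fin m → ℕ) (c : Finset (Fin M))
    (f : MvPolynomial (Fin M) ℂ) :
    antisym (m := m) (initialMonomial h α * (columnMonomial c * f)) =
      antisym (initialMonomial h (fun i => α i + if Fin.castLE h i ∈ c then 1 else 0) * f) := by
  rw [antisym_apply, antisym_apply]
  refine Finset.sum_congr rfl fun σ _ => ?_
  rw [map_mul, map_mul, map_mul, permSubst_initialMonomial, permSubst_initialMonomial, ← mul_assoc,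
    permSubst_columnMonomial h, ← Finset.prod_mul_distrib]
  simp only [pow_add]

theorem exists_ascent {α : Fin m → ℕ} (h : ¬ StrictAnti α) :
    ∃ (k : ℕ) (hk : k + 1 < m), α ⟨k, by omega⟩ ≤ α ⟨k + 1, hk⟩ := by
  by_contra! hc
  apply h
  rcases m with _ | m
  · exact fun i => i.elim0
  · rw [Fin.strictAnti_iff_succ_lt]
    intro i
    exact hc i (by omega)

open Classical in
/-- Multiplying a monomial with decreasing exponents by a column either keeps them decreasing, or
the antisymmetrization of its product with the generating function is zero. -/
theorem antisym_mul_tableauSum_eq_zero (h : m ≤ M) {α : Fin m → ℕ} (hα : StrictAnti α)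
    (hs : List ℕ) (c : Finset (Fin M)) {k : ℕ} (hk : k + 1 < m)
    (hle : α ⟨k, by omega⟩ + (if Fin.castLE h ⟨k, by omega⟩ ∈ c then 1 else 0) ≤
      α ⟨k + 1, hk⟩ + (if Fin.castLE h ⟨k + 1, hk⟩ ∈ c then 1 else 0)) :
    antisym (m := m)
      (initialMonomial h (fun i => α i + if Fin.castLE h i ∈ c then 1 else 0) *
        tableauSum hs c) = 0 := by
  have h1 : α ⟨k + 1, hk⟩ < α ⟨k, by omega⟩ := hα (Fin.mk_lt_mk.2 (Nat.lt_succ_self k))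
  -- The exponents drop by at least one at `k`, and a column raises each by at most one. So a
  -- violation means that `c` contains `k + 1` but not `k` and that the two new exponents are equal:
  -- both the monomial and the tableau sum are then symmetric in these letters.
  have hkc : Fin.castLE h ⟨k, by omega⟩ ∉ c := by
    intro h2
    rw [if_pos h2] at hle
    split_ifs at hle <;> omega
  have hkc' : Fin.castLE h ⟨k + 1, hk⟩ ∈ c := by
    by_contra h2
    rw [if_neg h2] at hle
    split_ifs at hle <;> omega
  rw [if_neg hkc, if_pos hkc'] at hle
  apply antisym_eq_zero h hk
  rw [map_mul, tableauSum_rename_of_descent (hk.trans_le h) hs c fun h3 => absurd h3 hkc]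
  congr 1
  rw [initialMonomial, map_prod, ← Equiv.prod_comp (adjSwap hk)]
  refine Finset.prod_congr rfl fun i _ => ?_
  rw [map_pow, MvPolynomial.rename_X]
  have h4 : adjSwap (hk.trans_le h) (Fin.castLE h (adjSwap hk i)) = Fin.castLE h i := by
    simp only [adjSwap, Equiv.swap_apply_def, Fin.ext_iff]
    by_cases i1 : (i : ℕ) = k
    · simp [i1]
    · by_cases i2 : (i : ℕ) = k + 1
      · simp [i2]
      · simp [i1, i2]
  rw [h4]
  congr 1
  simp only [adjSwap, Equiv.swap_apply_def]
  split_ifs <;> subst_vars <;> first | omega | (simp_all; try omega)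

/-- The columns are absorbed into the exponents one at a time. Each choice of a column either keeps
the exponents strictly decreasing or contributes zero, so no signs ever appear; this is the
Littlewood–Richardson positivity that is needed. -/
theorem antisym_mul_tableauSum_mem (h : m ≤ M) (hs : List ℕ) :
    ∀ (C : Finset (Fin M)) {α : Fin m → ℕ}, StrictAnti α →
      antisym (initialMonomial h α * tableauSum hs C) ∈
        AddSubmonoid.closure {p | ∃ β : Fin m → ℕ, StrictAnti β ∧ p = alternant β} := by
  classical
  induction hs with
  | nil =>
    intro C α hα
    rw [tableauSum, mul_one, antisym_initialMonomial]
    exact AddSubmonoid.subset_closure ⟨α, hα, rfl⟩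
  | cons l hs ih =>
    intro C α hα
    rw [tableauSum, Finset.mul_sum, map_sum]
    refine AddSubmonoid.sum_mem _ fun c _ => ?_
    split_ifs
    · rw [antisym_mul_columnMonomial]
      by_cases hc : StrictAnti fun i => α i + if Fin.castLE h i ∈ c then 1 else 0
      · exact ih c hc
      · obtain ⟨k, hk, hle⟩ := exists_ascent hc
        rw [antisym_mul_tableauSum_eq_zero h hα hs c hk hle]
        exact AddSubmonoid.zero_mem _
    · simp
    · simp

theorem permSubst_tableauSum (h : m ≤ M) (hs : List ℕ) (σ : Equiv.Perm (Fin m)) :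
    permSubst σ (tableauSum hs (∅ : Finset (Fin M))) =
      permSubst 1 (tableauSum hs (∅ : Finset (Fin M))) := by
  rcases m with _ | m
  · rw [Subsingleton.elim σ 1]
  have hσ : σ ∈ Submonoid.closure (Set.range fun i : Fin m => Equiv.swap i.castSucc i.succ) := by
    rw [Equiv.Perm.mclosure_swap_castSucc_succ]; trivial
  induction hσ using Submonoid.closure_induction_right with
  | one => rfl
  | mul_right x hx y hy ih =>
    obtain ⟨i, rfl⟩ := hy
    have hk : (i : ℕ) + 1 < m + 1 := by omega
    have : Equiv.swap i.castSucc i.succ = adjSwap hk := rfl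
    simp only [this]
    rw [permSubst_mul_adjSwap h hk, tableauSum_rename_of_descent _ _ _ (by simp), ih]

/-- With no column to the right there is no constraint, the tableau sum is symmetric and comes out
of the antisymmetrization. -/
theorem antisym_mul_tableauSum (h : m ≤ M) (hs : List ℕ) (α : Fin m → ℕ) :
    antisym (initialMonomial h α * tableauSum hs (∅ : Finset (Fin M))) =
      alternant α * permSubst 1 (tableauSum hs (∅ : Finset (Fin M))) := by
  rw [antisym_apply, ← antisym_initialMonomial h, antisym_apply, Finset.sum_mul]
  refine Finset.sum_congr rfl fun σ _ => ?_
  rw [map_mul, permSubst_tableauSum h hs σ, smul_mul_assoc]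

/-- The column with the first `h` letters. -/
def initialColumn (M h : ℕ) : Finset (Fin M) := Finset.univ.filter fun i : Fin M => (i : ℕ) < h

theorem countBelow_initialColumn {h v : ℕ} (hv : v ≤ M) :
    countBelow (initialColumn M h) v = min v h := by
  induction v with
  | zero => simp [countBelow]
  | succ v ih =>
    classical
    rw [countBelow_succ _ hv, ih (by omega)]
    simp only [initialColumn, Finset.mem_filter, Finset.mem_univ, true_and]
    split_ifs <;> omega

/-- Identifies tableau sums with Schur polynomials. As long as the exponents descend in steps of
exactly one from row `h₀` on, every column other than the initial one creates two equal exponents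
and is annihilated, so a single filling survives. -/
theorem antisym_mul_tableauSum_initialColumn (hs : List ℕ) :
    ∀ (h₀ : ℕ) {α : Fin M → ℕ}, StrictAnti α → (hs.Pairwise (· ≤ ·)) → (∀ h ∈ hs, h₀ ≤ h) →
      (∀ h ∈ hs, h ≤ M) →
      (∀ (k : ℕ) (hk : k + 1 < M), h₀ ≤ k → α ⟨k, by omega⟩ = α ⟨k + 1, hk⟩ + 1) →
      antisym (initialMonomial le_rfl α * tableauSum hs (initialColumn M h₀)) =
        alternant fun i => α i + hs.countP fun h => (i : ℕ) < h := by
  classical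
  induction hs with
  | nil =>
    intro h₀ α _ _ _ _ _
    rw [tableauSum, mul_one, antisym_initialMonomial]
    simp
  | cons l hs ih =>
    intro h₀ α hα hsort hle hM hstep
    have hl0 : h₀ ≤ l := hle l (by simp)
    have hlM : l ≤ M := hM l (by simp)
    rw [tableauSum, Finset.mul_sum, map_sum, Finset.sum_eq_single (initialColumn M l)]
    · rw [if_pos, if_pos, antisym_mul_columnMonomial]
      · have hα' : (fun i : Fin M => α i + if Fin.castLE le_rfl i ∈ initialColumn M l then 1 else 0) =
            fun i => α i + if (i : ℕ) < l then 1 else 0 := by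
          funext i; simp [initialColumn]
        rw [hα', ih l]
        · congr 1
          funext i
          simp only [List.countP_cons, decide_eq_true_eq]
          ring
        · intro i j hij
          have := hα hij
          simp only
          split_ifs <;> omega
        · exact (List.pairwise_cons.1 hsort).2
        · exact (List.pairwise_cons.1 hsort).1
        · exact fun h hh => hM h (by simp [hh])
        · intro k hk hlk
          simp only
          rw [if_neg (by omega), if_neg (by omega), add_zero, add_zero]
          exact hstep k hk (by omega)
      · have := countBelow_initialColumn (M := M) (h := l) le_rfl
        rw [countBelow, Finset.filter_true_of_mem (fun i _ => i.2)] at this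
        omega
      · intro v
        rcases le_total v M with hv | hv
        · rw [countBelow_initialColumn hv, countBelow_initialColumn hv]; omega
        · have : ∀ c : Finset (Fin M), countBelow c v = countBelow c M := by
            intro c
            simp only [countBelow]
            congr 1
            ext i
            simp only [Finset.mem_filter]
            have := i.2
            constructor <;> (rintro ⟨h1, -⟩; exact ⟨h1, by omega⟩)
          rw [this, this, countBelow_initialColumn le_rfl, countBelow_initialColumn le_rfl]; omega
    · intro c _ hc
      split_ifs with hcC hcard
      · rw [antisym_mul_columnMonomial]
        -- A column that fits to the left of the initial column of height `h₀` contains it. Hence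
        -- the gap `k`, with `k + 1` present, found below lies in the range where the exponents
        -- descend by one.
        have hsub : ∀ i : Fin M, (i : ℕ) < h₀ → i ∈ c := by
          intro i hi
          by_contra hic
          have h1 := hcC (i + 1)
          rw [countBelow_initialColumn i.2, countBelow_succ c i.2, if_neg hic] at h1
          have h2 : countBelow c i ≤ i := by
            rw [countBelow]
            calc _ ≤ (initialColumn M i).card := by
                  apply Finset.card_le_card
                  intro j; simp only [Finset.mem_filter, initialColumn]; simp
              _ = countBelow (initialColumn M i) i := by
                  rw [countBelow]; congr 1; ext j; simp [initialColumn]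
              _ = i := by rw [countBelow_initialColumn i.2.le]; simp
          omega
        obtain ⟨k, hk, hkc, hkc'⟩ : ∃ (k : ℕ) (hk : k + 1 < M),
            (⟨k, by omega⟩ : Fin M) ∉ c ∧ (⟨k + 1, hk⟩ : Fin M) ∈ c := by
          by_contra! hno
          apply hc
          have hdown : ∀ (d j : ℕ) (hj : j + d < M), (⟨j + d, hj⟩ : Fin M) ∈ c →
              (⟨j, by omega⟩ : Fin M) ∈ c := by
            intro d
            induction d with
            | zero => intro j _ h; exact h
            | succ d ihd =>
              intro j hj hjc
              refine ihd j (by omega) ?_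
              by_contra h5
              exact hno (j + d) hj h5 hjc
          have hcnt : ∀ v ≤ M, (∀ i : Fin M, (i : ℕ) < v → i ∈ c) ∨ (∀ i ∈ c, (i : ℕ) < v) := by
            intro v hv
            by_cases h5 : ∀ i ∈ c, (i : ℕ) < v
            · exact Or.inr h5
            · left
              push Not at h5
              obtain ⟨i, hic, hvi⟩ := h5
              intro j hj
              have := hdown (i - j) j (by omega) (by convert hic using 1; ext; simp; omega)
              exact this
          have hlcard : (initialColumn M l).card = l := by
            have := countBelow_initialColumn (M := M) (h := l) le_rfl
            rw [countBelow, Finset.filter_true_of_mem (fun i _ => i.2)] at this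
            omega
          rcases hcnt l hlM with h5 | h5
          · symm
            apply Finset.eq_of_subset_of_card_le
            · intro i hi
              exact h5 i (by simpa [initialColumn] using hi)
            · omega
          · apply Finset.eq_of_subset_of_card_le
            · intro i hi
              simpa [initialColumn] using h5 i hi
            · omega
        have hk0 : h₀ ≤ k := by
          by_contra h5
          exact hkc (hsub _ (by simpa using h5))
        apply antisym_mul_tableauSum_eq_zero le_rfl hα hs c hk
        simp only [Fin.castLE_rfl, id_eq]
        rw [if_neg hkc, if_pos hkc', hstep k hk hk0]
      · simp
      · simp
    · simp

/-- The exponents `N - 1, …, 1, 0`. -/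
def staircase (N : ℕ) : Fin N → ℕ := fun j => N - 1 - j

theorem strictAnti_staircase (N : ℕ) : StrictAnti (staircase N) := by
  intro i j hij
  simp only [staircase, Fin.lt_def] at *
  have := j.2
  omega

theorem alternant_staircase (N : ℕ) : alternant (staircase N) = vandermondePoly N := by
  have h := Matrix.det_projVandermonde (fun _ : Fin N => (1 : MvPolynomial (Fin N) ℂ))
    MvPolynomial.X
  rw [alternant, vandermondePoly, Finset.prod_filter]
  have h1 : (Matrix.of fun i j => (MvPolynomial.X i : MvPolynomial (Fin N) ℂ) ^ staircase N j) =
      Matrix.projVandermonde (fun _ : Fin N => (1 : MvPolynomial (Fin N) ℂ)) MvPolynomial.X := by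
    ext i j
    simp [Matrix.projVandermonde_apply, staircase, Fin.rev]
    congr 2
    omega
  rw [h1, h]
  rw [← Finset.univ_product_univ, Finset.prod_product]
  refine Finset.prod_congr rfl fun i _ => ?_
  rw [← Finset.prod_filter]
  refine Finset.prod_congr ?_ fun j _ => by simp
  ext j; simp

theorem vandermondePoly_ne_zero (N : ℕ) : vandermondePoly N ≠ 0 := by
  rw [vandermondePoly, Finset.prod_ne_zero_iff]
  rintro ⟨i, j⟩ hij
  exact (prime_X_sub_X (Finset.mem_filter.1 hij).2.ne).ne_zero

/-- The polynomial Schur functions are generating functions of tableaux. -/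
theorem exists_tableauSum (ν : Fin M → ℕ) (hν : Antitone ν) :
    ∃ hs : List ℕ, alternantQuotient (fun i => ν i + staircase M i) =
      tableauSum hs (∅ : Finset (Fin M)) := by
  classical
  set K := ∑ i, ν i with hK
  have hνK : ∀ i, ν i ≤ K := fun i => Finset.single_le_sum (fun _ _ => Nat.zero_le _)
    (Finset.mem_univ i)
  -- The column lengths of the diagram of `ν`, from right to left and therefore weakly increasing.
  -- The list starts with empty columns if `K` exceeds the largest part.
  set hs : List ℕ := (List.range K).reverse.map fun j => (Finset.univ.filter fun i => j < ν i).card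
    with hhs
  have hbelow : ∀ (i : Fin M) j, (i : ℕ) < (Finset.univ.filter fun i => j < ν i).card ↔ j < ν i := by
    intro i j
    constructor
    · intro h
      by_contra hc
      have : (Finset.univ.filter fun i => j < ν i) ⊆ initialColumn M i := by
        intro i' hi'
        simp only [Finset.mem_filter, Finset.mem_univ, true_and, initialColumn] at *
        by_contra h2
        have := hν (show i ≤ i' from not_lt.1 h2)
        omega
      have h3 := Finset.card_le_card this
      have h4 := countBelow_initialColumn (M := M) (h := i) le_rfl
      rw [countBelow, Finset.filter_true_of_mem (fun i _ => i.2)] at h4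
      omega
    · intro h
      have : initialColumn M (i + 1) ⊆ (Finset.univ.filter fun i => j < ν i) := by
        intro i' hi'
        simp only [Finset.mem_filter, Finset.mem_univ, true_and, initialColumn] at *
        have := hν (show i' ≤ i from Fin.le_def.2 (by omega))
        omega
      have h3 := Finset.card_le_card this
      have h4 := countBelow_initialColumn (M := M) (h := i + 1) le_rfl
      rw [countBelow, Finset.filter_true_of_mem (fun i _ => i.2)] at h4
      have := i.2
      omega
  have h1 := antisym_mul_tableauSum_initialColumn (M := M) hs 0 (strictAnti_staircase M)
    (by
      rw [hhs, List.pairwise_map, List.pairwise_reverse]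
      refine List.Pairwise.imp ?_ List.pairwise_lt_range
      intro a b hab
      apply Finset.card_le_card
      intro i
      simp only [Finset.mem_filter, Finset.mem_univ, true_and]
      omega)
    (fun _ _ => Nat.zero_le _)
    (by
      intro h hh
      rw [hhs, List.mem_map] at hh
      obtain ⟨j, -, rfl⟩ := hh
      simpa using Finset.card_le_univ (Finset.univ.filter fun i : Fin M => j < ν i))
    (by
      intro k hk _
      simp only [staircase]
      omega)
  have h0 : initialColumn M 0 = ∅ := by simp [initialColumn]
  have hcount : ∀ i : Fin M, (hs.countP fun h => (i : ℕ) < h) = ν i := by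
    intro i
    rw [hhs, List.countP_map, List.countP_reverse]
    have h2 : ((fun h => decide ((i : ℕ) < h)) ∘ fun j => (Finset.univ.filter fun i => j < ν i).card) =
        fun j => decide (j < ν i) := by
      funext j
      simp [hbelow]
    rw [h2]
    have h3 : ∀ n, List.countP (fun j => decide (j < ν i)) (List.range n) = min n (ν i) := by
      intro n
      induction n with
      | zero => simp
      | succ n ih =>
        rw [List.range_succ, List.countP_append, ih, List.countP_singleton]
        simp only [decide_eq_true_eq]
        split_ifs <;> omega
    rw [h3]
    exact min_eq_right (hνK i)
  rw [h0, antisym_mul_tableauSum] at h1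
  refine ⟨hs, ?_⟩
  have h4 := vandermondePoly_mul_alternantQuotient (fun i => ν i + staircase M i)
  have h5 : permSubst (m := M) 1 (tableauSum hs (∅ : Finset (Fin M))) = tableauSum hs ∅ := by
    have : (permSubst (m := M) (M := M) 1) = AlgHom.id ℂ _ := by
      apply MvPolynomial.algHom_ext
      intro i
      simp [permSubst]
    rw [this]; rfl
  rw [h5, alternant_staircase] at h1
  simp only [hcount] at h1
  apply mul_left_cancel₀ (vandermondePoly_ne_zero M)
  rw [h4, h1]
  congr 1
  funext i
  ring

end Antisymmetrization

/-! ### Positivity properties of Schur functions -/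

section SchurPositivity

variable {m M N : ℕ}

theorem alternant_add_const (β : Fin N → ℕ) (c : ℕ) :
    alternant (fun j => β j + c) = (∏ i, MvPolynomial.X i) ^ c * alternant β := by
  rw [alternant, alternant, ← Finset.prod_pow, ← Matrix.det_mul_column]
  congr 1
  ext i j
  simp [pow_add, mul_comm]

theorem alternantQuotient_add_const (β : Fin N → ℕ) (c : ℕ) :
    alternantQuotient (fun j => β j + c) = (∏ i, MvPolynomial.X i) ^ c * alternantQuotient β := by
  apply mul_left_cancel₀ (vandermondePoly_ne_zero N)
  rw [vandermondePoly_mul_alternantQuotient, alternant_add_const, mul_left_comm,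
    vandermondePoly_mul_alternantQuotient]

theorem le_shift (l : Signature N) (j : Fin N) : 0 ≤ l.1 j + shift l := by
  have h1 : (l.1 j).natAbs ≤ shift l :=
    Finset.single_le_sum (f := fun j => (l.1 j).natAbs) (fun _ _ => Nat.zero_le _)
      (Finset.mem_univ j)
  omega

/-- The partition obtained by adding `K` to all the parts of a signature. -/
def shifted (l : Signature N) (K : ℕ) (j : Fin N) : ℕ := (l.1 j + K).toNat

theorem antitone_shifted (l : Signature N) (K : ℕ) : Antitone (shifted l K) := by
  intro i j hij
  have := l.2 hij
  simp only [shifted]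
  omega

theorem schur_eq_shift (l : Signature N) (x : Fin N → ℂ) :
    schur l x = (∏ i, x i) ^ (-(shift l : ℤ)) *
      MvPolynomial.eval x (alternantQuotient fun j => shifted l (shift l) j + staircase N j) := by
  rw [schur]
  congr 4
  funext j
  have h1 := le_shift l j
  have h2 := j.2
  simp only [shifted, staircase]
  omega

theorem schur_eq (l : Signature N) {K : ℕ} (hK : ∀ j, 0 ≤ l.1 j + K) {x : Fin N → ℂ}
    (hx : ∀ i, x i ≠ 0) :
    schur l x = (∏ i, x i) ^ (-(K : ℤ)) *
      MvPolynomial.eval x (alternantQuotient fun j => shifted l K j + staircase N j) := by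
  have hp : (∏ i, x i) ≠ 0 := Finset.prod_ne_zero_iff.2 fun i _ => hx i
  have key : ∀ (K c : ℕ), (∀ j, 0 ≤ l.1 j + K) → (∏ i, x i) ^ (-((K + c : ℕ) : ℤ)) *
      MvPolynomial.eval x (alternantQuotient fun j => shifted l (K + c) j + staircase N j) =
      (∏ i, x i) ^ (-(K : ℤ)) *
      MvPolynomial.eval x (alternantQuotient fun j => shifted l K j + staircase N j) := by
    intro K c hK
    have h1 : (fun j => shifted l (K + c) j + staircase N j) =
        fun j => (shifted l K j + staircase N j) + c := by
      funext j
      have := hK j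
      simp only [shifted]
      omega
    rw [h1, alternantQuotient_add_const, map_mul, map_pow, map_prod]
    simp only [MvPolynomial.eval_X]
    rw [← mul_assoc, ← zpow_natCast, ← zpow_add₀ hp]
    congr 2
    push_cast
    ring
  rw [schur_eq_shift, ← key K (shift l) hK, ← key (shift l) K (le_shift l), add_comm]

theorem alternant_ne_zero {β : Fin N → ℕ} (hβ : Function.Injective β) : alternant β ≠ 0 := by
  intro h
  have h1 := congrArg (MvPolynomial.coeff (Finsupp.equivFunOnFinite.symm β)) h
  rw [alternant, Matrix.det_apply, MvPolynomial.coeff_sum, Finset.sum_eq_single 1] at h1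
  · have h2 : (∏ i, (MvPolynomial.X i : MvPolynomial (Fin N) ℂ) ^ β i) =
        MvPolynomial.monomial (Finsupp.equivFunOnFinite.symm β) 1 := by
      rw [MvPolynomial.monomial_eq, Finsupp.prod_fintype _ _ (by simp)]
      simp
    simp [h2] at h1
  · intro σ _ hσ
    have h2 : (∏ i, (MvPolynomial.X (σ i) : MvPolynomial (Fin N) ℂ) ^ β i) =
        MvPolynomial.monomial (Finsupp.equivFunOnFinite.symm (β ∘ σ.symm)) 1 := by
      rw [MvPolynomial.monomial_eq, Finsupp.prod_fintype _ _ (by simp), MvPolynomial.C_1, one_mul,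
        ← Equiv.prod_comp σ (fun i => MvPolynomial.X i ^ _)]
      simp
    simp only [Matrix.of_apply, h2, MvPolynomial.coeff_smul, MvPolynomial.coeff_monomial]
    rw [if_neg, smul_zero]
    intro h3
    apply hσ
    have h4 := Finsupp.equivFunOnFinite.symm.injective h3
    ext i
    have h5 := congrFun h4 (σ i)
    simp only [Function.comp_apply, Equiv.symm_apply_apply] at h5
    rw [← hβ h5]; rfl
  · simp

/-- Up to a power of `x_1 ⋯ x_N`, Schur functions are polynomials with nonnegative coefficients. -/
theorem exists_schur_eq (l : Signature N) : ∃ P : MvPolynomial (Fin N) ℕ, P ≠ 0 ∧ ∀ x,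
    schur l x = (∏ i, x i) ^ (-(shift l : ℤ)) *
      MvPolynomial.eval x (MvPolynomial.map (Nat.castRingHom ℂ) P) := by
  obtain ⟨hs, h⟩ := exists_tableauSum (shifted l (shift l)) (antitone_shifted l _)
  obtain ⟨P, hP⟩ := tableauSum_eq_map hs (∅ : Finset (Fin N))
  refine ⟨P, ?_, fun x => by rw [schur_eq_shift, h, hP]⟩
  rintro rfl
  rw [map_zero] at hP
  rw [hP] at h
  have h1 := vandermondePoly_mul_alternantQuotient fun i => shifted l (shift l) i + staircase N i
  rw [h, mul_zero] at h1
  refine alternant_ne_zero ?_ h1.symm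
  intro i j hij
  by_contra hne
  rcases lt_or_gt_of_ne hne with h2 | h2 <;>
  · have h3 := antitone_shifted l (shift l) h2.le
    have h4 := strictAnti_staircase N h2
    simp only at hij
    omega

/-- The antisymmetrization of x^(ν + δ) s_λ(x, 1, …, 1), with δ the staircase, is V s_ν(x) s_λ(x, 1,
…, 1), because s_λ is symmetric. By the column argument it is also a sum of alternants of strictly
decreasing exponents. Division by V gives a sum of Schur functions with multiplicities. -/
theorem exists_schur_mul_schur (h : m ≤ M) (ν : Signature m) (l : Signature M) :
    ∃ c : Signature m →₀ ℕ, ∀ x : Fin m → ℂ, (∀ i, x i ≠ 0) →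
      schur ν x * schur l (padOnes x) = c.sum fun κ n => (n : ℂ) * schur κ x := by
  obtain ⟨hs, hF⟩ := exists_tableauSum (shifted l (shift l)) (antitone_shifted l _)
  set K := shift ν + shift l with hK
  have key : ∀ p ∈ AddSubmonoid.closure
      {p | ∃ β : Fin m → ℕ, StrictAnti β ∧ p = alternant β},
      ∃ (q : MvPolynomial (Fin m) ℂ) (c : Signature m →₀ ℕ), p = vandermondePoly m * q ∧
        ∀ x : Fin m → ℂ, (∀ i, x i ≠ 0) → (∏ i, x i) ^ (-(K : ℤ)) * MvPolynomial.eval x q =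
          c.sum fun κ n => (n : ℂ) * schur κ x := by
    intro p hp
    induction hp using AddSubmonoid.closure_induction with
    | mem p hp =>
      obtain ⟨β, hβ, rfl⟩ := hp
      have hβ1 : ∀ (d j : ℕ) (hj : j + d < m), β ⟨j + d, hj⟩ + d ≤ β ⟨j, by omega⟩ := by
        intro d
        induction d with
        | zero => intro j hj; simp
        | succ d ih =>
          intro j hj
          have h1 := ih j (by omega)
          have h2 : β ⟨j + (d + 1), hj⟩ < β ⟨j + d, by omega⟩ :=
            hβ (Fin.mk_lt_mk.2 (by omega))
          omega
      -- Both factors were shifted to become polynomials, so the signature is recovered by removing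
      -- the sum `K` of the two shifts together with the staircase.
      let κ : Signature m := ⟨fun j => (β j : ℤ) - staircase m j - K, by
        intro i j hij
        have h1 := hβ1 (j - i) i (by omega)
        have h2 : (⟨i + (j - i), by omega⟩ : Fin m) = j := by ext; simp; omega
        rw [h2] at h1
        have h3 := i.2
        have h4 := j.2
        simp only [staircase, Fin.eta] at *
        have h5 : (i : ℕ) ≤ j := hij
        omega⟩
      refine ⟨alternantQuotient β, Finsupp.single κ 1,
        (vandermondePoly_mul_alternantQuotient β).symm, fun x hx => ?_⟩
      have hβ2 : ∀ j, staircase m j ≤ β j := by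
        intro j
        have h1 := hβ1 (m - 1 - j) j (by omega)
        simp only [staircase, Fin.eta] at *
        omega
      have h1 := schur_eq κ (K := K) (fun j => by simp only [κ]; have := hβ2 j; omega) hx
      rw [Finsupp.sum_single_index (by simp), h1, Nat.cast_one, one_mul]
      congr 3
      funext j
      have := hβ2 j
      simp only [shifted, κ]
      omega
    | zero => exact ⟨0, 0, by simp, fun x _ => by simp⟩
    | add p q _ _ hp hq =>
      obtain ⟨q1, c1, h1, h1'⟩ := hp
      obtain ⟨q2, c2, h2, h2'⟩ := hq
      refine ⟨q1 + q2, c1 + c2, by rw [h1, h2, mul_add], fun x hx => ?_⟩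
      rw [map_add, mul_add, h1' x hx, h2' x hx, Finsupp.sum_add_index']
      · simp
      · intros; push_cast; ring
  have hα : StrictAnti fun j => shifted ν (shift ν) j + staircase m j := by
    intro i j hij
    have h1 := antitone_shifted ν (shift ν) hij.le
    have h2 := strictAnti_staircase m hij
    simp only at *
    omega
  obtain ⟨q, c, h1, h2⟩ := key _ (antisym_mul_tableauSum_mem h hs ∅ hα)
  refine ⟨c, fun x hx => ?_⟩
  rw [← h2 x hx]
  rw [antisym_mul_tableauSum h, ← vandermondePoly_mul_alternantQuotient, mul_assoc] at h1
  have h3 := mul_left_cancel₀ (vandermondePoly_ne_zero m) h1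
  have hp : (∏ i, x i) ≠ 0 := Finset.prod_ne_zero_iff.2 fun i _ => hx i
  rw [← h3, schur_eq_shift, schur_eq_shift, hF, map_mul]
  have h4 : MvPolynomial.eval x (permSubst 1 (tableauSum hs (∅ : Finset (Fin M)))) =
      MvPolynomial.eval (padOnes x) (tableauSum hs (∅ : Finset (Fin M))) := by
    have : ((MvPolynomial.aeval x : MvPolynomial (Fin m) ℂ →ₐ[ℂ] ℂ).comp (permSubst 1)) =
        (MvPolynomial.aeval (padOnes x : Fin M → ℂ)) := by
      apply MvPolynomial.algHom_ext
      intro i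
      simp only [AlgHom.comp_apply, permSubst, MvPolynomial.aeval_X, padOnes]
      split_ifs <;> simp
    have h5 := congrArg (fun f => f (tableauSum hs (∅ : Finset (Fin M)))) this
    simpa [MvPolynomial.aeval_eq_eval] using h5
  have h5 : (∏ i : Fin M, padOnes x i : ℂ) = ∏ i, x i := by
    have h6 : ∀ i : Fin M, i ∉ (Finset.univ.map (Fin.castLEEmb h)) → (padOnes x i : ℂ) = 1 := by
      intro i hi
      have h3 : ¬ (i : ℕ) < m := by
        intro h3
        apply hi
        rw [Finset.mem_map]
        exact ⟨⟨i, h3⟩, Finset.mem_univ _, Fin.ext rfl⟩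
      simp [padOnes, h3]
    rw [← Finset.prod_subset (Finset.subset_univ (Finset.univ.map (Fin.castLEEmb h)))
      fun i _ hi => h6 i hi, Finset.prod_map]
    refine Finset.prod_congr rfl fun i _ => by simp [padOnes]
  rw [h4, h5, hK, Nat.cast_add, neg_add, zpow_add₀ hp]
  ring

end SchurPositivity

/-! ### Normalized Schur functions and the transition probabilities -/

section Transition

variable {m M N : ℕ}

/-- The Schur function, normalized to be `1` at `(1, …, 1)`. -/
def normSchur (l : Signature N) (x : Fin N → ℂ) : ℂ := schur l x / schur l 1

theorem schurTerm_eq (ρ : PMF (Signature N)) (l : Signature N) (x : Fin N → ℂ) :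
    schurTerm ρ l x = ((ρ l).toReal : ℂ) * normSchur l x := rfl

theorem exists_schur_one_eq (l : Signature N) : ∃ n : ℕ, 0 < n ∧ schur l 1 = n := by
  obtain ⟨P, hP, h⟩ := exists_schur_eq l
  refine ⟨MvPolynomial.eval 1 P, ?_, ?_⟩
  · rw [MvPolynomial.eval_eq]
    simp only [Pi.one_apply, one_pow, Finset.prod_const_one, mul_one]
    obtain ⟨d, hd⟩ := MvPolynomial.support_nonempty.2 hP
    exact Finset.sum_pos' (fun _ _ => Nat.zero_le _)
      ⟨d, hd, Nat.pos_of_ne_zero (MvPolynomial.mem_support_iff.1 hd)⟩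
  · rw [h]
    simp only [Pi.one_apply, Finset.prod_const_one, one_zpow, one_mul, MvPolynomial.eval_map]
    rw [MvPolynomial.eval₂_eq, MvPolynomial.eval_eq]
    simp

theorem schur_one_ne_zero (l : Signature N) : schur l 1 ≠ 0 := by
  obtain ⟨n, hn, h⟩ := exists_schur_one_eq l
  rw [h]
  exact_mod_cast hn.ne'

theorem normSchur_one (l : Signature N) : normSchur l 1 = 1 := div_self (schur_one_ne_zero l)

/-- Normalized Schur functions are convex combinations of Laurent monomials. -/
theorem exists_normSchur_eq_sum (l : Signature N) : ∃ (S : Finset (Fin N →₀ ℕ))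
    (w : (Fin N →₀ ℕ) → Fin N → ℤ) (k : (Fin N →₀ ℕ) → ℝ), (∀ d, 0 ≤ k d) ∧
      ∀ x : Fin N → ℂ, (∀ i, x i ≠ 0) → normSchur l x = ∑ d ∈ S, (k d : ℂ) * ∏ i, x i ^ w d i := by
  obtain ⟨P, hP, h⟩ := exists_schur_eq l
  obtain ⟨n, hn, h1⟩ := exists_schur_one_eq l
  refine ⟨P.support, fun d i => (d i : ℤ) - shift l, fun d => ((P.coeff d : ℕ) : ℝ) / n,
    fun d => by positivity, fun x hx => ?_⟩
  rw [normSchur, h1, h, MvPolynomial.eval_map, MvPolynomial.eval₂_eq', Finset.mul_sum,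
    Finset.sum_div]
  refine Finset.sum_congr rfl fun d _ => ?_
  have h2 : ∀ i, x i ^ ((d i : ℤ) - shift l) = x i ^ d i * x i ^ (-(shift l : ℤ)) := by
    intro i
    rw [sub_eq_add_neg, zpow_add₀ (hx i), zpow_natCast]
  simp only [h2, Finset.prod_mul_distrib, Finset.prod_zpow]
  simp
  ring

/-- The triangle inequality for a sum of Laurent monomials with nonnegative coefficients. The second
clause records that the value at the moduli is its own norm. -/
theorem norm_normSchur_le (l : Signature N) {x : Fin N → ℂ} (hx : ∀ i, x i ≠ 0) :
    (‖normSchur l x‖ : ℝ) ≤ ‖normSchur l fun i => ((‖x i‖ : ℝ) : ℂ)‖ ∧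
      normSchur l (fun i => ((‖x i‖ : ℝ) : ℂ)) = ((‖normSchur l fun i => ((‖x i‖ : ℝ) : ℂ)‖ : ℝ) : ℂ) := by
  obtain ⟨S, w, k, hk, h⟩ := exists_normSchur_eq_sum l
  have h1 : normSchur l (fun i => ((‖x i‖ : ℝ) : ℂ)) =
      ((∑ d ∈ S, k d * ∏ i, ‖x i‖ ^ w d i : ℝ) : ℂ) := by
    rw [h _ (fun i => by simpa using hx i)]
    push_cast
    rfl
  have h0 : 0 ≤ ∑ d ∈ S, k d * ∏ i, ‖x i‖ ^ w d i :=
    Finset.sum_nonneg fun d _ => mul_nonneg (hk d) (Finset.prod_nonneg fun i _ => by positivity)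
  rw [h1, Complex.norm_real, Real.norm_of_nonneg h0]
  refine ⟨?_, rfl⟩
  rw [h x hx]
  refine (norm_sum_le _ _).trans (Finset.sum_le_sum fun d _ => ?_)
  rw [norm_mul, Complex.norm_real, Real.norm_of_nonneg (hk d), norm_prod]
  simp

/-- The points with all the coordinates equal to `r` or `r⁻¹`. -/
def corner (r : ℝ) (ε : Fin N → Bool) : Fin N → ℂ := fun i => if ε i then (r : ℂ) else (r : ℂ)⁻¹

/-- For one variable, |x|^w ≤ r^w + r^(-w). Multiplying over the variables and expanding yields the
sum over the corners. Thus convergence at finitely many points controls a whole neighbourhood. -/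
theorem norm_normSchur_le_sum_corner (l : Signature N) {r : ℝ} (hr : 1 ≤ r) {x : Fin N → ℂ}
    (hx : ∀ i, r⁻¹ ≤ ‖x i‖) (hx' : ∀ i, ‖x i‖ ≤ r) :
    ‖normSchur l x‖ ≤ ∑ ε : Fin N → Bool, ‖normSchur l (corner r ε)‖ := by
  obtain ⟨S, w, k, hk, h⟩ := exists_normSchur_eq_sum l
  have hr0 : 0 < r := by linarith
  have hx0 : ∀ i, 0 < ‖x i‖ := fun i => (inv_pos.2 hr0).trans_le (hx i)
  have hc : ∀ ε : Fin N → Bool, ‖normSchur l (corner r ε)‖ =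
      ∑ d ∈ S, k d * ∏ i, (if ε i then r else r⁻¹) ^ w d i := by
    intro ε
    have h0 : 0 ≤ ∑ d ∈ S, k d * ∏ i, (if ε i then r else r⁻¹) ^ w d i :=
      Finset.sum_nonneg fun d _ => mul_nonneg (hk d)
        (Finset.prod_nonneg fun i _ => by split_ifs <;> positivity)
    have h1 : normSchur l (corner r ε) =
        ((∑ d ∈ S, k d * ∏ i, (if ε i then r else r⁻¹) ^ w d i : ℝ) : ℂ) := by
      rw [h _ (fun i => by simp only [corner]; split_ifs <;> simp [hr0.ne'])]
      push_cast
      refine Finset.sum_congr rfl fun d _ => ?_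
      congr 1
      refine Finset.prod_congr rfl fun i _ => ?_
      simp only [corner]
      split_ifs <;> simp
    rw [h1, Complex.norm_real, Real.norm_of_nonneg h0]
  simp only [hc]
  rw [Finset.sum_comm, h x fun i => norm_pos_iff.1 (hx0 i)]
  refine (norm_sum_le _ _).trans (Finset.sum_le_sum fun d _ => ?_)
  rw [norm_mul, Complex.norm_real, Real.norm_of_nonneg (hk d), norm_prod, ← Finset.mul_sum]
  refine mul_le_mul_of_nonneg_left ?_ (hk d)
  have h2 := Finset.prod_univ_sum (fun _ : Fin N => (Finset.univ : Finset Bool))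
    fun i b => (if b then r else r⁻¹) ^ w d i
  rw [Fintype.piFinset_univ] at h2
  rw [← h2]
  refine Finset.prod_le_prod (fun i _ => norm_nonneg _) fun i _ => ?_
  rw [norm_zpow]
  simp only [Fintype.sum_bool, if_true, Bool.false_eq_true, if_false]
  rcases le_total 0 (w d i) with hw | hw
  · have := zpow_le_zpow_left₀ hw (hx0 i).le (hx' i)
    have : 0 ≤ r⁻¹ ^ w d i := by positivity
    linarith
  · have h3 : ‖x i‖ ^ w d i ≤ r⁻¹ ^ w d i := by
      obtain ⟨n, hn⟩ := Int.exists_eq_neg_ofNat hw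
      rw [hn, zpow_neg, zpow_neg, zpow_natCast, zpow_natCast]
      exact inv_anti₀ (by positivity) (pow_le_pow_left₀ (by positivity) (hx i) n)
    have : 0 ≤ r ^ w d i := by positivity
    linarith

theorem padOnes_one : (padOnes (1 : Fin m → ℂ) : Fin M → ℂ) = 1 := by
  funext i
  simp [padOnes]

/-- Positivity of the expansion gives nonnegative weights, and evaluation at (1, …, 1) shows that
they sum to one. -/
theorem exists_normSchur_mul_normSchur (h : m ≤ M) (ν : Signature m) (l : Signature M) :
    ∃ (k : PMF (Signature m)) (S : Finset (Signature m)), (∀ κ ∉ S, k κ = 0) ∧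
      ∀ x : Fin m → ℂ, (∀ i, x i ≠ 0) → normSchur ν x * normSchur l (padOnes x) =
        ∑ κ ∈ S, ((k κ).toReal : ℂ) * normSchur κ x := by
  obtain ⟨c, hc⟩ := exists_schur_mul_schur h ν l
  choose n hn hn1 using fun l : Signature m => exists_schur_one_eq l
  obtain ⟨n', hn', hn1'⟩ := exists_schur_one_eq l
  have hsum : ∑ κ ∈ c.support, (c κ * n κ : ℕ) = n ν * n' := by
    have h1 := hc 1 (by simp)
    rw [padOnes_one, hn1, hn1', Finsupp.sum] at h1
    simp only [hn1] at h1
    exact_mod_cast h1.symm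
  have h0 : (n ν * n' : ENNReal) ≠ 0 := by
    have := hn ν
    simp; omega
  have htop : (n ν * n' : ENNReal) ≠ ⊤ := ENNReal.mul_ne_top (by simp) (by simp)
  refine ⟨PMF.ofFinset (fun κ => (c κ * n κ : ENNReal) / (n ν * n')) c.support ?_ ?_, c.support,
    ?_, ?_⟩
  · simp only [div_eq_mul_inv]
    rw [← Finset.sum_mul, ← div_eq_mul_inv]
    have : (∑ κ ∈ c.support, (c κ * n κ : ENNReal)) = n ν * n' := by exact_mod_cast hsum
    rw [this, ENNReal.div_self h0 htop]
  · intro κ hκ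
    simp [Finsupp.notMem_support_iff.1 hκ]
  · intro κ hκ
    simp [Finsupp.notMem_support_iff.1 hκ]
  · intro x hx
    rw [normSchur, normSchur, div_mul_div_comm, hc x hx, Finsupp.sum, Finset.sum_div]
    refine Finset.sum_congr rfl fun κ _ => ?_
    rw [normSchur, hn1, hn1, hn1', PMF.ofFinset_apply, ENNReal.toReal_div, ENNReal.toReal_mul,
      ENNReal.toReal_mul]
    have h2 : (n κ : ℂ) ≠ 0 := by exact_mod_cast (hn κ).ne'
    have h3 : (n ν : ℂ) ≠ 0 := by exact_mod_cast (hn ν).ne'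
    have h4 : (n' : ℂ) ≠ 0 := by exact_mod_cast hn'.ne'
    simp only [ENNReal.toReal_natCast]
    push_cast
    field_simp

theorem norm_toReal_mul (a : ENNReal) (z : ℂ) : ‖((a.toReal : ℝ) : ℂ) * z‖ = a.toReal * ‖z‖ := by
  rw [norm_mul, Complex.norm_real, Real.norm_of_nonneg ENNReal.toReal_nonneg]

theorem eventually_ne_zero : ∀ᶠ x in 𝓝 (1 : Fin N → ℂ), ∀ i, x i ≠ 0 := by
  rw [Filter.eventually_all]
  intro i
  have : ContinuousAt (fun x : Fin N → ℂ => x i) 1 :=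
    (continuous_apply i).continuousAt
  exact this.eventually_ne (by simp)

theorem tendsto_norm_one :
    Tendsto (fun x : Fin N → ℂ => fun i => ((‖x i‖ : ℝ) : ℂ)) (𝓝 1) (𝓝 1) := by
  have : Continuous (fun x : Fin N → ℂ => fun i => ((‖x i‖ : ℝ) : ℂ)) := by fun_prop
  have h := this.tendsto 1
  convert h using 2
  funext i
  simp

theorem SchurConvergent.eventually_summable {ρ : PMF (Signature N)} (hρ : SchurConvergent ρ) :
    ∀ᶠ x in 𝓝 (1 : Fin N → ℂ), Summable fun l => schurTerm ρ l x := by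
  obtain ⟨U, hU, h1, hs⟩ := hρ
  filter_upwards [hU.mem_nhds h1] with x hx
  exact hs.summable hx

/-- The transition law is a mixture: choose ν with law `ρ`, then expand s_ν(x) s_λ(x, 1, …, 1). Only
the interchange of the two summations needs an argument. -/
theorem exists_isTransition (h : m ≤ M) {ρ : PMF (Signature m)} (hρ : SchurConvergent ρ)
    (l : Signature M) : ∃ q : PMF (Signature m), IsTransition (schurGen ρ) l q := by
  choose k S hS hk using fun ν : Signature m => exists_normSchur_mul_normSchur h ν l
  refine ⟨ρ.bind k, ?_⟩
  have hev := hρ.eventually_summable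
  filter_upwards [hev, tendsto_norm_one.eventually hev, eventually_ne_zero] with x hx hx' hx0
  set y : Fin m → ℂ := fun i => ((‖x i‖ : ℝ) : ℂ) with hy
  have hy0 : ∀ i, y i ≠ 0 := fun i => by simpa [hy] using hx0 i
  have hkS : ∀ ν (f : Signature m → ℂ),
      HasSum (fun κ => ((k ν κ).toReal : ℂ) * f κ) (∑ κ ∈ S ν, ((k ν κ).toReal : ℂ) * f κ) :=
    fun ν f => hasSum_sum_of_ne_finset_zero fun κ hκ => by simp [hS ν κ hκ]
  set f : Signature m × Signature m → ℂ :=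
    fun p => ((ρ p.1).toReal : ℂ) * (((k p.1 p.2).toReal : ℂ) * normSchur p.2 x) with hf
  -- Absolute convergence: replacing x_i by |x_i| turns the inner sums of norms into an upper bound
  -- that is again a product of normalized Schur functions, and the outer series converges at the
  -- point of moduli too, if `x` is near (1, …, 1).
  have hsum : Summable f := by
    rw [← summable_norm_iff, summable_prod_of_nonneg (fun _ => norm_nonneg _)]
    have h1 : ∀ ν, HasSum (fun κ => ‖f (ν, κ)‖)
        (∑ κ ∈ S ν, (ρ ν).toReal * ((k ν κ).toReal * ‖normSchur κ x‖)) := by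
      intro ν
      simp only [hf, norm_toReal_mul]
      exact hasSum_sum_of_ne_finset_zero fun κ hκ => by simp [hS ν κ hκ]
    refine ⟨fun ν => (h1 ν).summable, ?_⟩
    simp only [(h1 _).tsum_eq]
    refine Summable.of_nonneg_of_le (fun ν => Finset.sum_nonneg fun κ _ => by positivity) ?_
      (hx'.norm.mul_right ‖normSchur l (padOnes y)‖)
    intro ν
    rw [schurTerm_eq, norm_toReal_mul, mul_assoc, ← Finset.mul_sum]
    refine mul_le_mul_of_nonneg_left ?_ ENNReal.toReal_nonneg
    rw [← norm_mul, hk ν y hy0]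
    have h2 : (∑ κ ∈ S ν, ((k ν κ).toReal : ℂ) * normSchur κ y) =
        ((∑ κ ∈ S ν, (k ν κ).toReal * ‖normSchur κ y‖ : ℝ) : ℂ) := by
      push_cast
      refine Finset.sum_congr rfl fun κ _ => ?_
      rw [← (norm_normSchur_le κ hx0).2]
    rw [h2, Complex.norm_real, Real.norm_of_nonneg
      (Finset.sum_nonneg fun κ _ => mul_nonneg ENNReal.toReal_nonneg (norm_nonneg _))]
    exact Finset.sum_le_sum fun κ _ =>
      mul_le_mul_of_nonneg_left (norm_normSchur_le κ hx0).1 ENNReal.toReal_nonneg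
  have h1 : HasSum f (schurGen ρ x * normSchur l (padOnes x)) := by
    have h2 := hsum.hasSum.prod_fiberwise fun ν => (hkS ν (fun κ => normSchur κ x)).mul_left
      ((ρ ν).toReal : ℂ)
    have h3 := hx.hasSum.mul_right (normSchur l (padOnes x))
    have h4 : (fun ν => ((ρ ν).toReal : ℂ) * ∑ κ ∈ S ν, ((k ν κ).toReal : ℂ) * normSchur κ x) =
        fun ν => schurTerm ρ ν x * normSchur l (padOnes x) := by
      funext ν
      rw [← hk ν x hx0, schurTerm_eq, mul_assoc]
    rw [h4] at h2
    have h5 := h2.unique h3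
    rw [schurGen, ← h5]
    exact hsum.hasSum
  have h2 : HasSum (fun p : Signature m × Signature m => f p.swap)
      (schurGen ρ x * normSchur l (padOnes x)) :=
    (Equiv.prodComm (Signature m) (Signature m)).hasSum_iff.2 h1
  refine h2.prod_fiberwise fun κ => ?_
  have h3 : HasSum (fun ν => (ρ ν * k ν κ).toReal) ((ρ.bind k) κ).toReal := by
    rw [PMF.bind_apply, ENNReal.tsum_toReal_eq]
    · refine (ENNReal.summable_toReal ?_).hasSum
      rw [← PMF.bind_apply]
      exact PMF.apply_ne_top _ _
    · exact fun ν => ENNReal.mul_ne_top (PMF.apply_ne_top _ _) (PMF.apply_ne_top _ _)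
  have h4 := ((Complex.hasSum_ofReal.2 h3).mul_right (normSchur κ x))
  rw [schurTerm_eq]
  have h5 : (fun ν => f (Prod.swap (κ, ν))) =
      fun ν => (((ρ ν * k ν κ).toReal : ℝ) : ℂ) * normSchur κ x := by
    funext ν
    simp [hf, ENNReal.toReal_mul, mul_assoc]
  rw [h5]
  exact h4

theorem isTransition_transition (h : m ≤ M) {ρ : PMF (Signature m)} (hρ : SchurConvergent ρ)
    (l : Signature M) : IsTransition (schurGen ρ) l (transition (schurGen ρ) l) := by
  have h1 := exists_isTransition h hρ l
  rw [transition, dif_pos h1]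
  exact h1.choose_spec

end Transition

/-! ### Taylor series at `(1, …, 1)` -/

section Taylor

open scoped Nat

variable {m M : ℕ} {f g : (Fin m → ℂ) → ℂ} {x : Fin m → ℂ}

/-- The direction of the `i`-th variable. -/
def direction (m i : ℕ) : Fin m → ℂ := fun j => if (j : ℕ) = i then 1 else 0

theorem partialDeriv_eq (i : ℕ) (f : (Fin m → ℂ) → ℂ) (x : Fin m → ℂ) :
    partialDeriv i f x = lineDeriv ℂ f x (direction m i) := rfl

theorem partialDeriv_congr (i : ℕ) (h : f =ᶠ[𝓝 x] g) : partialDeriv i f =ᶠ[𝓝 x] partialDeriv i g := by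
  filter_upwards [h.eventuallyEq_nhds] with y hy
  exact hy.lineDeriv_eq

theorem mixedPartial_cons (i : ℕ) (is : List ℕ) (f : (Fin m → ℂ) → ℂ) :
    mixedPartial (i :: is) f = partialDeriv i (mixedPartial is f) := rfl

theorem mixedPartial_append (is js : List ℕ) (f : (Fin m → ℂ) → ℂ) :
    mixedPartial (is ++ js) f = mixedPartial is (mixedPartial js f) := by
  simp [mixedPartial]

theorem mixedPartial_congr (is : List ℕ) (h : f =ᶠ[𝓝 x] g) :
    mixedPartial is f =ᶠ[𝓝 x] mixedPartial is g := by
  induction is with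
  | nil => exact h
  | cons i is ih => exact partialDeriv_congr i ih

theorem partialDeriv_eventuallyEq (i : ℕ) (hf : AnalyticAt ℂ f x) :
    partialDeriv i f =ᶠ[𝓝 x] fun y => fderiv ℂ f y (direction m i) := by
  filter_upwards [hf.eventually_analyticAt] with y hy
  exact hy.differentiableAt.lineDeriv_eq_fderiv

theorem analyticAt_partialDeriv (i : ℕ) (hf : AnalyticAt ℂ f x) :
    AnalyticAt ℂ (partialDeriv i f) x := by
  refine AnalyticAt.congr ?_ (partialDeriv_eventuallyEq i hf).symm
  exact (ContinuousLinearMap.analyticAt (ContinuousLinearMap.apply ℂ ℂ (direction m i)) _).comp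
    hf.fderiv

theorem analyticAt_mixedPartial (is : List ℕ) (hf : AnalyticAt ℂ f x) :
    AnalyticAt ℂ (mixedPartial is f) x := by
  induction is with
  | nil => exact hf
  | cons i is ih => exact analyticAt_partialDeriv i ih

theorem partialDeriv_comm (i j : ℕ) (hf : AnalyticAt ℂ f x) :
    partialDeriv i (partialDeriv j f) =ᶠ[𝓝 x] partialDeriv j (partialDeriv i f) := by
  have key : ∀ (i j : ℕ) (y : Fin m → ℂ), AnalyticAt ℂ f y → partialDeriv i (partialDeriv j f) y =
      fderiv ℂ (fderiv ℂ f) y (direction m i) (direction m j) := by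
    intro i j y hy
    rw [(partialDeriv_congr i (partialDeriv_eventuallyEq j hy)).eq_of_nhds,
      partialDeriv_eq, DifferentiableAt.lineDeriv_eq_fderiv]
    · have h1 := ((ContinuousLinearMap.apply ℂ ℂ (direction m j)).hasFDerivAt.comp y
        hy.fderiv.differentiableAt.hasFDerivAt).fderiv
      have h2 : ((ContinuousLinearMap.apply ℂ ℂ (direction m j)) ∘ fderiv ℂ f) =
          fun y => fderiv ℂ f y (direction m j) := rfl
      rw [h2] at h1
      rw [h1]
      rfl
    · exact ((ContinuousLinearMap.analyticAt (ContinuousLinearMap.apply ℂ ℂ (direction m j)) _).comp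
        hy.fderiv).differentiableAt
  filter_upwards [hf.eventually_analyticAt] with y hy
  rw [key i j y hy, key j i y hy]
  exact (hy.contDiffAt (n := ⊤)).isSymmSndFDerivAt_of_omega _ _

theorem mixedPartial_perm {is js : List ℕ} (h : is.Perm js) (hf : AnalyticAt ℂ f x) :
    mixedPartial is f =ᶠ[𝓝 x] mixedPartial js f := by
  induction h with
  | nil => rfl
  | cons i _ ih => exact partialDeriv_congr i ih
  | swap i j is => exact partialDeriv_comm j i (analyticAt_mixedPartial is hf)
  | trans _ _ h1 h2 => exact h1.trans h2

theorem partialDeriv_add (i : ℕ) (hf : AnalyticAt ℂ f x) (hg : AnalyticAt ℂ g x) :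
    partialDeriv i (f + g) =ᶠ[𝓝 x] partialDeriv i f + partialDeriv i g := by
  filter_upwards [hf.eventually_analyticAt, hg.eventually_analyticAt] with y h1 h2
  simp only [partialDeriv_eq, Pi.add_apply]
  rw [DifferentiableAt.lineDeriv_eq_fderiv (h1.add h2).differentiableAt,
    DifferentiableAt.lineDeriv_eq_fderiv h1.differentiableAt,
    DifferentiableAt.lineDeriv_eq_fderiv h2.differentiableAt,
    fderiv_add h1.differentiableAt h2.differentiableAt]
  rfl

theorem partialDeriv_mul (i : ℕ) (hf : AnalyticAt ℂ f x) (hg : AnalyticAt ℂ g x) :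
    partialDeriv i (f * g) =ᶠ[𝓝 x] f * partialDeriv i g + partialDeriv i f * g := by
  filter_upwards [hf.eventually_analyticAt, hg.eventually_analyticAt] with y h1 h2
  simp only [partialDeriv_eq, Pi.add_apply, Pi.mul_apply]
  rw [DifferentiableAt.lineDeriv_eq_fderiv (h1.mul h2).differentiableAt,
    DifferentiableAt.lineDeriv_eq_fderiv h1.differentiableAt,
    DifferentiableAt.lineDeriv_eq_fderiv h2.differentiableAt,
    fderiv_mul h1.differentiableAt h2.differentiableAt]
  simp [mul_comm]

theorem partialDeriv_const_mul (i : ℕ) (c : ℂ) (hf : AnalyticAt ℂ f x) :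
    partialDeriv i (fun y => c * f y) =ᶠ[𝓝 x] fun y => c * partialDeriv i f y := by
  filter_upwards [hf.eventually_analyticAt] with y h1
  simp only [partialDeriv_eq]
  rw [DifferentiableAt.lineDeriv_eq_fderiv (h1.differentiableAt.const_mul c),
    DifferentiableAt.lineDeriv_eq_fderiv h1.differentiableAt,
    fderiv_const_mul h1.differentiableAt]
  rfl

theorem mixedPartial_add (is : List ℕ) (hf : AnalyticAt ℂ f x) (hg : AnalyticAt ℂ g x) :
    mixedPartial is (f + g) =ᶠ[𝓝 x] mixedPartial is f + mixedPartial is g := by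
  induction is with
  | nil => rfl
  | cons i is ih =>
    exact (partialDeriv_congr i ih).trans (partialDeriv_add i (analyticAt_mixedPartial is hf)
      (analyticAt_mixedPartial is hg))

theorem mixedPartial_const_mul (is : List ℕ) (c : ℂ) (hf : AnalyticAt ℂ f x) :
    mixedPartial is (fun y => c * f y) =ᶠ[𝓝 x] fun y => c * mixedPartial is f y := by
  induction is with
  | nil => rfl
  | cons i is ih =>
    exact (partialDeriv_congr i ih).trans
      (partialDeriv_const_mul i c (analyticAt_mixedPartial is hf))

/-- The variables of a monomial, with multiplicity. -/
def variableList (α : Fin m →₀ ℕ) : List ℕ := ((Finsupp.toMultiset α).map Fin.val).toList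

theorem perm_variableList {α : Fin m →₀ ℕ} {is : List ℕ}
    (h : (is : Multiset ℕ) = (Finsupp.toMultiset α).map Fin.val) : is.Perm (variableList α) := by
  rw [← Multiset.coe_eq_coe, h, variableList, Multiset.coe_toList]

/-- The Taylor series of a function at `(1, …, 1)`. -/
def taylor (f : (Fin m → ℂ) → ℂ) : MvPowerSeries (Fin m) ℂ :=
  fun α => (∏ i, (α i)! : ℂ)⁻¹ * mixedPartial (variableList α) f 1

theorem coeff_taylor (α : Fin m →₀ ℕ) (f : (Fin m → ℂ) → ℂ) :
    MvPowerSeries.coeff α (taylor f) =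
      (∏ i, (α i)! : ℂ)⁻¹ * mixedPartial (variableList α) f 1 := rfl

theorem taylor_congr (h : f =ᶠ[𝓝 1] g) : taylor f = taylor g := by
  ext α
  rw [coeff_taylor, coeff_taylor, (mixedPartial_congr _ h).eq_of_nhds]

theorem constantCoeff_taylor (f : (Fin m → ℂ) → ℂ) :
    MvPowerSeries.constantCoeff (taylor f) = f 1 := by
  rw [← MvPowerSeries.coeff_zero_eq_constantCoeff_apply, coeff_taylor]
  simp [variableList, mixedPartial]

theorem pderiv_taylor (i : Fin m) (hf : AnalyticAt ℂ f 1) :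
    MvPowerSeries.pderiv ℂ i (taylor f) = taylor (partialDeriv i f) := by
  ext α
  rw [MvPowerSeries.coeff_pderiv, coeff_taylor, coeff_taylor]
  have h1 : mixedPartial (variableList (α + Finsupp.single i 1)) f 1 =
      mixedPartial (variableList α) (partialDeriv i f) 1 := by
    have h2 : (variableList α ++ [(i : ℕ)]).Perm (variableList (α + Finsupp.single i 1)) := by
      apply perm_variableList
      rw [map_add, Multiset.map_add, Finsupp.toMultiset_single, one_smul, Multiset.map_singleton,
        ← Multiset.coe_add, variableList, Multiset.coe_toList]
      rfl
    rw [← (mixedPartial_perm h2 hf).eq_of_nhds, mixedPartial_append]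
    rfl
  have h3 : (∏ j, ((α + Finsupp.single i 1 : Fin m →₀ ℕ) j)! : ℂ) =
      (α i + 1) * ∏ j, ((α j)! : ℂ) := by
    classical
    rw [← Finset.mul_prod_erase _ _ (Finset.mem_univ i), ← Finset.mul_prod_erase _ (fun j => ((α j)! : ℂ)) (Finset.mem_univ i),
      ← mul_assoc]
    congr 1
    · simp [Nat.factorial_succ]
    · refine Finset.prod_congr rfl fun j hj => ?_
      have : i ≠ j := (Finset.ne_of_mem_erase hj).symm
      simp [this]
  rw [h1, h3]
  have h4 : (α i + 1 : ℂ) ≠ 0 := by exact_mod_cast Nat.succ_ne_zero (α i)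
  have h5 : (∏ j, ((α j)! : ℂ)) ≠ 0 :=
    Finset.prod_ne_zero_iff.2 fun j _ => by exact_mod_cast Nat.factorial_ne_zero (α j)
  field_simp

theorem taylor_add (hf : AnalyticAt ℂ f 1) (hg : AnalyticAt ℂ g 1) :
    taylor (f + g) = taylor f + taylor g := by
  ext α
  rw [map_add, coeff_taylor, coeff_taylor, coeff_taylor, (mixedPartial_add _ hf hg).eq_of_nhds,
    Pi.add_apply, mul_add]

theorem taylor_const_mul (c : ℂ) (hf : AnalyticAt ℂ f 1) :
    taylor (fun x => c * f x) = c • taylor f := by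
  ext α
  rw [MvPowerSeries.coeff_smul, coeff_taylor, coeff_taylor,
    (mixedPartial_const_mul _ c hf).eq_of_nhds]
  ring

theorem taylor_sum {ι : Type*} (s : Finset ι) (f : ι → (Fin m → ℂ) → ℂ)
    (hf : ∀ i ∈ s, AnalyticAt ℂ (f i) 1) :
    AnalyticAt ℂ (∑ i ∈ s, f i) 1 ∧ taylor (∑ i ∈ s, f i) = ∑ i ∈ s, taylor (f i) := by
  classical
  induction s using Finset.induction_on with
  | empty =>
    refine ⟨by rw [Finset.sum_empty]; exact analyticAt_const (v := (0 : ℂ)), ?_⟩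
    have := taylor_const_mul (m := m) 0 (analyticAt_const (v := (0 : ℂ)))
    rw [Finset.sum_empty, Finset.sum_empty]
    simp only [mul_zero, zero_smul] at this
    exact this
  | insert i s hi ih =>
    obtain ⟨h1, h2⟩ := ih fun j hj => hf j (Finset.mem_insert_of_mem hj)
    have h3 := hf i (Finset.mem_insert_self i s)
    rw [Finset.sum_insert hi, Finset.sum_insert hi, taylor_add h3 h1, h2]
    exact ⟨h3.add h1, rfl⟩

/-- Induction on the degree: a coefficient of positive degree is determined by a partial derivative,
and both sides obey the Leibniz rule. This avoids the general product rule for iterated partial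
derivatives. -/
theorem taylor_mul (hf : AnalyticAt ℂ f 1) (hg : AnalyticAt ℂ g 1) :
    taylor (f * g) = taylor f * taylor g := by
  have key : ∀ (n : ℕ) (f g : (Fin m → ℂ) → ℂ), AnalyticAt ℂ f 1 → AnalyticAt ℂ g 1 →
      ∀ α : Fin m →₀ ℕ, α.degree = n → MvPowerSeries.coeff α (taylor (f * g)) =
        MvPowerSeries.coeff α (taylor f * taylor g) := by
    intro n
    induction n with
    | zero =>
      intro f g _ _ α hα
      have : α = 0 := (Finsupp.degree_eq_zero_iff α).1 hα
      subst this
      rw [MvPowerSeries.coeff_zero_eq_constantCoeff_apply,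
        MvPowerSeries.coeff_zero_eq_constantCoeff_apply, map_mul, constantCoeff_taylor,
        constantCoeff_taylor, constantCoeff_taylor, Pi.mul_apply]
    | succ n ih =>
      intro f g hf hg α hα
      obtain ⟨i, hi⟩ : ∃ i, α i ≠ 0 := by
        by_contra! h
        have : α = 0 := Finsupp.ext h
        subst this
        simp at hα
      obtain ⟨β, rfl⟩ : ∃ β, α = β + Finsupp.single i 1 := by
        refine ⟨α - Finsupp.single i 1, ?_⟩
        rw [tsub_add_cancel_of_le]
        simpa using Nat.one_le_iff_ne_zero.2 hi
      have hβ : β.degree = n := by simpa using hα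
      have h1 : (β i + 1 : ℂ) ≠ 0 := by exact_mod_cast Nat.succ_ne_zero (β i)
      apply mul_right_cancel₀ h1
      rw [← MvPowerSeries.coeff_pderiv, ← MvPowerSeries.coeff_pderiv, pderiv_taylor i (hf.mul hg),
        taylor_congr (partialDeriv_mul i hf hg),
        taylor_add (hf.mul (analyticAt_partialDeriv i hg)) ((analyticAt_partialDeriv i hf).mul hg),
        Derivation.leibniz, map_add, map_add, ih f _ hf (analyticAt_partialDeriv i hg) β hβ,
        ih _ g (analyticAt_partialDeriv i hf) hg β hβ, pderiv_taylor i hf, pderiv_taylor i hg,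
        smul_eq_mul, smul_eq_mul, mul_comm (taylor g)]
  ext α
  exact key _ f g hf hg α rfl

/-- The only fact about F = exp(log F) that is used later: its logarithmic derivative. No formal
exponential series is required. -/
theorem pderiv_taylor_exp (i : Fin m) (hf : AnalyticAt ℂ f 1) :
    MvPowerSeries.pderiv ℂ i (taylor fun x => Complex.exp (f x)) =
      MvPowerSeries.pderiv ℂ i (taylor f) * taylor fun x => Complex.exp (f x) := by
  have he : AnalyticAt ℂ (fun x => Complex.exp (f x)) 1 := hf.cexp
  rw [pderiv_taylor i hf, pderiv_taylor i he, ← taylor_mul (analyticAt_partialDeriv i hf) he]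
  apply taylor_congr
  filter_upwards [hf.eventually_analyticAt] with y hy
  simp only [partialDeriv_eq, Pi.mul_apply]
  rw [DifferentiableAt.lineDeriv_eq_fderiv hy.differentiableAt.hasFDerivAt.cexp.differentiableAt,
    DifferentiableAt.lineDeriv_eq_fderiv hy.differentiableAt, hy.differentiableAt.hasFDerivAt.cexp.fderiv]
  simp [mul_comm]

theorem padOnes_add_smul_direction {i : ℕ} (hi : i < m) (x : Fin m → ℂ) (t : ℂ) :
    (padOnes (x + t • direction m i) : Fin M → ℂ) = padOnes x + t • direction M i := by
  funext j
  by_cases hj : (j : ℕ) < m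
  · simp [padOnes, hj, direction]
  · have : (j : ℕ) ≠ i := by omega
    simp [padOnes, hj, direction, this]

theorem mixedPartial_comp_padOnes (f : (Fin M → ℂ) → ℂ) (is : List ℕ)
    (his : ∀ i ∈ is, i < m) :
    mixedPartial is (fun x : Fin m → ℂ => f (padOnes x)) =
      fun x => mixedPartial is f (padOnes x) := by
  induction is with
  | nil => rfl
  | cons i is ih =>
    rw [mixedPartial_cons, ih fun j hj => his j (by simp [hj])]
    funext x
    simp only [mixedPartial_cons, partialDeriv_eq, lineDeriv]
    simp only [padOnes_add_smul_direction (his i (by simp))]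

theorem analyticAt_comp_padOnes {f : (Fin M → ℂ) → ℂ} (hf : AnalyticAt ℂ f 1) :
    AnalyticAt ℂ (fun x : Fin m → ℂ => f (padOnes x)) 1 := by
  have h1 : AnalyticAt ℂ (fun x : Fin m → ℂ => (padOnes x : Fin M → ℂ)) 1 := by
    rw [analyticAt_pi_iff]
    intro i
    by_cases hi : (i : ℕ) < m
    · simp only [padOnes, hi, dif_pos]
      exact (ContinuousLinearMap.proj (R := ℂ) (⟨i, hi⟩ : Fin m) :
        (Fin m → ℂ) →L[ℂ] ℂ).analyticAt _
    · simp only [padOnes, hi, dif_neg, not_false_eq_true]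
      exact analyticAt_const
  refine AnalyticAt.fun_comp ?_ h1
  rw [padOnes_one]
  exact hf

theorem continuous_padOnes : Continuous (fun x : Fin m → ℂ => (padOnes x : Fin M → ℂ)) := by
  refine continuous_pi fun i => ?_
  by_cases hi : (i : ℕ) < m
  · simp only [padOnes, hi, dif_pos]
    exact continuous_apply _
  · simp only [padOnes, hi, dif_neg, not_false_eq_true]
    exact continuous_const

theorem tendsto_padOnes_one :
    Tendsto (fun x : Fin m → ℂ => (padOnes x : Fin M → ℂ)) (𝓝 1) (𝓝 1) := by
  have := (continuous_padOnes (m := m) (M := M)).tendsto 1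
  rwa [padOnes_one] at this

theorem taylor_comp_padOnes (h : m ≤ M) (f : (Fin M → ℂ) → ℂ) :
    taylor (fun x : Fin m → ℂ => f (padOnes x)) =
      MvPowerSeries.killCompl (Fin.castLEEmb h) (taylor f) := by
  ext α
  rw [MvPowerSeries.coeff_killCompl, coeff_taylor, coeff_taylor]
  have h1 : variableList (Finsupp.embDomain (Fin.castLEEmb h) α) = variableList α := by
    rw [variableList, variableList]
    congr 1
    rw [Finsupp.embDomain_eq_mapDomain, ← Finsupp.toMultiset_map, Multiset.map_map]
    rfl
  rw [h1, mixedPartial_comp_padOnes f]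
  · simp only [padOnes_one]
    congr 2
    have h2 : ∀ i : Fin M, i ∉ (Finset.univ.map (Fin.castLEEmb h)) →
        ((Finsupp.embDomain (Fin.castLEEmb h) α i)! : ℂ) = 1 := by
      intro i hi
      rw [Finsupp.embDomain_of_notMem_range]
      · simp
      · simpa only [Finset.mem_map, Finset.mem_univ, true_and, Set.mem_range] using hi
    rw [← Finset.prod_subset (Finset.subset_univ (Finset.univ.map (Fin.castLEEmb h)))
      fun i _ hi => h2 i hi, Finset.prod_map]
    simp only [Finsupp.embDomain_apply_self]
  · intro i hi
    rw [variableList, Multiset.mem_toList, Multiset.mem_map] at hi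
    obtain ⟨j, -, rfl⟩ := hi
    exact j.2

theorem lineDeriv_comp_perm (σ : Equiv.Perm (Fin m)) (i : Fin m)
    {F G : (Fin m → ℂ) → ℂ} (hFG : ∀ x, F (x ∘ σ) = G x) (x : Fin m → ℂ) :
    partialDeriv i F (x ∘ σ) = partialDeriv (σ i) G x := by
  simp only [partialDeriv_eq, lineDeriv, ← hFG]
  congr 1
  funext t
  congr 1
  funext j
  simp [direction, Fin.ext_iff.symm]

theorem mixedPartial_map_perm (σ : Equiv.Perm (Fin m)) (hf : ∀ x, f (x ∘ σ) = f x)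
    (is : List (Fin m)) (x : Fin m → ℂ) :
    mixedPartial (is.map Fin.val) f (x ∘ σ) =
      mixedPartial (is.map fun i => (σ i).val) f x := by
  induction is generalizing x with
  | nil => exact hf x
  | cons i is ih => exact lineDeriv_comp_perm σ i ih x

theorem coeff_taylor_comp_perm (σ : Equiv.Perm (Fin m)) (hf : ∀ x, f (x ∘ σ) = f x)
    (ha : AnalyticAt ℂ f 1) (α : Fin m →₀ ℕ) :
    MvPowerSeries.coeff (α.mapDomain σ) (taylor f) = MvPowerSeries.coeff α (taylor f) := by
  rw [coeff_taylor, coeff_taylor]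
  have h1 := mixedPartial_map_perm σ hf (Finsupp.toMultiset α).toList 1
  have h2 : ((Finsupp.toMultiset α).toList.map Fin.val).Perm (variableList α) := by
    apply perm_variableList
    rw [← Multiset.map_coe, Multiset.coe_toList]
  have h3 : ((Finsupp.toMultiset α).toList.map fun i => (σ i).val).Perm
      (variableList (α.mapDomain σ)) := by
    apply perm_variableList
    rw [← Multiset.map_coe, Multiset.coe_toList, ← Finsupp.toMultiset_map, Multiset.map_map]
    rfl
  rw [← (mixedPartial_perm h2 ha).eq_of_nhds, ← (mixedPartial_perm h3 ha).eq_of_nhds, ← h1]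
  congr 2
  rw [← Equiv.prod_comp σ]
  simp only [Finsupp.mapDomain_apply σ.injective]

end Taylor

/-! ### Taylor series of Schur generating functions -/

section SchurTaylor

variable {m M : ℕ}

theorem analyticAt_normSchur (l : Signature m) {x : Fin m → ℂ} (hx : ∀ i, x i ≠ 0) :
    AnalyticAt ℂ (normSchur l) x := by
  have h1 : AnalyticAt ℂ (fun x : Fin m → ℂ => ∏ i, x i) x := by
    refine Finset.analyticAt_fun_prod _ fun i _ => ?_
    exact (ContinuousLinearMap.proj (R := ℂ) i : (Fin m → ℂ) →L[ℂ] ℂ).analyticAt _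
  have h2 : AnalyticAt ℂ (fun x : Fin m → ℂ => MvPolynomial.eval x
      (alternantQuotient fun j => (l.1 j + shift l + ((m : ℤ) - 1 - (j : ℕ))).toNat)) x := by
    simp only [← MvPolynomial.aeval_eq_eval]
    refine AnalyticAt.aeval_mvPolynomial (fun i => ?_) _
    exact (ContinuousLinearMap.proj (R := ℂ) i : (Fin m → ℂ) →L[ℂ] ℂ).analyticAt _
  have h3 : AnalyticAt ℂ (schur l) x :=
    (h1.zpow (Finset.prod_ne_zero_iff.2 fun i _ => hx i)).mul h2
  exact h3.div analyticAt_const (schur_one_ne_zero l)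

theorem norm_direction_le (i : ℕ) : ‖direction m i‖ ≤ 1 := by
  rw [pi_norm_le_iff_of_nonneg zero_le_one]
  intro j
  simp only [direction]
  split_ifs <;> simp

/-- Termwise differentiation of a series of analytic functions that converges normally. -/
theorem exists_hasSum_mixedPartial {ι : Type*} {F : ι → (Fin m → ℂ) → ℂ} {δ : ℝ} (hδ : 0 < δ)
    {u : ι → ℝ} (hu : Summable u) (hF : ∀ i, ∀ x ∈ Metric.ball (1 : Fin m → ℂ) δ, AnalyticAt ℂ (F i) x)
    (hb : ∀ i, ∀ x ∈ Metric.ball (1 : Fin m → ℂ) δ, ‖F i x‖ ≤ u i) (is : List ℕ) :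
    ∃ δ' > 0, δ' ≤ δ ∧ ∃ u' : ι → ℝ, Summable u' ∧
      (∀ i, ∀ x ∈ Metric.ball (1 : Fin m → ℂ) δ', ‖mixedPartial is (F i) x‖ ≤ u' i) ∧
      ∀ x ∈ Metric.ball (1 : Fin m → ℂ) δ', HasSum (fun i => mixedPartial is (F i) x)
        (mixedPartial is (fun x => ∑' i, F i x) x) := by
  induction is with
  | nil =>
    refine ⟨δ, hδ, le_rfl, u, hu, hb, fun x hx => ?_⟩
    exact (Summable.of_norm_bounded hu fun i => hb i x hx).hasSum
  | cons k is ih =>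
    obtain ⟨δ', hδ', hle, u', hu', hb', hs'⟩ := ih
    have hmem : ∀ x ∈ Metric.ball (1 : Fin m → ℂ) (δ' / 2), ∀ t ∈ Metric.ball (0 : ℂ) (δ' / 2),
        x + t • direction m k ∈ Metric.ball (1 : Fin m → ℂ) δ' := by
      intro x hx t ht
      rw [mem_ball_iff_norm] at hx ⊢
      rw [mem_ball_zero_iff] at ht
      have h1 : ‖t • direction m k‖ ≤ ‖t‖ := by
        rw [norm_smul]
        exact mul_le_of_le_one_right (norm_nonneg _) (norm_direction_le k)
      calc ‖x + t • direction m k - 1‖ = ‖(x - 1) + t • direction m k‖ := by congr 1; ring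
        _ ≤ ‖x - 1‖ + ‖t • direction m k‖ := norm_add_le _ _
        _ < δ' := by linarith
    have hdiff : ∀ i, ∀ x ∈ Metric.ball (1 : Fin m → ℂ) (δ' / 2), DifferentiableOn ℂ
        (fun t : ℂ => mixedPartial is (F i) (x + t • direction m k)) (Metric.ball 0 (δ' / 2)) := by
      intro i x hx t ht
      have h1 := analyticAt_mixedPartial is
        (hF i _ (Metric.ball_subset_ball hle (hmem x hx t ht)))
      have h2 : DifferentiableAt ℂ (fun t : ℂ => x + t • direction m k) t := by fun_prop
      exact (h1.differentiableAt.comp t h2).differentiableWithinAt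
    have h0 : (0 : ℂ) ∈ Metric.ball (0 : ℂ) (δ' / 2) := Metric.mem_ball_self (by linarith)
    -- Cauchy's estimate on circles of radius `δ' / 4` inside the old ball bounds the derivative, so
    -- normal convergence survives on the smaller ball.
    refine ⟨δ' / 2, by linarith, by linarith, fun i => u' i / (δ' / 4), hu'.div_const _, ?_, ?_⟩
    · intro i x hx
      refine Complex.norm_deriv_le_of_forall_mem_sphere_norm_le (by linarith) ?_ fun t ht => ?_
      · refine DifferentiableOn.diffContOnCl ?_
        refine (hdiff i x hx).mono ?_
        rw [closure_ball _ (by linarith)]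
        exact Metric.closedBall_subset_ball (by linarith)
      · refine hb' i _ (hmem x hx t ?_)
        rw [mem_sphere_zero_iff_norm] at ht
        rw [mem_ball_zero_iff, ht]
        linarith
    · intro x hx
      have h1 := Complex.hasSum_deriv_of_summable_norm hu' (fun i => hdiff i x hx)
        Metric.isOpen_ball (fun i t ht => hb' i _ (hmem x hx t ht)) h0
      have h2 : (fun t : ℂ => ∑' i, mixedPartial is (F i) (x + t • direction m k)) =ᶠ[𝓝 0]
          fun t => mixedPartial is (fun x => ∑' i, F i x) (x + t • direction m k) := by
        filter_upwards [Metric.isOpen_ball.mem_nhds h0] with t ht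
        exact (hs' _ (hmem x hx t ht)).tsum_eq
      rw [h2.deriv_eq] at h1
      exact h1

theorem tendsto_corner (ε : Fin m → Bool) : Tendsto (fun r : ℝ => corner r ε) (𝓝 1) (𝓝 1) := by
  rw [tendsto_pi_nhds]
  intro i
  have h1 : Tendsto (fun r : ℝ => (r : ℂ)) (𝓝 1) (𝓝 1) := by
    have := Complex.continuous_ofReal.tendsto 1
    simpa using this
  by_cases h : ε i
  · simpa [corner, h] using h1
  · simpa [corner, h] using h1.inv₀ one_ne_zero

open scoped MvPowerSeries.WithPiTopology in
/-- Schur expansions may be differentiated termwise. -/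
theorem hasSum_taylor_normSchur {q : PMF (Signature m)} {G : (Fin m → ℂ) → ℂ}
    (h : ∀ᶠ x in 𝓝 (1 : Fin m → ℂ), HasSum (fun μ => schurTerm q μ x) (G x)) :
    HasSum (fun μ => ((q μ).toReal : ℂ) • taylor (normSchur μ)) (taylor G) := by
  have h1 : ∀ᶠ r : ℝ in 𝓝 1, ∀ ε : Fin m → Bool,
      HasSum (fun μ => schurTerm q μ (corner r ε)) (G (corner r ε)) := by
    rw [Filter.eventually_all]
    exact fun ε => (tendsto_corner ε).eventually h
  -- A single `r > 1` for which the expansion converges at all 2^m corners. The corner bound then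
  -- gives normal convergence on a ball around (1, …, 1), and there termwise differentiation is
  -- allowed.
  obtain ⟨r, hr, hr1⟩ : ∃ r : ℝ, (∀ ε : Fin m → Bool,
      HasSum (fun μ => schurTerm q μ (corner r ε)) (G (corner r ε))) ∧ 1 < r := by
    have h2 : ∀ᶠ r : ℝ in 𝓝[>] 1, ∀ ε : Fin m → Bool,
      HasSum (fun μ => schurTerm q μ (corner r ε)) (G (corner r ε)) :=
      h1.filter_mono nhdsWithin_le_nhds
    exact (h2.and self_mem_nhdsWithin).exists
  have hr0 : 0 < r := by linarith
  have hinv : r⁻¹ < 1 := inv_lt_one_of_one_lt₀ hr1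
  have hsum2 : 2 ≤ r + r⁻¹ := by
    have h2 : r * r⁻¹ = 1 := mul_inv_cancel₀ hr0.ne'
    nlinarith [sq_nonneg (r - 1), inv_pos.2 hr0]
  have hball : ∀ x ∈ Metric.ball (1 : Fin m → ℂ) (1 - r⁻¹), ∀ i, r⁻¹ ≤ ‖x i‖ ∧ ‖x i‖ ≤ r := by
    intro x hx i
    rw [mem_ball_iff_norm] at hx
    have h2 : ‖x i - 1‖ < 1 - r⁻¹ := (norm_le_pi_norm (x - 1) i).trans_lt hx
    have h3 := norm_sub_norm_le (1 : ℂ) (1 - x i)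
    have h4 := norm_add_le (1 : ℂ) (x i - 1)
    rw [← norm_sub_rev] at h2
    simp only [sub_sub_cancel, add_sub_cancel, norm_one] at h3 h4
    rw [norm_sub_rev] at h4
    constructor <;> linarith
  have hx0 : ∀ x ∈ Metric.ball (1 : Fin m → ℂ) (1 - r⁻¹), ∀ i, x i ≠ 0 := by
    intro x hx i
    have := (hball x hx i).1
    have h3 : 0 < ‖x i‖ := (inv_pos.2 hr0).trans_le this
    exact norm_pos_iff.1 h3
  have hu : Summable fun μ => ∑ ε : Fin m → Bool, ‖schurTerm q μ (corner r ε)‖ :=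
    summable_sum fun ε _ => (hr ε).summable.norm
  have hG : G =ᶠ[𝓝 1] fun x => ∑' μ, schurTerm q μ x := by
    filter_upwards [h] with x hx
    exact hx.tsum_eq.symm
  rw [taylor_congr hG]
  refine Pi.hasSum.2 fun α => ?_
  obtain ⟨δ', hδ', -, -, -, -, hs⟩ := exists_hasSum_mixedPartial (F := fun μ => schurTerm q μ)
    (sub_pos.2 hinv) hu
    (fun μ x hx => analyticAt_const.mul (analyticAt_normSchur μ (hx0 x hx)))
    (fun μ x hx => by
      simp only [schurTerm_eq, norm_toReal_mul, ← Finset.mul_sum]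
      exact mul_le_mul_of_nonneg_left (norm_normSchur_le_sum_corner μ hr1.le
        (fun i => (hball x hx i).1) (fun i => (hball x hx i).2)) ENNReal.toReal_nonneg)
    (variableList α)
  have h5 := (hs 1 (Metric.mem_ball_self hδ')).mul_left (∏ i, ((α i).factorial : ℂ))⁻¹
  have h6 : ∀ μ, (((q μ).toReal : ℂ) • taylor (normSchur μ)) α =
      (∏ i, ((α i).factorial : ℂ))⁻¹ * mixedPartial (variableList α) (schurTerm q μ) 1 := by
    intro μ
    have h7 := congrArg (MvPowerSeries.coeff α) (taylor_const_mul ((q μ).toReal : ℂ)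
      (analyticAt_normSchur μ (x := 1) (by simp)))
    rw [coeff_taylor] at h7
    exact h7.symm
  simp only [h6]
  exact h5

theorem constantCoeff_taylor_normSchur (l : Signature m) :
    MvPowerSeries.constantCoeff (taylor (normSchur l)) = 1 := by
  rw [constantCoeff_taylor, normSchur_one]

end SchurTaylor

/-! ### Division by the Vandermonde determinant -/

section Division

variable {m M : ℕ}

open MvPowerSeries
open scoped MvPowerSeries.WithPiTopology

/-- The power series without terms of degree less than `e`. -/
def highOrder (m e : ℕ) : Ideal (MvPowerSeries (Fin m) ℂ) where
  carrier := {f | (e : ℕ∞) ≤ f.order}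
  add_mem' ha hb := (le_min ha hb).trans min_order_le_add
  zero_mem' := by simp
  smul_mem' a f hf := by
    rw [smul_eq_mul]
    exact (le_add_left hf).trans le_order_mul

theorem mem_highOrder {e : ℕ} {f : MvPowerSeries (Fin m) ℂ} :
    f ∈ highOrder m e ↔ (e : ℕ∞) ≤ f.order := Iff.rfl

theorem mem_highOrder_iff {e : ℕ} {f : MvPowerSeries (Fin m) ℂ} :
    f ∈ highOrder m e ↔ ∀ α : Fin m →₀ ℕ, α.degree < e → coeff α f = 0 := by
  rw [mem_highOrder]
  constructor
  · intro h α hα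
    exact coeff_of_lt_order (lt_of_lt_of_le (by exact_mod_cast hα) h)
  · exact fun h => nat_le_order h

theorem highOrder_antitone {e e' : ℕ} (h : e ≤ e') : highOrder m e' ≤ highOrder m e := by
  intro f hf
  rw [mem_highOrder] at *
  exact le_trans (by exact_mod_cast h) hf

theorem mem_highOrder_zero (f : MvPowerSeries (Fin m) ℂ) : f ∈ highOrder m 0 := by
  simp [mem_highOrder]

theorem mul_mem_highOrder {a b : ℕ} {f g : MvPowerSeries (Fin m) ℂ} (hf : f ∈ highOrder m a)
    (hg : g ∈ highOrder m b) : f * g ∈ highOrder m (a + b) := by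
  rw [mem_highOrder] at *
  push_cast
  exact (add_le_add hf hg).trans le_order_mul

theorem pderiv_mem_highOrder {e : ℕ} {f : MvPowerSeries (Fin m) ℂ} (hf : f ∈ highOrder m e)
    (i : Fin m) : pderiv ℂ i f ∈ highOrder m (e - 1) := by
  rw [mem_highOrder_iff] at *
  intro α hα
  rw [coeff_pderiv, hf, zero_mul]
  simp
  omega

theorem X_sub_X_mem_highOrder (i j : Fin m) :
    (X i - X j : MvPowerSeries (Fin m) ℂ) ∈ highOrder m 1 := by
  rw [mem_highOrder_iff]
  intro α hα
  have : α = 0 := (Finsupp.degree_eq_zero_iff α).1 (by omega)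
  subst this
  simp

theorem continuous_pderiv (i : Fin m) :
    Continuous (pderiv ℂ i : MvPowerSeries (Fin m) ℂ → MvPowerSeries (Fin m) ℂ) := by
  refine continuous_pi fun α => ?_
  have h : (fun f : MvPowerSeries (Fin m) ℂ => (pderiv ℂ i f) α) =
      fun f => coeff (α + Finsupp.single i 1) f * ((α i : ℂ) + 1) := by
    funext f
    exact coeff_pderiv f α
  rw [h]
  exact (WithPiTopology.continuous_coeff ℂ _).mul continuous_const

theorem continuous_killCompl (e : Fin m ↪ Fin M) :
    Continuous (killCompl e : MvPowerSeries (Fin M) ℂ →ₐ[ℂ] MvPowerSeries (Fin m) ℂ) :=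
  continuous_pi fun α => WithPiTopology.continuous_coeff ℂ (Finsupp.embDomain e α)

/-- A left inverse of the multiplication by `X_i - X_j`. -/
def divX (i j : Fin m) : MvPowerSeries (Fin m) ℂ →L[ℂ] MvPowerSeries (Fin m) ℂ where
  toFun f := fun α => ∑ c ∈ Finset.range (α j + 1),
    coeff (α + Finsupp.single i (c + 1) - Finsupp.single j c) f
  map_add' f g := by
    funext α
    simp only [map_add, Finset.sum_add_distrib]
    rfl
  map_smul' r f := by
    funext α
    simp only [map_smul, RingHom.id_apply, ← Finset.smul_sum]
    rfl
  cont := continuous_pi fun α =>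
    continuous_finsetSum _ fun c _ => WithPiTopology.continuous_coeff ℂ _

theorem coeff_divX (i j : Fin m) (f : MvPowerSeries (Fin m) ℂ) (α : Fin m →₀ ℕ) :
    coeff α (divX i j f) = ∑ c ∈ Finset.range (α j + 1),
      coeff (α + Finsupp.single i (c + 1) - Finsupp.single j c) f := rfl

/-- The coefficients in the definition run along the line from α towards higher powers of X_i and
lower powers of X_j. For a multiple of X_i - X_j their sum telescopes to the coefficient of the
quotient at α. -/
theorem divX_mul {i j : Fin m} (hij : i ≠ j) (g : MvPowerSeries (Fin m) ℂ) :
    divX i j ((X i - X j) * g) = g := by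
  ext α
  rw [coeff_divX]
  have h1 : ∀ c ∈ Finset.range (α j + 1),
      coeff (α + Finsupp.single i (c + 1) - Finsupp.single j c) ((X i - X j) * g) =
      coeff (α + Finsupp.single i c - Finsupp.single j c) g -
        if c < α j then coeff (α + Finsupp.single i (c + 1) - Finsupp.single j (c + 1)) g else 0 := by
    intro c hc
    rw [Finset.mem_range] at hc
    rw [sub_mul, map_sub]
    congr 1
    · have h2 : α + Finsupp.single i (c + 1) - Finsupp.single j c =
          Finsupp.single i 1 + (α + Finsupp.single i c - Finsupp.single j c) := by
        ext k
        simp only [Finsupp.tsub_apply, Finsupp.add_apply, Finsupp.single_apply]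
        split_ifs <;> subst_vars <;> omega
      rw [h2, X, coeff_add_monomial_mul, one_mul]
    · split_ifs with h3
      · have h2 : α + Finsupp.single i (c + 1) - Finsupp.single j c =
            Finsupp.single j 1 + (α + Finsupp.single i (c + 1) - Finsupp.single j (c + 1)) := by
          ext k
          simp only [Finsupp.tsub_apply, Finsupp.add_apply, Finsupp.single_apply]
          split_ifs <;> subst_vars <;> omega
        rw [h2, X, coeff_add_monomial_mul, one_mul]
      · have h4 : (X j : MvPowerSeries (Fin m) ℂ) ∣ X j * g := dvd_mul_right _ _
        rw [X_dvd_iff] at h4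
        apply h4
        simp only [Finsupp.tsub_apply, Finsupp.add_apply, Finsupp.single_apply, hij, if_false,
          if_true]
        omega
  rw [Finset.sum_congr rfl h1, Finset.sum_sub_distrib, Finset.sum_range_succ']
  rw [Finset.sum_range_succ (fun c => if c < α j then
    coeff (α + Finsupp.single i (c + 1) - Finsupp.single j (c + 1)) g else 0)]
  rw [Finset.sum_congr rfl (g := fun c => coeff (α + Finsupp.single i (c + 1) -
    Finsupp.single j (c + 1)) g) (s₁ := Finset.range (α j)) (f := fun c => if c < α j then
    coeff (α + Finsupp.single i (c + 1) - Finsupp.single j (c + 1)) g else 0)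
    (fun c hc => if_pos (Finset.mem_range.1 hc))]
  simp

theorem divX_mem_highOrder (i j : Fin m) {e : ℕ} {f : MvPowerSeries (Fin m) ℂ}
    (hf : f ∈ highOrder m (e + 1)) : divX i j f ∈ highOrder m e := by
  rw [mem_highOrder_iff] at *
  intro α hα
  rw [coeff_divX]
  refine Finset.sum_eq_zero fun c hc => hf _ ?_
  have h1 : α + Finsupp.single i (c + 1) = (α + Finsupp.single i (c + 1) - Finsupp.single j c) +
      Finsupp.single j c := by
    rw [tsub_add_cancel_of_le]
    intro k
    rw [Finset.mem_range] at hc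
    simp only [Finsupp.add_apply, Finsupp.single_apply]
    split_ifs <;> subst_vars <;> omega
  have h2 := congrArg Finsupp.degree h1
  simp only [map_add, Finsupp.degree_single] at h2
  omega

/-- A continuous linear left inverse defined on all series is more convenient than actual division:
it can be applied to error terms without proving divisibility, and only the loss of order, one per
factor, matters there. -/
theorem exists_divX_prod (s : Finset (Fin m × Fin m)) (hs : ∀ p ∈ s, p.1 ≠ p.2) :
    ∃ Λ : MvPowerSeries (Fin m) ℂ →L[ℂ] MvPowerSeries (Fin m) ℂ,
      (∀ g, Λ ((∏ p ∈ s, (X p.1 - X p.2)) * g) = g) ∧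
      ∀ (e : ℕ) (f), f ∈ highOrder m (e + s.card) → Λ f ∈ highOrder m e := by
  classical
  induction s using Finset.induction_on with
  | empty => exact ⟨ContinuousLinearMap.id ℂ _, by simp, by simp⟩
  | insert p s hp ih =>
    obtain ⟨Λ, h1, h2⟩ := ih fun q hq => hs q (Finset.mem_insert_of_mem hq)
    refine ⟨Λ.comp (divX p.1 p.2), fun g => ?_, fun e f hf => ?_⟩
    · rw [Finset.prod_insert hp, mul_assoc, ContinuousLinearMap.comp_apply,
        divX_mul (hs p (Finset.mem_insert_self p s)), h1]
    · rw [Finset.card_insert_of_notMem hp, ← add_assoc] at hf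
      exact h2 e _ (divX_mem_highOrder _ _ hf)

/-- The pairs `i < j`. -/
def increasingPairs (m : ℕ) : Finset (Fin m × Fin m) := Finset.univ.filter fun p => p.1 < p.2

/-- The Vandermonde product as a power series. -/
def vandermondeSeries (m : ℕ) : MvPowerSeries (Fin m) ℂ :=
  ∏ p ∈ increasingPairs m, (X p.1 - X p.2)

theorem coe_vandermondePoly : ((vandermondePoly m : MvPolynomial (Fin m) ℂ) :
    MvPowerSeries (Fin m) ℂ) = vandermondeSeries m := by
  rw [vandermondePoly, vandermondeSeries, increasingPairs]
  have h := map_prod (MvPolynomial.coeToMvPowerSeries.ringHom (σ := Fin m) (R := ℂ))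
    (fun p : Fin m × Fin m => (MvPolynomial.X p.1 - MvPolynomial.X p.2 : MvPolynomial (Fin m) ℂ))
    (Finset.univ.filter fun p => p.1 < p.2)
  refine h.trans (Finset.prod_congr rfl fun p _ => ?_)
  rw [map_sub]
  simp

theorem exists_divVandermonde (m : ℕ) :
    ∃ Λ : MvPowerSeries (Fin m) ℂ →L[ℂ] MvPowerSeries (Fin m) ℂ,
      (∀ g, Λ (vandermondeSeries m * g) = g) ∧
      ∀ (e : ℕ) (f), f ∈ highOrder m (e + (increasingPairs m).card) → Λ f ∈ highOrder m e :=
  exists_divX_prod _ fun _ hp => (Finset.mem_filter.1 hp).2.ne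

/-- Division by the Vandermonde product. -/
def divVandermonde (m : ℕ) : MvPowerSeries (Fin m) ℂ →L[ℂ] MvPowerSeries (Fin m) ℂ :=
  (exists_divVandermonde m).choose

theorem divVandermonde_mul (g : MvPowerSeries (Fin m) ℂ) :
    divVandermonde m (vandermondeSeries m * g) = g := (exists_divVandermonde m).choose_spec.1 g

theorem divVandermonde_mem_highOrder {e : ℕ} {f : MvPowerSeries (Fin m) ℂ}
    (hf : f ∈ highOrder m (e + (increasingPairs m).card)) : divVandermonde m f ∈ highOrder m e :=
  (exists_divVandermonde m).choose_spec.2 e f hf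

theorem iterate_pderiv_vandermondeSeries_mem (i : Fin m) (s : ℕ) :
    (pderiv ℂ i)^[s] (vandermondeSeries m) ∈ highOrder m ((increasingPairs m).card - s) := by
  induction s with
  | zero =>
    have : ∀ s : Finset (Fin m × Fin m),
        (∏ p ∈ s, (X p.1 - X p.2) : MvPowerSeries (Fin m) ℂ) ∈ highOrder m s.card := by
      classical
      intro s
      induction s using Finset.induction_on with
      | empty => exact mem_highOrder_zero _
      | insert p s hp ih =>
        rw [Finset.prod_insert hp, Finset.card_insert_of_notMem hp, add_comm]
        exact mul_mem_highOrder (X_sub_X_mem_highOrder _ _) ih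
    exact this _
  | succ s ih =>
    rw [Function.iterate_succ_apply', ← Nat.sub_sub]
    exact pderiv_mem_highOrder ih i

/-- The operator `∑ x_i ^ k ∂_i ^ k` in the variables `y_i = x_i - 1`. -/
def eulerOp (m k : ℕ) : MvPowerSeries (Fin m) ℂ →L[ℂ] MvPowerSeries (Fin m) ℂ where
  toFun f := ∑ i, (1 + X i) ^ k * (pderiv ℂ i)^[k] f
  map_add' f g := by
    rw [← Finset.sum_add_distrib]
    refine Finset.sum_congr rfl fun i _ => ?_
    rw [← mul_add, iterate_map_add]
  map_smul' r f := by
    rw [RingHom.id_apply, Finset.smul_sum]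
    refine Finset.sum_congr rfl fun i _ => ?_
    have : (pderiv ℂ i)^[k] (r • f) = r • (pderiv ℂ i)^[k] f := by
      induction k with
      | zero => rfl
      | succ k ih => rw [Function.iterate_succ_apply', ih, Derivation.map_smul,
          Function.iterate_succ_apply']
    rw [this, mul_smul_comm]
  cont := continuous_finsetSum _ fun i _ => continuous_const.mul ((continuous_pderiv i).iterate k)

theorem eulerOp_apply (k : ℕ) (f : MvPowerSeries (Fin m) ℂ) :
    eulerOp m k f = ∑ i, (1 + X i) ^ k * (pderiv ℂ i)^[k] f := rfl

/-- The conjugation of `eulerOp` with the Vandermonde product. -/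
def schurOp (m k : ℕ) : MvPowerSeries (Fin m) ℂ →L[ℂ] MvPowerSeries (Fin m) ℂ :=
  (divVandermonde m).comp ((eulerOp m k).comp
    ⟨LinearMap.mulLeft ℂ (vandermondeSeries m), continuous_const.mul continuous_id⟩)

theorem schurOp_apply (k : ℕ) (f : MvPowerSeries (Fin m) ℂ) :
    schurOp m k f = divVandermonde m (eulerOp m k (vandermondeSeries m * f)) := rfl

/-! ### Schur functions are eigenfunctions -/

/-- A Laurent monomial. -/
def laurentMonomial (a : Fin m → ℤ) (x : Fin m → ℂ) : ℂ := ∏ i, x i ^ a i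

theorem analyticAt_laurentMonomial (a : Fin m → ℤ) {x : Fin m → ℂ} (hx : ∀ i, x i ≠ 0) :
    AnalyticAt ℂ (laurentMonomial a) x := by
  refine Finset.analyticAt_fun_prod _ fun i _ => ?_
  exact ((ContinuousLinearMap.proj (R := ℂ) i : (Fin m → ℂ) →L[ℂ] ℂ).analyticAt _).zpow (hx i)

theorem partialDeriv_laurentMonomial (a : Fin m → ℤ) (i : Fin m) {x : Fin m → ℂ}
    (hx : ∀ i, x i ≠ 0) : partialDeriv i (laurentMonomial a) x =
      a i * laurentMonomial (Function.update a i (a i - 1)) x := by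
  have h1 : ∀ (b : Fin m → ℤ) (y : Fin m → ℂ), laurentMonomial b y =
      y i ^ b i * ∏ j ∈ Finset.univ.erase i, y j ^ b j :=
    fun b y => (Finset.mul_prod_erase _ _ (Finset.mem_univ i)).symm
  have h2 : (fun t : ℂ => laurentMonomial a (x + t • direction m i)) = fun t =>
      (x i + t) ^ a i * ∏ j ∈ Finset.univ.erase i, x j ^ a j := by
    funext t
    rw [h1]
    congr 1
    · simp [direction]
    · refine Finset.prod_congr rfl fun j hj => ?_
      have : (j : ℕ) ≠ i := fun h => Finset.ne_of_mem_erase hj (Fin.ext h)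
      simp [direction, this]
  rw [partialDeriv_eq, lineDeriv, h2]
  have h3 : HasDerivAt (fun t : ℂ => (x i + t) ^ a i) (a i * (x i + 0) ^ (a i - 1)) 0 := by
    have h4 := (hasDerivAt_zpow (a i) (x i + 0) (Or.inl (by simpa using hx i)))
    have h5 : HasDerivAt (fun t : ℂ => x i + t) 1 0 := (hasDerivAt_id 0).const_add (x i)
    simpa [Function.comp_def] using h4.comp (0 : ℂ) h5
  rw [(h3.mul_const _).deriv, h1, add_zero, Function.update_self, mul_assoc]
  congr 2
  refine Finset.prod_congr rfl fun j hj => ?_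
  rw [Function.update_of_ne (Finset.ne_of_mem_erase hj)]

/-- The falling factorial `a (a - 1) ⋯ (a - k + 1)`. -/
def fallingFactorial (k : ℕ) (a : ℂ) : ℂ := ∏ c ∈ Finset.range k, (a - c)

theorem iterate_pderiv_laurentMonomial (a : Fin m → ℤ) (i : Fin m) (k : ℕ) :
    (pderiv ℂ i)^[k] (taylor (laurentMonomial a)) =
      fallingFactorial k (a i) • taylor (laurentMonomial (Function.update a i (a i - k))) := by
  induction k with
  | zero => simp [fallingFactorial]
  | succ k ih =>
    have h1 : ∀ b : Fin m → ℤ, pderiv ℂ i (taylor (laurentMonomial b)) =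
        (b i : ℂ) • taylor (laurentMonomial (Function.update b i (b i - 1))) := by
      intro b
      rw [pderiv_taylor i (analyticAt_laurentMonomial b (by simp)),
        ← taylor_const_mul _ (analyticAt_laurentMonomial _ (by simp))]
      apply taylor_congr
      filter_upwards [eventually_ne_zero] with x hx
      exact partialDeriv_laurentMonomial b i hx
    rw [Function.iterate_succ_apply', ih, Derivation.map_smul, h1, smul_smul, Function.update_self,
      Function.update_idem, fallingFactorial, fallingFactorial, Finset.prod_range_succ]
    push_cast
    rw [sub_sub]

theorem taylor_apply_eq (i : Fin m) : taylor (fun x : Fin m → ℂ => x i) = 1 + X i := by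
  have ha : ∀ y, AnalyticAt ℂ (fun x : Fin m → ℂ => x i) y := fun y =>
    (ContinuousLinearMap.proj (R := ℂ) i : (Fin m → ℂ) →L[ℂ] ℂ).analyticAt _
  apply pderiv.ext
  · intro j
    rw [pderiv_taylor j (ha 1), map_add, pderiv_one, zero_add, pderiv_X]
    have h1 : partialDeriv j (fun x : Fin m → ℂ => x i) = fun _ => if i = j then 1 else 0 := by
      funext x
      rw [partialDeriv_eq, DifferentiableAt.lineDeriv_eq_fderiv (ha x).differentiableAt]
      have h2 := (ContinuousLinearMap.proj (R := ℂ) i : (Fin m → ℂ) →L[ℂ] ℂ).hasFDerivAt (x := x)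
      have h3 : fderiv ℂ (fun x : Fin m → ℂ => x i) x = ContinuousLinearMap.proj (R := ℂ) i := h2.fderiv
      rw [h3]
      simp [direction, Fin.ext_iff]
    rw [h1]
    have h4 : ∀ c : ℂ, taylor (fun _ : Fin m → ℂ => c) = C c := by
      intro c
      apply pderiv.ext
      · intro k
        rw [pderiv_taylor k analyticAt_const, pderiv_C]
        have : partialDeriv k (fun _ : Fin m → ℂ => c) = fun _ => 0 := by
          funext x
          simp [partialDeriv_eq, lineDeriv]
        rw [this]
        ext α
        have h5 : ∀ is : List ℕ, mixedPartial is (fun _ : Fin m → ℂ => (0 : ℂ)) = fun _ => 0 := by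
          intro is
          induction is with
          | nil => rfl
          | cons i is ih => rw [mixedPartial_cons, ih]; funext x; simp [partialDeriv_eq, lineDeriv]
        rw [coeff_taylor, h5]
        simp
      · rw [constantCoeff_taylor]; simp
    rw [h4]
    by_cases hij : i = j
    · subst hij; simp
    · rw [if_neg hij, Pi.single_eq_of_ne hij]; simp
  · rw [constantCoeff_taylor]; simp

theorem analyticAt_apply (i : Fin m) (y : Fin m → ℂ) :
    AnalyticAt ℂ (fun x : Fin m → ℂ => x i) y :=
  (ContinuousLinearMap.proj (R := ℂ) i : (Fin m → ℂ) →L[ℂ] ℂ).analyticAt _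

theorem taylor_prod {ι : Type*} (s : Finset ι) (f : ι → (Fin m → ℂ) → ℂ)
    (hf : ∀ i ∈ s, AnalyticAt ℂ (f i) 1) :
    AnalyticAt ℂ (∏ i ∈ s, f i) 1 ∧ taylor (∏ i ∈ s, f i) = ∏ i ∈ s, taylor (f i) := by
  classical
  induction s using Finset.induction_on with
  | empty =>
    refine ⟨by rw [Finset.prod_empty]; exact analyticAt_const (v := (1 : ℂ)), ?_⟩
    have h := iterate_pderiv_laurentMonomial (m := m) 0
    rw [Finset.prod_empty, Finset.prod_empty]
    apply pderiv.ext
    · intro i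
      have h1 : (1 : (Fin m → ℂ) → ℂ) = laurentMonomial 0 := by
        funext x; simp [laurentMonomial]
      rw [h1]
      have h2 := h i 1
      simp only [Function.iterate_one] at h2
      rw [h2, pderiv_one]
      simp [fallingFactorial]
    · rw [constantCoeff_taylor]; simp
  | insert i s hi ih =>
    obtain ⟨h1, h2⟩ := ih fun j hj => hf j (Finset.mem_insert_of_mem hj)
    have h3 := hf i (Finset.mem_insert_self i s)
    rw [Finset.prod_insert hi, Finset.prod_insert hi, taylor_mul h3 h1, h2]
    exact ⟨h3.mul h1, rfl⟩

/-- In the original variables the operator is Σ x_i^k ∂_i^k, which is diagonal on Laurent monomials.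
-/
theorem eulerOp_laurentMonomial (a : Fin m → ℤ) (k : ℕ) :
    eulerOp m k (taylor (laurentMonomial a)) =
      (∑ i, fallingFactorial k (a i)) • taylor (laurentMonomial a) := by
  rw [eulerOp_apply, Finset.sum_smul]
  refine Finset.sum_congr rfl fun i _ => ?_
  rw [iterate_pderiv_laurentMonomial, mul_smul_comm]
  congr 1
  have h1 := (taylor_prod (Finset.range k) (fun _ => fun x : Fin m → ℂ => x i)
    fun _ _ => analyticAt_apply i 1)
  simp only [Finset.prod_const, Finset.card_range, taylor_apply_eq] at h1
  rw [← h1.2, ← taylor_mul h1.1 (analyticAt_laurentMonomial _ (by simp))]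
  apply taylor_congr
  filter_upwards [eventually_ne_zero] with x hx
  have h2 : ∀ b : Fin m → ℤ, laurentMonomial b x =
      x i ^ b i * ∏ j ∈ Finset.univ.erase i, x j ^ b j :=
    fun b => (Finset.mul_prod_erase _ _ (Finset.mem_univ i)).symm
  simp only [Pi.mul_apply, Pi.pow_apply]
  rw [h2, h2, Function.update_self, ← mul_assoc, ← zpow_natCast, ← zpow_add₀ (hx i)]
  congr 1
  · congr 1; ring
  · refine Finset.prod_congr rfl fun j hj => ?_
    rw [Function.update_of_ne (Finset.ne_of_mem_erase hj)]

theorem vandermondeSeries_mul_taylor_normSchur (l : Signature m) :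
    vandermondeSeries m * taylor (normSchur l) = ∑ σ : Equiv.Perm (Fin m),
      ((schur l 1)⁻¹ * (((Equiv.Perm.sign σ : ℤˣ) : ℤ) : ℂ)) •
        taylor (laurentMonomial fun i => l.1 (σ.symm i) + ((m : ℤ) - 1 - (σ.symm i : ℕ))) := by
  have h1 := taylor_prod (increasingPairs m)
    (fun p => (fun x : Fin m → ℂ => x p.1) + (fun x => (-1) * x p.2))
    (fun p _ => (analyticAt_apply _ _).add (analyticAt_const.mul (analyticAt_apply _ _)))
  have h2 : ∏ p ∈ increasingPairs m,
      taylor ((fun x : Fin m → ℂ => x p.1) + (fun x => (-1) * x p.2)) = vandermondeSeries m := by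
    refine Finset.prod_congr rfl fun p _ => ?_
    have ha : AnalyticAt ℂ (fun x : Fin m → ℂ => (-1) * x p.2) 1 :=
      analyticAt_const.mul (analyticAt_apply _ _)
    rw [taylor_add (analyticAt_apply _ _) ha, taylor_const_mul _ (analyticAt_apply _ _), taylor_apply_eq, taylor_apply_eq, neg_one_smul]
    ring
  have ha : ∀ σ : Equiv.Perm (Fin m), AnalyticAt ℂ
      (laurentMonomial fun i => l.1 (σ.symm i) + ((m : ℤ) - 1 - (σ.symm i : ℕ))) 1 :=
    fun σ => analyticAt_laurentMonomial _ (by simp)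
  rw [h2] at h1
  rw [← h1.2, ← taylor_mul h1.1 (analyticAt_normSchur l (by simp))]
  have h3 := (taylor_sum Finset.univ (fun (σ : Equiv.Perm (Fin m)) (x : Fin m → ℂ) =>
    ((schur l 1)⁻¹ * (((Equiv.Perm.sign σ : ℤˣ) : ℤ) : ℂ)) *
      laurentMonomial (fun i => l.1 (σ.symm i) + ((m : ℤ) - 1 - (σ.symm i : ℕ))) x)
    fun σ _ => analyticAt_const.mul (ha σ)).2
  simp only [taylor_const_mul _ (ha _)] at h3
  rw [← h3]
  apply taylor_congr
  filter_upwards [eventually_ne_zero] with x hx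
  have h4 := schur_mul_vandermonde l x hx
  rw [Matrix.det_apply'] at h4
  simp only [Pi.mul_apply, Finset.prod_apply, Pi.add_apply, Finset.sum_apply, neg_one_mul,
    ← sub_eq_add_neg, normSchur]
  rw [← mul_div_assoc, mul_comm _ (schur l x), increasingPairs, h4, Finset.sum_div]
  refine Finset.sum_congr rfl fun σ _ => ?_
  rw [div_eq_mul_inv, mul_comm _ (schur l 1)⁻¹, mul_assoc, laurentMonomial,
    ← Equiv.prod_comp σ (fun i => x i ^ (l.1 (σ.symm i) + ((m : ℤ) - 1 - (σ.symm i : ℕ))))]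
  simp

/-- The eigenvalue: the sum of the falling factorials of `λ_j + m - j`. -/
def fallingSum (k : ℕ) (l : Signature m) : ℂ :=
  ∑ j : Fin m, fallingFactorial k ((l.1 j : ℂ) + ((m : ℂ) - 1 - (j : ℕ)))

/-- V s_λ is a signed sum of Laurent monomials whose exponents are permutations of λ_j + m - j. They
all have the same eigenvalue, since it is symmetric in the exponents. -/
theorem schurOp_taylor_normSchur (k : ℕ) (l : Signature m) :
    schurOp m k (taylor (normSchur l)) = fallingSum k l • taylor (normSchur l) := by
  rw [schurOp_apply]
  have h1 : eulerOp m k (vandermondeSeries m * taylor (normSchur l)) =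
      vandermondeSeries m * (fallingSum k l • taylor (normSchur l)) := by
    rw [mul_smul_comm, vandermondeSeries_mul_taylor_normSchur, map_sum, Finset.smul_sum]
    refine Finset.sum_congr rfl fun σ _ => ?_
    rw [map_smul, eulerOp_laurentMonomial, smul_comm]
    congr 1
    rw [fallingSum, ← Equiv.sum_comp σ.symm
      (fun j : Fin m => fallingFactorial k ((l.1 j : ℂ) + ((m : ℂ) - 1 - (j : ℕ))))]
    push_cast
    rfl
  rw [h1, divVandermonde_mul]

end Division

/-! ### Derivatives of the Vandermonde product -/

section Vandermonde

variable {m : ℕ}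

/-- The power sum `p_r` as a formal variable; `p_0` is the number `M` of variables. -/
def formalPower (M : ℂ) : ℕ → MvPolynomial ℕ ℂ
  | 0 => MvPolynomial.C M
  | r + 1 => MvPolynomial.X r

/-- The polynomial in the power sums that represents
`(s + 1) V⁻¹ ∑ y_i ^ n ∂_i ^ s V`, with `V` the Vandermonde product. -/
def vandermondeSum (M : ℂ) : ℕ → ℕ → MvPolynomial ℕ ℂ
  | 0, n => formalPower M n
  | _ + 1, 0 => 0
  | s + 1, n + 1 => ∑ a ∈ Finset.range (n + 1), formalPower M a * vandermondeSum M s (n - a) -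
      ((n : ℂ) + 1) • vandermondeSum M s n

/-- The value of a polynomial in the power sums at the power sums of the elements `y_i`. -/
def powerEval {A : Type*} [CommRing A] [Algebra ℂ A] (y : Fin m → A) : MvPolynomial ℕ ℂ →ₐ[ℂ] A :=
  MvPolynomial.aeval fun r => ∑ i, y i ^ (r + 1)

theorem powerEval_formalPower {A : Type*} [CommRing A] [Algebra ℂ A] (y : Fin m → A) (r : ℕ) :
    powerEval y (formalPower m r) = ∑ i, y i ^ r := by
  cases r with
  | zero => simp [formalPower, powerEval]
  | succ r => simp [formalPower, powerEval]

/-- The residue of `q^(s+1) / q` at `y_i`, with `q = ∏ (X - y_j)`. -/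
def nodalResidue (y : Fin m → ℂ) (s : ℕ) (i : Fin m) : ℂ :=
  (Polynomial.derivative^[s + 1] (Lagrange.nodal Finset.univ y)).eval (y i) /
    (Lagrange.nodal (Finset.univ.erase i) y).eval (y i)

theorem eval_nodal_erase_ne_zero {y : Fin m → ℂ} (hy : Function.Injective y) (i : Fin m) :
    (Lagrange.nodal (Finset.univ.erase i) y).eval (y i) ≠ 0 := by
  apply Lagrange.eval_nodal_not_at_node
  intro j hj h
  exact Finset.ne_of_mem_erase hj (hy h).symm

/-- Lagrange interpolation: derivatives of q = ∏ (X - y_j) have degree less than m, so they are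
determined by their values at the nodes. -/
theorem iterate_derivative_nodal_eq {y : Fin m → ℂ} (hy : Function.Injective y) (s : ℕ) :
    Polynomial.derivative^[s + 1] (Lagrange.nodal Finset.univ y) =
      ∑ j, Polynomial.C (nodalResidue y s j) * Lagrange.nodal (Finset.univ.erase j) y := by
  have hcard : (Finset.univ : Finset (Fin m)).card = m := by simp
  apply Polynomial.eq_of_degrees_lt_of_eval_index_eq Finset.univ hy.injOn
  · rw [hcard]
    rcases Nat.eq_zero_or_pos m with rfl | hm
    · simp [Lagrange.nodal]
    rw [Function.iterate_succ_apply]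
    refine lt_of_le_of_lt (b := (((m - 1 : ℕ)) : WithBot ℕ)) ?_ (by exact_mod_cast (by omega))
    have h2 : ∀ p : Polynomial ℂ, (Polynomial.derivative^[s] p).degree ≤ p.degree := by
      intro p
      induction s with
      | zero => exact le_rfl
      | succ s ih =>
        rw [Function.iterate_succ_apply']
        exact (Polynomial.degree_derivative_le).trans ih
    refine (h2 _).trans ?_
    rw [← Polynomial.natDegree_le_iff_degree_le]
    refine (Polynomial.natDegree_derivative_le _).trans ?_
    rw [Lagrange.natDegree_nodal, hcard]
  · refine (Polynomial.degree_sum_le _ _).trans_lt ?_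
    rw [Finset.sup_lt_iff (by rw [hcard]; exact WithBot.bot_lt_coe m)]
    intro j hj
    refine (Polynomial.degree_mul_le _ _).trans_lt ?_
    refine (add_le_add_left Polynomial.degree_C_le _).trans_lt ?_
    rw [zero_add, Lagrange.degree_nodal, Finset.card_erase_of_mem hj, hcard]
    have := j.2
    exact_mod_cast (by omega)
  · intro i _
    rw [Polynomial.eval_finsetSum, Finset.sum_eq_single i]
    · rw [Polynomial.eval_mul, Polynomial.eval_C, nodalResidue,
        div_mul_cancel₀ _ (eval_nodal_erase_ne_zero hy i)]
    · intro j _ hj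
      rw [Polynomial.eval_mul, Lagrange.eval_nodal_at_node, mul_zero]
      exact Finset.mem_erase.2 ⟨hj.symm, Finset.mem_univ _⟩
    · simp

theorem nodalResidue_zero {y : Fin m → ℂ} (hy : Function.Injective y) (i : Fin m) :
    nodalResidue y 0 i = 1 := by
  rw [nodalResidue, zero_add, Function.iterate_one,
    Lagrange.eval_nodal_derivative_eval_node_eq (Finset.mem_univ i)]
  exact div_self (eval_nodal_erase_ne_zero hy i)

/-- Differentiate the interpolation formula once more and evaluate at y_i. The derivative of the
summand of `i` yields all the terms with its own residue, and the summand of each other `j` yields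
one term. -/
theorem nodalResidue_succ {y : Fin m → ℂ} (hy : Function.Injective y) (s : ℕ) (i : Fin m) :
    nodalResidue y (s + 1) i = ∑ j ∈ Finset.univ.erase i,
      (nodalResidue y s i + nodalResidue y s j) / (y i - y j) := by
  have h0 := eval_nodal_erase_ne_zero hy i
  have h1 : ∀ j ∈ Finset.univ.erase i,
      (Lagrange.nodal ((Finset.univ.erase i).erase j) y).eval (y i) =
        (Lagrange.nodal (Finset.univ.erase i) y).eval (y i) / (y i - y j) := by
    intro j hj
    rw [Lagrange.nodal_eq_mul_nodal_erase hj, Polynomial.eval_mul, Polynomial.eval_sub,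
      Polynomial.eval_X, Polynomial.eval_C, mul_div_cancel_left₀]
    rw [sub_ne_zero]
    exact fun h => Finset.ne_of_mem_erase hj (hy h).symm
  rw [nodalResidue, Function.iterate_succ_apply', iterate_derivative_nodal_eq hy,
    Polynomial.derivative_sum, Polynomial.eval_finsetSum, Finset.sum_div,
    ← Finset.add_sum_erase _ _ (Finset.mem_univ i)]
  simp only [Polynomial.derivative_C_mul, Polynomial.eval_mul, Polynomial.eval_C]
  rw [Lagrange.derivative_nodal, Polynomial.eval_finsetSum, Finset.mul_sum, Finset.sum_div,
    ← Finset.sum_add_distrib]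
  refine Finset.sum_congr rfl fun j hj => ?_
  have hij : i ∈ Finset.univ.erase j :=
    Finset.mem_erase.2 ⟨(Finset.ne_of_mem_erase hj).symm, Finset.mem_univ _⟩
  rw [Lagrange.eval_nodal_derivative_eval_node_eq hij, Finset.erase_right_comm (a := j), h1 j hj]
  have : y i - y j ≠ 0 := by
    rw [sub_ne_zero]
    exact fun h => Finset.ne_of_mem_erase hj (hy h).symm
  field_simp

/-- Symmetrizing the double sum produced by the recursion replaces y_i^n / (y_i - y_j) by the
divided difference (y_i^n - y_j^n) / (y_i - y_j), which is a polynomial. Adding and removing the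
diagonal j = i gives products with power sums and the correction with factor n. -/
theorem sum_pow_mul_nodalResidue {y : Fin m → ℂ} (hy : Function.Injective y) (s n : ℕ) :
    ∑ i, y i ^ n * nodalResidue y s i = powerEval y (vandermondeSum m s n) := by
  induction s generalizing n with
  | zero =>
    rw [vandermondeSum, powerEval_formalPower]
    simp [nodalResidue_zero hy]
  | succ s ih =>
    have hsplit : ∑ i, y i ^ n * nodalResidue y (s + 1) i =
        ∑ i, ∑ j ∈ Finset.univ.erase i,
          nodalResidue y s i * ((y i ^ n - y j ^ n) / (y i - y j)) := by
      have h1 : ∀ f : Fin m → Fin m → ℂ, ∑ i, ∑ j ∈ Finset.univ.erase i, f i j =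
          ∑ i, ∑ j ∈ Finset.univ.erase i, f j i := by
        intro f
        rw [Finset.sum_comm' (t' := Finset.univ) (s' := fun j => Finset.univ.erase j)]
        intro x z
        simp [ne_comm]
      calc ∑ i, y i ^ n * nodalResidue y (s + 1) i
          = ∑ i, ∑ j ∈ Finset.univ.erase i, (nodalResidue y s i * (y i ^ n / (y i - y j))
              + nodalResidue y s j * (y i ^ n / (y i - y j))) := by
            refine Finset.sum_congr rfl fun i _ => ?_
            rw [nodalResidue_succ hy, Finset.mul_sum]
            refine Finset.sum_congr rfl fun j _ => ?_
            ring
        _ = _ := by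
            simp only [Finset.sum_add_distrib]
            rw [h1 fun i j => nodalResidue y s j * (y i ^ n / (y i - y j))]
            rw [← Finset.sum_add_distrib]
            refine Finset.sum_congr rfl fun i _ => ?_
            rw [← Finset.sum_add_distrib]
            refine Finset.sum_congr rfl fun j _ => ?_
            rw [← neg_sub (y i) (y j), div_neg]
            ring
    rw [hsplit]
    cases n with
    | zero => simp [vandermondeSum]
    | succ n =>
      rw [vandermondeSum, map_sub, map_smul, map_sum]
      simp only [map_mul, powerEval_formalPower, ← ih]
      have h2 : ∀ i, ∑ j ∈ Finset.univ.erase i,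
          nodalResidue y s i * ((y i ^ (n + 1) - y j ^ (n + 1)) / (y i - y j)) =
          ∑ a ∈ Finset.range (n + 1), (∑ j, y j ^ a) * (y i ^ (n - a) * nodalResidue y s i) -
            ((n : ℂ) + 1) * (y i ^ n * nodalResidue y s i) := by
        intro i
        have h3 : ∀ j ∈ Finset.univ.erase i,
            nodalResidue y s i * ((y i ^ (n + 1) - y j ^ (n + 1)) / (y i - y j)) =
            ∑ a ∈ Finset.range (n + 1), y j ^ a * (y i ^ (n - a) * nodalResidue y s i) := by
          intro j hj
          have h4 : y i - y j ≠ 0 := by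
            rw [sub_ne_zero]
            exact fun h => Finset.ne_of_mem_erase hj (hy h).symm
          have h5 := (Commute.all (y j) (y i)).geom_sum₂_mul (n + 1)
          have h6 : (y i ^ (n + 1) - y j ^ (n + 1)) / (y i - y j) =
              ∑ a ∈ Finset.range (n + 1), y j ^ a * y i ^ (n - a) := by
            rw [div_eq_iff h4, ← neg_sub (y j ^ (n + 1)), ← h5]
            simp only [Nat.add_sub_cancel]
            ring
          rw [h6, Finset.mul_sum]
          refine Finset.sum_congr rfl fun a _ => ?_
          ring
        rw [Finset.sum_congr rfl h3, Finset.sum_comm, eq_sub_iff_add_eq]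
        have h7 : ((n : ℂ) + 1) * (y i ^ n * nodalResidue y s i) =
            ∑ a ∈ Finset.range (n + 1), y i ^ a * (y i ^ (n - a) * nodalResidue y s i) := by
          rw [Finset.sum_congr rfl (g := fun _ => y i ^ n * nodalResidue y s i)]
          · simp
          · intro a ha
            rw [← mul_assoc, ← pow_add, Nat.add_sub_cancel' (by simpa [Nat.lt_succ_iff] using ha)]
        rw [h7, ← Finset.sum_add_distrib]
        refine Finset.sum_congr rfl fun a _ => ?_
        rw [add_comm, Finset.sum_mul,
          Finset.add_sum_erase Finset.univ (fun j => y j ^ a * (y i ^ (n - a) * nodalResidue y s i))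
            (Finset.mem_univ i)]
      rw [Finset.sum_congr rfl fun i _ => h2 i, Finset.sum_sub_distrib, Finset.sum_comm,
        smul_eq_mul, Finset.mul_sum]
      congr 1
      refine Finset.sum_congr rfl fun a _ => ?_
      rw [Finset.mul_sum]

/-- The polynomial in the variable `i` that arises by giving values to the other variables. -/
def specialize (y : Fin m → ℂ) (i : Fin m) : MvPolynomial (Fin m) ℂ →ₐ[ℂ] Polynomial ℂ :=
  MvPolynomial.aeval fun j => if j = i then Polynomial.X else Polynomial.C (y j)

theorem eval_specialize (y : Fin m → ℂ) (i : Fin m) (p : MvPolynomial (Fin m) ℂ) :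
    (specialize y i p).eval (y i) = MvPolynomial.eval y p := by
  have h : (Polynomial.aeval (y i)).comp (specialize y i) = MvPolynomial.aeval y := by
    apply MvPolynomial.algHom_ext
    intro j
    by_cases hj : j = i
    · subst hj; simp [specialize]
    · simp [specialize, hj]
  have h2 := DFunLike.congr_fun h p
  rw [AlgHom.comp_apply, MvPolynomial.aeval_eq_eval, Polynomial.coe_aeval_eq_eval] at h2
  exact h2

theorem specialize_pderiv (y : Fin m → ℂ) (i : Fin m) (p : MvPolynomial (Fin m) ℂ) :
    specialize y i (MvPolynomial.pderiv i p) = Polynomial.derivative (specialize y i p) := by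
  induction p using MvPolynomial.induction_on with
  | C a => simp [specialize]
  | add p q hp hq => simp [hp, hq]
  | mul_X p j hp =>
    rw [Derivation.leibniz, map_add, smul_eq_mul, smul_eq_mul, map_mul, map_mul, hp, map_mul,
      Polynomial.derivative_mul]
    by_cases hj : j = i
    · subst hj; simp [specialize]; ring
    · simp [specialize, hj, MvPolynomial.pderiv_X_of_ne hj]; ring

theorem specialize_iterate_pderiv (y : Fin m → ℂ) (i : Fin m) (s : ℕ)
    (p : MvPolynomial (Fin m) ℂ) : specialize y i ((MvPolynomial.pderiv i)^[s] p) =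
      Polynomial.derivative^[s] (specialize y i p) := by
  induction s with
  | zero => rfl
  | succ s ih => rw [Function.iterate_succ_apply', specialize_pderiv, ih,
      Function.iterate_succ_apply']

theorem exists_specialize_vandermondePoly (y : Fin m → ℂ) (i : Fin m) :
    ∃ c : ℂ, specialize y i (vandermondePoly m) =
      Polynomial.C c * Lagrange.nodal (Finset.univ.erase i) y := by
  set g : Fin m × Fin m → Polynomial ℂ := fun p =>
    if p.1 = i then Polynomial.X - Polynomial.C (y p.2)
    else if p.2 = i then Polynomial.X - Polynomial.C (y p.1) else 1 with hg
  have h1 : ∀ p ∈ increasingPairs m, ∃ c : ℂ,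
      specialize y i (MvPolynomial.X p.1 - MvPolynomial.X p.2) = Polynomial.C c * g p := by
    intro p hp
    have hp' := (Finset.mem_filter.1 hp).2.ne
    by_cases h1 : p.1 = i
    · have h2 : p.2 ≠ i := fun h => hp' (h1.trans h.symm)
      exact ⟨1, by simp [specialize, hg, h1, h2]⟩
    · by_cases h2 : p.2 = i
      · exact ⟨-1, by simp [specialize, hg, h1, h2]⟩
      · exact ⟨y p.1 - y p.2, by simp [specialize, hg, h1, h2]⟩
  choose! c hc using h1
  refine ⟨∏ p ∈ increasingPairs m, c p, ?_⟩
  rw [vandermondePoly, map_prod, map_prod]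
  refine (Finset.prod_congr rfl hc).trans ?_
  rw [Finset.prod_mul_distrib]
  congr 1
  rw [Lagrange.nodal, ← Finset.prod_filter_mul_prod_filter_not (increasingPairs m)
    (fun p => p.1 = i ∨ p.2 = i)]
  rw [Finset.prod_eq_one (s := (increasingPairs m).filter fun p => ¬(p.1 = i ∨ p.2 = i)), mul_one]
  · symm
    refine Finset.prod_bij (fun j _ => (min i j, max i j)) ?_ ?_ ?_ ?_
    · intro j hj
      have hj' := Finset.ne_of_mem_erase hj
      simp only [increasingPairs, Finset.mem_filter, Finset.mem_univ, true_and]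
      rcases lt_or_gt_of_ne hj' with h | h
      · simp [min_eq_right h.le, max_eq_left h.le, h]
      · simp [min_eq_left h.le, max_eq_right h.le, h]
    · intro j hj k hk h
      simp only [Prod.mk.injEq] at h
      have h3 : min i j + max i j = min i k + max i k := by rw [h.1, h.2]
      rw [Fin.ext_iff, Fin.ext_iff] at h
      apply Fin.ext
      rcases le_total i j with h1 | h1 <;> rcases le_total i k with h2 | h2 <;>
        simp [h1, h2] at h <;> omega
    · intro p hp
      simp only [increasingPairs, Finset.mem_filter, Finset.mem_univ, true_and] at hp
      rcases hp with ⟨h, rfl | rfl⟩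
      · exact ⟨p.2, Finset.mem_erase.2 ⟨h.ne', Finset.mem_univ _⟩, by
          simp [min_eq_left h.le, max_eq_right h.le]⟩
      · exact ⟨p.1, Finset.mem_erase.2 ⟨h.ne, Finset.mem_univ _⟩, by
          simp [min_eq_right h.le, max_eq_left h.le]⟩
    · intro j hj
      have hj' := Finset.ne_of_mem_erase hj
      rcases lt_or_gt_of_ne hj' with h | h
      · simp [hg, min_eq_right h.le, max_eq_left h.le, hj']
      · simp [hg, min_eq_left h.le, max_eq_right h.le]
  · intro p hp
    have := (Finset.mem_filter.1 hp).2
    rw [not_or] at this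
    simp [hg, this]

/-- As a polynomial in the variable `i` alone, V is a constant times q / (X - y_i). By the Leibniz
rule the (s + 1)-st derivative of q at y_i is s + 1 times the s-th derivative of that quotient. -/
theorem eval_iterate_pderiv_vandermondePoly {y : Fin m → ℂ} (hy : Function.Injective y)
    (i : Fin m) (s : ℕ) :
    ((s : ℂ) + 1) * MvPolynomial.eval y ((MvPolynomial.pderiv i)^[s] (vandermondePoly m)) =
      MvPolynomial.eval y (vandermondePoly m) * nodalResidue y s i := by
  obtain ⟨c, hc⟩ := exists_specialize_vandermondePoly y i
  rw [← eval_specialize y i, ← eval_specialize y i (vandermondePoly m),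
    specialize_iterate_pderiv, hc, Polynomial.iterate_derivative_C_mul, Polynomial.eval_mul,
    Polynomial.eval_mul, nodalResidue, Polynomial.eval_C, mul_assoc,
    mul_div_cancel₀ _ (eval_nodal_erase_ne_zero hy i)]
  have h1 : ∀ (p : Polynomial ℂ) (b : ℂ) (s : ℕ),
      Polynomial.derivative^[s + 1] ((Polynomial.X - Polynomial.C b) * p) =
        (Polynomial.X - Polynomial.C b) * Polynomial.derivative^[s + 1] p +
          ((s : Polynomial ℂ) + 1) * Polynomial.derivative^[s] p := by
    intro p b s
    induction s with
    | zero => simp [Polynomial.derivative_mul]; ring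
    | succ s ih =>
      rw [Function.iterate_succ_apply', ih, Polynomial.derivative_add, Polynomial.derivative_mul,
        Polynomial.derivative_mul, ← Function.iterate_succ_apply' Polynomial.derivative,
        ← Function.iterate_succ_apply' Polynomial.derivative]
      simp
      ring
  rw [Lagrange.nodal_eq_mul_nodal_erase (Finset.mem_univ i), h1]
  simp
  ring

/-- After multiplication of both sides by V the identity is trivial at points with coinciding
coordinates; at the other points the residues are available. -/
theorem sum_pow_mul_iterate_pderiv_vandermondePoly (s n : ℕ) :
    ((s : ℂ) + 1) • ∑ i, MvPolynomial.X i ^ n * (MvPolynomial.pderiv i)^[s] (vandermondePoly m) =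
      vandermondePoly m * powerEval MvPolynomial.X (vandermondeSum m s n) := by
  apply mul_left_cancel₀ (vandermondePoly_ne_zero m)
  apply MvPolynomial.funext
  intro y
  rw [map_mul, map_mul]
  by_cases hV : MvPolynomial.eval y (vandermondePoly m) = 0
  · rw [hV, zero_mul, zero_mul]
  · congr 1
    have hy : Function.Injective y := by
      intro i j hij
      by_contra hne
      apply hV
      rw [vandermondePoly, map_prod]
      rcases lt_or_gt_of_ne hne with h | h
      · exact Finset.prod_eq_zero (i := (i, j)) (by simp [h]) (by simp [hij])
      · exact Finset.prod_eq_zero (i := (j, i)) (by simp [h]) (by simp [hij])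
    rw [MvPolynomial.smul_eval, map_sum, map_mul, Finset.mul_sum]
    have h1 : MvPolynomial.eval y (powerEval MvPolynomial.X (vandermondeSum m s n)) =
        powerEval y (vandermondeSum m s n) := by
      have h : (MvPolynomial.aeval y).comp (powerEval (MvPolynomial.X (R := ℂ))) = powerEval y := by
        apply MvPolynomial.algHom_ext
        intro j
        simp [powerEval]
      have h2 := DFunLike.congr_fun h (vandermondeSum m s n)
      rw [AlgHom.comp_apply, MvPolynomial.aeval_eq_eval] at h2
      exact h2
    rw [h1, ← sum_pow_mul_nodalResidue hy, Finset.mul_sum]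
    refine Finset.sum_congr rfl fun i _ => ?_
    rw [map_mul, map_pow, MvPolynomial.eval_X, mul_left_comm,
      eval_iterate_pderiv_vandermondePoly hy]
    ring

end Vandermonde

/-! ### The action of the operators on polynomials in power sums -/

section SymbolCalculus

variable {m : ℕ}

/-- The differential of a polynomial in the power sums. -/
def symbolDeriv : Derivation ℂ (MvPolynomial ℕ ℂ) (Polynomial (MvPolynomial ℕ ℂ)) :=
  MvPolynomial.mkDerivation ℂ fun r => ((r : ℂ) + 1) • Polynomial.X ^ r

theorem symbolDeriv_X (r : ℕ) :
    symbolDeriv (MvPolynomial.X r) = ((r : ℂ) + 1) • Polynomial.X ^ r := by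
  simp [symbolDeriv]

/-- The total derivative with respect to one of the variables `y_i`, for polynomials in `y_i` whose
coefficients are polynomials in the power sums. -/
def totalDeriv : Polynomial (MvPolynomial ℕ ℂ) →ₗ[ℂ] Polynomial (MvPolynomial ℕ ℂ) :=
  Polynomial.derivative.restrictScalars ℂ +
    Polynomial.lsum fun n => (LinearMap.mulRight ℂ (Polynomial.X ^ n)) ∘ₗ symbolDeriv.toLinearMap

theorem totalDeriv_C_mul_X_pow (P : MvPolynomial ℕ ℂ) (n : ℕ) :
    totalDeriv (Polynomial.C P * Polynomial.X ^ n) =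
      Polynomial.C P * Polynomial.derivative (Polynomial.X ^ n) +
        symbolDeriv P * Polynomial.X ^ n := by
  rw [totalDeriv, LinearMap.add_apply]
  congr 1
  · simp [Polynomial.derivative_mul]
  · rw [Polynomial.C_mul_X_pow_eq_monomial]
    change Polynomial.sum _ _ = _
    rw [Polynomial.sum_monomial_index]
    · rfl
    · simp

/-- The total derivative, conjugated with `exp h̃`, where `h` is the derivative of `h̃`. -/
def twistedDeriv (h : Polynomial (MvPolynomial ℕ ℂ)) :
    Polynomial (MvPolynomial ℕ ℂ) →ₗ[ℂ] Polynomial (MvPolynomial ℕ ℂ) :=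
  totalDeriv + LinearMap.mulLeft ℂ h

theorem twistedDeriv_apply (h W : Polynomial (MvPolynomial ℕ ℂ)) :
    twistedDeriv h W = totalDeriv W + h * W := rfl

/-- The map `W ↦ V⁻¹ ∑ W(y_i) ∂_i ^ s V`. -/
def vandermondeMap (M : ℂ) (s : ℕ) : Polynomial (MvPolynomial ℕ ℂ) →ₗ[ℂ] MvPolynomial ℕ ℂ :=
  Polynomial.lsum fun n => LinearMap.mulRight ℂ (((s : ℂ) + 1)⁻¹ • vandermondeSum M s n)

theorem vandermondeMap_C_mul_X_pow (M : ℂ) (s : ℕ) (P : MvPolynomial ℕ ℂ) (n : ℕ) :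
    vandermondeMap M s (Polynomial.C P * Polynomial.X ^ n) =
      P * (((s : ℂ) + 1)⁻¹ • vandermondeSum M s n) := by
  rw [Polynomial.C_mul_X_pow_eq_monomial]
  change Polynomial.sum _ _ = _
  rw [Polynomial.sum_monomial_index]
  · rfl
  · simp

/-- The operator on polynomials in the power sums that corresponds to `schurOp`. -/
def symbolOp (M : ℂ) (h : Polynomial (MvPolynomial ℕ ℂ)) (k : ℕ) :
    MvPolynomial ℕ ℂ →ₗ[ℂ] MvPolynomial ℕ ℂ :=
  ∑ s ∈ Finset.range (k + 1), (k.choose s : ℂ) • (vandermondeMap M s ∘ₗ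
    LinearMap.mulLeft ℂ ((1 + Polynomial.X) ^ k) ∘ₗ ((twistedDeriv h) ^ (k - s)) ∘ₗ
    (Polynomial.CAlgHom (R := ℂ) (A := MvPolynomial ℕ ℂ)).toLinearMap)

theorem symbolOp_apply (M : ℂ) (h : Polynomial (MvPolynomial ℕ ℂ)) (k : ℕ)
    (P : MvPolynomial ℕ ℂ) : symbolOp M h k P = ∑ s ∈ Finset.range (k + 1), (k.choose s : ℂ) •
      vandermondeMap M s ((1 + Polynomial.X) ^ k *
        (twistedDeriv h)^[k - s] (Polynomial.C P)) := by
  simp only [symbolOp, LinearMap.sum_apply, LinearMap.smul_apply, LinearMap.comp_apply,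
    LinearMap.mulLeft_apply, Module.End.pow_apply]
  rfl

/-- Evaluation of a polynomial in the power sums. -/
abbrev seriesEval (m : ℕ) : MvPolynomial ℕ ℂ →ₐ[ℂ] MvPowerSeries (Fin m) ℂ :=
  powerEval MvPowerSeries.X

/-- Evaluation of a polynomial in `y_i` whose coefficients are polynomials in the power sums. -/
def seriesEvalAt (i : Fin m) : Polynomial (MvPolynomial ℕ ℂ) →+* MvPowerSeries (Fin m) ℂ :=
  Polynomial.eval₂RingHom (seriesEval m).toRingHom (MvPowerSeries.X i)

theorem seriesEvalAt_C (i : Fin m) (P : MvPolynomial ℕ ℂ) :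
    seriesEvalAt i (Polynomial.C P) = seriesEval m P := by
  simp [seriesEvalAt]

theorem seriesEvalAt_X (i : Fin m) : seriesEvalAt i Polynomial.X = MvPowerSeries.X i := by
  simp [seriesEvalAt]

theorem seriesEvalAt_smul (i : Fin m) (c : ℂ) (W : Polynomial (MvPolynomial ℕ ℂ)) :
    seriesEvalAt i (c • W) = c • seriesEvalAt i W := by
  have h : c • W = Polynomial.C (MvPolynomial.C c) * W := by
    rw [← Polynomial.smul_eq_C_mul, ← MvPolynomial.algebraMap_eq, algebraMap_smul]
  rw [h, map_mul, seriesEvalAt_C, ← MvPolynomial.algebraMap_eq, AlgHom.commutes,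
    Algebra.smul_def]

theorem pderiv_seriesEval (i : Fin m) (P : MvPolynomial ℕ ℂ) :
    MvPowerSeries.pderiv ℂ i (seriesEval m P) = seriesEvalAt i (symbolDeriv P) := by
  induction P using MvPolynomial.induction_on with
  | C a =>
    rw [← MvPolynomial.algebraMap_eq, AlgHom.commutes, Derivation.map_algebraMap,
      Derivation.map_algebraMap, map_zero]
  | add p q hp hq => simp only [map_add, hp, hq]
  | mul_X p r hp =>
    rw [map_mul, Derivation.leibniz, Derivation.leibniz, hp, map_add, symbolDeriv_X]
    simp only [smul_eq_mul, Polynomial.smul_eq_C_mul]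
    rw [map_mul, map_mul, seriesEvalAt_C, seriesEvalAt_C, seriesEvalAt_smul, map_pow,
      seriesEvalAt_X]
    congr 2
    simp only [powerEval, MvPolynomial.aeval_X, map_sum]
    rw [Finset.sum_eq_single i]
    · rw [MvPowerSeries.pderiv_pow, MvPowerSeries.pderiv_X_self]
      simp [Algebra.smul_def]
    · intro j _ hj
      rw [MvPowerSeries.pderiv_pow, MvPowerSeries.pderiv_X_of_ne hj, mul_zero]
    · simp

theorem pderiv_seriesEvalAt (i : Fin m) (W : Polynomial (MvPolynomial ℕ ℂ)) :
    MvPowerSeries.pderiv ℂ i (seriesEvalAt i W) = seriesEvalAt i (totalDeriv W) := by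
  induction W using Polynomial.induction_on' with
  | add p q hp hq => simp only [map_add, hp, hq]
  | monomial n P =>
    rw [← Polynomial.C_mul_X_pow_eq_monomial, totalDeriv_C_mul_X_pow, map_mul, Derivation.leibniz,
      map_add, map_mul, map_mul, seriesEvalAt_C, pderiv_seriesEval, map_pow, seriesEvalAt_X,
      MvPowerSeries.pderiv_pow, MvPowerSeries.pderiv_X_self, Polynomial.derivative_X_pow]
    simp [seriesEvalAt_X, smul_eq_mul]
    ring

theorem sum_pow_mul_iterate_pderiv_vandermondeSeries (s n : ℕ) :
    ∑ i, MvPowerSeries.X i ^ n * (MvPowerSeries.pderiv ℂ i)^[s] (vandermondeSeries m) =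
      vandermondeSeries m * seriesEval m (((s : ℂ) + 1)⁻¹ • vandermondeSum m s n) := by
  have hs : ((s : ℂ) + 1) ≠ 0 := Nat.cast_add_one_ne_zero s
  have h1 := congrArg (MvPolynomial.coeToMvPowerSeries.algHom (σ := Fin m) (R := ℂ) ℂ)
    (sum_pow_mul_iterate_pderiv_vandermondePoly (m := m) s n)
  have h2 : ∀ (i : Fin m) (s : ℕ) (p : MvPolynomial (Fin m) ℂ),
      (((MvPolynomial.pderiv i)^[s] p : MvPolynomial (Fin m) ℂ) : MvPowerSeries (Fin m) ℂ) =
        (MvPowerSeries.pderiv ℂ i)^[s] (p : MvPowerSeries (Fin m) ℂ) := by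
    intro i s p
    induction s with
    | zero => rfl
    | succ s ih => rw [Function.iterate_succ_apply', ← MvPowerSeries.pderiv_coe, ih,
        Function.iterate_succ_apply']
  have h3 : (MvPolynomial.coeToMvPowerSeries.algHom (σ := Fin m) (R := ℂ) ℂ).comp
      (powerEval MvPolynomial.X) = seriesEval m := by
    apply MvPolynomial.algHom_ext
    intro r
    simp [powerEval, MvPolynomial.coeToMvPowerSeries.algHom_apply]
  have h4 := DFunLike.congr_fun h3 (vandermondeSum m s n)
  rw [AlgHom.comp_apply] at h4
  rw [map_smul, map_mul, h4, map_sum] at h1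
  simp only [map_mul, map_pow, MvPolynomial.coeToMvPowerSeries.algHom_apply, h2,
    coe_vandermondePoly, MvPolynomial.coe_X] at h1
  rw [map_smul, mul_smul_comm, eq_inv_smul_iff₀ hs]
  simpa using h1

theorem sum_seriesEvalAt_mul (s : ℕ) (W : Polynomial (MvPolynomial ℕ ℂ)) :
    ∑ i, seriesEvalAt i W * (MvPowerSeries.pderiv ℂ i)^[s] (vandermondeSeries m) =
      vandermondeSeries m * seriesEval m (vandermondeMap m s W) := by
  induction W using Polynomial.induction_on' with
  | add p q hp hq => simp only [map_add, add_mul, mul_add, Finset.sum_add_distrib, hp, hq]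
  | monomial n P =>
    rw [← Polynomial.C_mul_X_pow_eq_monomial, vandermondeMap_C_mul_X_pow, map_mul, mul_left_comm,
      ← sum_pow_mul_iterate_pderiv_vandermondeSeries, Finset.mul_sum]
    refine Finset.sum_congr rfl fun i _ => ?_
    rw [map_mul, map_pow, seriesEvalAt_C, seriesEvalAt_X, mul_assoc]

theorem iterate_derivation_mul {A : Type*} [CommRing A] [Algebra ℂ A] (d : Derivation ℂ A A) (k : ℕ)
    (f g : A) : d^[k] (f * g) =
      ∑ s ∈ Finset.range (k + 1), (k.choose s : ℂ) • (d^[s] f * d^[k - s] g) := by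
  rw [← Finset.Nat.sum_antidiagonal_eq_sum_range_succ
    (fun i j => (k.choose i : ℂ) • (d^[i] f * d^[j] g))]
  simp only [Nat.cast_smul_eq_nsmul]
  induction k with
  | zero => simp
  | succ k ih =>
    rw [Finset.sum_antidiagonal_choose_succ_nsmul (M := A) (fun i j => d^[i] f * d^[j] g) k,
      Function.iterate_succ_apply', ih, map_sum, ← Finset.sum_add_distrib]
    refine Finset.sum_congr rfl fun ij hij => ?_
    have h1 : k.choose ij.2 = k.choose ij.1 := by
      rw [Nat.choose_symm_of_eq_add (Finset.HasAntidiagonal.mem_antidiagonal.1 hij).symm]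
    rw [map_nsmul, Derivation.leibniz, Function.iterate_succ_apply', Function.iterate_succ_apply',
      smul_eq_mul, smul_eq_mul, smul_add, h1]
    congr 1
    rw [mul_comm]

/-- If T is the exponential of a function with derivative `h`, up to high order, then conjugation
with T turns ∂_i into ∂_i + h. Each differentiation costs one order of the error. -/
theorem iterate_pderiv_mul_seriesEvalAt {D : ℕ} {T : MvPowerSeries (Fin m) ℂ}
    {h : Polynomial (MvPolynomial ℕ ℂ)} {i : Fin m}
    (hT : MvPowerSeries.pderiv ℂ i T - T * seriesEvalAt i h ∈ highOrder m D)
    (W : Polynomial (MvPolynomial ℕ ℂ)) (a : ℕ) :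
    (MvPowerSeries.pderiv ℂ i)^[a] (T * seriesEvalAt i W) -
      T * seriesEvalAt i ((twistedDeriv h)^[a] W) ∈ highOrder m (D - a) := by
  induction a with
  | zero => simp
  | succ a ih =>
    rw [Function.iterate_succ_apply', Function.iterate_succ_apply']
    set U := (twistedDeriv h)^[a] W
    set f := (MvPowerSeries.pderiv ℂ i)^[a] (T * seriesEvalAt i W)
    have h1 : MvPowerSeries.pderiv ℂ i f - T * seriesEvalAt i (twistedDeriv h U) =
        MvPowerSeries.pderiv ℂ i (f - T * seriesEvalAt i U) +
          seriesEvalAt i U * (MvPowerSeries.pderiv ℂ i T - T * seriesEvalAt i h) := by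
      rw [map_sub, Derivation.leibniz, pderiv_seriesEvalAt, twistedDeriv_apply, map_add, map_mul,
        smul_eq_mul, smul_eq_mul]
      ring
    rw [h1]
    refine add_mem ?_ (Ideal.mul_mem_left _ _ (highOrder_antitone (by omega) hT))
    have := pderiv_mem_highOrder ih i
    rwa [Nat.sub_sub] at this

theorem iterate_pderiv_mem_highOrder {e : ℕ} {f : MvPowerSeries (Fin m) ℂ}
    (hf : f ∈ highOrder m e) (i : Fin m) (s : ℕ) :
    (MvPowerSeries.pderiv ℂ i)^[s] f ∈ highOrder m (e - s) := by
  induction s with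
  | zero => exact hf
  | succ s ih =>
    rw [Function.iterate_succ_apply', ← Nat.sub_sub]
    exact pderiv_mem_highOrder ih i

theorem vandermondeSeries_mem_highOrder :
    vandermondeSeries m ∈ highOrder m (increasingPairs m).card := by
  rcases Nat.eq_zero_or_pos m with rfl | hm
  · have : (increasingPairs 0).card = 0 := by simp [increasingPairs]
    rw [this]
    exact mem_highOrder_zero _
  · exact iterate_pderiv_vandermondeSeries_mem ⟨0, hm⟩ 0

/-- Multiplication by V raises the order by the number of pairs and division lowers it by the same
number, so only the k derivatives count. -/
theorem schurOp_mem_highOrder {e k : ℕ} (hk : k ≤ e) {f : MvPowerSeries (Fin m) ℂ}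
    (hf : f ∈ highOrder m e) : schurOp m k f ∈ highOrder m (e - k) := by
  rw [schurOp_apply]
  apply divVandermonde_mem_highOrder
  rw [eulerOp_apply]
  refine sum_mem fun i _ => Ideal.mul_mem_left _ _ ?_
  have := iterate_pderiv_mem_highOrder (mul_mem_highOrder vandermondeSeries_mem_highOrder hf) i k
  exact highOrder_antitone (by omega) this

/-- The Leibniz rule for ∂_i^k (V · T P) distributes derivatives between V and T P. The former are
re-expressed by power sums, the latter by the twisted derivative, and the factor T comes out. The
error of order `D` loses at most `k`. -/
theorem schurOp_mul_seriesEval {D k : ℕ} (hk : k ≤ D) {T : MvPowerSeries (Fin m) ℂ}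
    {h : Polynomial (MvPolynomial ℕ ℂ)}
    (hT : ∀ i, MvPowerSeries.pderiv ℂ i T - T * seriesEvalAt i h ∈ highOrder m D)
    (P : MvPolynomial ℕ ℂ) :
    schurOp m k (T * seriesEval m P) - T * seriesEval m (symbolOp m h k P) ∈
      highOrder m (D - k) := by
  have key : eulerOp m k (vandermondeSeries m * (T * seriesEval m P)) -
      vandermondeSeries m * (T * seriesEval m (symbolOp m h k P)) ∈
        highOrder m (D - k + (increasingPairs m).card) := by
    have h1 : vandermondeSeries m * (T * seriesEval m (symbolOp m h k P)) =
        ∑ i, (1 + MvPowerSeries.X i) ^ k * ∑ s ∈ Finset.range (k + 1), (k.choose s : ℂ) •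
          ((MvPowerSeries.pderiv ℂ i)^[s] (vandermondeSeries m) *
            (T * seriesEvalAt i ((twistedDeriv h)^[k - s] (Polynomial.C P)))) := by
      rw [symbolOp_apply, map_sum, Finset.mul_sum, Finset.mul_sum]
      simp only [Finset.mul_sum]
      rw [Finset.sum_comm]
      refine Finset.sum_congr rfl fun s _ => ?_
      rw [map_smul, mul_smul_comm, mul_smul_comm, mul_left_comm, ← sum_seriesEvalAt_mul,
        Finset.mul_sum, Finset.smul_sum]
      refine Finset.sum_congr rfl fun i _ => ?_
      rw [map_mul, map_pow, map_add, map_one, seriesEvalAt_X, mul_smul_comm]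
      congr 1
      ring
    rw [h1, eulerOp_apply, ← Finset.sum_sub_distrib]
    refine sum_mem fun i _ => ?_
    rw [← mul_sub]
    refine Ideal.mul_mem_left _ _ ?_
    rw [iterate_derivation_mul, ← Finset.sum_sub_distrib]
    refine sum_mem fun s hs => ?_
    rw [← smul_sub, ← mul_sub, Algebra.smul_def]
    refine Ideal.mul_mem_left _ _ ?_
    have h2 := iterate_pderiv_mul_seriesEvalAt (hT i) (Polynomial.C P) (k - s)
    rw [seriesEvalAt_C] at h2
    -- The factor ∂^s V still has order at least the number of pairs minus `s`, and the other factor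
    -- has lost at most `k - s`. In total `k` orders are lost, with the order of V left over for the
    -- division.
    refine highOrder_antitone ?_ (mul_mem_highOrder (iterate_pderiv_vandermondeSeries_mem i s) h2)
    rw [Finset.mem_range] at hs
    omega
  rw [schurOp_apply, ← divVandermonde_mul (T * seriesEval m (symbolOp m h k P)), ← map_sub]
  exact divVandermonde_mem_highOrder key

theorem killCompl_mem_highOrder {M e : ℕ} (ι : Fin m ↪ Fin M) {f : MvPowerSeries (Fin M) ℂ}
    (hf : f ∈ highOrder M e) : MvPowerSeries.killCompl ι f ∈ highOrder m e := by
  rw [mem_highOrder_iff] at *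
  intro α hα
  rw [MvPowerSeries.coeff_killCompl]
  apply hf
  rwa [Finsupp.embDomain_eq_mapDomain, Finsupp.degree_mapDomain]

theorem killCompl_seriesEval {M : ℕ} (ι : Fin m ↪ Fin M) (P : MvPolynomial ℕ ℂ) :
    MvPowerSeries.killCompl ι (seriesEval M P) = seriesEval m P := by
  have h : (MvPowerSeries.killCompl (R := ℂ) ι).comp (seriesEval M) = seriesEval m := by
    apply MvPolynomial.algHom_ext
    intro r
    simp only [AlgHom.comp_apply, powerEval, MvPolynomial.aeval_X, map_sum, map_pow]
    rw [← Finset.sum_subset (Finset.subset_univ (Finset.univ.map ι)), Finset.sum_map]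
    · simp
    · intro j _ hj
      rw [MvPowerSeries.killCompl_X_eq_zero]
      · simp
      · simpa using hj
  exact DFunLike.congr_fun h P

end SymbolCalculus

/-! ### Coefficientwise convergence -/

/-- Convergence in the finest topology of a vector space, for sequences that stay in a subspace of
finite dimension. -/
inductive FinTendsto {V : Type*} [AddCommGroup V] [Module ℂ V] : (ℕ → V) → V → Prop
  | smul_const {c : ℕ → ℂ} {c₀ : ℂ} (v : V) (h : Tendsto c atTop (𝓝 c₀)) :
      FinTendsto (fun N => c N • v) (c₀ • v)
  | add {u u' : ℕ → V} {v v' : V} (h : FinTendsto u v) (h' : FinTendsto u' v') :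
      FinTendsto (fun N => u N + u' N) (v + v')
  | congr {u u' : ℕ → V} {v : V} (h : FinTendsto u v) (h' : u =ᶠ[atTop] u') : FinTendsto u' v

namespace FinTendsto

variable {V W : Type*} [AddCommGroup V] [Module ℂ V] [AddCommGroup W] [Module ℂ W]

theorem of_eq {u u' : ℕ → V} {v v' : V} (h : FinTendsto u v) (hu : ∀ N, u N = u' N)
    (hv : v = v') : FinTendsto u' v' := by
  rw [← hv, ← funext hu]
  exact h

theorem const (v : V) : FinTendsto (fun _ => v) v := by
  simpa using smul_const v (tendsto_const_nhds (x := (1 : ℂ)))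

theorem zero : FinTendsto (fun _ => (0 : V)) 0 := const 0

theorem smul {c : ℕ → ℂ} {c₀ : ℂ} (hc : Tendsto c atTop (𝓝 c₀)) {u : ℕ → V} {v : V}
    (h : FinTendsto u v) : FinTendsto (fun N => c N • u N) (c₀ • v) := by
  induction h with
  | smul_const w h => simpa only [smul_smul] using smul_const w (hc.mul h)
  | add _ _ ih ih' => simpa only [smul_add] using ih.add ih'
  | congr _ h' ih => exact ih.congr (h'.mono fun N hN => by simp only [hN])

theorem const_smul (c : ℂ) {u : ℕ → V} {v : V} (h : FinTendsto u v) :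
    FinTendsto (fun N => c • u N) (c • v) := h.smul tendsto_const_nhds

theorem smul_zero' {c : ℕ → ℂ} (hc : Tendsto c atTop (𝓝 0)) {u : ℕ → V} {v : V}
    (h : FinTendsto u v) : FinTendsto (fun N => c N • u N) 0 := by
  simpa using h.smul hc

theorem sub {u u' : ℕ → V} {v v' : V} (h : FinTendsto u v) (h' : FinTendsto u' v') :
    FinTendsto (fun N => u N - u' N) (v - v') := by
  simpa [sub_eq_add_neg] using h.add (h'.const_smul (-1))

theorem sum {ι : Type*} (s : Finset ι) {u : ι → ℕ → V} {v : ι → V}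
    (h : ∀ i ∈ s, FinTendsto (u i) (v i)) :
    FinTendsto (fun N => ∑ i ∈ s, u i N) (∑ i ∈ s, v i) := by
  classical
  induction s using Finset.induction_on with
  | empty => simpa using zero
  | insert i s hi ih =>
    simp only [Finset.sum_insert hi]
    exact (h i (Finset.mem_insert_self i s)).add
      (ih fun j hj => h j (Finset.mem_insert_of_mem hj))

/-- Pointwise convergence of the operators suffices, because the argument stays eventually in the
span of finitely many fixed vectors. This is why this notion of convergence is composable without
any norm. -/
theorem map_op {A : ℕ → V →ₗ[ℂ] W} {A₀ : V →ₗ[ℂ] W}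
    (hA : ∀ w, FinTendsto (fun N => A N w) (A₀ w)) {u : ℕ → V} {v : V} (h : FinTendsto u v) :
    FinTendsto (fun N => A N (u N)) (A₀ v) := by
  induction h with
  | smul_const w h => simpa only [map_smul] using (hA w).smul h
  | add _ _ ih ih' => simpa only [map_add] using ih.add ih'
  | congr _ h' ih => exact ih.congr (h'.mono fun N hN => by simp only [hN])

theorem map (A : V →ₗ[ℂ] W) {u : ℕ → V} {v : V} (h : FinTendsto u v) :
    FinTendsto (fun N => A (u N)) (A v) := h.map_op fun w => const (A w)

theorem mul {A : Type*} [CommRing A] [Algebra ℂ A] {u u' : ℕ → A} {v v' : A}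
    (h : FinTendsto u v) (h' : FinTendsto u' v') : FinTendsto (fun N => u N * u' N) (v * v') :=
  map_op (A := fun N => LinearMap.mulLeft ℂ (u N)) (A₀ := LinearMap.mulLeft ℂ v)
    (fun w => h.map (LinearMap.mulRight ℂ w)) h'

theorem tendsto {u : ℕ → V} {v : V} (h : FinTendsto u v) (l : V →ₗ[ℂ] ℂ) :
    Tendsto (fun N => l (u N)) atTop (𝓝 (l v)) := by
  induction h with
  | smul_const w h => simpa only [map_smul] using h.smul_const (l w)
  | add _ _ ih ih' => simpa only [map_add] using ih.add ih'
  | congr _ h' ih => exact ih.congr' (h'.mono fun N hN => by simp only [hN])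

end FinTendsto

/-! ### Asymptotics of the operators -/

section Asymptotics

theorem tendsto_inv_natCast : Tendsto (fun N : ℕ => (N : ℂ)⁻¹) atTop (𝓝 0) :=
  tendsto_inv_atTop_nhds_zero_nat

theorem natCast_mul_inv_eventuallyEq : (fun N : ℕ => (N : ℂ) * (N : ℂ)⁻¹) =ᶠ[atTop] fun _ => 1 := by
  filter_upwards [eventually_ne_atTop 0] with N hN
  exact mul_inv_cancel₀ (Nat.cast_ne_zero.2 hN)

/-- The scalar part of `vandermondeSum`. -/
def vandermondeConst (M : ℂ) (s n : ℕ) : ℂ := if n = s then fallingFactorial (s + 1) M else 0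

theorem vandermondeConst_succ (M : ℂ) (s n : ℕ) :
    vandermondeConst M (s + 1) (n + 1) = (M - (n + 1)) * vandermondeConst M s n := by
  by_cases h : n = s
  · subst h
    rw [vandermondeConst, vandermondeConst, if_pos rfl, if_pos rfl, fallingFactorial,
      Finset.prod_range_succ, fallingFactorial]
    push_cast
    ring
  · simp [vandermondeConst, h]

/-- `p_{n-s}` if `s < n`, and `0` otherwise. -/
def shiftedPower (s n : ℕ) : MvPolynomial ℕ ℂ :=
  if s < n then MvPolynomial.X (n - s - 1) else 0

variable {b : ℂ} {M : ℕ → ℂ}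

theorem tendsto_vandermondeConst (hM : Tendsto (fun N : ℕ => (N : ℂ)⁻¹ * M N) atTop (𝓝 b))
    (s n : ℕ) : Tendsto (fun N : ℕ => ((N : ℂ)⁻¹) ^ (s + 1) * vandermondeConst (M N) s n) atTop
      (𝓝 (if n = s then b ^ (s + 1) else 0)) := by
  by_cases h : n = s
  · simp only [vandermondeConst, h, if_true, fallingFactorial]
    have h1 : Tendsto (fun N : ℕ => ∏ j ∈ Finset.range (s + 1),
        ((N : ℂ)⁻¹ * M N - (N : ℂ)⁻¹ * j)) atTop (𝓝 (∏ j ∈ Finset.range (s + 1), (b - 0 * j))) :=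
      tendsto_finsetProd _ fun j _ => hM.sub (tendsto_inv_natCast.mul_const _)
    simp only [zero_mul, sub_zero, Finset.prod_const, Finset.card_range] at h1
    refine h1.congr fun N => ?_
    simp only [← mul_sub, Finset.prod_mul_distrib, Finset.prod_const, Finset.card_range]
  · simp [vandermondeConst, h]

/-- Here M grows like b N while the power sums are formal variables. In the recursion the summand a
= 0 multiplies by M. The other summands are p_a times a lower sum, and matter only where that sum
has its scalar part, that is for n - a = s. So the coefficient of the linear term grows by b^(s+1)
at each step, which accounts for the factor s + 1. -/
theorem finTendsto_vandermondeSum (hM : Tendsto (fun N : ℕ => (N : ℂ)⁻¹ * M N) atTop (𝓝 b))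
    (s n : ℕ) : FinTendsto (fun N : ℕ => ((N : ℂ)⁻¹) ^ s •
      (vandermondeSum (M N) s n - MvPolynomial.C (vandermondeConst (M N) s n)))
      ((((s : ℂ) + 1) * b ^ s) • shiftedPower s n) := by
  induction s generalizing n with
  | zero =>
    cases n with
    | zero => simpa [vandermondeSum, formalPower, vandermondeConst, fallingFactorial, shiftedPower]
        using FinTendsto.zero
    | succ n => simpa [vandermondeSum, formalPower, vandermondeConst, shiftedPower]
        using FinTendsto.const (MvPolynomial.X n : MvPolynomial ℕ ℂ)
  | succ s ih =>
    cases n with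
    | zero => simpa [vandermondeSum, vandermondeConst, shiftedPower] using FinTendsto.zero
    | succ n =>
      have h1 : ∀ N : ℕ, ((N : ℂ)⁻¹) ^ (s + 1) • (vandermondeSum (M N) (s + 1) (n + 1) -
          MvPolynomial.C (vandermondeConst (M N) (s + 1) (n + 1))) =
          ∑ a ∈ Finset.range n, MvPolynomial.X a * (
            (((N : ℂ)⁻¹) ^ (s + 1) * vandermondeConst (M N) s (n - (a + 1))) • 1 +
            (N : ℂ)⁻¹ • (((N : ℂ)⁻¹) ^ s • (vandermondeSum (M N) s (n - (a + 1)) -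
              MvPolynomial.C (vandermondeConst (M N) s (n - (a + 1)))))) +
          ((N : ℂ)⁻¹ * M N - (N : ℂ)⁻¹ * (n + 1)) • (((N : ℂ)⁻¹) ^ s •
            (vandermondeSum (M N) s n - MvPolynomial.C (vandermondeConst (M N) s n))) := by
        intro N
        rw [vandermondeSum, Finset.sum_range_succ', vandermondeConst_succ]
        simp only [formalPower, Nat.sub_zero, MvPolynomial.smul_eq_C_mul, map_mul, map_sub, map_pow,
          map_add, map_one, pow_succ]
        simp only [mul_sub, mul_add, Finset.sum_add_distrib, Finset.mul_sum, Finset.sum_sub_distrib]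
        have h2 : ∀ f g : ℕ → MvPolynomial ℕ ℂ, (∀ a, f a = g a) →
          ∑ a ∈ Finset.range n, f a = ∑ a ∈ Finset.range n, g a :=
            fun f g h => Finset.sum_congr rfl fun a _ => h a
        rw [h2 _ (fun a => (MvPolynomial.C (N : ℂ)⁻¹ ^ s * MvPolynomial.C (N : ℂ)⁻¹) *
          (MvPolynomial.X a * vandermondeSum (M N) s (n - (a + 1)))) (fun a => by ring),
          h2 (fun a => MvPolynomial.X a * (MvPolynomial.C (N : ℂ)⁻¹ * (MvPolynomial.C (N : ℂ)⁻¹ ^ s *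
            vandermondeSum (M N) s (n - (a + 1))))) (fun a => (MvPolynomial.C (N : ℂ)⁻¹ ^ s *
            MvPolynomial.C (N : ℂ)⁻¹) * (MvPolynomial.X a * vandermondeSum (M N) s (n - (a + 1))))
            (fun a => by ring),
          h2 (fun a => MvPolynomial.X a * (MvPolynomial.C (N : ℂ)⁻¹ * (MvPolynomial.C (N : ℂ)⁻¹ ^ s *
            MvPolynomial.C (vandermondeConst (M N) s (n - (a + 1))))))
            (fun a => MvPolynomial.X a * (MvPolynomial.C (N : ℂ)⁻¹ ^ s * MvPolynomial.C (N : ℂ)⁻¹ *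
            MvPolynomial.C (vandermondeConst (M N) s (n - (a + 1))) * 1))
            (fun a => by ring)]
        ring
      have h3 : FinTendsto (fun N : ℕ => ∑ a ∈ Finset.range n, (MvPolynomial.X a :
          MvPolynomial ℕ ℂ) * (
            (((N : ℂ)⁻¹) ^ (s + 1) * vandermondeConst (M N) s (n - (a + 1))) • 1 +
            (N : ℂ)⁻¹ • (((N : ℂ)⁻¹) ^ s • (vandermondeSum (M N) s (n - (a + 1)) -
              MvPolynomial.C (vandermondeConst (M N) s (n - (a + 1))))))
          + ((N : ℂ)⁻¹ * M N - (N : ℂ)⁻¹ * (n + 1)) • (((N : ℂ)⁻¹) ^ s •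
            (vandermondeSum (M N) s n - MvPolynomial.C (vandermondeConst (M N) s n))))
          (∑ a ∈ Finset.range n, MvPolynomial.X a *
            ((if n - (a + 1) = s then b ^ (s + 1) else 0) • 1 + 0) +
            (b - 0 * (n + 1)) • ((((s : ℂ) + 1) * b ^ s) • shiftedPower s n)) := by
        refine (FinTendsto.sum _ fun a _ => (FinTendsto.const _).mul ((FinTendsto.smul_const 1
          (tendsto_vandermondeConst hM s _)).add
          (FinTendsto.smul_zero' tendsto_inv_natCast (ih _)))).add
          (FinTendsto.smul (hM.sub (tendsto_inv_natCast.mul_const _)) (ih n))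
      simp only [h1]
      convert h3 using 1
      have h4 : ∑ a ∈ Finset.range n, (MvPolynomial.X a : MvPolynomial ℕ ℂ) *
          ((if n - (a + 1) = s then b ^ (s + 1) else 0) • 1 + 0) =
          b ^ (s + 1) • shiftedPower s n := by
        by_cases hs : s < n
        · rw [Finset.sum_eq_single (n - s - 1)]
          · have : n - (n - s - 1 + 1) = s := by omega
            rw [if_pos this, shiftedPower, if_pos hs, add_zero, mul_smul_comm, mul_one]
          · intro a ha hne
            rw [Finset.mem_range] at ha
            have : n - (a + 1) ≠ s := by omega
            simp [this]
          · intro h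
            rw [Finset.mem_range] at h
            omega
        · rw [shiftedPower, if_neg hs, smul_zero]
          refine Finset.sum_eq_zero fun a ha => ?_
          rw [Finset.mem_range] at ha
          have : n - (a + 1) ≠ s := by omega
          simp [this]
      have h5 : shiftedPower (s + 1) (n + 1) = shiftedPower s n := by
        simp [shiftedPower]
      rw [h4, h5, smul_smul, ← add_smul]
      congr 1
      push_cast
      ring

/-- The linear map `W ↦ ∑_{n > s} W_n p_{n-s}`. -/
def tailMap (s : ℕ) : Polynomial (MvPolynomial ℕ ℂ) →ₗ[ℂ] MvPolynomial ℕ ℂ :=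
  Polynomial.lsum fun n => LinearMap.mulRight ℂ (shiftedPower s n)

theorem tailMap_C_mul_X_pow (s : ℕ) (P : MvPolynomial ℕ ℂ) (n : ℕ) :
    tailMap s (Polynomial.C P * Polynomial.X ^ n) = P * shiftedPower s n := by
  rw [Polynomial.C_mul_X_pow_eq_monomial]
  change Polynomial.sum _ _ = _
  rw [Polynomial.sum_monomial_index]
  · rfl
  · simp

/-- The coefficient of `X ^ s`. -/
def coeffMap (s : ℕ) : Polynomial (MvPolynomial ℕ ℂ) →ₗ[ℂ] MvPolynomial ℕ ℂ :=
  (Polynomial.lcoeff (MvPolynomial ℕ ℂ) s).restrictScalars ℂ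

theorem coeffMap_apply (s : ℕ) (W : Polynomial (MvPolynomial ℕ ℂ)) : coeffMap s W = W.coeff s := rfl

/-- The map has a scalar part of order N^(s+1), seen only by the coefficient of X^s, and behind it a
part of order N^s that multiplies by power sums. The scalar part is removed here so that the second
order becomes visible. -/
theorem finTendsto_vandermondeMap_sub
    (hM : Tendsto (fun N : ℕ => (N : ℂ)⁻¹ * M N) atTop (𝓝 b)) (s : ℕ)
    (W : Polynomial (MvPolynomial ℕ ℂ)) :
    FinTendsto (fun N : ℕ => (((N : ℂ)⁻¹) ^ s • (vandermondeMap (M N) s -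
      (((s : ℂ) + 1)⁻¹ * vandermondeConst (M N) s s) • coeffMap s)) W)
      (b ^ s • tailMap s W) := by
  induction W using Polynomial.induction_on' with
  | add p q hp hq =>
    simp only [map_add, smul_add]
    exact hp.add hq
  | monomial n P =>
    rw [← Polynomial.C_mul_X_pow_eq_monomial, tailMap_C_mul_X_pow]
    have h1 := (FinTendsto.const P).mul
      ((finTendsto_vandermondeSum hM s n).const_smul ((s : ℂ) + 1)⁻¹)
    have hs : ((s : ℂ) + 1) ≠ 0 := Nat.cast_add_one_ne_zero s
    refine h1.of_eq (fun N => ?_) ?_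
    · symm
      rw [LinearMap.smul_apply, LinearMap.sub_apply, vandermondeMap_C_mul_X_pow,
        LinearMap.smul_apply, coeffMap_apply, Polynomial.coeff_C_mul_X_pow]
      have h2 : (((s : ℂ) + 1)⁻¹ * vandermondeConst (M N) s s) • (if s = n then P else 0) =
          P * (((s : ℂ) + 1)⁻¹ • MvPolynomial.C (vandermondeConst (M N) s n)) := by
        by_cases h : n = s
        · subst h
          simp only [if_true, MvPolynomial.smul_eq_C_mul, map_mul]
          ring
        · have h' : ¬ s = n := fun h2 => h h2.symm
          simp [vandermondeConst, h, h']
      rw [h2, ← mul_sub, ← smul_sub, mul_smul_comm, mul_smul_comm, mul_smul_comm, smul_comm]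
    · rw [mul_smul_comm, mul_smul_comm, smul_smul, inv_mul_cancel_left₀ hs]

theorem finTendsto_vandermondeMap (hM : Tendsto (fun N : ℕ => (N : ℂ)⁻¹ * M N) atTop (𝓝 b))
    (s : ℕ) (W : Polynomial (MvPolynomial ℕ ℂ)) :
    FinTendsto (fun N : ℕ => (((N : ℂ)⁻¹) ^ (s + 1) • vandermondeMap (M N) s) W)
      (((((s : ℂ) + 1)⁻¹ * b ^ (s + 1)) • coeffMap s) W) := by
  have h1 := (FinTendsto.smul_zero' tendsto_inv_natCast (finTendsto_vandermondeMap_sub hM s W)).add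
    (FinTendsto.smul_const (coeffMap s W)
      ((tendsto_vandermondeConst hM s s).const_mul ((s : ℂ) + 1)⁻¹))
  convert h1 using 1
  · funext N
    simp only [LinearMap.smul_apply, LinearMap.sub_apply, smul_sub, smul_smul]
    module
  · simp

theorem vandermondeMap_C_mul (M : ℂ) (s : ℕ) (P : MvPolynomial ℕ ℂ)
    (W : Polynomial (MvPolynomial ℕ ℂ)) :
    vandermondeMap M s (Polynomial.C P * W) = P * vandermondeMap M s W := by
  induction W using Polynomial.induction_on' with
  | add p q hp hq => simp only [mul_add, map_add, hp, hq]
  | monomial n Q =>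
    rw [← Polynomial.C_mul_X_pow_eq_monomial, ← mul_assoc, ← map_mul, vandermondeMap_C_mul_X_pow,
      vandermondeMap_C_mul_X_pow, mul_assoc]

/-- Polynomials with scalar coefficients. -/
def scalarPoly : Polynomial ℂ →ₐ[ℂ] Polynomial (MvPolynomial ℕ ℂ) :=
  Polynomial.mapAlgHom (Algebra.ofId ℂ (MvPolynomial ℕ ℂ))

theorem scalarPoly_C_mul_X_pow (c : ℂ) (n : ℕ) : scalarPoly (Polynomial.C c * Polynomial.X ^ n) =
    Polynomial.C (MvPolynomial.C c) * Polynomial.X ^ n := by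
  simp [scalarPoly]

theorem scalarPoly_X : scalarPoly Polynomial.X = Polynomial.X := by
  simp [scalarPoly]

theorem coeff_scalarPoly (p : Polynomial ℂ) (n : ℕ) :
    (scalarPoly p).coeff n = MvPolynomial.C (p.coeff n) := by
  simp [scalarPoly]

theorem totalDeriv_scalarPoly_mul_C (p : Polynomial ℂ) (P : MvPolynomial ℕ ℂ) :
    totalDeriv (scalarPoly p * Polynomial.C P) =
      scalarPoly (Polynomial.derivative p) * Polynomial.C P + scalarPoly p * symbolDeriv P := by
  induction p using Polynomial.induction_on' with
  | add p q hp hq => simp only [map_add, add_mul, hp, hq]; ring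
  | monomial n c =>
    rw [← Polynomial.C_mul_X_pow_eq_monomial, Polynomial.derivative_C_mul_X_pow,
      scalarPoly_C_mul_X_pow, scalarPoly_C_mul_X_pow]
    have h1 : Polynomial.C (MvPolynomial.C c) * Polynomial.X ^ n * Polynomial.C P =
        Polynomial.C (MvPolynomial.C c * P) * Polynomial.X ^ n := by
      rw [map_mul]; ring
    rw [h1, totalDeriv_C_mul_X_pow, Derivation.leibniz, Polynomial.derivative_X_pow,
      ← MvPolynomial.algebraMap_eq, Derivation.map_algebraMap]
    simp only [map_mul, smul_zero, add_zero, Polynomial.smul_eq_C_mul,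
      MvPolynomial.algebraMap_eq, map_natCast]
    ring

/-- The scalar part of the iterates of `twistedDeriv`. -/
def scalarIterate (a : Polynomial ℂ) (N : ℂ) : ℕ → Polynomial ℂ
  | 0 => 1
  | s + 1 => Polynomial.derivative (scalarIterate a N s) + N • (a * scalarIterate a N s)

variable {A : ℕ → Polynomial ℂ} {α : Polynomial ℂ}

theorem finTendsto_scalarIterate (hA : FinTendsto A α) (s : ℕ) :
    FinTendsto (fun N : ℕ => ((N : ℂ)⁻¹) ^ s • scalarIterate (A N) N s) (α ^ s) := by
  induction s with
  | zero => simpa [scalarIterate] using FinTendsto.const (1 : Polynomial ℂ)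
  | succ s ih =>
    have h1 := (FinTendsto.smul_zero' tendsto_inv_natCast
      (ih.map (Polynomial.derivative (R := ℂ)))).add (hA.mul ih)
    rw [zero_add, ← pow_succ'] at h1
    refine h1.congr ?_
    filter_upwards [natCast_mul_inv_eventuallyEq] with N hN
    simp only [scalarIterate, map_smul, smul_add, smul_smul, mul_smul_comm]
    rw [pow_succ, mul_assoc, mul_comm (N : ℂ)⁻¹ (N : ℂ), hN, mul_one, mul_comm]

variable {B : ℕ → Polynomial (MvPolynomial ℕ ℂ)} {β : Polynomial (MvPolynomial ℕ ℂ)}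

/-- With h = N A + B, the leading term of the s-fold twisted derivative uses N A every time and is
scalar. At the next order exactly one of the s factors is replaced by a derivative of `P` or by B,
and the derivatives of A itself stay in the scalar part. -/
theorem finTendsto_iterate_twistedDeriv (hA : FinTendsto A α) (hB : FinTendsto B β)
    (P : MvPolynomial ℕ ℂ) (s : ℕ) :
    FinTendsto (fun N : ℕ => ((N : ℂ) * ((N : ℂ)⁻¹) ^ s) •
      ((twistedDeriv ((N : ℂ) • scalarPoly (A N) + B N))^[s] (Polynomial.C P) -
        scalarPoly (scalarIterate (A N) N s) * Polynomial.C P))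
      ((s : ℂ) • (scalarPoly α ^ (s - 1) * (symbolDeriv P + β * Polynomial.C P))) := by
  induction s with
  | zero => simpa [scalarIterate] using FinTendsto.zero
  | succ s ih =>
    have hS := (finTendsto_scalarIterate hA s).map scalarPoly.toLinearMap
    have hA' := hA.map scalarPoly.toLinearMap
    have h1 := ((hS.mul (FinTendsto.const (symbolDeriv P))).add
      (hB.mul (hS.mul (FinTendsto.const (Polynomial.C P))))).add
      (((FinTendsto.smul_zero' tendsto_inv_natCast (ih.map totalDeriv)).add
        (hA'.mul ih)).add (FinTendsto.smul_zero' tendsto_inv_natCast (hB.mul ih)))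
    have h2 : scalarPoly.toLinearMap (α ^ s) * symbolDeriv P +
        β * (scalarPoly.toLinearMap (α ^ s) * Polynomial.C P) + (0 + scalarPoly.toLinearMap α *
          ((s : ℂ) • (scalarPoly α ^ (s - 1) * (symbolDeriv P + β * Polynomial.C P))) + 0) =
        (((s + 1 : ℕ) : ℂ)) • (scalarPoly α ^ (s + 1 - 1) *
          (symbolDeriv P + β * Polynomial.C P)) := by
      simp only [AlgHom.toLinearMap_apply, map_pow, Nat.add_sub_cancel, zero_add, add_zero]
      cases s with
      | zero => simp
      | succ s =>
        push_cast
        simp only [add_smul, one_smul, mul_smul_comm, pow_succ, mul_add]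
        ring_nf
    rw [h2] at h1
    refine h1.congr ?_
    filter_upwards [natCast_mul_inv_eventuallyEq] with N hN
    simp only [Function.iterate_succ_apply']
    set U := (twistedDeriv ((N : ℂ) • scalarPoly (A N) + B N))^[s] (Polynomial.C P)
    set S := scalarIterate (A N) N s
    have h3 : twistedDeriv ((N : ℂ) • scalarPoly (A N) + B N) U -
        scalarPoly (scalarIterate (A N) N (s + 1)) * Polynomial.C P =
        scalarPoly S * symbolDeriv P + B N * (scalarPoly S * Polynomial.C P) +
          totalDeriv (U - scalarPoly S * Polynomial.C P) +
          ((N : ℂ) • scalarPoly (A N) + B N) * (U - scalarPoly S * Polynomial.C P) := by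
      rw [map_sub, totalDeriv_scalarPoly_mul_C, twistedDeriv_apply, scalarIterate, map_add,
        map_smul, map_mul]
      simp only [Algebra.smul_def]
      ring
    have hN' : (N : ℂ) * ((N : ℂ)⁻¹) ^ (s + 1) = ((N : ℂ)⁻¹) ^ s := by
      rw [pow_succ', ← mul_assoc, hN, one_mul]
    have hN2 : (N : ℂ)⁻¹ * ((N : ℂ) * ((N : ℂ)⁻¹) ^ s) = ((N : ℂ)⁻¹) ^ s := by
      rw [← mul_assoc, mul_comm (N : ℂ)⁻¹, hN, one_mul]
    rw [h3, hN']
    simp only [AlgHom.toLinearMap_apply, map_smul, smul_add, smul_mul_assoc, mul_smul_comm,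
      smul_smul, hN2, add_mul, smul_add]
    rw [mul_comm (N : ℂ) (((N : ℂ)⁻¹) ^ s)]
    ring_nf

/-- The scalar `E p_k^{[k]}` up to lower order terms. -/
def scalarMean (M : ℂ) (a : Polynomial ℂ) (N : ℂ) (k : ℕ) : ℂ :=
  ∑ s ∈ Finset.range (k + 1), (k.choose s : ℂ) * ((((s : ℂ) + 1)⁻¹ * vandermondeConst M s s) *
    ((1 + Polynomial.X) ^ k * scalarIterate a N (k - s)).coeff s)

/-- The polynomial `((1 + X) (b + X α)) ^ k`. -/
def limitSymbol (b : ℂ) (α : Polynomial ℂ) (k : ℕ) : Polynomial ℂ :=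
  ((1 + Polynomial.X) * (Polynomial.C b + Polynomial.X * α)) ^ k

/-- The linear form in the power sums that appears in the limit of the operators. -/
def limitForm (b : ℂ) (α : Polynomial ℂ) (β : Polynomial (MvPolynomial ℕ ℂ)) (k : ℕ) :
    MvPolynomial ℕ ℂ :=
  tailMap k (scalarPoly (limitSymbol b α k)) +
    coeffMap (k - 1) (scalarPoly (limitSymbol b α k) * β)

/-- The derivation that appears in the limit of the operators. -/
def limitDeriv (b : ℂ) (α : Polynomial ℂ) (k : ℕ) :
    Derivation ℂ (MvPolynomial ℕ ℂ) (MvPolynomial ℕ ℂ) :=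
  MvPolynomial.mkDerivation ℂ fun r =>
    coeffMap (k - 1) (scalarPoly (limitSymbol b α k) * symbolDeriv (MvPolynomial.X r))

theorem limitDeriv_apply (b : ℂ) (α : Polynomial ℂ) (k : ℕ) (P : MvPolynomial ℕ ℂ) :
    limitDeriv b α k P = coeffMap (k - 1) (scalarPoly (limitSymbol b α k) * symbolDeriv P) := by
  induction P using MvPolynomial.induction_on with
  | C a =>
    rw [← MvPolynomial.algebraMap_eq, Derivation.map_algebraMap, Derivation.map_algebraMap,
      mul_zero, map_zero]
  | add p q hp hq => simp only [map_add, mul_add, hp, hq]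
  | mul_X p r hp =>
    rw [Derivation.leibniz, Derivation.leibniz, hp, mul_add, map_add]
    simp only [smul_eq_mul, Polynomial.smul_eq_C_mul, coeffMap_apply, mul_left_comm _
      (Polynomial.C _), Polynomial.coeff_C_mul]
    rw [limitDeriv, MvPolynomial.mkDerivation_X]
    rfl

theorem tailMap_X_pow_mul (s j : ℕ) (W : Polynomial (MvPolynomial ℕ ℂ)) :
    tailMap (s + j) (Polynomial.X ^ j * W) = tailMap s W := by
  induction W using Polynomial.induction_on' with
  | add p q hp hq => simp only [mul_add, map_add, hp, hq]
  | monomial n P =>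
    rw [← Polynomial.C_mul_X_pow_eq_monomial, mul_left_comm, ← pow_add, tailMap_C_mul_X_pow,
      tailMap_C_mul_X_pow, shiftedPower, shiftedPower]
    congr 1
    by_cases h : s < n
    · rw [if_pos h, if_pos (by omega)]
      congr 1
      omega
    · rw [if_neg h, if_neg (by omega)]

theorem scalarPoly_limitSymbol (k : ℕ) : scalarPoly (limitSymbol b α k) =
    ∑ s ∈ Finset.range (k + 1), ((k.choose s : ℂ) * b ^ s) • (Polynomial.X ^ (k - s) *
      ((1 + Polynomial.X) ^ k * scalarPoly α ^ (k - s))) := by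
  rw [limitSymbol, mul_pow, add_pow (Polynomial.C b), Finset.mul_sum, map_sum]
  refine Finset.sum_congr rfl fun s _ => ?_
  simp only [map_mul, map_pow, map_add, map_one, scalarPoly_X, map_natCast, Algebra.smul_def,
    mul_pow]
  have h1 : scalarPoly (Polynomial.C b) = algebraMap ℂ _ b := scalarPoly.commutes b
  rw [h1]
  ring

theorem tailMap_limitSymbol (k : ℕ) : tailMap k (scalarPoly (limitSymbol b α k)) =
    ∑ s ∈ Finset.range (k + 1), ((k.choose s : ℂ) * b ^ s) •
      tailMap s ((1 + Polynomial.X) ^ k * scalarPoly α ^ (k - s)) := by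
  have key : ∀ s ∈ Finset.range (k + 1), ∀ W : Polynomial (MvPolynomial ℕ ℂ),
      tailMap k (Polynomial.X ^ (k - s) * W) = tailMap s W := by
    intro s hs W
    rw [Finset.mem_range] at hs
    have h := tailMap_X_pow_mul s (k - s) W
    rwa [Nat.add_sub_cancel' (by omega)] at h
  rw [scalarPoly_limitSymbol, map_sum]
  refine Finset.sum_congr rfl fun s hs => ?_
  rw [map_smul, key s hs]

/-- The binomial expansion of the symbol with its index moved by one: C(k+1, s) (k+1-s) / (s+1) =
C(k+1, s+1). The weights 1 / (s + 1) from the Vandermonde part are thus absorbed. -/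
theorem coeffMap_limitSymbol_mul (k : ℕ) (W : Polynomial (MvPolynomial ℕ ℂ)) :
    coeffMap k (scalarPoly (limitSymbol b α (k + 1)) * W) =
      ∑ s ∈ Finset.range (k + 2), (((k + 1).choose s : ℂ) *
        (((s : ℂ) + 1)⁻¹ * b ^ (s + 1)) * ((k + 1 - s : ℕ) : ℂ)) •
        coeffMap s ((1 + Polynomial.X) ^ (k + 1) * (scalarPoly α ^ (k + 1 - s - 1) * W)) := by
  conv_rhs => rw [Finset.sum_range_succ]
  rw [scalarPoly_limitSymbol, Finset.sum_mul, map_sum, Finset.sum_range_succ']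
  simp only [Nat.sub_self, Nat.cast_zero, mul_zero, zero_smul, add_zero, smul_mul_assoc, map_smul]
  have h0 : coeffMap k (Polynomial.X ^ (k + 1 - 0) * ((1 + Polynomial.X) ^ (k + 1) *
      scalarPoly α ^ (k + 1 - 0)) * W) = 0 := by
    rw [mul_assoc, coeffMap_apply, Polynomial.coeff_X_pow_mul', if_neg (by omega)]
  rw [h0, smul_zero, add_zero]
  refine Finset.sum_congr rfl fun s hs => ?_
  rw [Finset.mem_range] at hs
  have h1 : k + 1 - (s + 1) = k - s := by omega
  have h2 : k + 1 - s - 1 = k - s := by omega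
  rw [h1, h2]
  have h3 : coeffMap k (Polynomial.X ^ (k - s) * ((1 + Polynomial.X) ^ (k + 1) *
      scalarPoly α ^ (k - s)) * W) =
      coeffMap s ((1 + Polynomial.X) ^ (k + 1) * (scalarPoly α ^ (k - s) * W)) := by
    rw [mul_assoc, coeffMap_apply, Polynomial.coeff_X_pow_mul', if_pos (by omega), mul_assoc,
      coeffMap_apply]
    congr 1
    omega
  rw [h3]
  congr 1
  have h4 : ((k + 1).choose (s + 1) : ℂ) * ((s : ℂ) + 1) =
      ((k + 1).choose s : ℂ) * ((k + 1 - s : ℕ) : ℂ) := by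
    exact_mod_cast Nat.choose_succ_right_eq (k + 1) s
  have hs : ((s : ℂ) + 1) ≠ 0 := Nat.cast_add_one_ne_zero s
  field_simp
  linear_combination b ^ (s + 1) * h4

/-- Let K = k + 1 be the degree. In the summand with s derivatives on V, the Vandermonde factor has
orders N^(s+1) and N^s, and the twisted derivative N^(K-s) and N^(K-s-1). The product of the two
leading parts, of order N^(K+1), is the scalar that is subtracted. At order N^K there are two
contributions, leading times subleading in either way: one multiplies `P` by power sums, the other
involves the first derivative of `P` and β. Nothing else survives. -/
theorem finTendsto_symbolOp (hM : Tendsto (fun N : ℕ => (N : ℂ)⁻¹ * M N) atTop (𝓝 b))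
    (hA : FinTendsto A α) (hB : FinTendsto B β) (k : ℕ) (P : MvPolynomial ℕ ℂ) :
    FinTendsto (fun N : ℕ => ((N : ℂ)⁻¹) ^ (k + 1) •
      (symbolOp (M N) ((N : ℂ) • scalarPoly (A N) + B N) (k + 1) P -
        scalarMean (M N) (A N) N (k + 1) • P))
      (limitForm b α β (k + 1) * P + limitDeriv b α (k + 1) P) := by
  have hterm : ∀ s ∈ Finset.range (k + 1 + 1), FinTendsto (fun N : ℕ => ((k + 1).choose s : ℂ) •
      ((((N : ℂ)⁻¹) ^ (s + 1) • vandermondeMap (M N) s) ((1 + Polynomial.X) ^ (k + 1) *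
        (((N : ℂ) * ((N : ℂ)⁻¹) ^ (k + 1 - s)) •
      ((twistedDeriv ((N : ℂ) • scalarPoly (A N) + B N))^[k + 1 - s] (Polynomial.C P) -
        scalarPoly (scalarIterate (A N) N (k + 1 - s)) * Polynomial.C P))) +
      P * (((N : ℂ)⁻¹) ^ s • (vandermondeMap (M N) s -
      (((s : ℂ) + 1)⁻¹ * vandermondeConst (M N) s s) • coeffMap s)) ((1 + Polynomial.X) ^ (k + 1) *
        scalarPoly (((N : ℂ)⁻¹) ^ (k + 1 - s) • scalarIterate (A N) N (k + 1 - s)))))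
      (((k + 1).choose s : ℂ) • (((((s : ℂ) + 1)⁻¹ * b ^ (s + 1)) • coeffMap s)
        ((1 + Polynomial.X) ^ (k + 1) * (((k + 1 - s : ℕ) : ℂ) • (scalarPoly α ^ (k + 1 - s - 1) *
          (symbolDeriv P + β * Polynomial.C P)))) +
        P * (b ^ s • tailMap s) ((1 + Polynomial.X) ^ (k + 1) *
          scalarPoly (α ^ (k + 1 - s))))) := by
    intro s hs
    refine FinTendsto.const_smul _ (FinTendsto.add ?_ ((FinTendsto.const P).mul ?_))
    · exact FinTendsto.map_op (finTendsto_vandermondeMap hM s)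
        ((FinTendsto.const _).mul (finTendsto_iterate_twistedDeriv hA hB P (k + 1 - s)))
    · exact FinTendsto.map_op (finTendsto_vandermondeMap_sub hM s)
        ((FinTendsto.const _).mul ((finTendsto_scalarIterate hA (k + 1 - s)).map
          scalarPoly.toLinearMap))
  have hsum := FinTendsto.sum _ hterm
  have hlim : ∑ s ∈ Finset.range (k + 1 + 1), ((k + 1).choose s : ℂ) •
      (((((s : ℂ) + 1)⁻¹ * b ^ (s + 1)) • coeffMap s)
        ((1 + Polynomial.X) ^ (k + 1) * (((k + 1 - s : ℕ) : ℂ) • (scalarPoly α ^ (k + 1 - s - 1) *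
          (symbolDeriv P + β * Polynomial.C P)))) +
        P * (b ^ s • tailMap s) ((1 + Polynomial.X) ^ (k + 1) *
          scalarPoly (α ^ (k + 1 - s)))) =
      limitForm b α β (k + 1) * P + limitDeriv b α (k + 1) P := by
    have h1 : limitForm b α β (k + 1) * P + limitDeriv b α (k + 1) P =
        coeffMap k (scalarPoly (limitSymbol b α (k + 1)) *
          (symbolDeriv P + β * Polynomial.C P)) +
        P * tailMap (k + 1) (scalarPoly (limitSymbol b α (k + 1))) := by
      rw [limitForm, limitDeriv_apply, mul_add, map_add, Nat.add_sub_cancel, ← mul_assoc _ β]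
      simp only [coeffMap_apply, Polynomial.coeff_mul_C]
      ring
    rw [h1, coeffMap_limitSymbol_mul, tailMap_limitSymbol, Finset.mul_sum, ← Finset.sum_add_distrib]
    refine Finset.sum_congr rfl fun s _ => ?_
    simp only [smul_add, LinearMap.smul_apply, mul_smul_comm, map_smul, smul_smul, map_pow]
    congr 2
    ring
  rw [hlim] at hsum
  refine hsum.congr ?_
  filter_upwards [natCast_mul_inv_eventuallyEq] with N hN
  rw [symbolOp_apply, scalarMean, Finset.sum_smul, ← Finset.sum_sub_distrib, Finset.smul_sum]
  refine Finset.sum_congr rfl fun s hs => ?_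
  rw [Finset.mem_range] at hs
  set U := (twistedDeriv ((N : ℂ) • scalarPoly (A N) + B N))^[k + 1 - s] (Polynomial.C P)
  set S := scalarIterate (A N) N (k + 1 - s)
  have hp : ((N : ℂ)⁻¹) ^ (k + 1) = ((N : ℂ)⁻¹) ^ s * ((N : ℂ)⁻¹) ^ (k + 1 - s) := by
    rw [← pow_add]
    congr 1
    omega
  have h1 : ((1 + Polynomial.X) ^ (k + 1) * scalarPoly S : Polynomial (MvPolynomial ℕ ℂ)) =
      scalarPoly ((1 + Polynomial.X) ^ (k + 1) * S) := by
    simp [scalarPoly_X]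
  -- `P` is constant with respect to the distinguished variable, so the scalar part of the twisted
  -- derivative carries it along as a plain factor.
  have h2 : vandermondeMap (M N) s ((1 + Polynomial.X) ^ (k + 1) * U) =
      vandermondeMap (M N) s ((1 + Polynomial.X) ^ (k + 1) * (U - scalarPoly S * Polynomial.C P)) +
        P * vandermondeMap (M N) s ((1 + Polynomial.X) ^ (k + 1) * scalarPoly S) := by
    rw [← vandermondeMap_C_mul, ← map_add]
    congr 1
    ring
  have h3 : (N : ℂ) * ((N : ℂ)⁻¹) ^ (k + 1 - s) * (N : ℂ)⁻¹ ^ (s + 1) = ((N : ℂ)⁻¹) ^ (k + 1) := by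
    rw [hp, pow_succ]
    linear_combination ((N : ℂ)⁻¹) ^ s * ((N : ℂ)⁻¹) ^ (k + 1 - s) * hN
  rw [h2]
  simp only [LinearMap.smul_apply, LinearMap.sub_apply, map_smul, mul_smul_comm, smul_smul, h3, h1,
    coeffMap_apply, coeff_scalarPoly]
  rw [mul_comm _ (((N : ℂ)⁻¹) ^ s), ← hp]
  have h4 : (((k + 1).choose s : ℂ) * (((s : ℂ) + 1)⁻¹ * vandermondeConst (M N) s s *
      ((1 + Polynomial.X) ^ (k + 1) * S).coeff s)) • P = ((k + 1).choose s : ℂ) •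
      (P * ((((s : ℂ) + 1)⁻¹ * vandermondeConst (M N) s s) •
        MvPolynomial.C (((1 + Polynomial.X) ^ (k + 1) * S).coeff s))) := by
    simp only [MvPolynomial.smul_eq_C_mul, map_mul]
    ring
  rw [h4]
  simp only [smul_add, smul_sub, mul_sub, mul_smul_comm, smul_smul]
  module

end Asymptotics

/-! ### Symmetric power series in terms of power sums -/

section Augmented

variable {m : ℕ}

/-- The augmented monomial symmetric function with exponents `k_0 + 1, k_1 + 1, …`, as a polynomial
in the power sums. -/
def augmentedMonomial : (s : ℕ) → (Fin s → ℕ) → MvPolynomial ℕ ℂ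
  | 0, _ => 1
  | s + 1, k => MvPolynomial.X (k 0) * augmentedMonomial s (Fin.tail k) -
      ∑ j, augmentedMonomial s (Function.update (Fin.tail k) j (Fin.tail k j + k 0 + 1))

theorem powerEval_X {A : Type*} [CommRing A] [Algebra ℂ A] (y : Fin m → A) (r : ℕ) :
    powerEval y (MvPolynomial.X r) = ∑ i, y i ^ (r + 1) := by
  simp [powerEval]

/-- Multiplying by a power sum chooses one more index. Either it is new, or it coincides with one of
the indices already chosen and the exponents add; as exponents are stored minus one, merging adds an
extra 1. -/
theorem powerEval_augmentedMonomial {A : Type*} [CommRing A] [Algebra ℂ A] (y : Fin m → A) (s : ℕ)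
    (k : Fin s → ℕ) : powerEval y (augmentedMonomial s k) =
      ∑ e : Fin s ↪ Fin m, ∏ j, y (e j) ^ (k j + 1) := by
  induction s with
  | zero => simp [augmentedMonomial]
  | succ s ih =>
    rw [augmentedMonomial, map_sub, map_mul, map_sum, ih, powerEval_X]
    simp only [ih]
    rw [← Equiv.sum_comp (Equiv.embeddingFinSucc s (Fin m)).symm, Fintype.sum_sigma,
      Finset.sum_comm (s := Finset.univ (α := Fin s)), Finset.mul_sum, ← Finset.sum_sub_distrib]
    refine Finset.sum_congr rfl fun e _ => ?_
    have h1 : ∀ i : {i // i ∉ Set.range e},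
        ∏ j, y ((Equiv.embeddingFinSucc s (Fin m)).symm ⟨e, i⟩ j) ^ (k j + 1) =
          y i ^ (k 0 + 1) * ∏ j, y (e j) ^ (Fin.tail k j + 1) := by
      intro i
      rw [Fin.prod_univ_succ]
      simp [Fin.tail]
    simp only [h1]
    have h2 : ∀ j, ∏ l, y (e l) ^ (Function.update (Fin.tail k) j (Fin.tail k j + k 0 + 1) l + 1) =
        y (e j) ^ (k 0 + 1) * ∏ l, y (e l) ^ (Fin.tail k l + 1) := by
      intro j
      rw [← Finset.mul_prod_erase _ _ (Finset.mem_univ j), ← Finset.mul_prod_erase Finset.univ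
        (fun l => y (e l) ^ (Fin.tail k l + 1)) (Finset.mem_univ j), Function.update_self,
        ← mul_assoc, ← pow_add]
      congr 1
      · congr 1; ring
      · refine Finset.prod_congr rfl fun l hl => ?_
        rw [Function.update_of_ne (Finset.ne_of_mem_erase hl)]
    simp only [h2]
    rw [← Finset.sum_mul, ← Finset.sum_mul, ← sub_mul]
    congr 1
    have h3 := Finset.sum_add_sum_compl (Finset.univ.map e) (fun i => y i ^ (k 0 + 1))
    rw [Finset.sum_map] at h3
    rw [← h3, add_sub_cancel_left]
    exact Finset.sum_subtype (Finset.univ.map e)ᶜ (p := fun i => i ∉ Set.range e)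
      (fun i => by simp) (fun i => y i ^ (k 0 + 1))

/-- The polynomial in the power sums that represents, up to terms of degree more than `D`, the
symmetric power series whose coefficient at a monomial with exponents `k_0 + 1, …, k_{s-1} + 1` is
`f s k`. -/
def symmetricPoly (D : ℕ) (f : (s : ℕ) → (Fin s → ℕ) → ℂ) : MvPolynomial ℕ ℂ :=
  ∑ s ∈ Finset.range (D + 1), ((s.factorial : ℂ)⁻¹) •
    ∑ k : Fin s → Fin D, f s (fun j => k j) • augmentedMonomial s fun j => k j

theorem card_embedding_map_eq (s : ℕ) (T : Finset (Fin m)) :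
    (Finset.univ.filter fun e : Fin s ↪ Fin m => Finset.univ.map e = T).card =
      if T.card = s then s.factorial else 0 := by
  split_ifs with h
  · have h1 : (Finset.univ.filter fun e : Fin s ↪ Fin m => Finset.univ.map e = T) =
        Finset.univ.image fun g : Fin s ↪ T => g.trans (Function.Embedding.subtype _) := by
      ext e
      simp only [Finset.mem_filter, Finset.mem_univ, true_and, Finset.mem_image]
      constructor
      · intro he
        refine ⟨⟨fun j => ⟨e j, ?_⟩, fun i j hij => ?_⟩, ?_⟩
        · rw [← he]; simp
        · exact e.injective (by simpa using hij)
        · ext j; rfl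
      · rintro ⟨g, rfl⟩
        apply Finset.eq_of_subset_of_card_le
        · intro x hx
          simp only [Finset.mem_map, Finset.mem_univ, true_and] at hx
          obtain ⟨j, rfl⟩ := hx
          exact (g j).2
        · simp [h]
    rw [h1, Finset.card_image_of_injective, Finset.card_univ, Fintype.card_embedding_eq]
    · simp [h, Nat.descFactorial_self]
    · intro g g' hg
      ext j
      have := DFunLike.congr_fun hg j
      exact congrArg Fin.val this
  · rw [Finset.card_eq_zero, Finset.filter_eq_empty_iff]
    rintro e - rfl
    simp at h

theorem coeff_prod_X_pow (s : ℕ) (e : Fin s → Fin m) (k : Fin s → ℕ) (α : Fin m →₀ ℕ) :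
    MvPowerSeries.coeff α (∏ j, (MvPowerSeries.X (e j) : MvPowerSeries (Fin m) ℂ) ^ k j) =
      if α = ∑ j, Finsupp.single (e j) (k j) then 1 else 0 := by
  have h : ∏ j, (MvPowerSeries.X (e j) : MvPowerSeries (Fin m) ℂ) ^ k j =
      MvPowerSeries.monomial (∑ j, Finsupp.single (e j) (k j)) 1 := by
    simp only [MvPowerSeries.X_pow_eq]
    have : ∀ t : Finset (Fin s), ∏ j ∈ t, (MvPowerSeries.monomial (Finsupp.single (e j) (k j)) 1 :
        MvPowerSeries (Fin m) ℂ) = MvPowerSeries.monomial (∑ j ∈ t, Finsupp.single (e j) (k j)) 1 := by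
      intro t
      induction t using Finset.induction_on with
      | empty => simp
      | insert j t hj ih =>
        rw [Finset.prod_insert hj, Finset.sum_insert hj, ih, MvPowerSeries.monomial_mul_monomial,
          mul_one]
    exact this _
  rw [h, MvPowerSeries.coeff_monomial]

theorem sum_single_apply (s : ℕ) (e : Fin s ↪ Fin m) (k : Fin s → ℕ) (j : Fin s) :
    (∑ i, Finsupp.single (e i) (k i)) (e j) = k j := by
  rw [Finsupp.finsetSum_apply, Finset.sum_eq_single j]
  · simp
  · intro i _ hi
    rw [Finsupp.single_apply, if_neg (fun h => hi (e.injective h))]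
  · simp

theorem sum_single_apply_of_notMem (s : ℕ) (e : Fin s ↪ Fin m) (k : Fin s → ℕ) {i : Fin m}
    (hi : i ∉ Set.range e) : (∑ j, Finsupp.single (e j) (k j)) i = 0 := by
  rw [Finsupp.finsetSum_apply]
  refine Finset.sum_eq_zero fun j _ => ?_
  rw [Finsupp.single_apply, if_neg fun h => hi ⟨j, h⟩]

/-- A monomial supported on s variables arises from exactly s! injections of s letters, which the
factor 1 / s! compensates. For degree at most `D`, neither the support size nor the exponents leave
the summation range. -/
theorem sub_seriesEval_symmetricPoly_mem (D : ℕ) (f : (s : ℕ) → (Fin s → ℕ) → ℂ)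
    (h : MvPowerSeries (Fin m) ℂ)
    (hf : ∀ (s : ℕ) (k : Fin s → ℕ) (e : Fin s ↪ Fin m),
      MvPowerSeries.coeff (∑ j, Finsupp.single (e j) (k j + 1)) h = f s k) :
    h - seriesEval m (symmetricPoly D f) ∈ highOrder m (D + 1) := by
  rw [mem_highOrder_iff]
  intro α hα
  have hle : ∀ i, α i ≤ D := fun i => (Finsupp.le_degree i α).trans (by omega)
  have hinner : ∀ (s : ℕ) (e : Fin s ↪ Fin m), ∑ k : Fin s → Fin D, f s (fun j => k j) *
      (if α = ∑ j, Finsupp.single (e j) ((k j : ℕ) + 1) then 1 else 0) =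
      if Finset.univ.map e = α.support then MvPowerSeries.coeff α h else 0 := by
    intro s e
    split_ifs with hs
    · have hpos : ∀ j, 1 ≤ α (e j) := by
        intro j
        have : e j ∈ α.support := by rw [← hs]; simp
        exact Nat.one_le_iff_ne_zero.2 (Finsupp.mem_support_iff.1 this)
      have hα' : α = ∑ j, Finsupp.single (e j) ((α (e j) - 1) + 1) := by
        ext i
        by_cases hi : i ∈ Set.range e
        · obtain ⟨j, rfl⟩ := hi
          rw [sum_single_apply s e (fun j => (α (e j) - 1) + 1)]
          have := hpos j
          omega
        · rw [sum_single_apply_of_notMem s e _ hi]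
          have : i ∉ α.support := by rw [← hs]; simpa using hi
          exact Finsupp.notMem_support_iff.1 this
      rw [Finset.sum_eq_single (fun j => (⟨α (e j) - 1, by
        have := hpos j; have := hle (e j); omega⟩ : Fin D))]
      · rw [if_pos hα', mul_one, ← hf s _ e]
        rw [← hα']
      · intro k _ hk
        rw [if_neg, mul_zero]
        intro h1
        apply hk
        funext j
        apply Fin.ext
        have h2 := sum_single_apply s e (fun j => (k j : ℕ) + 1) j
        rw [← h1] at h2
        simp [h2]
      · simp
    · refine Finset.sum_eq_zero fun k _ => ?_
      rw [if_neg, mul_zero]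
      intro h1
      apply hs
      ext i
      rw [Finsupp.mem_support_iff]
      by_cases hi : i ∈ Set.range e
      · obtain ⟨j, rfl⟩ := hi
        rw [h1, sum_single_apply s e (fun j => (k j : ℕ) + 1)]
        simp
      · rw [h1, sum_single_apply_of_notMem s e _ hi]
        simpa using hi
  rw [map_sub, symmetricPoly, map_sum, map_sum, sub_eq_zero]
  have hterm : ∀ s ∈ Finset.range (D + 1), MvPowerSeries.coeff α (seriesEval m
      (((s.factorial : ℂ)⁻¹) • ∑ k : Fin s → Fin D, f s (fun j => k j) •
        augmentedMonomial s fun j => k j)) =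
      if α.support.card = s then MvPowerSeries.coeff α h else 0 := by
    intro s _
    rw [map_smul, map_smul, map_sum, map_sum, smul_eq_mul]
    simp only [map_smul, smul_eq_mul, seriesEval, powerEval_augmentedMonomial, map_sum,
      coeff_prod_X_pow s _ _ α, Finset.mul_sum]
    rw [Finset.sum_comm]
    simp only [← Finset.mul_sum, hinner]
    rw [← Finset.sum_filter, Finset.sum_const, card_embedding_map_eq]
    split_ifs with h1
    · have : (s.factorial : ℂ) ≠ 0 := Nat.cast_ne_zero.2 (Nat.factorial_ne_zero s)
      rw [nsmul_eq_mul, inv_mul_cancel_left₀ this]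
    · simp
  rw [Finset.sum_congr rfl hterm, Finset.sum_ite_eq, if_pos]
  rw [Finset.mem_range]
  have h1 : α.support.card ≤ α.degree := by
    rw [Finsupp.degree, Finset.card_eq_sum_ones]
    refine Finset.sum_le_sum fun i hi => ?_
    exact Nat.one_le_iff_ne_zero.2 (Finsupp.mem_support_iff.1 hi)
  omega

/-- The Taylor coefficient of a symmetric function at a monomial with exponents
`k_0 + 1, …, k_{s-1} + 1`. -/
def symmetricCoeff (f : (Fin m → ℂ) → ℂ) (s : ℕ) (k : Fin s → ℕ) : ℂ :=
  (∏ j, ((k j + 1).factorial : ℂ))⁻¹ *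
    mixedPartial ((List.finRange s).flatMap fun j => List.replicate (k j + 1) (j : ℕ)) f 1

theorem exists_perm_castLE_eq {s : ℕ} (hs : s ≤ m) (e : Fin s ↪ Fin m) :
    ∃ σ : Equiv.Perm (Fin m), ∀ j, σ (Fin.castLE hs j) = e j := by
  classical
  set e₁ : Fin s ↪ Fin m := Fin.castLEEmb hs
  set g : {x // x ∈ Set.range e₁} ≃ {x // x ∈ Set.range e} :=
    e₁.toEquivRange.symm.trans e.toEquivRange with hg
  refine ⟨g.extendSubtype, fun j => ?_⟩
  have hj : Fin.castLE hs j ∈ Set.range e₁ := ⟨j, rfl⟩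
  rw [Equiv.extendSubtype_apply_of_mem g _ hj, hg]
  have : (⟨Fin.castLE hs j, hj⟩ : {x // x ∈ Set.range e₁}) = e₁.toEquivRange j := rfl
  rw [this]
  simp

theorem coeff_taylor_eq_symmetricCoeff {f : (Fin m → ℂ) → ℂ}
    (hf : ∀ (σ : Equiv.Perm (Fin m)) (x : Fin m → ℂ), f (x ∘ σ) = f x) (ha : AnalyticAt ℂ f 1)
    (s : ℕ) (k : Fin s → ℕ) (e : Fin s ↪ Fin m) :
    MvPowerSeries.coeff (∑ j, Finsupp.single (e j) (k j + 1)) (taylor f) = symmetricCoeff f s k := by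
  have hs : s ≤ m := by simpa using Fintype.card_le_of_embedding e
  obtain ⟨σ, hσ⟩ := exists_perm_castLE_eq hs e
  have h1 : ∑ j, Finsupp.single (e j) (k j + 1) =
      (∑ j, Finsupp.single (Fin.castLEEmb hs j) (k j + 1)).mapDomain σ := by
    rw [Finsupp.mapDomain_finsetSum]
    refine Finset.sum_congr rfl fun j _ => ?_
    rw [Finsupp.mapDomain_single]
    congr 1
    exact (hσ j).symm
  rw [h1, coeff_taylor_comp_perm σ (hf σ) ha, coeff_taylor, symmetricCoeff]
  congr 1
  · congr 1
    have h2 : ∀ i, i ∉ Finset.univ.map (Fin.castLEEmb hs) →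
        (((∑ j, Finsupp.single (Fin.castLEEmb hs j) (k j + 1)) i).factorial : ℂ) = 1 := by
      intro i hi
      rw [sum_single_apply_of_notMem s (Fin.castLEEmb hs) (fun j => k j + 1) (by
        rintro ⟨j, rfl⟩
        exact hi (by simp))]
      simp
    rw [← Finset.prod_subset (Finset.subset_univ (Finset.univ.map (Fin.castLEEmb hs)))
      fun i _ hi => h2 i hi, Finset.prod_map]
    refine Finset.prod_congr rfl fun j _ => ?_
    rw [sum_single_apply s (Fin.castLEEmb hs) (fun j => k j + 1)]
  · refine (mixedPartial_perm (List.Perm.symm (perm_variableList ?_)) ha).eq_of_nhds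
    have h3 : ∀ l : List (Fin s),
        ((l.flatMap fun j => List.replicate (k j + 1) (j : ℕ) : List ℕ) : Multiset ℕ) =
          (l.map fun j => Multiset.replicate (k j + 1) (j : ℕ)).sum := by
      intro l
      induction l with
      | nil => rfl
      | cons j l ih => rw [List.flatMap_cons, ← Multiset.coe_add, ih]; rfl
    rw [h3, ← Fin.sum_univ_def, map_sum, ← Multiset.coe_mapAddMonoidHom, map_sum]
    simp only [Finsupp.toMultiset_single, Multiset.coe_mapAddMonoidHom,
      Multiset.nsmul_singleton, Multiset.map_replicate]
    rfl

end Augmented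

/-! ### Limits of the operators for appropriate sequences -/

section Limits

/-- The limit of the derivative of the part of `log F_N` that is linear in the power sums. -/
def limitAlpha (a : ℂ) (c : ℕ → ℝ) (D : ℕ) : Polynomial ℂ :=
  ∑ k ∈ Finset.range D, (a * (c (k + 1) : ℂ) / ((k + 1).factorial : ℂ)) •
    (((k : ℂ) + 1) • Polynomial.X ^ k)

/-- The limit of the derivative of the remaining part of `log F_N`. -/
def limitBeta (d : ℕ → ℕ → ℝ) (D : ℕ) : Polynomial (MvPolynomial ℕ ℂ) :=
  symbolDeriv ((2 : ℂ)⁻¹ • ∑ k ∈ Finset.range D, ∑ l ∈ Finset.range D,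
    ((d (k + 1) (l + 1) : ℂ) / (((k + 1).factorial : ℂ) * ((l + 1).factorial : ℂ))) •
      (MvPolynomial.X k * MvPolynomial.X l - MvPolynomial.X (l + k + 1)))

variable {m : ℕ → ℕ} {F : ∀ N, (Fin (m N) → ℂ) → ℂ} {c : ℕ → ℝ} {d : ℕ → ℕ → ℝ}

/-- The polynomial in the power sums that represents `log F_N` up to terms of degree more than
`D`. -/
def logPoly (F : ∀ N, (Fin (m N) → ℂ) → ℂ) (D N : ℕ) : MvPolynomial ℕ ℂ :=
  symmetricPoly D (symmetricCoeff fun x => Complex.log (F N x))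

/-- The hypothesis of the symbol calculus for T = F_N: the derivative of log F_N is that of a
polynomial in the power sums, up to order `D`, because log F_N is symmetric. -/
theorem pderiv_taylor_sub_mem (h : HasLimits m F c d) (D N : ℕ) (i : Fin (m N)) :
    MvPowerSeries.pderiv ℂ i (taylor (F N)) -
      taylor (F N) * seriesEvalAt i (symbolDeriv (logPoly F D N)) ∈ highOrder (m N) D := by
  have ha := h.holomorphic N
  have h1 : taylor (F N) = taylor fun x => Complex.exp (Complex.log (F N x)) := by
    apply taylor_congr
    filter_upwards [h.ne_zero N] with x hx
    exact (Complex.exp_log hx).symm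
  have h2 := sub_seriesEval_symmetricPoly_mem D (symmetricCoeff fun x => Complex.log (F N x))
    (taylor fun x => Complex.log (F N x)) fun s k e =>
      coeff_taylor_eq_symmetricCoeff (fun σ x => by simp only [h.symm N σ x]) ha s k e
  have h3 := pderiv_mem_highOrder h2 i
  rw [Nat.add_sub_cancel, map_sub, pderiv_seriesEval] at h3
  rw [h1, pderiv_taylor_exp i ha, mul_comm, ← mul_sub]
  exact Ideal.mul_mem_left _ _ h3

theorem tendsto_symmetricCoeff_one {a : ℂ} (ha : a ≠ 0)
    (hm : Tendsto (fun N : ℕ => (N : ℂ)⁻¹ * (m N : ℂ)) atTop (𝓝 a)) (h : HasLimits m F c d)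
    (k : Fin 1 → ℕ) : Tendsto (fun N : ℕ => (N : ℂ)⁻¹ *
      symmetricCoeff (fun x => Complex.log (F N x)) 1 k) atTop
      (𝓝 (a * (c (k 0 + 1) : ℂ) / ((k 0 + 1).factorial : ℂ))) := by
  have h1 := (hm.mul (h.one_index 0 (k 0 + 1) (by omega))).div_const ((k 0 + 1).factorial : ℂ)
  refine h1.congr' ?_
  filter_upwards [hm.eventually_ne ha] with N hN
  have hN' : (m N : ℂ) ≠ 0 := right_ne_zero_of_mul hN
  have h2 : ((List.finRange 1).flatMap fun j => List.replicate (k j + 1) (j : ℕ)) =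
      List.replicate (k 0 + 1) 0 := by
    simp [List.finRange_succ]
  rw [symmetricCoeff, h2]
  simp only [Fin.prod_univ_one]
  field_simp

theorem tendsto_symmetricCoeff_two (h : HasLimits m F c d) (k : Fin 2 → ℕ) :
    Tendsto (fun N : ℕ => symmetricCoeff (fun x => Complex.log (F N x)) 2 k) atTop
      (𝓝 ((d (k 0 + 1) (k 1 + 1) : ℂ) / (((k 0 + 1).factorial : ℂ) * ((k 1 + 1).factorial : ℂ)))) := by
  have h1 := (h.two_indices 0 1 (k 0 + 1) (k 1 + 1) (by omega) (by omega) (by omega)).div_const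
    (((k 0 + 1).factorial : ℂ) * ((k 1 + 1).factorial : ℂ))
  refine h1.congr fun N => ?_
  have h2 : ((List.finRange 2).flatMap fun j => List.replicate (k j + 1) (j : ℕ)) =
      List.replicate (k 0 + 1) 0 ++ List.replicate (k 1 + 1) 1 := by
    simp [List.finRange_succ]
  rw [symmetricCoeff, h2, Fin.prod_univ_two, div_eq_inv_mul]

theorem tendsto_symmetricCoeff_of_three_le (h : HasLimits m F c d) {s : ℕ} (hs : 3 ≤ s)
    (k : Fin s → ℕ) :
    Tendsto (fun N : ℕ => symmetricCoeff (fun x => Complex.log (F N x)) s k) atTop (𝓝 0) := by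
  have h1 : ((List.finRange s).flatMap fun j => List.replicate (k j + 1) (j : ℕ)).toFinset =
      Finset.range s := by
    ext i
    simp only [List.mem_toFinset, List.mem_flatMap, List.mem_finRange, true_and,
      List.mem_replicate, Finset.mem_range]
    constructor
    · rintro ⟨j, -, rfl⟩
      exact j.2
    · intro hi
      exact ⟨⟨i, hi⟩, by omega, rfl⟩
  have h2 := (h.many_indices ((List.finRange s).flatMap fun j => List.replicate (k j + 1) (j : ℕ))
    (by rw [h1, Finset.card_range]; exact hs)).const_mul (∏ j, ((k j + 1).factorial : ℂ))⁻¹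
  rwa [mul_zero] at h2

/-- The part of log F_N with one variable per monomial has coefficients of order N and is linear in
the power sums, so its derivative has scalar coefficients: this is N A. Monomials in two variables
have convergent coefficients and form the limit of B; those in three or more variables tend to zero.
-/
theorem exists_symbolDeriv_logPoly {a : ℂ} (ha : a ≠ 0)
    (hm : Tendsto (fun N : ℕ => (N : ℂ)⁻¹ * (m N : ℂ)) atTop (𝓝 a)) (h : HasLimits m F c d)
    {D : ℕ} (hD : 2 ≤ D) :
    ∃ (A : ℕ → Polynomial ℂ) (B : ℕ → Polynomial (MvPolynomial ℕ ℂ)),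
      FinTendsto A (limitAlpha a c D) ∧ FinTendsto B (limitBeta d D) ∧
      ∀ᶠ N : ℕ in atTop, symbolDeriv (logPoly F D N) = (N : ℂ) • scalarPoly (A N) + B N := by
  obtain ⟨e, rfl⟩ := Nat.exists_eq_add_of_le' hD
  set f : ∀ N s, (Fin s → ℕ) → ℂ := fun N => symmetricCoeff fun x => Complex.log (F N x) with hf
  set t : ∀ N s, MvPolynomial ℕ ℂ := fun N s => ((s.factorial : ℂ)⁻¹) •
    ∑ k : Fin s → Fin (e + 2), f N s (fun j => k j) • augmentedMonomial s fun j => k j with ht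
  refine ⟨fun N => ∑ k ∈ Finset.range (e + 2), ((N : ℂ)⁻¹ * f N 1 (fun _ => k)) •
      (((k : ℂ) + 1) • Polynomial.X ^ k),
    fun N => symbolDeriv (∑ s ∈ Finset.range e, t N (s + 3) + t N 2), ?_, ?_, ?_⟩
  · exact FinTendsto.sum _ fun k _ =>
      FinTendsto.smul_const _ (tendsto_symmetricCoeff_one ha hm h fun _ => k)
  · refine FinTendsto.map symbolDeriv.toLinearMap ?_
    have h3 : FinTendsto (fun N => ∑ s ∈ Finset.range e, t N (s + 3))
        (∑ s ∈ Finset.range e, ((s + 3).factorial : ℂ)⁻¹ • ∑ k : Fin (s + 3) → Fin (e + 2),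
          (0 : ℂ) • augmentedMonomial (s + 3) fun j => (k j : ℕ)) :=
      FinTendsto.sum _ fun s _ => (FinTendsto.sum _ fun k _ => FinTendsto.smul_const _
        (tendsto_symmetricCoeff_of_three_le h (by omega) _)).const_smul _
    have h2 : FinTendsto (fun N => t N 2) ((2 : ℂ)⁻¹ • ∑ k : Fin 2 → Fin (e + 2),
        ((d (k 0 + 1) (k 1 + 1) : ℂ) / ((((k 0 : ℕ) + 1).factorial : ℂ) *
          (((k 1 : ℕ) + 1).factorial : ℂ))) • augmentedMonomial 2 fun j => (k j : ℕ)) := by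
      have := (FinTendsto.sum Finset.univ fun k _ => FinTendsto.smul_const
        (augmentedMonomial 2 fun j => ((k : Fin 2 → Fin (e + 2)) j : ℕ))
        (tendsto_symmetricCoeff_two h fun j => k j)).const_smul (2 : ℂ)⁻¹
      simpa [ht] using this
    refine (h3.add h2).of_eq (fun N => rfl) ?_
    simp only [zero_smul, Finset.sum_const_zero, smul_zero, zero_add]
    congr 1
    rw [← Equiv.sum_comp (finTwoArrowEquiv (Fin (e + 2))).symm, Fintype.sum_prod_type,
      Finset.sum_range]
    refine Finset.sum_congr rfl fun k _ => ?_
    rw [Finset.sum_range]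
    refine Finset.sum_congr rfl fun l _ => ?_
    simp [augmentedMonomial, Fin.tail]
  · filter_upwards [natCast_mul_inv_eventuallyEq] with N hN
    rw [logPoly, symmetricPoly]
    change symbolDeriv (∑ s ∈ Finset.range (e + 3), t N s) = _
    rw [Finset.sum_range_succ', Finset.sum_range_succ', Finset.sum_range_succ']
    -- The value of log F_N at (1, …, 1), a constant without influence on the derivative.
    have h0 : t N 0 = algebraMap ℂ _ (f N 0 Fin.elim0) := by
      rw [ht]
      simp only [augmentedMonomial, Algebra.algebraMap_eq_smul_one]
      simp
      congr
      funext j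
      exact j.elim0
    have h1 : t N 1 = ∑ k ∈ Finset.range (e + 2), f N 1 (fun _ => k) • MvPolynomial.X k := by
      rw [ht, ← Fin.sum_univ_eq_sum_range (fun k => f N 1 (fun _ => k) •
        (MvPolynomial.X k : MvPolynomial ℕ ℂ)), ← Equiv.sum_comp (Equiv.funUnique (Fin 1) _)]
      simp only [Nat.factorial_one, Nat.cast_one, inv_one, one_smul]
      refine Finset.sum_congr rfl fun k _ => ?_
      have : (fun j => (k j : ℕ)) = fun _ => ((k 0 : Fin (e + 2)) : ℕ) := by
        funext j
        rw [Subsingleton.elim j 0]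
      rw [this]
      simp [augmentedMonomial]
    rw [h0, map_add, Derivation.map_algebraMap, add_zero, map_add, add_comm]
    congr 1
    rw [h1, map_sum, map_sum, Finset.smul_sum]
    refine Finset.sum_congr rfl fun k _ => ?_
    rw [Derivation.map_smul, symbolDeriv_X, map_smul, map_smul, map_pow, scalarPoly_X,
      smul_smul (N : ℂ), ← mul_assoc, hN, one_mul]

open scoped MvPowerSeries.WithPiTopology

/-- The operator that corresponds to the power sum `∑ (λ_i + m - i) ^ k`. -/
def powerOp (m k : ℕ) : MvPowerSeries (Fin m) ℂ →L[ℂ] MvPowerSeries (Fin m) ℂ :=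
  ∑ j ∈ Finset.range (k + 1), (Nat.stirlingSecond k j : ℂ) • schurOp m j

theorem powerOp_apply (m k : ℕ) (f : MvPowerSeries (Fin m) ℂ) : powerOp m k f =
    ∑ j ∈ Finset.range (k + 1), (Nat.stirlingSecond k j : ℂ) • schurOp m j f := by
  simp [powerOp]

theorem pow_eq_sum_fallingFactorial (k : ℕ) (x : ℂ) : x ^ k =
    ∑ j ∈ Finset.range (k + 1), (Nat.stirlingSecond k j : ℂ) * fallingFactorial j x := by
  induction k with
  | zero => simp [fallingFactorial]
  | succ k ih =>
    have h1 : ∀ j, x * fallingFactorial j x =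
        fallingFactorial (j + 1) x + j * fallingFactorial j x := by
      intro j
      rw [fallingFactorial, fallingFactorial, Finset.prod_range_succ]
      ring
    have h2 : ∑ j ∈ Finset.range (k + 1), (Nat.stirlingSecond k j : ℂ) * (j * fallingFactorial j x) =
        ∑ j ∈ Finset.range (k + 1), (Nat.stirlingSecond k (j + 1) : ℂ) *
          ((j + 1 : ℕ) * fallingFactorial (j + 1) x) := by
      rw [Finset.sum_range_succ', Finset.sum_range_succ _ k,
        Nat.stirlingSecond_eq_zero_of_lt (Nat.lt_succ_self k)]
      simp
    rw [pow_succ', ih, Finset.mul_sum, Finset.sum_range_succ' _ (k + 1), Nat.stirlingSecond_succ_zero]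
    simp only [mul_left_comm x, h1, mul_add, Finset.sum_add_distrib, h2]
    rw [← Finset.sum_add_distrib]
    simp only [Nat.cast_zero, zero_mul, add_zero]
    refine Finset.sum_congr rfl fun j _ => ?_
    rw [Nat.stirlingSecond_succ_succ]
    push_cast
    ring

/-- The shifted power sum of a signature. -/
def signaturePower {m : ℕ} (k : ℕ) (l : Signature m) : ℝ :=
  ∑ i : Fin m, ((l.1 i : ℝ) + (m : ℝ) - ((i : ℕ) + 1 : ℝ)) ^ k

theorem powerOp_taylor_normSchur {m : ℕ} (k : ℕ) (l : Signature m) :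
    powerOp m k (taylor (normSchur l)) = (signaturePower k l : ℂ) • taylor (normSchur l) := by
  simp only [powerOp_apply, schurOp_taylor_normSchur, smul_smul]
  rw [← Finset.sum_smul]
  congr 1
  simp only [fallingSum, Finset.mul_sum]
  rw [Finset.sum_comm, signaturePower]
  push_cast
  refine Finset.sum_congr rfl fun i _ => ?_
  rw [← pow_eq_sum_fallingFactorial]
  congr 1
  ring

/-- The operator on polynomials in the power sums that corresponds to `powerOp`. -/
def symbolPowerOp (M : ℂ) (h : Polynomial (MvPolynomial ℕ ℂ)) (k : ℕ) :
    MvPolynomial ℕ ℂ →ₗ[ℂ] MvPolynomial ℕ ℂ :=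
  ∑ j ∈ Finset.range (k + 1), (Nat.stirlingSecond k j : ℂ) • symbolOp M h j

theorem symbolPowerOp_apply (M : ℂ) (h : Polynomial (MvPolynomial ℕ ℂ)) (k : ℕ)
    (P : MvPolynomial ℕ ℂ) : symbolPowerOp M h k P =
      ∑ j ∈ Finset.range (k + 1), (Nat.stirlingSecond k j : ℂ) • symbolOp M h j P := by
  simp [symbolPowerOp, LinearMap.sum_apply]

theorem powerOp_sub_mem {m D e k : ℕ} (he : e ≤ D) (hk : k ≤ e) {T : MvPowerSeries (Fin m) ℂ}
    {h : Polynomial (MvPolynomial ℕ ℂ)}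
    (hT : ∀ i, MvPowerSeries.pderiv ℂ i T - T * seriesEvalAt i h ∈ highOrder m D)
    {f : MvPowerSeries (Fin m) ℂ} {P : MvPolynomial ℕ ℂ}
    (hf : f - T * seriesEval m P ∈ highOrder m e) :
    powerOp m k f - T * seriesEval m (symbolPowerOp m h k P) ∈ highOrder m (e - k) := by
  rw [powerOp_apply, symbolPowerOp_apply, map_sum, Finset.mul_sum, ← Finset.sum_sub_distrib]
  refine sum_mem fun j hj => ?_
  rw [Finset.mem_range] at hj
  rw [map_smul, mul_smul_comm, ← smul_sub, Algebra.smul_def]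
  refine Ideal.mul_mem_left _ _ ?_
  have h1 := schurOp_mul_seriesEval (k := j) (D := D) (by omega) hT P
  have h2 := schurOp_mem_highOrder (k := j) (by omega) hf
  rw [map_sub] at h2
  have h3 := add_mem (highOrder_antitone (e := e - k) (by omega) h2)
    (highOrder_antitone (e := e - k) (by omega) h1)
  rwa [sub_add_sub_cancel] at h3

/-- Ordinary powers are combinations of falling factorials. After centring, the operator of degree j
is of order N^j, so only the top one, with Stirling number 1, contributes to the limit. The degree
is written k + 1 because the Stirling number for j = 0 vanishes then. -/
theorem finTendsto_symbolPowerOp {a : ℂ} (ha : a ≠ 0)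
    (hm : Tendsto (fun N : ℕ => (N : ℂ)⁻¹ * (m N : ℂ)) atTop (𝓝 a)) (h : HasLimits m F c d)
    {D : ℕ} (hD : 2 ≤ D) (k : ℕ) :
    ∃ E : ℕ → ℂ, ∀ P, FinTendsto (fun N : ℕ => ((N : ℂ)⁻¹) ^ (k + 1) •
      (symbolPowerOp (m N) (symbolDeriv (logPoly F D N)) (k + 1) P - E N • P))
      (limitForm a (limitAlpha a c D) (limitBeta d D) (k + 1) * P +
        limitDeriv a (limitAlpha a c D) (k + 1) P) := by
  obtain ⟨A, B, hA, hB, hAB⟩ := exists_symbolDeriv_logPoly ha hm h hD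
  refine ⟨fun N => ∑ j ∈ Finset.range (k + 1), (Nat.stirlingSecond (k + 1) (j + 1) : ℂ) *
    scalarMean (m N) (A N) N (j + 1), fun P => ?_⟩
  have h1 : FinTendsto (fun N : ℕ => ∑ j ∈ Finset.range (k + 1),
      (Nat.stirlingSecond (k + 1) (j + 1) : ℂ) • (((N : ℂ)⁻¹) ^ (k - j) • (((N : ℂ)⁻¹) ^ (j + 1) •
      (symbolOp (m N) ((N : ℂ) • scalarPoly (A N) + B N) (j + 1) P -
        scalarMean (m N) (A N) N (j + 1) • P))))
      (∑ j ∈ Finset.range (k + 1), (Nat.stirlingSecond (k + 1) (j + 1) : ℂ) •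
        ((0 : ℂ) ^ (k - j) • (limitForm a (limitAlpha a c D) (limitBeta d D) (j + 1) * P +
        limitDeriv a (limitAlpha a c D) (j + 1) P))) :=
    FinTendsto.sum _ fun j _ => (FinTendsto.smul (tendsto_inv_natCast.pow _)
      (finTendsto_symbolOp hm hA hB j P)).const_smul _
  rw [Finset.sum_range_succ, Finset.sum_eq_zero] at h1
  · simp only [Nat.stirlingSecond_self, Nat.cast_one, Nat.sub_self, pow_zero, one_smul,
      zero_add] at h1
    refine h1.congr ?_
    filter_upwards [hAB] with N hN
    rw [symbolPowerOp_apply, Finset.sum_range_succ' _ (k + 1), Nat.stirlingSecond_succ_zero, hN,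
      Finset.sum_smul]
    simp only [Nat.cast_zero, zero_smul, add_zero]
    rw [← Finset.sum_sub_distrib, Finset.smul_sum]
    refine Finset.sum_congr rfl fun j hj => ?_
    rw [Finset.mem_range] at hj
    have : ((N : ℂ)⁻¹) ^ (k + 1) = ((N : ℂ)⁻¹) ^ (k - j) * ((N : ℂ)⁻¹) ^ (j + 1) := by
      rw [← pow_add]
      congr 1
      omega
    rw [this]
    module
  · intro j hj
    rw [Finset.mem_range] at hj
    rw [zero_pow (by omega), zero_smul, smul_zero]

end Limits

/-! ### Expectations for the multilevel chain -/

section Chain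

open scoped MvPowerSeries.WithPiTopology

theorem jointWeight_succ {n : ℕ} {m : Fin (n + 2) → ℕ} (ρ : ∀ t, PMF (Signature (m t)))
    (l : ∀ t, Signature (m t)) : jointWeight ρ l =
      jointWeight (m := fun t : Fin (n + 1) => m t.succ) (fun t => ρ t.succ) (fun t => l t.succ) *
        transition (schurGen (ρ 0)) (l (Fin.succ 0)) (l 0) := by
  rw [jointWeight, jointWeight, Fin.prod_univ_succ, mul_comm (transition _ _ _), ← mul_assoc]
  rfl

theorem jointWeight_ne_top {n : ℕ} {m : Fin (n + 1) → ℕ} (ρ : ∀ t, PMF (Signature (m t)))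
    (l : ∀ t, Signature (m t)) : jointWeight ρ l ≠ ⊤ := by
  rw [jointWeight]
  exact ENNReal.mul_ne_top (PMF.apply_ne_top _ _)
    (ENNReal.prod_ne_top fun i _ => PMF.apply_ne_top _ _)

/-- The series that is obtained from the Schur generating functions when, from the top level
downwards, the operators `Φ t` are applied. -/
def chainSeries : ∀ {n : ℕ} {m : Fin (n + 1) → ℕ}, Monotone m → (∀ t, PMF (Signature (m t))) →
    (∀ t, MvPowerSeries (Fin (m t)) ℂ →L[ℂ] MvPowerSeries (Fin (m t)) ℂ) →
    MvPowerSeries (Fin (m 0)) ℂ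
  | 0, _, _, ρ, _ => taylor (schurGen (ρ 0))
  | n + 1, m, hm, ρ, Φ => taylor (schurGen (ρ 0)) *
      MvPowerSeries.killCompl (Fin.castLEEmb (hm (Fin.zero_le (Fin.succ 0))))
        (Φ (Fin.succ 0) (chainSeries (n := n) (m := fun t => m t.succ)
          (fun _ _ h => hm (Fin.succ_le_succ_iff.2 h)) (fun t => ρ t.succ) (fun t => Φ t.succ)))

theorem exists_real_hasSum {ι : Type*} {f : ι → ℝ} {z : ℂ} (h : HasSum (fun i => (f i : ℂ)) z) :
    ∃ r : ℝ, z = r ∧ HasSum f r := by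
  have h1 := Complex.hasSum_re h
  have h2 := Complex.hasSum_im h
  simp only [Complex.ofReal_re, Complex.ofReal_im] at h1 h2
  refine ⟨z.re, ?_, h1⟩
  apply Complex.ext
  · simp
  · rw [Complex.ofReal_im, h2.unique hasSum_zero]

/-- One step of the chain on the level of power series: averaging the normalized Schur functions
over the transition law is restriction followed by multiplication by the generating function. -/
theorem hasSum_transition {m M : ℕ} (h : m ≤ M) {ρ : PMF (Signature m)} (hρ : SchurConvergent ρ)
    (hg : AnalyticAt ℂ (schurGen ρ) 1) (l : Signature M) :
    HasSum (fun μ => ((transition (schurGen ρ) l μ).toReal : ℂ) • taylor (normSchur μ))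
      (taylor (schurGen ρ) * MvPowerSeries.killCompl (Fin.castLEEmb h) (taylor (normSchur l))) := by
  have h1 := hasSum_taylor_normSchur (isTransition_transition h hρ l)
  have h2 : AnalyticAt ℂ (fun x : Fin m → ℂ => normSchur l (padOnes x)) 1 :=
    analyticAt_comp_padOnes (analyticAt_normSchur l (by simp))
  rw [← taylor_comp_padOnes h, ← taylor_mul hg h2]
  exact h1

/-- Induction on the number of levels by summing out the lowest signature. `L` is a functional on
the lowest level and `u` the function it induces on signatures; after one transition they become a
functional and a function on the next level. The alternative in the hypothesis is Tonelli or Fubini: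
for nonnegative functions summability is a conclusion, otherwise it has to be supplied. The first
case is what later proves that all moments are finite. -/
theorem exists_hasSum_chainSeries {n : ℕ} {m : Fin (n + 1) → ℕ} (hm : Monotone m)
    (ρ : ∀ t, PMF (Signature (m t))) (hρ : ∀ t, SchurConvergent (ρ t))
    (hg : ∀ t, AnalyticAt ℂ (schurGen (ρ t)) 1) (f : ∀ t, Signature (m t) → ℝ)
    (Φ : ∀ t, MvPowerSeries (Fin (m t)) ℂ →L[ℂ] MvPowerSeries (Fin (m t)) ℂ)
    (hΦ : ∀ t l, Φ t (taylor (normSchur l)) = (f t l : ℂ) • taylor (normSchur l))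
    (L : MvPowerSeries (Fin (m 0)) ℂ →L[ℂ] ℂ) (u : Signature (m 0) → ℝ)
    (hu : ∀ l, L (taylor (normSchur l)) = u l)
    (h : ((∀ l, 0 ≤ u l) ∧ ∀ t l, 0 ≤ f t l) ∨
      Summable fun l : ∀ t, Signature (m t) =>
        (jointWeight ρ l).toReal * (u (l 0) * ∏ t : Fin n, f t.succ (l t.succ))) :
    ∃ r : ℝ, L (chainSeries hm ρ Φ) = r ∧
      HasSum (fun l : ∀ t, Signature (m t) =>
        (jointWeight ρ l).toReal * (u (l 0) * ∏ t : Fin n, f t.succ (l t.succ))) r := by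
  induction n with
  | zero =>
    obtain ⟨r, hr, hsum⟩ := exists_real_hasSum (f := fun l => ((ρ 0) l).toReal * u l)
      (z := L (taylor (schurGen (ρ 0)))) (by
        have h1 : ∀ᶠ x in 𝓝 (1 : Fin (m 0) → ℂ),
            HasSum (fun μ => schurTerm (ρ 0) μ x) (schurGen (ρ 0) x) := by
          filter_upwards [(hρ 0).eventually_summable] with x hx
          exact hx.hasSum
        have h2 := (hasSum_taylor_normSchur h1).mapL L
        simpa [hu] using h2)
    refine ⟨r, hr, ?_⟩
    rw [← (Equiv.piUnique fun t : Fin 1 => Signature (m t)).symm.hasSum_iff]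
    have h1 : ((fun l : ∀ t, Signature (m t) => (jointWeight ρ l).toReal *
        (u (l 0) * ∏ t : Fin 0, f t.succ (l t.succ))) ∘
        (Equiv.piUnique fun t : Fin 1 => Signature (m t)).symm) =
        fun l => ((ρ 0) l).toReal * u l := by
      funext l
      simp only [Function.comp_apply, jointWeight, Finset.univ_eq_empty, Finset.prod_empty, mul_one]
      rfl
    rw [h1]
    exact hsum
  | succ n ih =>
    set m' : Fin (n + 1) → ℕ := fun t => m t.succ with hm'
    have hm1 : Monotone m' := fun _ _ h => hm (Fin.succ_le_succ_iff.2 h)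
    have h01 : m 0 ≤ m' 0 := hm (Fin.zero_le (Fin.succ 0))
    -- The functional on level 1: insert the operator of that level, restrict, multiply by g_0 and
    -- apply `L`. Its value at a normalized Schur function is the eigenvalue times the conditional
    -- expectation `v` of `u`.
    set L' : MvPowerSeries (Fin (m' 0)) ℂ →L[ℂ] ℂ :=
      ⟨L.toLinearMap ∘ₗ LinearMap.mulLeft ℂ (taylor (schurGen (ρ 0))) ∘ₗ
        (MvPowerSeries.killCompl (Fin.castLEEmb h01)).toLinearMap ∘ₗ (Φ (Fin.succ 0)).toLinearMap,
        L.continuous.comp (continuous_const.mul ((continuous_killCompl _).comp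
          (Φ (Fin.succ 0)).continuous))⟩ with hL'
    have hL'_apply : ∀ F, L' F = L (taylor (schurGen (ρ 0)) *
      MvPowerSeries.killCompl (Fin.castLEEmb h01) (Φ (Fin.succ 0) F)) := fun _ => rfl
    have hst : ∀ l : Signature (m' 0), ∃ r : ℝ, L (taylor (schurGen (ρ 0)) *
        MvPowerSeries.killCompl (Fin.castLEEmb h01) (taylor (normSchur l))) = r ∧
        HasSum (fun μ => (transition (schurGen (ρ 0)) l μ).toReal * u μ) r := by
      intro l
      apply exists_real_hasSum
      have h2 := (hasSum_transition h01 (hρ 0) (hg 0) l).mapL L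
      simpa [hu] using h2
    choose v hv hvsum using hst
    have hw : ∀ (l' : ∀ t, Signature (m' t)) (μ : Signature (m 0)),
        (jointWeight ρ (Fin.cons μ l' : ∀ t, Signature (m t))).toReal *
          (u μ * ∏ t : Fin (n + 1), f t.succ (l' t)) =
        (jointWeight (fun t => ρ t.succ) l').toReal * (∏ t : Fin (n + 1), f t.succ (l' t)) *
          ((transition (schurGen (ρ 0)) (l' 0) μ).toReal * u μ) := by
      intro l' μ
      rw [jointWeight_succ, ENNReal.toReal_mul]
      have e1 : (fun t : Fin (n + 1) => (Fin.cons μ l' : ∀ t, Signature (m t)) t.succ) = l' := rfl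
      have e2 : (Fin.cons μ l' : ∀ t, Signature (m t)) (Fin.succ 0) = l' 0 := rfl
      have e3 : (Fin.cons μ l' : ∀ t, Signature (m t)) 0 = μ := rfl
      rw [e1, e2, e3]
      ring
    have hinner : ∀ l' : ∀ t, Signature (m' t), HasSum (fun μ : Signature (m 0) =>
        (jointWeight ρ (Fin.cons μ l' : ∀ t, Signature (m t))).toReal *
          (u μ * ∏ t : Fin (n + 1), f t.succ (l' t)))
        ((jointWeight (fun t => ρ t.succ) l').toReal *
          ((f (Fin.succ 0) (l' 0) * v (l' 0)) * ∏ t : Fin n, f t.succ.succ (l' t.succ))) := by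
      intro l'
      simp only [hw]
      have h1 := (hvsum (l' 0)).mul_left
        ((jointWeight (fun t => ρ t.succ) l').toReal * (∏ t : Fin (n + 1), f t.succ (l' t)))
      have h2 : (jointWeight (fun t => ρ t.succ) l').toReal *
          ((f (Fin.succ 0) (l' 0) * v (l' 0)) * ∏ t : Fin n, f t.succ.succ (l' t.succ)) =
          (jointWeight (fun t => ρ t.succ) l').toReal * (∏ t : Fin (n + 1), f t.succ (l' t)) *
            v (l' 0) := by
        rw [Fin.prod_univ_succ]
        ring
      rw [h2]
      exact h1
    set E : ((∀ t, Signature (m' t)) × Signature (m 0)) ≃ ∀ t, Signature (m t) :=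
      (Equiv.prodComm _ _).trans (Fin.consEquiv fun t => Signature (m t)) with hE
    set g : (∀ t, Signature (m t)) → ℝ := fun l =>
      (jointWeight ρ l).toReal * (u (l 0) * ∏ t : Fin (n + 1), f t.succ (l t.succ)) with hgdef
    have hgE : ∀ p, g (E p) = (jointWeight ρ (Fin.cons p.2 p.1 : ∀ t, Signature (m t))).toReal *
        (u p.2 * ∏ t : Fin (n + 1), f t.succ (p.1 t)) := fun p => rfl
    -- Both alternatives pass to the smaller chain: conditional expectations of nonnegative
    -- functions are nonnegative, and iterated sums of a summable family are summable.
    have hih : ((∀ l, 0 ≤ f (Fin.succ 0) l * v l) ∧ ∀ (t : Fin (n + 1)) l, 0 ≤ f t.succ l) ∨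
        Summable fun l' : ∀ t, Signature (m' t) => (jointWeight (fun t => ρ t.succ) l').toReal *
          ((f (Fin.succ 0) (l' 0) * v (l' 0)) * ∏ t : Fin n, f t.succ.succ (l' t.succ)) := by
      rcases h with h | h
      · refine Or.inl ⟨fun l => mul_nonneg (h.2 _ _) ?_, fun t l => h.2 _ _⟩
        exact (hvsum l).nonneg fun μ => mul_nonneg ENNReal.toReal_nonneg (h.1 μ)
      · right
        have h1 : Summable (g ∘ E) := E.summable_iff.2 h
        have h2 := h1.prod
        refine h2.congr fun l' => ?_
        exact ((hinner l').tsum_eq)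
    obtain ⟨r, hr, hsum⟩ := ih hm1 (fun t => ρ t.succ) (fun t => hρ t.succ) (fun t => hg t.succ)
      (fun t => f t.succ) (fun t => Φ t.succ) (fun t => hΦ t.succ) L'
      (fun l => f (Fin.succ 0) l * v l) (fun l => by
        rw [hL'_apply, hΦ, map_smul, mul_smul_comm, map_smul, hv]
        simp) hih
    refine ⟨r, ?_, ?_⟩
    · rw [← hr]
      rfl
    · have hsummable : Summable (g ∘ E) := by
        rcases h with h | h
        · rw [summable_prod_of_nonneg]
          · refine ⟨fun l' => (hinner l').summable, ?_⟩
            refine hsum.summable.congr fun l' => ?_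
            exact (hinner l').tsum_eq.symm
          · intro p
            exact mul_nonneg ENNReal.toReal_nonneg (mul_nonneg (h.1 _)
              (Finset.prod_nonneg fun t _ => h.2 _ _))
        · exact E.summable_iff.2 h
      have h3 := hsummable.hasSum.prod_fiberwise hinner
      rw [← h3.unique hsum, ← E.hasSum_iff]
      exact hsummable.hasSum

end Chain

/-! ### Moments of the chain in terms of operators -/

section Moments

open scoped MvPowerSeries.WithPiTopology

theorem hasSum_toReal {α : Type*} (p : PMF α) : HasSum (fun x => (p x).toReal) 1 := by
  have h := ENNReal.hasSum_toReal (f := p) (by rw [p.tsum_coe]; exact ENNReal.one_ne_top)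
  rwa [← ENNReal.tsum_toReal_eq fun x => p.apply_ne_top x, p.tsum_coe, ENNReal.toReal_one] at h

theorem schurGen_one {N : ℕ} (ρ : PMF (Signature N)) : schurGen ρ 1 = 1 := by
  have h1 : ∀ l, schurTerm ρ l 1 = ((ρ l).toReal : ℂ) := by
    intro l
    rw [schurTerm, div_self (schur_one_ne_zero l), mul_one]
  rw [schurGen]
  simp only [h1]
  exact_mod_cast (Complex.hasSum_ofReal.2 (hasSum_toReal ρ)).tsum_eq

/-! ### Recursion and normalization of the functions H_t -/

section LevelFun

variable {n : ℕ}

theorem levelFun_last {m : Fin (n + 1) → ℕ} (ρ : ∀ t, PMF (Signature (m t))) :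
    levelFun ρ (Fin.last n) = schurGen (ρ (Fin.last n)) := by
  simp [levelFun]

theorem levelFun_castSucc {m : Fin (n + 1) → ℕ} (ρ : ∀ t, PMF (Signature (m t))) (i : Fin n) :
    levelFun ρ i.castSucc = fun x => levelFun ρ i.succ (padOnes x) * schurGen (ρ i.castSucc) x := by
  simp [levelFun]

theorem levelFun_succ {m : Fin (n + 2) → ℕ} (ρ : ∀ t, PMF (Signature (m t))) (t : Fin (n + 1)) :
    levelFun (m := fun t : Fin (n + 1) => m t.succ) (fun t => ρ t.succ) t = levelFun ρ t.succ := by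
  induction t using Fin.reverseInduction with
  | last =>
    rw [levelFun_last]
    exact (levelFun_last ρ).symm
  | cast i ih =>
    rw [levelFun_castSucc, ih]
    exact (levelFun_castSucc ρ i.succ).symm

theorem levelFun_zero_succ {m : Fin (n + 2) → ℕ} (ρ : ∀ t, PMF (Signature (m t))) :
    levelFun ρ 0 = fun x => levelFun ρ (Fin.succ 0) (padOnes x) * schurGen (ρ 0) x :=
  levelFun_castSucc ρ 0

theorem levelFun_one {m : Fin (n + 1) → ℕ} (ρ : ∀ t, PMF (Signature (m t))) (t : Fin (n + 1)) :
    levelFun ρ t 1 = 1 := by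
  induction t using Fin.reverseInduction with
  | last => rw [levelFun_last, schurGen_one]
  | cast i ih =>
    rw [levelFun_castSucc]
    show levelFun ρ i.succ (padOnes 1) * schurGen (ρ i.castSucc) 1 = 1
    rw [padOnes_one, ih, schurGen_one, mul_one]

end LevelFun

theorem constantCoeff_killCompl {m M : ℕ} (ι : Fin m ↪ Fin M) (f : MvPowerSeries (Fin M) ℂ) :
    MvPowerSeries.constantCoeff (MvPowerSeries.killCompl ι f) = MvPowerSeries.constantCoeff f := by
  rw [← MvPowerSeries.coeff_zero_eq_constantCoeff_apply, MvPowerSeries.coeff_killCompl]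
  simp

/-- The constant coefficient as a continuous linear map. -/
def constantCoeffL (m : ℕ) : MvPowerSeries (Fin m) ℂ →L[ℂ] ℂ :=
  ⟨MvPowerSeries.coeff 0, MvPowerSeries.WithPiTopology.continuous_coeff ℂ 0⟩

theorem constantCoeffL_apply {m : ℕ} (f : MvPowerSeries (Fin m) ℂ) :
    constantCoeffL m f = MvPowerSeries.constantCoeff f :=
  MvPowerSeries.coeff_zero_eq_constantCoeff_apply f

theorem exists_hasSum_prod {n : ℕ} {m : Fin (n + 1) → ℕ} (hm : Monotone m)
    (ρ : ∀ t, PMF (Signature (m t))) (hρ : ∀ t, SchurConvergent (ρ t))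
    (hg : ∀ t, AnalyticAt ℂ (schurGen (ρ t)) 1) (f : ∀ t, Signature (m t) → ℝ)
    (Φ : ∀ t, MvPowerSeries (Fin (m t)) ℂ →L[ℂ] MvPowerSeries (Fin (m t)) ℂ)
    (hΦ : ∀ t l, Φ t (taylor (normSchur l)) = (f t l : ℂ) • taylor (normSchur l))
    (h : (∀ t l, 0 ≤ f t l) ∨ Summable fun l : ∀ t, Signature (m t) =>
        (jointWeight ρ l).toReal * ∏ t, f t (l t)) :
    ∃ r : ℝ, MvPowerSeries.constantCoeff (Φ 0 (chainSeries hm ρ Φ)) = r ∧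
      HasSum (fun l : ∀ t, Signature (m t) => (jointWeight ρ l).toReal * ∏ t, f t (l t)) r := by
  have h1 := exists_hasSum_chainSeries hm ρ hρ hg f Φ hΦ ((constantCoeffL (m 0)).comp (Φ 0)) (f 0)
    (fun l => by
      rw [ContinuousLinearMap.comp_apply, hΦ, constantCoeffL_apply,
        ← MvPowerSeries.coeff_zero_eq_constantCoeff_apply, map_smul,
        MvPowerSeries.coeff_zero_eq_constantCoeff_apply, constantCoeff_taylor_normSchur]
      simp)
    (by
      rcases h with h | h
      · exact Or.inl ⟨h 0, h⟩
      · right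
        simpa only [Fin.prod_univ_succ] using h)
  simpa only [Fin.prod_univ_succ, ContinuousLinearMap.comp_apply, constantCoeffL_apply] using h1

theorem constantCoeff_chainSeries_id {n : ℕ} {m : Fin (n + 1) → ℕ} (hm : Monotone m)
    (ρ : ∀ t, PMF (Signature (m t))) : MvPowerSeries.constantCoeff
      (chainSeries hm ρ fun _ => ContinuousLinearMap.id ℂ _) = 1 := by
  induction n with
  | zero => rw [chainSeries, constantCoeff_taylor, schurGen_one]
  | succ n ih =>
    rw [chainSeries, map_mul, constantCoeff_taylor, schurGen_one, one_mul, constantCoeff_killCompl]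
    exact ih _ _

theorem hasSum_jointWeight {n : ℕ} {m : Fin (n + 1) → ℕ} (hm : Monotone m)
    (ρ : ∀ t, PMF (Signature (m t))) (hρ : ∀ t, SchurConvergent (ρ t))
    (hg : ∀ t, AnalyticAt ℂ (schurGen (ρ t)) 1) :
    HasSum (fun l => (jointWeight ρ l).toReal) 1 := by
  obtain ⟨r, hr, hsum⟩ := exists_hasSum_prod hm ρ hρ hg (fun _ _ => 1)
    (fun _ => ContinuousLinearMap.id ℂ _) (fun t l => by simp) (Or.inl fun _ _ => zero_le_one)
  have : r = 1 := by
    have h := constantCoeff_chainSeries_id hm ρ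
    rw [ContinuousLinearMap.id_apply, h] at hr
    exact_mod_cast hr.symm
  simpa [this] using hsum

theorem isProbabilityMeasure_jointLaw {n : ℕ} {m : Fin (n + 1) → ℕ} (hm : Monotone m)
    (ρ : ∀ t, PMF (Signature (m t))) (hρ : ∀ t, SchurConvergent (ρ t))
    (hg : ∀ t, AnalyticAt ℂ (schurGen (ρ t)) 1) : IsProbabilityMeasure (jointLaw ρ) := by
  constructor
  have h := hasSum_jointWeight hm ρ hρ hg
  rw [jointLaw, Measure.sum_apply _ MeasurableSet.univ]
  simp only [Measure.smul_apply, measure_univ, smul_eq_mul, mul_one]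
  have h1 : ∀ l, jointWeight ρ l = ENNReal.ofReal (jointWeight ρ l).toReal :=
    fun l => (ENNReal.ofReal_toReal (jointWeight_ne_top ρ l)).symm
  rw [tsum_congr h1, ← ENNReal.ofReal_tsum_of_nonneg (fun _ => ENNReal.toReal_nonneg) h.summable,
    h.tsum_eq, ENNReal.ofReal_one]

/-- The polynomial that represents `chainSeries`. -/
def chainPoly : ∀ {n : ℕ}, (Fin (n + 1) → MvPolynomial ℕ ℂ → MvPolynomial ℕ ℂ) → MvPolynomial ℕ ℂ
  | 0, _ => 1
  | _ + 1, A => A (Fin.succ 0) (chainPoly fun t => A t.succ)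

/-- A series close to H_{t+1} P becomes, after restriction and multiplication by g_t, close to H_t
P: power sums restrict to power sums and H_t(x) = H_{t+1}(x, 1) g_t(x). Hence the polynomial travels
down unchanged between operators, while the precision drops by the sum of the degrees. -/
theorem chainSeries_sub_mem {n : ℕ} {m : Fin (n + 1) → ℕ} (hm : Monotone m)
    (ρ : ∀ t, PMF (Signature (m t)))
    (hg : ∀ t, AnalyticAt ℂ (schurGen (ρ t)) 1) (hH : ∀ t, AnalyticAt ℂ (levelFun ρ t) 1)
    (Φ : ∀ t, MvPowerSeries (Fin (m t)) ℂ →L[ℂ] MvPowerSeries (Fin (m t)) ℂ)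
    (A : Fin (n + 1) → MvPolynomial ℕ ℂ → MvPolynomial ℕ ℂ) (D : ℕ) (K : Fin (n + 1) → ℕ)
    (hrep : ∀ t e f P, e ≤ D → K t ≤ e →
      f - taylor (levelFun ρ t) * seriesEval (m t) P ∈ highOrder (m t) e →
      Φ t f - taylor (levelFun ρ t) * seriesEval (m t) (A t P) ∈ highOrder (m t) (e - K t))
    (hK : ∑ t : Fin n, K t.succ ≤ D) :
    chainSeries hm ρ Φ - taylor (levelFun ρ 0) * seriesEval (m 0) (chainPoly A) ∈
      highOrder (m 0) (D - ∑ t : Fin n, K t.succ) := by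
  induction n with
  | zero =>
    rw [chainSeries, chainPoly, map_one, mul_one]
    have : levelFun ρ 0 = schurGen (ρ 0) := levelFun_last ρ
    rw [this, sub_self]
    exact zero_mem _
  | succ n ih =>
    rw [Fin.sum_univ_succ] at hK ⊢
    have h1 := ih (m := fun t => m t.succ) (fun _ _ h => hm (Fin.succ_le_succ_iff.2 h))
      (fun t => ρ t.succ) (fun t => hg t.succ) (fun t => by rw [levelFun_succ]; exact hH t.succ)
      (fun t => Φ t.succ) (fun t => A t.succ) (fun t => K t.succ)
      (fun t => by rw [levelFun_succ]; exact hrep t.succ) (by omega)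
    rw [levelFun_succ] at h1
    have h2 := hrep (Fin.succ 0) _ _ _ (Nat.sub_le _ _) (by omega) h1
    have h01 : m 0 ≤ m (Fin.succ 0) := hm (Fin.zero_le (Fin.succ 0))
    have h3 := killCompl_mem_highOrder (Fin.castLEEmb h01) h2
    rw [map_sub, map_mul, killCompl_seriesEval, ← taylor_comp_padOnes h01] at h3
    have h4 : taylor (levelFun ρ 0) = taylor (schurGen (ρ 0)) *
        taylor (fun x : Fin (m 0) → ℂ => levelFun ρ (Fin.succ 0) (padOnes x)) := by
      rw [← taylor_mul (hg 0) (analyticAt_comp_padOnes (hH (Fin.succ 0))), levelFun_zero_succ,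
        mul_comm]
      rfl
    rw [chainSeries, h4, mul_assoc, ← mul_sub, chainPoly]
    refine Ideal.mul_mem_left _ _ (highOrder_antitone ?_ h3)
    omega

theorem constantCoeff_seriesEval (m : ℕ) (P : MvPolynomial ℕ ℂ) :
    MvPowerSeries.constantCoeff (seriesEval m P) = MvPolynomial.constantCoeff P := by
  induction P using MvPolynomial.induction_on with
  | C a => rw [← MvPolynomial.algebraMap_eq, AlgHom.commutes]; simp [MvPowerSeries.algebraMap_apply]
  | add p q hp hq => rw [map_add, map_add, map_add, hp, hq]
  | mul_X p r hp => rw [map_mul, map_mul, powerEval_X]; simp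

/-- The integral of a product of functions of the levels. -/
theorem integral_jointLaw_prod {n : ℕ} {m : Fin (n + 1) → ℕ} (hm : Monotone m)
    (ρ : ∀ t, PMF (Signature (m t))) (hρ : ∀ t, SchurConvergent (ρ t))
    (hg : ∀ t, AnalyticAt ℂ (schurGen (ρ t)) 1) (hH : ∀ t, AnalyticAt ℂ (levelFun ρ t) 1)
    (f : ∀ t, Signature (m t) → ℝ)
    (Φ : ∀ t, MvPowerSeries (Fin (m t)) ℂ →L[ℂ] MvPowerSeries (Fin (m t)) ℂ)
    (hΦ : ∀ t l, Φ t (taylor (normSchur l)) = (f t l : ℂ) • taylor (normSchur l))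
    (A : Fin (n + 1) → MvPolynomial ℕ ℂ → MvPolynomial ℕ ℂ) (D : ℕ) (K : Fin (n + 1) → ℕ)
    (hrep : ∀ t e f P, e ≤ D → K t ≤ e →
      f - taylor (levelFun ρ t) * seriesEval (m t) P ∈ highOrder (m t) e →
      Φ t f - taylor (levelFun ρ t) * seriesEval (m t) (A t P) ∈ highOrder (m t) (e - K t))
    (hK : ∑ t, K t < D)
    (hsum : Summable fun l : ∀ t, Signature (m t) => (jointWeight ρ l).toReal * ‖∏ t, f t (l t)‖) :
    ((∫ l, ∏ t, f t (l t) ∂(jointLaw ρ) : ℝ) : ℂ) =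
      MvPolynomial.constantCoeff (A 0 (chainPoly A)) := by
  have hsum' : Summable fun l : ∀ t, Signature (m t) =>
      (jointWeight ρ l).toReal * ∏ t, f t (l t) := by
    refine Summable.of_norm (hsum.congr fun l => ?_)
    rw [norm_mul, Real.norm_of_nonneg ENNReal.toReal_nonneg]
  obtain ⟨r, hr, hs⟩ := exists_hasSum_prod hm ρ hρ hg f Φ hΦ (Or.inr hsum')
  have h1 := hasSum_integral_sum_dirac (x := id) (f := fun l : ∀ t, Signature (m t) =>
    ∏ t, f t (l t)) (jointWeight_ne_top ρ) hsum
  have h2 : ∫ l, ∏ t, f t (l t) ∂(jointLaw ρ) = r := h1.unique hs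
  rw [h2, ← hr]
  rw [Fin.sum_univ_succ] at hK
  have h3 := hrep 0 _ _ _ (Nat.sub_le _ _) (by omega)
    (chainSeries_sub_mem hm ρ hg hH Φ A D K hrep (by omega))
  rw [mem_highOrder_iff] at h3
  -- The total loss is less than `D`, so the constant coefficient is still exact. Since H_0 is 1 at
  -- (1, …, 1), only the constant coefficient of the polynomial remains.
  have h4 := h3 0 (by rw [map_zero]; omega)
  rw [MvPowerSeries.coeff_zero_eq_constantCoeff_apply, map_sub, map_mul, constantCoeff_taylor,
    levelFun_one, one_mul, constantCoeff_seriesEval, sub_eq_zero] at h4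
  exact h4

end Moments

/-! ### Mixed moments of functions of the levels -/

section Words

variable {n : ℕ} {ι : Type*}

/-- The elements of a list, sorted by their levels. -/
def levelSort (τ : ι → Fin (n + 1)) (w : List ι) : List ι :=
  (List.finRange (n + 1)).flatMap fun t => w.filter fun j => τ j = t

theorem foldr_flatMap {κ α : Type*} (L : List κ) (g : κ → List ι) (B : ι → α → α) (x : α) :
    (L.flatMap g).foldr B x = L.foldr (fun t y => (g t).foldr B y) x := by
  induction L with
  | nil => rfl
  | cons t L ih => rw [List.flatMap_cons, List.foldr_append, ih, List.foldr_cons]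

theorem chainPoly_eq_foldr (A : Fin (n + 1) → MvPolynomial ℕ ℂ → MvPolynomial ℕ ℂ) :
    A 0 (chainPoly A) = (List.finRange (n + 1)).foldr A 1 := by
  induction n with
  | zero => simp [chainPoly, List.finRange_succ]
  | succ n ih =>
    rw [List.finRange_succ, List.foldr_cons, List.foldr_map, ← ih fun t => A t.succ, chainPoly]

theorem foldr_levelSort (τ : ι → Fin (n + 1)) (w : List ι)
    (B : Fin (n + 1) → ι → MvPolynomial ℕ ℂ → MvPolynomial ℕ ℂ) (x : MvPolynomial ℕ ℂ) :
    (levelSort τ w).foldr (fun j => B (τ j) j) x =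
      (List.finRange (n + 1)).foldr (fun t y => (w.filter fun j => τ j = t).foldr (B t) y) x := by
  rw [levelSort, foldr_flatMap]
  congr 1
  funext t y
  refine List.foldr_ext _ _ _ fun j hj z => ?_
  rw [of_decide_eq_true (List.mem_filter.1 hj).2]

theorem prod_filter_level {M : Type*} [CommMonoid M] (τ : ι → Fin (n + 1)) (w : List ι)
    (g : Fin (n + 1) → ι → M) :
    ∏ t, ((w.filter fun j => τ j = t).map (g t)).prod = (w.map fun j => g (τ j) j).prod := by
  induction w with
  | nil => simp
  | cons j w ih =>
    have h : ∀ t, (((j :: w).filter fun j => τ j = t).map (g t)).prod =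
        (if τ j = t then g t j else 1) * ((w.filter fun j => τ j = t).map (g t)).prod := by
      intro t
      by_cases h : τ j = t <;> simp [h]
    simp only [h, Finset.prod_mul_distrib, ih, Finset.prod_ite_eq, Finset.mem_univ, if_true,
      List.map_cons, List.prod_cons]

theorem sum_filter_level (τ : ι → Fin (n + 1)) (w : List ι) (k : ι → ℕ) :
    ∑ t, ((w.filter fun j => τ j = t).map k).sum = (w.map k).sum := by
  have := prod_filter_level (M := Multiplicative ℕ) τ w fun _ j => Multiplicative.ofAdd (k j)
  exact this

theorem perm_levelSort (τ : ι → Fin (n + 1)) (w : List ι) : (levelSort τ w).Perm w := by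
  classical
  rw [List.perm_iff_count]
  intro a
  rw [levelSort, List.count_flatMap]
  have h : (List.count a ∘ fun t => w.filter fun j => τ j = t) =
      fun t => if t = τ a then List.count a w else 0 := by
    funext t
    by_cases h : t = τ a
    · subst h
      simp [List.count_filter]
    · rw [Function.comp_apply, if_neg h, List.count_eq_zero]
      intro h1
      exact h (of_decide_eq_true (List.mem_filter.1 h1).2).symm
  rw [h, ← Fin.sum_univ_def]
  simp

theorem pairwise_levelSort (τ : ι → Fin (n + 1)) (w : List ι) :
    (levelSort τ w).Pairwise fun i j => τ i ≤ τ j := by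
  rw [levelSort, List.pairwise_flatMap]
  constructor
  · intro t _
    refine (List.pairwise_of_forall_mem_list fun i hi j hj => ?_)
    rw [of_decide_eq_true (List.mem_filter.1 hi).2, of_decide_eq_true (List.mem_filter.1 hj).2]
  · refine List.Pairwise.imp ?_ (List.pairwise_lt_finRange _)
    intro s t hst i hi j hj
    rw [of_decide_eq_true (List.mem_filter.1 hi).2, of_decide_eq_true (List.mem_filter.1 hj).2]
    exact hst.le

end Words

/-! ### Finiteness of moments and the operator formula for words of power sums -/

section Moments

open scoped MvPowerSeries.WithPiTopology

variable {Ω : Type*}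

/-- All absolute moments of `h` with respect to the weights `W` are finite. -/
def FiniteMoments (W h : Ω → ℝ) : Prop := ∀ r : ℕ, Summable fun x => W x * |h x| ^ r

theorem FiniteMoments.mul {W h g : Ω → ℝ} (hW : ∀ x, 0 ≤ W x) (hh : FiniteMoments W h)
    (hg : FiniteMoments W g) : FiniteMoments W fun x => h x * g x := by
  intro r
  refine Summable.of_nonneg_of_le (fun x => mul_nonneg (hW x) (by positivity)) (fun x => ?_)
    ((hh (r * 2)).add (hg (r * 2)))
  rw [← mul_add]
  refine mul_le_mul_of_nonneg_left ?_ (hW x)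
  rw [abs_mul, mul_pow, pow_mul, pow_mul]
  have h1 : 0 ≤ |h x| ^ r := by positivity
  have h2 : 0 ≤ |g x| ^ r := by positivity
  nlinarith [sq_nonneg (|h x| ^ r - |g x| ^ r), mul_nonneg h1 h2]

theorem FiniteMoments.of_even {W h : Ω → ℝ} (hW : ∀ x, 0 ≤ W x)
    (hh : ∀ r : ℕ, Summable fun x => W x * h x ^ (2 * r)) : FiniteMoments W h := by
  intro r
  refine Summable.of_nonneg_of_le (fun x => mul_nonneg (hW x) (by positivity)) (fun x => ?_)
    ((hh 0).add (hh r))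
  rw [← mul_add]
  refine mul_le_mul_of_nonneg_left ?_ (hW x)
  rw [mul_zero, pow_zero, mul_comm 2 r, pow_mul, ← sq_abs, ← abs_pow]
  nlinarith [sq_nonneg (|h x| ^ r - 1), abs_pow (h x) r, abs_nonneg (h x ^ r)]

theorem FiniteMoments.list_prod {ι : Type*} {W : Ω → ℝ} (hW : ∀ x, 0 ≤ W x) (hs : Summable W)
    (w : List ι) {h : ι → Ω → ℝ} (hh : ∀ j ∈ w, FiniteMoments W (h j)) :
    FiniteMoments W fun x => (w.map fun j => h j x).prod := by
  induction w with
  | nil => intro r; simpa using hs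
  | cons j w ih =>
    simp only [List.map_cons, List.prod_cons]
    exact (hh j List.mem_cons_self).mul hW (ih fun i hi => hh i (List.mem_cons_of_mem _ hi))

variable {n : ℕ} {m : Fin (n + 1) → ℕ}

/-- Even powers are nonnegative, so the operator identity itself yields their summability, with the
iterated operator on one level and the identity on the others. Odd absolute moments are dominated by
even ones. -/
theorem finiteMoments_level (hm : Monotone m)
    (ρ : ∀ t, PMF (Signature (m t))) (hρ : ∀ t, SchurConvergent (ρ t))
    (hg : ∀ t, AnalyticAt ℂ (schurGen (ρ t)) 1) (φ : ∀ t, Signature (m t) → ℝ)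
    (Ψ : ∀ t, MvPowerSeries (Fin (m t)) ℂ →L[ℂ] MvPowerSeries (Fin (m t)) ℂ)
    (hΨ : ∀ t l, Ψ t (taylor (normSchur l)) = (φ t l : ℂ) • taylor (normSchur l))
    (t : Fin (n + 1)) :
    FiniteMoments (fun l : ∀ t, Signature (m t) => (jointWeight ρ l).toReal) fun l => φ t (l t) := by
  refine FiniteMoments.of_even (fun _ => ENNReal.toReal_nonneg) fun r => ?_
  set e : Fin (n + 1) → ℕ := fun t' => if t' = t then 2 * r else 0 with he
  have hpow : ∀ (e : ℕ) t l, (Ψ t ^ e) (taylor (normSchur l)) =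
      ((φ t l ^ e : ℝ) : ℂ) • taylor (normSchur l) := by
    intro e t l
    induction e with
    | zero => simp
    | succ e ih =>
      rw [pow_succ', mul_apply_eq_comp, ih, map_smul, hΨ, smul_smul, pow_succ]
      push_cast
      rfl
  obtain ⟨x, -, hx⟩ := exists_hasSum_prod hm ρ hρ hg (fun t' l => φ t' l ^ e t')
    (fun t' => Ψ t' ^ e t') (fun t' l => hpow _ _ _) (Or.inl fun t' l => by
      by_cases h : t' = t
      · simp only [he, h, if_true]; rw [pow_mul]; positivity
      · simp [he, h])
  refine hx.summable.congr fun l => ?_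
  rw [Finset.prod_eq_single t]
  · simp [he]
  · intro t' _ h; simp [he, h]
  · simp

theorem FiniteMoments.integrable {ρ : ∀ t, PMF (Signature (m t))}
    {h : (∀ t, Signature (m t)) → ℝ}
    (hh : FiniteMoments (fun l : ∀ t, Signature (m t) => (jointWeight ρ l).toReal) h) :
    Integrable h (jointLaw ρ) := by
  have h1 := hh 1
  simp only [pow_one] at h1
  exact (integrable_sum_dirac_iff (x := id) (jointWeight_ne_top ρ)).2 h1

variable {ι : Type*}

/-- The mixed moments of functions of the levels in terms of operators on polynomials. -/
theorem integral_jointLaw_word (hm : Monotone m)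
    (ρ : ∀ t, PMF (Signature (m t))) (hρ : ∀ t, SchurConvergent (ρ t))
    (hg : ∀ t, AnalyticAt ℂ (schurGen (ρ t)) 1) (hH : ∀ t, AnalyticAt ℂ (levelFun ρ t) 1)
    (τ : ι → Fin (n + 1)) (φ : ∀ t, ι → Signature (m t) → ℝ)
    (Ψ : ∀ t, ι → MvPowerSeries (Fin (m t)) ℂ →L[ℂ] MvPowerSeries (Fin (m t)) ℂ)
    (hΨ : ∀ t j l, Ψ t j (taylor (normSchur l)) = (φ t j l : ℂ) • taylor (normSchur l))
    (B : Fin (n + 1) → ι → MvPolynomial ℕ ℂ → MvPolynomial ℕ ℂ) (D : ℕ) (k : ι → ℕ)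
    (hrep : ∀ t j e f P, e ≤ D → k j ≤ e →
      f - taylor (levelFun ρ t) * seriesEval (m t) P ∈ highOrder (m t) e →
      Ψ t j f - taylor (levelFun ρ t) * seriesEval (m t) (B t j P) ∈ highOrder (m t) (e - k j))
    (w : List ι) (hD : (w.map k).sum < D) :
    ((∫ l, (w.map fun j => φ (τ j) j (l (τ j))).prod ∂(jointLaw ρ) : ℝ) : ℂ) =
      MvPolynomial.constantCoeff ((levelSort τ w).foldr (fun j => B (τ j) j) 1) := by
  -- The letters are collected by level, since the formula for the chain allows one function and one
  -- operator per level. The composite of the operators of a level has the product of the functions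
  -- as eigenvalue.
  set v : Fin (n + 1) → List ι := fun t => w.filter fun j => τ j = t with hv
  have hprod : ∀ l : ∀ t, Signature (m t), ∏ t, ((v t).map fun j => φ t j (l t)).prod =
      (w.map fun j => φ (τ j) j (l (τ j))).prod :=
    fun l => prod_filter_level τ w fun t j => φ t j (l t)
  have hfold : ∀ t (u : List ι) l, (u.foldr (fun j => Ψ t j) (taylor (normSchur l))) =
      (((u.map fun j => φ t j l).prod : ℝ) : ℂ) • taylor (normSchur l) := by
    intro t u l
    induction u with
    | nil => simp
    | cons j u ih =>
      rw [List.foldr_cons, ih, map_smul, hΨ, smul_smul, List.map_cons, List.prod_cons, mul_comm]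
      push_cast
      rfl
  have hcomp : ∀ t (u : List ι) f, (u.foldr (fun j T => (Ψ t j).comp T)
      (ContinuousLinearMap.id ℂ _)) f = u.foldr (fun j => Ψ t j) f := by
    intro t u f
    induction u with
    | nil => rfl
    | cons j u ih => rw [List.foldr_cons, ContinuousLinearMap.comp_apply, ih, List.foldr_cons]
  have h := integral_jointLaw_prod hm ρ hρ hg hH (fun t l => ((v t).map fun j => φ t j l).prod)
    (fun t => (v t).foldr (fun j T => (Ψ t j).comp T) (ContinuousLinearMap.id ℂ _))
    (fun t l => by rw [hcomp, hfold])
    (fun t => (v t).foldr (B t)) D (fun t => ((v t).map k).sum) (fun t e f P he => by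
      rw [hcomp]
      induction v t with
      | nil => intro _ h; simpa using h
      | cons j u ih =>
        intro hk h
        rw [List.map_cons, List.sum_cons] at hk
        rw [List.foldr_cons, List.foldr_cons, List.map_cons, List.sum_cons, add_comm, Nat.sub_add_eq]
        exact hrep t j _ _ _ (by omega) (by omega) (ih (by omega) h))
    (by rw [sum_filter_level]; exact hD) ?_
  · simp only [hprod] at h
    rw [h, foldr_levelSort, ← chainPoly_eq_foldr fun t => (v t).foldr (B t)]
  · simp only [hprod]
    have h1 := FiniteMoments.list_prod (W := fun l : ∀ t, Signature (m t) =>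
      (jointWeight ρ l).toReal) (fun _ => ENNReal.toReal_nonneg)
      (hasSum_jointWeight hm ρ hρ hg).summable w (h := fun j l => φ (τ j) j (l (τ j)))
      (fun j _ => finiteMoments_level hm ρ hρ hg (fun t => φ t j) (fun t => Ψ t j)
        (fun t => hΨ t j) (τ j)) 1
    simpa only [pow_one, Real.norm_eq_abs] using h1

end Moments

/-! ### Limits of the mixed moments -/

section LimitMoments

open scoped MvPowerSeries.WithPiTopology

theorem HasLimits.analyticAt {m : ℕ → ℕ} {F : ∀ N, (Fin (m N) → ℂ) → ℂ} {c : ℕ → ℝ}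
    {d : ℕ → ℕ → ℝ} (h : HasLimits m F c d) (N : ℕ) : AnalyticAt ℂ (F N) 1 := by
  refine AnalyticAt.congr (h.holomorphic N).cexp ?_
  filter_upwards [h.ne_zero N] with x hx
  exact Complex.exp_log hx

theorem tendsto_levelSize {n : ℕ} {a : Fin (n + 1) → ℝ} (ha : ∀ t, 0 < a t) (t : Fin (n + 1)) :
    Tendsto (fun N : ℕ => (N : ℂ)⁻¹ * (levelSize a N t : ℂ)) atTop (𝓝 (a t : ℂ)) := by
  have h := ((tendsto_nat_floor_mul_div_atTop (ha t).le).comp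
    (tendsto_natCast_atTop_atTop (R := ℝ)))
  have h1 := (Complex.continuous_ofReal.tendsto _).comp h
  refine h1.congr fun N => ?_
  simp only [Function.comp_apply, levelSize]
  push_cast
  rw [div_eq_mul_inv, mul_comm]

theorem levelSize_monotone {n : ℕ} {a : Fin (n + 1) → ℝ} (hmono : Monotone a) (N : ℕ) :
    Monotone (levelSize a N) := fun _ _ h =>
  Nat.floor_le_floor (mul_le_mul_of_nonneg_right (hmono h) (Nat.cast_nonneg N))

/-- The operator `P ↦ (ψ - ψ(0)) P + Γ P`. -/
def centredOp (ψ : MvPolynomial ℕ ℂ)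
    (Γ : Derivation ℂ (MvPolynomial ℕ ℂ) (MvPolynomial ℕ ℂ)) :
    MvPolynomial ℕ ℂ →ₗ[ℂ] MvPolynomial ℕ ℂ :=
  LinearMap.mulLeft ℂ (ψ - MvPolynomial.C (MvPolynomial.constantCoeff ψ)) + Γ.toLinearMap

theorem centredOp_apply (ψ : MvPolynomial ℕ ℂ)
    (Γ : Derivation ℂ (MvPolynomial ℕ ℂ) (MvPolynomial ℕ ℂ)) (P : MvPolynomial ℕ ℂ) :
    centredOp ψ Γ P = (ψ - MvPolynomial.C (MvPolynomial.constantCoeff ψ)) * P + Γ P := rfl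

/-- The asymptotic scalar E_N is replaced by the exact mean, the constant coefficient of V_N 1.
Applying the convergence to P = 1 shows that the rescaled difference tends to ψ(0), because Γ 1 = 0;
this is what `centredOp` subtracts. -/
theorem finTendsto_centred {V : ℕ → MvPolynomial ℕ ℂ →ₗ[ℂ] MvPolynomial ℕ ℂ} {x : ℕ → ℂ}
    {E : ℕ → ℂ} {ψ : MvPolynomial ℕ ℂ}
    {Γ : Derivation ℂ (MvPolynomial ℕ ℂ) (MvPolynomial ℕ ℂ)}
    (h : ∀ P, FinTendsto (fun N => x N • (V N P - E N • P)) (ψ * P + Γ P))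
    (P : MvPolynomial ℕ ℂ) :
    FinTendsto (fun N => x N • (V N P - (MvPolynomial.constantCoeff (V N 1)) • P))
      (centredOp ψ Γ P) := by
  have h1 := (h 1).tendsto (MvPolynomial.lcoeff ℂ 0)
  have h2 := FinTendsto.sub (h P) (FinTendsto.smul h1 (FinTendsto.const P))
  refine FinTendsto.of_eq h2 (fun N => ?_) ?_
  · simp only [MvPolynomial.lcoeff_apply, MvPolynomial.constantCoeff_eq, smul_sub, smul_smul,
      MvPolynomial.coeff_sub, MvPolynomial.coeff_smul, smul_eq_mul, sub_smul]
    simp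
  · rw [centredOp_apply]
    simp only [MvPolynomial.lcoeff_apply, MvPolynomial.constantCoeff_eq, Derivation.map_one_eq_zero,
      mul_one, add_zero, MvPolynomial.smul_eq_C_mul]
    ring

theorem finTendsto_foldr {V ι : Type*} [AddCommGroup V] [Module ℂ V] {B : ℕ → ι → V →ₗ[ℂ] V}
    {B₀ : ι → V →ₗ[ℂ] V} (h : ∀ j v, FinTendsto (fun N => B N j v) (B₀ j v)) (w : List ι) (v : V) :
    FinTendsto (fun N => w.foldr (fun j => B N j) v) (w.foldr (fun j => B₀ j) v) := by
  induction w with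
  | nil => exact FinTendsto.const v
  | cons j w ih => exact FinTendsto.map_op (h j) ih

variable {n : ℕ}

/-- The operator that multiplies Schur functions by `x (p_k - y)`. -/
def affineOp (m k : ℕ) (x y : ℝ) : MvPowerSeries (Fin m) ℂ →L[ℂ] MvPowerSeries (Fin m) ℂ :=
  (x : ℂ) • (powerOp m k - (y : ℂ) • ContinuousLinearMap.id ℂ (MvPowerSeries (Fin m) ℂ))

theorem affineOp_apply (m k : ℕ) (x y : ℝ) (f : MvPowerSeries (Fin m) ℂ) :
    affineOp m k x y f = (x : ℂ) • (powerOp m k f - (y : ℂ) • f) := rfl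

theorem affineOp_taylor_normSchur {m : ℕ} (k : ℕ) (x y : ℝ) (l : Signature m) :
    affineOp m k x y (taylor (normSchur l)) =
      ((x * (signaturePower k l - y) : ℝ) : ℂ) • taylor (normSchur l) := by
  rw [affineOp_apply, powerOp_taylor_normSchur, ← sub_smul, smul_smul]
  push_cast
  rfl

theorem affineOp_sub_mem {m D e k : ℕ} (he : e ≤ D) (hk : k ≤ e)
    {T : MvPowerSeries (Fin m) ℂ} {h : Polynomial (MvPolynomial ℕ ℂ)}
    (hT : ∀ i, MvPowerSeries.pderiv ℂ i T - T * seriesEvalAt i h ∈ highOrder m D)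
    (x y : ℝ) {f : MvPowerSeries (Fin m) ℂ} {P : MvPolynomial ℕ ℂ}
    (hf : f - T * seriesEval m P ∈ highOrder m e) :
    affineOp m k x y f - T * seriesEval m ((x : ℂ) • (symbolPowerOp m h k P - (y : ℂ) • P)) ∈ highOrder m (e - k) := by
  have h1 := sub_mem (powerOp_sub_mem he hk hT hf)
    (Ideal.mul_mem_left _ (algebraMap ℂ _ (y : ℂ)) (highOrder_antitone (Nat.sub_le e k) hf))
  have h2 := Ideal.mul_mem_left _ (algebraMap ℂ _ (x : ℂ)) h1
  have e1 : affineOp m k x y f -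
      T * seriesEval m ((x : ℂ) • (symbolPowerOp m h k P - (y : ℂ) • P)) =
      algebraMap ℂ _ (x : ℂ) * (powerOp m k f - T * seriesEval m (symbolPowerOp m h k P) -
        algebraMap ℂ _ (y : ℂ) * (f - T * seriesEval m P)) := by
    rw [map_smul, map_sub, map_smul, affineOp_apply]
    simp only [Algebra.smul_def]
    ring
  rw [e1]
  exact h2

/-- The limit of the operator that belongs to the centred power sum of degree `k` on a level. -/
def levelOp (a : ℂ) (c : ℕ → ℝ) (d : ℕ → ℕ → ℝ) (D k : ℕ) :
    MvPolynomial ℕ ℂ →ₗ[ℂ] MvPolynomial ℕ ℂ :=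
  centredOp (limitForm a (limitAlpha a c D) (limitBeta d D) k) (limitDeriv a (limitAlpha a c D) k)

variable {a : Fin (n + 1) → ℝ} {ρ : ∀ (N : ℕ) (t : Fin (n + 1)), PMF (Signature (levelSize a N t))}
  {c : Fin (n + 1) → ℕ → ℝ} {d : Fin (n + 1) → ℕ → ℕ → ℝ}

theorem integral_affine_word (hmono : Monotone a)
    (hρ : ∀ t, IsAppropriateMeasure (fun N => levelSize a N t) (fun N => ρ N t))
    (h : ∀ t, HasLimits (fun N => levelSize a N t) (fun N => levelFun (ρ N) t) (c t) (d t))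
    (w : List (Fin (n + 1) × ℕ+)) {D : ℕ} (hD : (w.map fun q => (q.2 : ℕ)).sum < D) (N : ℕ)
    (x y : Fin (n + 1) × ℕ+ → ℝ) :
    ((∫ l, (w.map fun q => x q * (powerSum q.1 q.2 l - y q)).prod ∂(jointLaw (ρ N)) : ℝ) : ℂ) =
      MvPolynomial.constantCoeff ((levelSort Prod.fst w).foldr (fun q P => (x q : ℂ) •
        (symbolPowerOp (levelSize a N q.1) (symbolDeriv
          (logPoly (fun N => levelFun (ρ N) q.1) D N)) q.2 P - (y q : ℂ) • P)) 1) := by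
  refine integral_jointLaw_word (levelSize_monotone hmono N) (ρ N) (fun t => (hρ t).1 N)
    (fun t => ?_) (fun t => (h t).analyticAt N) Prod.fst
    (fun t q l => x q * (signaturePower q.2 l - y q))
    (fun t q => affineOp (levelSize a N t) q.2 (x q) (y q))
    (fun t q l => affineOp_taylor_normSchur _ _ _ _) (fun t q P => (x q : ℂ) • (symbolPowerOp (levelSize a N t)
      (symbolDeriv (logPoly (fun N => levelFun (ρ N) t) D N)) q.2 P - (y q : ℂ) • P))
    D (fun q => q.2) (fun t q e f P he hk hf => ?_) w hD
  · obtain ⟨c', d', h'⟩ := (hρ t).2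
    exact h'.analyticAt N
  · exact affineOp_sub_mem he hk (pderiv_taylor_sub_mem (h t) D N) _ _ hf

/-- The centred and rescaled power sums. -/
def scaledSum (ρ : ∀ (N : ℕ) (t : Fin (n + 1)), PMF (Signature (levelSize a N t))) (N : ℕ)
    (q : Fin (n + 1) × ℕ+) (l : ∀ t, Signature (levelSize a N t)) : ℝ :=
  ((N : ℝ) ^ (q.2 : ℕ))⁻¹ * (powerSum q.1 q.2 l - ∫ l', powerSum q.1 q.2 l' ∂(jointLaw (ρ N)))

theorem integral_powerSum (hmono : Monotone a)
    (hρ : ∀ t, IsAppropriateMeasure (fun N => levelSize a N t) (fun N => ρ N t))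
    (h : ∀ t, HasLimits (fun N => levelSize a N t) (fun N => levelFun (ρ N) t) (c t) (d t))
    (q : Fin (n + 1) × ℕ+) {D : ℕ} (hD : (q.2 : ℕ) < D) (N : ℕ) :
    ((∫ l, powerSum q.1 q.2 l ∂(jointLaw (ρ N)) : ℝ) : ℂ) =
      MvPolynomial.constantCoeff (symbolPowerOp (levelSize a N q.1) (symbolDeriv
          (logPoly (fun N => levelFun (ρ N) q.1) D N)) q.2 1) := by
  have h1 := integral_affine_word hmono hρ h [q] (D := D) (by simpa using hD) N (fun _ => 1)
    fun _ => 0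
  have h2 : levelSort Prod.fst [q] = [q] := List.perm_singleton.1 (perm_levelSort _ _)
  rw [h2] at h1
  simpa using h1

/-- For each N the moment equals the constant coefficient of a word in centred operators, exactly
and with a truncation `D` independent of N. Therefore it suffices that each letter converges. -/
theorem tendsto_integral_word (ha : ∀ t, 0 < a t) (hmono : Monotone a)
    (hρ : ∀ t, IsAppropriateMeasure (fun N => levelSize a N t) (fun N => ρ N t))
    (h : ∀ t, HasLimits (fun N => levelSize a N t) (fun N => levelFun (ρ N) t) (c t) (d t))
    (w : List (Fin (n + 1) × ℕ+)) {D : ℕ} (hD2 : 2 ≤ D)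
    (hD : (w.map fun q => (q.2 : ℕ)).sum < D) :
    Tendsto (fun N => ((∫ l, (w.map fun q => scaledSum ρ N q l).prod ∂(jointLaw (ρ N)) : ℝ) : ℂ))
      atTop (𝓝 (MvPolynomial.constantCoeff ((levelSort Prod.fst w).foldr
        (fun q => levelOp (a q.1) (c q.1) (d q.1) D q.2) 1))) := by
  set V : ℕ → Fin (n + 1) × ℕ+ → MvPolynomial ℕ ℂ →ₗ[ℂ] MvPolynomial ℕ ℂ := fun N q =>
    symbolPowerOp (levelSize a N q.1) (symbolDeriv
          (logPoly (fun N => levelFun (ρ N) q.1) D N)) q.2 with hV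
  set B : ℕ → Fin (n + 1) × ℕ+ → MvPolynomial ℕ ℂ →ₗ[ℂ] MvPolynomial ℕ ℂ := fun N q =>
    (((N : ℂ)⁻¹) ^ (q.2 : ℕ)) • (V N q - (MvPolynomial.constantCoeff (V N q 1)) • LinearMap.id)
    with hB
  have hlim : ∀ q P, FinTendsto (fun N => B N q P) (levelOp (a q.1) (c q.1) (d q.1) D q.2 P) := by
    intro q P
    obtain ⟨t, k⟩ := q
    obtain ⟨E, hE⟩ := finTendsto_symbolPowerOp (a := (a t : ℂ))
      (by exact_mod_cast (ha t).ne') (tendsto_levelSize ha t) (h t) hD2 ((k : ℕ) - 1)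
    rw [show (k : ℕ) - 1 + 1 = k from Nat.sub_add_cancel k.2] at hE
    exact finTendsto_centred hE P
  have hw := (finTendsto_foldr hlim (levelSort Prod.fst w) 1).tendsto (MvPolynomial.lcoeff ℂ 0)
  simp only [MvPolynomial.lcoeff_apply, ← MvPolynomial.constantCoeff_eq] at hw
  refine hw.congr fun N => ?_
  have h1 := integral_affine_word hmono hρ h w hD N (fun q => ((N : ℝ) ^ (q.2 : ℕ))⁻¹)
    fun q => ∫ l', powerSum q.1 q.2 l' ∂(jointLaw (ρ N))
  simp only [scaledSum]
  rw [h1]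
  congr 1
  refine List.foldr_ext _ _ _ fun q hq P => ?_
  have hq' : (q.2 : ℕ) < D := by
    refine lt_of_le_of_lt ?_ hD
    exact List.single_le_sum (fun _ _ => Nat.zero_le _) _
      (List.mem_map_of_mem ((perm_levelSort _ _).mem_iff.1 hq))
  rw [integral_powerSum hmono hρ h q hq' N]
  simp only [hB, hV, LinearMap.smul_apply, LinearMap.sub_apply, LinearMap.id_apply]
  push_cast
  rw [inv_pow]

theorem finiteMoments_scaledSum (hmono : Monotone a)
    (hρ : ∀ t, IsAppropriateMeasure (fun N => levelSize a N t) (fun N => ρ N t)) (N : ℕ)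
    (q : Fin (n + 1) × ℕ+) : FiniteMoments (fun l => (jointWeight (ρ N) l).toReal)
      (scaledSum ρ N q) := by
  have hg : ∀ t, AnalyticAt ℂ (schurGen (ρ N t)) 1 := fun t => by
    obtain ⟨c', d', h'⟩ := (hρ t).2
    exact h'.analyticAt N
  refine finiteMoments_level (levelSize_monotone hmono N) (ρ N) (fun t => (hρ t).1 N) hg
    (fun t l => ((N : ℝ) ^ (q.2 : ℕ))⁻¹ * (signaturePower q.2 l -
      ∫ l', powerSum q.1 q.2 l' ∂(jointLaw (ρ N))))
    (fun t => affineOp (levelSize a N t) q.2 _ _)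
    (fun t l => affineOp_taylor_normSchur _ _ _ _) q.1

theorem integrable_scaledSum_word (hmono : Monotone a)
    (hρ : ∀ t, IsAppropriateMeasure (fun N => levelSize a N t) (fun N => ρ N t)) (N : ℕ)
    (w : List (Fin (n + 1) × ℕ+)) :
    Integrable (fun l => (w.map fun q => scaledSum ρ N q l).prod) (jointLaw (ρ N)) := by
  have hg : ∀ t, AnalyticAt ℂ (schurGen (ρ N t)) 1 := fun t => by
    obtain ⟨c', d', h'⟩ := (hρ t).2
    exact h'.analyticAt N
  exact (FiniteMoments.list_prod (fun _ => ENNReal.toReal_nonneg)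
    (hasSum_jointWeight (levelSize_monotone hmono N) (ρ N) (fun t => (hρ t).1 N) hg).summable w
    fun q _ => finiteMoments_scaledSum hmono hρ N q).integrable

end LimitMoments

/-! ### The Wick recursion -/

section Wick

variable {ι K : Type*} [CommRing K]

/-- The recursion for the mixed moments of a centred Gaussian vector with covariance `C`. -/
structure IsWick (C : ι → ι → K) (E : List ι → K) : Prop where
  nil : E [] = 1
  cons : ∀ i w, E (i :: w) = ∑ p : Fin w.length, C i (w.get p) * E (w.eraseIdx p)

/-- The recursion pairs a letter only with later ones, so only the values C i j with i before j in
the word enter. This matters because the operator covariance is the true one only for sorted levels.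
-/
theorem IsWick.eq_of_pairwise {C C' : ι → ι → K} {E E' : List ι → K} (h : IsWick C E)
    (h' : IsWick C' E') {w : List ι} (hw : w.Pairwise fun i j => C i j = C' i j) :
    E w = E' w := by
  induction hn : w.length using Nat.strong_induction_on generalizing w with
  | _ n ih =>
    cases w with
    | nil => rw [h.nil, h'.nil]
    | cons i w =>
      rw [h.cons, h'.cons]
      rw [List.pairwise_cons] at hw
      refine Finset.sum_congr rfl fun p _ => ?_
      rw [hw.1 _ (List.get_mem _ _)]
      congr 1
      refine ih _ ?_ (hw.2.sublist (List.eraseIdx_sublist _ _)) rfl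
      rw [List.length_eraseIdx, ← hn, if_pos p.2, List.length_cons]
      omega

/-- Creation and annihilation operators: replace the outermost T_i by D_i under Λ, and move D_i to
the right through the word. Each T_j that is passed contributes the commutator C i j, and finally
D_i kills `e`. -/
theorem isWick_foldr {A : Type*} [AddCommGroup A] [Module K A] {C : ι → ι → K}
    {T D : ι → A →ₗ[K] A} {e : A} {Λ : A →ₗ[K] K} (he : Λ e = 1) (hD : ∀ i, D i e = 0)
    (hTD : ∀ i j x, D i (T j x) = C i j • x + T j (D i x)) (hΛ : ∀ i x, Λ (T i x) = Λ (D i x)) :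
    IsWick C fun w => Λ (w.foldr (fun i => T i) e) := by
  have key : ∀ (i : ι) (w : List ι), D i (w.foldr (fun i => T i) e) =
      ∑ p : Fin w.length, C i (w.get p) • (w.eraseIdx p).foldr (fun i => T i) e := by
    intro i w
    induction w with
    | nil => simpa using hD i
    | cons j w ih =>
      rw [List.foldr_cons, hTD, ih, map_sum]
      simp only [List.length_cons, Fin.sum_univ_succ, map_smul]
      rfl
  refine ⟨he, fun i w => ?_⟩
  rw [List.foldr_cons, hΛ, key, map_sum]
  simp only [map_smul, smul_eq_mul]

theorem IsWick.ofReal {C : ι → ι → ℝ} {E : List ι → ℝ} (h : IsWick C E) :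
    IsWick (fun i j => (C i j : ℂ)) fun w => (E w : ℂ) :=
  ⟨by simp only [h.nil, Complex.ofReal_one], fun i w => by rw [h.cons]; push_cast; rfl⟩

theorem IsWick.comp {κ : Type*} {C : ι → ι → K} {E : List ι → K} (h : IsWick C E) (f : κ → ι) :
    IsWick (fun i j => C (f i) (f j)) fun w => E (w.map f) := by
  refine ⟨h.nil, fun i w => ?_⟩
  simp only [List.map_cons]
  rw [h.cons]
  refine Fintype.sum_equiv (finCongr (by simp)) _ _ fun p => ?_
  simp [List.eraseIdx_map]

end Wick

/-! ### Moments of Gaussian vectors -/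

section Gaussian

theorem iteratedDeriv_exp_sq (n : ℕ) (t : ℝ) :
    iteratedDeriv (n + 2) (fun t : ℝ => Real.exp (t ^ 2 / 2)) t =
      t * iteratedDeriv (n + 1) (fun t : ℝ => Real.exp (t ^ 2 / 2)) t +
        (n + 1) * iteratedDeriv n (fun t : ℝ => Real.exp (t ^ 2 / 2)) t := by
  set f : ℝ → ℝ := fun t => Real.exp (t ^ 2 / 2) with hf
  have hsmooth : ContDiff ℝ ⊤ f := by fun_prop
  have hd : ∀ n t, HasDerivAt (iteratedDeriv n f) (iteratedDeriv (n + 1) f t) t := by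
    intro n t
    rw [iteratedDeriv_succ]
    exact ((hsmooth.differentiable_iteratedDeriv n (by exact_mod_cast WithTop.coe_lt_top _)) t).hasDerivAt
  have h1 : ∀ t, iteratedDeriv 1 f t = t * f t := by
    intro t
    rw [iteratedDeriv_one]
    have : HasDerivAt f (Real.exp (t ^ 2 / 2) * (2 * t / 2)) t := by
      have := ((hasDerivAt_pow 2 t).div_const 2).exp
      simpa using this
    rw [this.deriv]
    simp only [hf]
    ring
  induction n generalizing t with
  | zero =>
    rw [iteratedDeriv_succ]
    have : iteratedDeriv 1 f = fun t => t * f t := funext h1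
    have h2 : HasDerivAt (fun t => t * f t) (1 * f t + t * iteratedDeriv 1 f t) t := by
      have h3 := (hd 0 t)
      rw [iteratedDeriv_zero] at h3
      exact (hasDerivAt_id t).mul h3
    rw [zero_add, this, h2.deriv, this]
    simp
    ring
  | succ n ih =>
    rw [iteratedDeriv_succ]
    have h2 : iteratedDeriv (n + 2) f = fun t => t * iteratedDeriv (n + 1) f t +
        (n + 1) * iteratedDeriv n f t := funext ih
    have h3 := ((hasDerivAt_id t).mul (hd (n + 1) t)).add ((hd n t).const_mul ((n : ℝ) + 1))
    have h4 : deriv (iteratedDeriv (n + 2) f) t = 1 * iteratedDeriv (n + 1) f t +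
        id t * iteratedDeriv (n + 1 + 1) f t + (n + 1) * iteratedDeriv (n + 1) f t := by
      refine Eq.trans ?_ h3.deriv
      congr 1
    rw [show n + 1 + 1 = n + 2 from rfl, h4]
    simp only [id, one_mul]
    push_cast
    ring

/-- The moments are the derivatives at 0 of exp(t² / 2), whose recursion comes from f' = t f. For n
= 0 the truncated exponent is harmless, as the factor n vanishes. -/
theorem integral_pow_gaussianReal_succ (n : ℕ) :
    ∫ x, x ^ (n + 1) ∂(gaussianReal 0 1) = n * ∫ x, x ^ (n - 1) ∂(gaussianReal 0 1) := by
  have h : ∀ n, ∫ x, x ^ n ∂(gaussianReal 0 1) =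
      iteratedDeriv n (fun t : ℝ => Real.exp (t ^ 2 / 2)) 0 := by
    intro n
    have h1 : mgf id (gaussianReal 0 1) = fun t : ℝ => Real.exp (t ^ 2 / 2) := by
      rw [mgf_id_gaussianReal]
      funext t
      simp
    rw [← h1, iteratedDeriv_mgf_zero (by simp [integrableExpSet_id_gaussianReal])]
    rfl
  cases n with
  | zero =>
    simp
  | succ n =>
    rw [h, h, iteratedDeriv_exp_sq]
    simp

theorem integrable_pow_gaussianReal (n : ℕ) : Integrable (fun x => x ^ n) (gaussianReal 0 1) := by
  have h := integrable_pow_of_mem_interior_integrableExpSet (X := id) (μ := gaussianReal 0 1)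
    (by simp [integrableExpSet_id_gaussianReal]) n
  simpa using h

variable {ι : Type*} [Fintype ι]

theorem integrable_eval_pi_gaussianReal (P : MvPolynomial ι ℝ) :
    Integrable (fun x => MvPolynomial.eval x P) (Measure.pi fun _ : ι => gaussianReal 0 1) := by
  simp only [MvPolynomial.eval_eq']
  refine integrable_finsetSum _ fun e _ => Integrable.const_mul ?_ _
  exact Integrable.fintype_prod fun i => integrable_pow_gaussianReal (e i)

/-- The expectation of a polynomial in independent standard Gaussian variables. -/
def gaussianMean : MvPolynomial ι ℝ →ₗ[ℝ] ℝ where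
  toFun P := ∫ x, MvPolynomial.eval x P ∂(Measure.pi fun _ : ι => gaussianReal 0 1)
  map_add' P Q := by
    simp only [map_add]
    exact integral_add (integrable_eval_pi_gaussianReal P) (integrable_eval_pi_gaussianReal Q)
  map_smul' c P := by
    simp only [MvPolynomial.smul_eval, integral_const_mul, RingHom.id_apply, smul_eq_mul]

theorem gaussianMean_monomial (e : ι →₀ ℕ) (c : ℝ) : gaussianMean (MvPolynomial.monomial e c) =
    c * ∏ i, ∫ x, x ^ e i ∂(gaussianReal 0 1) := by
  rw [gaussianMean, LinearMap.coe_mk, AddHom.coe_mk, ← integral_fintype_prod_eq_prod,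
    ← integral_const_mul]
  simp only [MvPolynomial.eval_monomial, Finsupp.prod_fintype _ _ fun _ => pow_zero _]

/-- Gaussian integration by parts, reduced to the one-dimensional moment recursion by factoring the
mean of a monomial. -/
theorem gaussianMean_X_mul (i : ι) (P : MvPolynomial ι ℝ) :
    gaussianMean (MvPolynomial.X i * P) = gaussianMean (MvPolynomial.pderiv i P) := by
  classical
  induction P using MvPolynomial.induction_on' with
  | add p q hp hq => rw [mul_add, map_add, map_add, map_add, hp, hq]
  | monomial e c =>
    rw [MvPolynomial.pderiv_monomial, mul_comm, MvPolynomial.X, MvPolynomial.monomial_mul, mul_one,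
      gaussianMean_monomial, gaussianMean_monomial, mul_assoc,
      ← Finset.mul_prod_erase _ _ (Finset.mem_univ i),
      ← Finset.mul_prod_erase (a := i) _ _ (Finset.mem_univ i)]
    simp only [Finsupp.add_apply, Finsupp.tsub_apply, Finsupp.single_eq_same]
    rw [integral_pow_gaussianReal_succ, mul_assoc]
    congr 3
    refine Finset.prod_congr rfl fun j hj => ?_
    rw [Finsupp.single_eq_of_ne (Finset.ne_of_mem_erase hj)]
    simp

/-- Multiplication by a linear form serves as the creation operator and the directional derivative
as the annihilation operator; their commutator is the inner product of the coefficient vectors. -/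
theorem isWick_gaussian {κ : Type*} (A : κ → ι → ℝ) :
    IsWick (fun i j => ∑ r, A i r * A j r) fun w => ∫ x, (w.map fun j => ∑ r, A j r * x r).prod
      ∂(Measure.pi fun _ : ι => gaussianReal 0 1) := by
  have h := isWick_foldr (K := ℝ) (A := MvPolynomial ι ℝ) (C := fun i j : κ => ∑ r, A i r * A j r)
    (T := fun j => LinearMap.mulLeft ℝ (∑ r, A j r • MvPolynomial.X r))
    (D := fun i => ∑ r, A i r • (MvPolynomial.pderiv r).toLinearMap) (e := 1) (Λ := gaussianMean)
    ?_ ?_ ?_ ?_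
  · have e : (fun w : List κ => ∫ x, (w.map fun j => ∑ r, A j r * x r).prod
        ∂(Measure.pi fun _ : ι => gaussianReal 0 1)) = fun w => gaussianMean (w.foldr
        (fun j => LinearMap.mulLeft ℝ (∑ r, A j r • (MvPolynomial.X r : MvPolynomial ι ℝ))) 1) := by
      funext w
      refine integral_congr_ae (ae_of_all _ fun x => ?_)
      induction w with
      | nil => simp
      | cons j w ih =>
        simp only [List.map_cons, List.prod_cons, List.foldr_cons, LinearMap.mulLeft_apply, map_mul]
          at ih ⊢
        rw [ih]
        simp
    rw [e]
    exact h
  · have := gaussianMean_monomial (ι := ι) 0 1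
    simpa using this
  · intro i
    simp [LinearMap.sum_apply]
  · intro i j P
    simp only [LinearMap.sum_apply, LinearMap.smul_apply, LinearMap.mulLeft_apply]
    have h1 : ∀ r, MvPolynomial.pderiv r (∑ s, A j s • (MvPolynomial.X s : MvPolynomial ι ℝ)) =
        MvPolynomial.C (A j r) := by
      classical
      intro r
      simp [MvPolynomial.smul_eq_C_mul, MvPolynomial.pderiv_X, Pi.single_apply]
    have h2 : ∀ r, (MvPolynomial.pderiv r).toLinearMap
        ((∑ s, A j s • (MvPolynomial.X s : MvPolynomial ι ℝ)) * P) =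
        (∑ s, A j s • (MvPolynomial.X s : MvPolynomial ι ℝ)) * MvPolynomial.pderiv r P +
          A j r • P := by
      intro r
      show MvPolynomial.pderiv r _ = _
      rw [Derivation.leibniz, h1, smul_eq_mul, smul_eq_mul, MvPolynomial.smul_eq_C_mul, mul_comm P]
    simp only [h2, smul_add, Finset.sum_add_distrib, Finset.sum_smul, Finset.mul_sum, smul_smul,
      mul_smul_comm]
    rw [add_comm]
    rfl
  · intro i P
    simp only [LinearMap.mulLeft_apply, Finset.sum_mul, map_sum, LinearMap.sum_apply,
      LinearMap.smul_apply, smul_mul_assoc, map_smul, gaussianMean_X_mul]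
    rfl

end Gaussian

-- The vector is the image of independent standard Gaussians under the symmetric square root of S,
-- and the inner products of the rows of this root are the entries of S.
open scoped MatrixOrder Matrix.Norms.L2Operator Matrix in
theorem isWick_multivariateGaussian {s : ℕ} {S : Matrix (Fin s) (Fin s) ℝ} (hS : S.PosSemidef) :
    IsWick (fun i j => S i j) fun w : List (Fin s) =>
      ∫ x, (w.map fun j => x j).prod ∂(multivariateGaussian 0 S) := by
  have h := isWick_gaussian fun i j : Fin s => CFC.sqrt S i j
  have hsymm : (CFC.sqrt S)ᵀ = CFC.sqrt S := by
    have h1 := (CFC.sqrt_nonneg S).isSelfAdjoint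
    rw [IsSelfAdjoint, Matrix.star_eq_conjTranspose, Matrix.conjTranspose_eq_transpose_of_trivial]
      at h1
    exact h1
  have e1 : (fun i j => S i j) = fun i j => ∑ r, CFC.sqrt S i r * CFC.sqrt S j r := by
    funext i j
    conv_lhs => rw [← CFC.sqrt_mul_sqrt_self _ hS.nonneg, Matrix.mul_apply]
    refine Finset.sum_congr rfl fun r _ => ?_
    rw [← Matrix.transpose_apply (CFC.sqrt S) j r, hsymm]
  have e2 : (fun w : List (Fin s) => ∫ x, (w.map fun j => x j).prod ∂(multivariateGaussian 0 S)) =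
      fun w => ∫ x, (w.map fun j => ∑ r, CFC.sqrt S j r * x r).prod
        ∂(Measure.pi fun _ : Fin s => gaussianReal 0 1) := by
    funext w
    rw [multivariateGaussian, integral_map, ← map_pi_eq_stdGaussian, integral_map]
    · simp only [zero_add]
      refine integral_congr_ae (ae_of_all _ fun x => ?_)
      simp [Matrix.toEuclideanCLM_toLp, Matrix.mulVec, dotProduct]
    · fun_prop
    · refine Continuous.aestronglyMeasurable ?_
      exact continuous_list_prod _ fun j _ => by fun_prop
    · fun_prop
    · refine Continuous.aestronglyMeasurable ?_
      exact continuous_list_prod _ fun j _ => by fun_prop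
  rw [e1, e2]
  exact h

/-! ### The limit operators and the Wick recursion -/

section LimitOperators

theorem limitDeriv_X (b : ℂ) (α : Polynomial ℂ) (k r : ℕ) : limitDeriv b α k (MvPolynomial.X r) =
    MvPolynomial.C (((r : ℂ) + 1) * (limitSymbol b α k * Polynomial.X ^ r).coeff (k - 1)) := by
  rw [limitDeriv_apply, symbolDeriv_X, coeffMap_apply, ← scalarPoly_X, ← map_pow, ← map_smul,
    ← map_mul, coeff_scalarPoly, mul_smul_comm, Polynomial.coeff_smul, smul_eq_mul]

/-- These derivations map the generators to constants, so all their commutators vanish on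
generators. -/
theorem limitDeriv_comm (b b' : ℂ) (α α' : Polynomial ℂ) (k k' : ℕ) (P : MvPolynomial ℕ ℂ) :
    limitDeriv b α k (limitDeriv b' α' k' P) = limitDeriv b' α' k' (limitDeriv b α k P) := by
  have h : ⁅limitDeriv b α k, limitDeriv b' α' k'⁆ = 0 := by
    refine MvPolynomial.derivation_ext fun r => ?_
    rw [Derivation.commutator_apply, limitDeriv_X, limitDeriv_X, MvPolynomial.derivation_C,
      MvPolynomial.derivation_C, sub_zero, Derivation.zero_apply]
  have h1 := DFunLike.congr_fun h P
  rw [Derivation.commutator_apply, Derivation.zero_apply, sub_eq_zero] at h1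
  exact h1

theorem tailMap_scalarPoly (p : Polynomial ℂ) (k M : ℕ) (hM : p.natDegree ≤ M) :
    tailMap k (scalarPoly p) =
      ∑ r ∈ Finset.range M, p.coeff (k + 1 + r) • (MvPolynomial.X r : MvPolynomial ℕ ℂ) := by
  conv_lhs => rw [p.as_sum_range_C_mul_X_pow' (n := k + 1 + M) (by omega)]
  rw [map_sum, map_sum, Finset.sum_range_add]
  have h1 : ∑ n ∈ Finset.range (k + 1), tailMap k (scalarPoly (Polynomial.C (p.coeff n) *
      Polynomial.X ^ n)) = 0 := by
    refine Finset.sum_eq_zero fun n hn => ?_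
    rw [scalarPoly_C_mul_X_pow, tailMap_C_mul_X_pow, shiftedPower, if_neg, mul_zero]
    rw [Finset.mem_range] at hn
    omega
  rw [h1, zero_add]
  refine Finset.sum_congr rfl fun r _ => ?_
  rw [scalarPoly_C_mul_X_pow, tailMap_C_mul_X_pow, shiftedPower, if_pos (by omega),
    MvPolynomial.smul_eq_C_mul, show k + 1 + r - k - 1 = r by omega]

theorem limitBeta_eq (d : ℕ → ℕ → ℝ) (D : ℕ) : limitBeta d D =
    (2 : ℂ)⁻¹ • ∑ k ∈ Finset.range D, ∑ l ∈ Finset.range D,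
      ((d (k + 1) (l + 1) : ℂ) / (((k + 1).factorial : ℂ) * ((l + 1).factorial : ℂ))) •
        (((l : ℂ) + 1) • (Polynomial.C (MvPolynomial.X k) * Polynomial.X ^ l) +
        ((k : ℂ) + 1) • (Polynomial.C (MvPolynomial.X l) * Polynomial.X ^ k) -
        (((l + k + 1 : ℕ) : ℂ) + 1) • Polynomial.X ^ (l + k + 1)) := by
  rw [limitBeta, Derivation.map_smul, map_sum]
  congr 1
  refine Finset.sum_congr rfl fun k _ => ?_
  rw [map_sum]
  refine Finset.sum_congr rfl fun l _ => ?_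
  rw [Derivation.map_smul, map_sub, Derivation.leibniz, symbolDeriv_X, symbolDeriv_X, symbolDeriv_X,
    smul_comm, smul_comm (MvPolynomial.X l : MvPolynomial ℕ ℂ), Polynomial.smul_eq_C_mul,
    Polynomial.smul_eq_C_mul]

theorem coeffMap_scalarPoly_mul_C (p : Polynomial ℂ) (s k l : ℕ) :
    coeffMap s (scalarPoly p * (Polynomial.C (MvPolynomial.X k) * Polynomial.X ^ l)) =
      (p * Polynomial.X ^ l).coeff s • (MvPolynomial.X k : MvPolynomial ℕ ℂ) := by
  rw [coeffMap_apply, mul_left_comm, Polynomial.coeff_C_mul, ← scalarPoly_X, ← map_pow, ← map_mul,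
    coeff_scalarPoly, MvPolynomial.smul_eq_C_mul, mul_comm]

theorem coeffMap_scalarPoly_mul_X_pow (p : Polynomial ℂ) (s l : ℕ) :
    coeffMap s (scalarPoly p * Polynomial.X ^ l) =
      MvPolynomial.C ((p * Polynomial.X ^ l).coeff s) := by
  rw [coeffMap_apply, ← scalarPoly_X, ← map_pow, ← map_mul, coeff_scalarPoly]

/-- The commutator of the operators that belong to two power sums. -/
def limitCov (B₁ B₂ : Polynomial ℂ) (d : ℕ → ℕ → ℝ) (D k₁ k₂ : ℕ) : ℂ :=
  (∑ r ∈ Finset.range k₁, B₂.coeff (k₂ + 1 + r) *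
      (((r : ℂ) + 1) * (B₁ * Polynomial.X ^ r).coeff (k₁ - 1))) +
  2⁻¹ * ∑ k ∈ Finset.range D, ∑ l ∈ Finset.range D,
    (d (k + 1) (l + 1) : ℂ) / (((k + 1).factorial : ℂ) * ((l + 1).factorial : ℂ)) *
      (((l : ℂ) + 1) * ((B₂ * Polynomial.X ^ l).coeff (k₂ - 1) *
        (((k : ℂ) + 1) * (B₁ * Polynomial.X ^ k).coeff (k₁ - 1))) +
      ((k : ℂ) + 1) * ((B₂ * Polynomial.X ^ k).coeff (k₂ - 1) *
        (((l : ℂ) + 1) * (B₁ * Polynomial.X ^ l).coeff (k₁ - 1))))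

/-- The form is affine in the power sums and the derivation has constant coefficients, so the result
is a number. The tail of the symbol gives the first sum of `limitCov`; β gives the second one, in a
symmetrized shape since each product p_{k+1} p_{l+1} can be differentiated in either factor. -/
theorem limitDeriv_limitForm (b₁ b₂ : ℂ) (α₁ α₂ : Polynomial ℂ) (d : ℕ → ℕ → ℝ) (D k₁ k₂ : ℕ)
    (hk : 0 < k₁) :
    limitDeriv b₁ α₁ k₁ (limitForm b₂ α₂ (limitBeta d D) k₂) =
      MvPolynomial.C (limitCov (limitSymbol b₁ α₁ k₁) (limitSymbol b₂ α₂ k₂) d D k₁ k₂) := by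
  rw [limitForm, limitCov, map_add, map_add]
  congr 1
  · rw [tailMap_scalarPoly _ _ ((limitSymbol b₂ α₂ k₂).natDegree + k₁) (by omega), map_sum, map_sum]
    symm
    -- For r ≥ k₁ the product with X^r has no coefficient of index k₁ - 1, which truncates the sum
    -- at `k₁`, independently of the degree of the symbol.
    refine Finset.sum_subset_zero_on_sdiff (fun r hr => ?_) (fun r hr => ?_) (fun r _ => ?_)
    · simp only [Finset.mem_range] at hr ⊢
      omega
    · simp only [Finset.mem_sdiff, Finset.mem_range, not_lt] at hr
      rw [Derivation.map_smul, limitDeriv_X, Polynomial.coeff_mul_X_pow', if_neg (by omega)]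
      simp
    · rw [Derivation.map_smul, limitDeriv_X, MvPolynomial.smul_eq_C_mul, ← map_mul]
  · rw [limitBeta_eq, mul_smul_comm, map_smul, Derivation.map_smul, Finset.mul_sum, map_sum, map_sum,
      map_mul MvPolynomial.C, map_sum, ← MvPolynomial.smul_eq_C_mul]
    congr 1
    refine Finset.sum_congr rfl fun k _ => ?_
    rw [Finset.mul_sum, map_sum, map_sum, map_sum]
    refine Finset.sum_congr rfl fun l _ => ?_
    rw [mul_smul_comm, map_smul, Derivation.map_smul, map_mul MvPolynomial.C, ← MvPolynomial.smul_eq_C_mul]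
    congr 1
    rw [mul_sub, mul_add, mul_smul_comm, mul_smul_comm, mul_smul_comm, map_sub, map_add, map_smul,
      map_smul, map_smul, coeffMap_scalarPoly_mul_C, coeffMap_scalarPoly_mul_C,
      coeffMap_scalarPoly_mul_X_pow, map_sub, map_add, Derivation.map_smul,
      Derivation.map_smul, Derivation.map_smul, Derivation.map_smul, Derivation.map_smul, limitDeriv_X, limitDeriv_X, MvPolynomial.derivation_C, smul_zero, sub_zero]
    simp only [MvPolynomial.smul_eq_C_mul, ← map_mul, ← map_add]

/-- The creation operators are the limits of the centred power sums and the annihilation operators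
their derivation parts. Under the constant coefficient the multiplication part drops out, because
the form was centred. -/
theorem isWick_levelOp {ι : Type*} (a : ι → ℂ) (c : ι → ℕ → ℝ) (d : ι → ℕ → ℕ → ℝ) (D : ℕ)
    (k : ι → ℕ+) : IsWick (fun i j => limitCov (limitSymbol (a i) (limitAlpha (a i) (c i) D) (k i))
      (limitSymbol (a j) (limitAlpha (a j) (c j) D) (k j)) (d j) D (k i) (k j))
      fun w => MvPolynomial.constantCoeff
        (w.foldr (fun i => levelOp (a i) (c i) (d i) D (k i)) 1) := by
  refine isWick_foldr (K := ℂ) (T := fun i => levelOp (a i) (c i) (d i) D (k i))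
    (D := fun i => (limitDeriv (a i) (limitAlpha (a i) (c i) D) (k i)).toLinearMap)
    (Λ := MvPolynomial.lcoeff ℂ 0) ?_ ?_ ?_ ?_
  · simp [MvPolynomial.lcoeff_apply]
  · intro i
    exact Derivation.map_one_eq_zero _
  · intro i j P
    show limitDeriv _ _ _ _ = _ • P + levelOp _ _ _ _ _ (limitDeriv _ _ _ P)
    rw [levelOp, centredOp_apply, centredOp_apply, map_add, Derivation.leibniz, map_sub,
      limitDeriv_limitForm _ _ _ _ _ _ _ _ (k i).pos, MvPolynomial.derivation_C, sub_zero,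
      limitDeriv_comm, smul_eq_mul, smul_eq_mul, MvPolynomial.smul_eq_C_mul]
    ring
  · intro i P
    rw [levelOp, centredOp_apply]
    simp only [MvPolynomial.lcoeff_apply, ← MvPolynomial.constantCoeff_eq, map_add, map_mul, map_sub,
      MvPolynomial.constantCoeff_C, sub_self, zero_mul, zero_add]
    rfl

end LimitOperators

/-! ### The central limit theorem -/

section Sorting

variable {n : ℕ} {ι κ : Type*}

theorem levelSort_map (τ : ι → Fin (n + 1)) (g : κ → ι) (w : List κ) :
    levelSort τ (w.map g) = (levelSort (fun j => τ (g j)) w).map g := by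
  rw [levelSort, levelSort, List.map_flatMap]
  congr 1
  funext t
  rw [List.filter_map]
  rfl

theorem levelSort_cons (τ : ι → Fin (n + 1)) (j : ι) (w : List ι) (h : ∀ i ∈ w, τ j ≤ τ i) :
    levelSort τ (j :: w) = j :: levelSort τ w := by
  rw [levelSort, levelSort]
  obtain ⟨s, u, hsu⟩ := List.append_of_mem (List.mem_finRange (τ j))
  have hp := List.pairwise_lt_finRange (n + 1)
  rw [hsu, List.pairwise_append, List.pairwise_cons] at hp
  rw [hsu, List.flatMap_append, List.flatMap_append, List.flatMap_cons, List.flatMap_cons]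
  have h1 : ∀ v : List ι, (∀ i ∈ v, τ j ≤ τ i) →
      (s.flatMap fun t => v.filter fun i => τ i = t) = [] := by
    intro v hv
    rw [List.flatMap_eq_nil_iff]
    intro t ht
    rw [List.filter_eq_nil_iff]
    intro i hi
    have h2 := hp.2.2 t ht (τ j) List.mem_cons_self
    simpa using (h2.trans_le (hv i hi)).ne'
  have h2 : (u.flatMap fun t => (j :: w).filter fun i => τ i = t) =
      u.flatMap fun t => w.filter fun i => τ i = t := by
    refine List.flatMap_congr fun t ht => ?_
    rw [List.filter_cons_of_neg]
    simpa using (hp.2.1.1 t ht).ne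
  rw [h1 _ h, h1 _ (by simpa using h), h2, List.filter_cons_of_pos (by simp)]
  rfl

theorem levelSort_pair (τ : ι → Fin (n + 1)) {i j : ι} (h : τ i ≤ τ j) :
    levelSort τ [i, j] = [i, j] := by
  rw [levelSort_cons τ i [j] (by simpa using h), levelSort_cons τ j [] (by simp)]
  simp [levelSort]

end Sorting

/-! ### Limit covariance, positivity and Gaussian convergence -/

section CLT

variable {n : ℕ} {a : Fin (n + 1) → ℝ}
  {ρ : ∀ (N : ℕ) (t : Fin (n + 1)), PMF (Signature (levelSize a N t))}
  {c : Fin (n + 1) → ℕ → ℝ} {d : Fin (n + 1) → ℕ → ℕ → ℝ}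

/-- The polynomial `B` of a level, `((1 + X) (a + a X F)) ^ k` up to order `D`. -/
def levelSymbol (a : ℝ) (c : ℕ → ℝ) (D k : ℕ) : Polynomial ℂ :=
  limitSymbol a (limitAlpha a c D) k

/-- The commutator of the operators of two power sums. -/
def levelCov (a : Fin (n + 1) → ℝ) (c : Fin (n + 1) → ℕ → ℝ) (d : Fin (n + 1) → ℕ → ℕ → ℝ) (D : ℕ)
    (p q : Fin (n + 1) × ℕ+) : ℂ :=
  limitCov (levelSymbol (a p.1) (c p.1) D p.2) (levelSymbol (a q.1) (c q.1) D q.2) (d q.1) D p.2 q.2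

theorem isWick_levelCov (a : Fin (n + 1) → ℝ) (c : Fin (n + 1) → ℕ → ℝ)
    (d : Fin (n + 1) → ℕ → ℕ → ℝ) (D : ℕ) :
    IsWick (levelCov a c d D) fun w => MvPolynomial.constantCoeff
      (w.foldr (fun q => levelOp (a q.1) (c q.1) (d q.1) D q.2) 1) :=
  isWick_levelOp (fun q : Fin (n + 1) × ℕ+ => (a q.1 : ℂ)) (fun q => c q.1) (fun q => d q.1) D
    fun q => q.2

theorem tendsto_integral_pair (ha : ∀ t, 0 < a t) (hmono : Monotone a)
    (hρ : ∀ t, IsAppropriateMeasure (fun N => levelSize a N t) (fun N => ρ N t))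
    (h : ∀ t, HasLimits (fun N => levelSize a N t) (fun N => levelFun (ρ N) t) (c t) (d t))
    (p q : Fin (n + 1) × ℕ+) (hpq : p.1 ≤ q.1) {D : ℕ} (hD : (p.2 : ℕ) + q.2 < D) :
    Tendsto (fun N => ((∫ l, scaledSum ρ N p l * scaledSum ρ N q l ∂(jointLaw (ρ N)) : ℝ) : ℂ))
      atTop (𝓝 (levelCov a c d D p q)) := by
  have h2 : 2 ≤ D := by have := p.2.pos; omega
  have h1 := tendsto_integral_word ha hmono hρ h [p, q] h2 (by simpa using hD)
  rw [levelSort_pair _ hpq] at h1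
  have hw := isWick_levelCov a c d D
  have e : MvPolynomial.constantCoeff (List.foldr (fun q => levelOp (a q.1) (c q.1) (d q.1) D q.2) 1
      [p, q]) = levelCov a c d D p q := by
    have h3 := hw.cons p [q]
    simp only [List.length_cons, List.length_nil, Fin.sum_univ_succ, Finset.univ_eq_empty,
      Finset.sum_empty, add_zero] at h3
    rw [h3]
    have h4 := hw.nil
    refine Eq.trans ?_ (mul_one _)
    rw [← h4]
    rfl
  rw [e] at h1
  simpa using h1

/-- The covariance is defined as the limit of actual covariances, hence is real and symmetric. For
unsorted levels its existence follows by exchanging the factors. Uniqueness of limits identifies it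
with the operator expression for every sufficiently large truncation, so that expression is
independent of `D`. -/
theorem exists_covariance (ha : ∀ t, 0 < a t) (hmono : Monotone a)
    (hρ : ∀ t, IsAppropriateMeasure (fun N => levelSize a N t) (fun N => ρ N t))
    (h : ∀ t, HasLimits (fun N => levelSize a N t) (fun N => levelFun (ρ N) t) (c t) (d t)) :
    ∃ C : Fin (n + 1) × ℕ+ → Fin (n + 1) × ℕ+ → ℝ,
      (∀ p q, Tendsto (fun N => ∫ l, scaledSum ρ N p l * scaledSum ρ N q l ∂(jointLaw (ρ N))) atTop
        (𝓝 (C p q))) ∧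
      ∀ p q D, p.1 ≤ q.1 → (p.2 : ℕ) + q.2 < D → (C p q : ℂ) = levelCov a c d D p q := by
  have key : ∀ p q : Fin (n + 1) × ℕ+, ∃ x : ℝ,
      Tendsto (fun N => ∫ l, scaledSum ρ N p l * scaledSum ρ N q l ∂(jointLaw (ρ N))) atTop
        (𝓝 x) := by
    have h1 : ∀ p q : Fin (n + 1) × ℕ+, p.1 ≤ q.1 → ∃ x : ℝ,
      Tendsto (fun N => ∫ l, scaledSum ρ N p l * scaledSum ρ N q l ∂(jointLaw (ρ N))) atTop
        (𝓝 x) := fun p q hpq =>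
      ⟨_, (Complex.continuous_re.tendsto _).comp
        (tendsto_integral_pair ha hmono hρ h p q hpq (Nat.lt_succ_self _))⟩
    intro p q
    rcases le_total p.1 q.1 with hpq | hpq
    · exact h1 p q hpq
    · obtain ⟨x, hx⟩ := h1 q p hpq
      exact ⟨x, by simpa only [mul_comm] using hx⟩
  choose C hC using key
  refine ⟨C, hC, fun p q D hpq hD => ?_⟩
  exact tendsto_nhds_unique ((Complex.continuous_ofReal.tendsto _).comp (hC p q))
    (tendsto_integral_pair ha hmono hρ h p q hpq hD)

/-- The quadratic form is a limit of second moments of linear combinations, so it is nonnegative. -/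
theorem posSemidef_covariance (hmono : Monotone a)
    (hρ : ∀ t, IsAppropriateMeasure (fun N => levelSize a N t) (fun N => ρ N t))
    {C : Fin (n + 1) × ℕ+ → Fin (n + 1) × ℕ+ → ℝ}
    (hC : ∀ p q, Tendsto (fun N => ∫ l, scaledSum ρ N p l * scaledSum ρ N q l ∂(jointLaw (ρ N)))
      atTop (𝓝 (C p q))) {s : ℕ} (idx : Fin s → Fin (n + 1) × ℕ+) :
    (Matrix.of fun i j => C (idx i) (idx j)).PosSemidef := by
  refine Matrix.PosSemidef.of_dotProduct_mulVec_nonneg ?_ fun x => ?_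
  · ext i j
    simp only [Matrix.conjTranspose_apply, Matrix.of_apply, star_trivial]
    exact tendsto_nhds_unique (hC _ _) (by simpa only [mul_comm] using hC (idx i) (idx j))
  · have h1 : Tendsto (fun N => ∑ i, ∑ j, x i * (x j * ∫ l, scaledSum ρ N (idx i) l *
        scaledSum ρ N (idx j) l ∂(jointLaw (ρ N)))) atTop
        (𝓝 (∑ i, ∑ j, x i * (x j * C (idx i) (idx j)))) :=
      tendsto_finsetSum _ fun i _ => tendsto_finsetSum _ fun j _ =>
        ((hC _ _).const_mul _).const_mul _
    have h2 : star x ⬝ᵥ (Matrix.of fun i j => C (idx i) (idx j)).mulVec x =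
        ∑ i, ∑ j, x i * (x j * C (idx i) (idx j)) := by
      simp only [dotProduct, Matrix.mulVec, Matrix.of_apply, Finset.mul_sum, star_trivial]
      refine Finset.sum_congr rfl fun i _ => Finset.sum_congr rfl fun j _ => ?_
      ring
    rw [h2]
    refine ge_of_tendsto' h1 fun N => ?_
    have hint : ∀ i j, Integrable (fun l => scaledSum ρ N (idx i) l * scaledSum ρ N (idx j) l)
        (jointLaw (ρ N)) := fun i j => by
      simpa using integrable_scaledSum_word hmono hρ N [idx i, idx j]
    have h3 : ∑ i, ∑ j, x i * (x j * ∫ l, scaledSum ρ N (idx i) l * scaledSum ρ N (idx j) l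
        ∂(jointLaw (ρ N))) = ∫ l, (∑ i, x i * scaledSum ρ N (idx i) l) ^ 2 ∂(jointLaw (ρ N)) := by
      have h4 : ∀ l, (∑ i, x i * scaledSum ρ N (idx i) l) ^ 2 = ∑ i, ∑ j, x i * (x j *
          (scaledSum ρ N (idx i) l * scaledSum ρ N (idx j) l)) := by
        intro l
        rw [sq, Finset.sum_mul_sum]
        refine Finset.sum_congr rfl fun i _ => Finset.sum_congr rfl fun j _ => ?_
        ring
      simp only [h4]
      rw [integral_finsetSum _ fun i _ => integrable_finsetSum _ fun j _ =>
        ((hint i j).const_mul _).const_mul _]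
      refine Finset.sum_congr rfl fun i _ => ?_
      rw [integral_finsetSum _ fun j _ => ((hint i j).const_mul _).const_mul _]
      simp only [integral_const_mul]
    rw [h3]
    exact integral_nonneg fun l => sq_nonneg _

/-- Both the operator limit and the Gaussian moment satisfy Wick's recursion. They are compared on
the word sorted by levels, where the two covariances agree; the order of the factors does not matter
for either integral. -/
theorem tendsto_integral_gaussian (ha : ∀ t, 0 < a t) (hmono : Monotone a)
    (hρ : ∀ t, IsAppropriateMeasure (fun N => levelSize a N t) (fun N => ρ N t))
    (h : ∀ t, HasLimits (fun N => levelSize a N t) (fun N => levelFun (ρ N) t) (c t) (d t))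
    {C : Fin (n + 1) × ℕ+ → Fin (n + 1) × ℕ+ → ℝ}
    (hC : ∀ p q D, p.1 ≤ q.1 → (p.2 : ℕ) + q.2 < D → (C p q : ℂ) = levelCov a c d D p q)
    {s : ℕ} (idx : Fin s → Fin (n + 1) × ℕ+)
    (hS : (Matrix.of fun i j => C (idx i) (idx j)).PosSemidef) :
    Tendsto (fun N => ∫ l, ∏ j, scaledSum ρ N (idx j) l ∂(jointLaw (ρ N))) atTop
      (𝓝 (∫ x, ∏ j, x j ∂(multivariateGaussian 0 (Matrix.of fun i j => C (idx i) (idx j))))) := by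
  set w : List (Fin (n + 1) × ℕ+) := (List.finRange s).map idx with hw
  set K : ℕ := (w.map fun q => (q.2 : ℕ)).sum with hK
  -- Large enough for the whole word and for any pair of its letters, each of degree at most `K`.
  set D : ℕ := 2 * K + 2 with hD
  set v := levelSort (fun j => (idx j).1) (List.finRange s) with hv
  have h1 := tendsto_integral_word ha hmono hρ h w (D := D) (by omega) (by omega)
  rw [hw, levelSort_map] at h1
  have hk : ∀ j, ((idx j).2 : ℕ) ≤ K := fun j =>
    List.single_le_sum (fun _ _ => Nat.zero_le _) _ (List.mem_map_of_mem
      (List.mem_map_of_mem (List.mem_finRange j)))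
  have h2 := ((isWick_levelCov a c d D).comp idx).eq_of_pairwise
    (isWick_multivariateGaussian hS).ofReal
    ((pairwise_levelSort (fun j => (idx j).1) (List.finRange s)).imp fun {i j} hij =>
      (hC (idx i) (idx j) D hij (by have := hk i; have := hk j; omega)).symm)
  simp only at h2
  rw [h2] at h1
  have h3 : ∀ x : EuclideanSpace ℝ (Fin s), ((levelSort (fun j => (idx j).1) (List.finRange s)).map
      fun j => x j).prod = ∏ j, x j := by
    intro x
    rw [((perm_levelSort _ _).map _).prod_eq, ← List.ofFn_eq_map, List.prod_ofFn]
  have h4 : ∀ N l, (w.map fun q => scaledSum ρ N q l).prod = ∏ j, scaledSum ρ N (idx j) l := by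
    intro N l
    rw [hw, List.map_map, ← List.ofFn_eq_map, List.prod_ofFn]
    rfl
  simp only [h3, ← hw, h4] at h1
  have h5 := (Complex.continuous_re.tendsto _).comp h1
  exact h5

theorem covariance_powerSum (N : ℕ) (p q : Fin (n + 1) × ℕ+) :
    cov[powerSum p.1 p.2, powerSum q.1 q.2; jointLaw (ρ N)] / (N : ℝ) ^ ((p.2 : ℕ) + (q.2 : ℕ)) =
      ∫ l, scaledSum ρ N p l * scaledSum ρ N q l ∂(jointLaw (ρ N)) := by
  rw [covariance, div_eq_inv_mul, ← integral_const_mul]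
  refine integral_congr_ae (ae_of_all _ fun l => ?_)
  simp only [scaledSum, pow_add, mul_inv]
  ring

end CLT

/-! ### The level functions are appropriate -/

section LevelFunctions

theorem padOnes_comp_perm {m M : ℕ} (h : m ≤ M) (σ : Equiv.Perm (Fin m)) (x : Fin m → ℂ) :
    (padOnes (x ∘ σ) : Fin M → ℂ) = padOnes x ∘ σ.viaEmbedding (Fin.castLEEmb h) := by
  funext i
  by_cases hi : (i : ℕ) < m
  · have h1 : i = Fin.castLEEmb h ⟨i, hi⟩ := rfl
    rw [Function.comp_apply, h1, Equiv.Perm.viaEmbedding_apply]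
    simp [padOnes]
    rw [dif_pos hi]
  · rw [Function.comp_apply, Equiv.Perm.viaEmbedding_apply_of_notMem]
    · simp [padOnes, hi]
    · rintro ⟨j, rfl⟩
      exact hi j.2

/-- Near a point where both functions equal 1 the arguments are small, so the principal logarithm is
additive. -/
theorem log_mul_eventuallyEq {E : Type*} [TopologicalSpace E] {f g : E → ℂ} {x : E}
    (hf : ContinuousAt f x) (hg : ContinuousAt g x) (hf1 : f x = 1) (hg1 : g x = 1) :
    (fun y => Complex.log (f y * g y)) =ᶠ[𝓝 x]
      (fun y => Complex.log (f y)) + fun y => Complex.log (g y) := by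
  have harg : ∀ {f : E → ℂ}, ContinuousAt f x → f x = 1 →
      ContinuousAt (fun y => Complex.arg (f y)) x := fun {f} hf hf1 =>
    ContinuousAt.comp (g := Complex.arg) (Complex.continuousAt_arg (by simp [hf1])) hf
  have h1 := (harg hf hf1).add (harg hg hg1)
  have h2 : ∀ᶠ y in 𝓝 x, Complex.arg (f y) + Complex.arg (g y) ∈ Set.Ioc (-Real.pi) Real.pi := by
    refine h1.eventually_mem (Ioc_mem_nhds ?_ ?_) <;>
      simp [hf1, hg1, Real.pi_pos]
  filter_upwards [h2, hf.eventually_ne (hf1.trans_ne one_ne_zero),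
    hg.eventually_ne (hg1.trans_ne one_ne_zero)] with y hy hfy hgy
  exact (Complex.log_mul_eq_add_log_iff hfy hgy).2 hy

/-- Logarithms add, and partial derivatives at (1, …, 1) in the remaining variables are unaffected
by setting the others to 1. First-order limits are normalized by the number of variables, so the
contribution of H is rescaled by the limit ratio `r` of these numbers. -/
theorem HasLimits.mul_comp_padOnes {m M : ℕ → ℕ} {F : ∀ N, (Fin (m N) → ℂ) → ℂ}
    {H : ∀ N, (Fin (M N) → ℂ) → ℂ} {c c' : ℕ → ℝ} {d d' : ℕ → ℕ → ℝ} {r : ℝ}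
    (hF : HasLimits m F c d) (hH : HasLimits M H c' d') (hF1 : ∀ N, F N 1 = 1)
    (hH1 : ∀ N, H N 1 = 1) (hmM : ∀ N, m N ≤ M N) (hm : Tendsto m atTop atTop)
    (hr : Tendsto (fun N => (M N : ℂ) / (m N : ℂ)) atTop (𝓝 (r : ℂ))) :
    HasLimits m (fun N x => H N (padOnes x) * F N x) (fun k => c k + r * c' k)
      (fun k l => d k l + d' k l) := by
  have hlog : ∀ N, (fun x : Fin (m N) → ℂ => Complex.log (H N (padOnes x) * F N x)) =ᶠ[𝓝 1]
      (fun x => Complex.log (H N (padOnes x))) + fun x => Complex.log (F N x) := fun N =>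
    log_mul_eventuallyEq (analyticAt_comp_padOnes (hH.analyticAt N)).continuousAt
      (hF.analyticAt N).continuousAt (by rw [padOnes_one, hH1]) (hF1 N)
  have hana : ∀ N, AnalyticAt ℂ (fun x : Fin (m N) → ℂ => Complex.log (H N (padOnes x))) 1 :=
    fun N => analyticAt_comp_padOnes (f := fun x => Complex.log (H N x)) (hH.holomorphic N)
  have hpartial : ∀ is : List ℕ, ∀ᶠ N in atTop,
      mixedPartial is (fun x : Fin (m N) → ℂ => Complex.log (H N (padOnes x) * F N x)) 1 =
        mixedPartial is (fun x => Complex.log (H N x)) 1 +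
          mixedPartial is (fun x => Complex.log (F N x)) 1 := by
    intro is
    -- For large N all the variables in the list are among the first `m N`; the sum of the list is a
    -- convenient upper bound for its entries.
    filter_upwards [hm.eventually_gt_atTop is.sum] with N hN
    rw [(mixedPartial_congr is (hlog N)).eq_of_nhds,
      (mixedPartial_add is (hana N) (hF.holomorphic N)).eq_of_nhds, Pi.add_apply]
    rw [mixedPartial_comp_padOnes (fun x => Complex.log (H N x)) is fun i hi =>
      (List.single_le_sum (fun _ _ => Nat.zero_le _) i hi).trans_lt hN]
    simp only [padOnes_one]
  refine ⟨?_, ?_, ?_, ?_, ?_, ?_, ?_, ?_⟩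
  · intro N σ x
    rw [padOnes_comp_perm (hmM N), hH.symm, hF.symm]
  · intro N
    filter_upwards [tendsto_padOnes_one.eventually (hH.ne_zero N), hF.ne_zero N] with x h1 h2
    exact mul_ne_zero h1 h2
  · intro N
    exact ((hana N).add (hF.holomorphic N)).congr (hlog N).symm
  · intro i k hk
    have h1 := (hF.one_index i k hk).add (hr.mul (hH.one_index i k hk))
    push_cast
    refine h1.congr' ?_
    filter_upwards [hpartial (List.replicate k i), hm.eventually_gt_atTop 0] with N hN hN0
    have h2 : (m N : ℂ) ≠ 0 := by exact_mod_cast hN0.ne'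
    have h3 : (M N : ℂ) ≠ 0 := by exact_mod_cast (hN0.trans_le (hmM N)).ne'
    rw [hN]
    field_simp
    ring
  · intro i j k l hij hk hl
    have h1 := (hF.two_indices i j k l hij hk hl).add (hH.two_indices i j k l hij hk hl)
    push_cast
    refine h1.congr' ?_
    filter_upwards [hpartial (List.replicate k i ++ List.replicate l j)] with N hN
    rw [hN, add_comm]
  · intro is his
    have h1 := (hF.many_indices is his).add (hH.many_indices is his)
    rw [add_zero] at h1
    refine h1.congr' ?_
    filter_upwards [hpartial is] with N hN
    rw [hN, add_comm]
  · filter_upwards [hF.summable_one, hH.summable_one] with x h1 h2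
    refine (h1.add (h2.mul_left (r : ℂ))).congr fun k => ?_
    push_cast
    ring
  · filter_upwards [hF.summable_two, hH.summable_two] with p h1 h2
    refine (h1.add h2).congr fun q => ?_
    push_cast
    ring

theorem tendsto_levelSize_atTop {n : ℕ} {a : Fin (n + 1) → ℝ} (ha : ∀ t, 0 < a t)
    (t : Fin (n + 1)) : Tendsto (fun N => levelSize a N t) atTop atTop :=
  tendsto_nat_floor_atTop.comp
    (Tendsto.const_mul_atTop (ha t) tendsto_natCast_atTop_atTop)

theorem isAppropriate_levelFun {n : ℕ} {a : Fin (n + 1) → ℝ} (ha : ∀ t, 0 < a t)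
    (hmono : Monotone a) {ρ : ∀ (N : ℕ) (t : Fin (n + 1)), PMF (Signature (levelSize a N t))}
    (hρ : ∀ t, IsAppropriateMeasure (fun N => levelSize a N t) (fun N => ρ N t))
    (t : Fin (n + 1)) :
    IsAppropriate (fun N => levelSize a N t) (fun N => levelFun (ρ N) t) := by
  induction t using Fin.reverseInduction with
  | last =>
    simp only [levelFun_last]
    exact (hρ _).2
  | cast i ih =>
    obtain ⟨c, d, h⟩ := (hρ i.castSucc).2
    obtain ⟨c', d', h'⟩ := ih
    simp only [levelFun_castSucc]
    refine ⟨_, _, h.mul_comp_padOnes (r := a i.succ / a i.castSucc) h' (fun N => schurGen_one _)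
      (fun N => levelFun_one _ _) (fun N => levelSize_monotone hmono N (Fin.castSucc_lt_succ).le)
      (tendsto_levelSize_atTop ha _) ?_⟩
    have h1 := (tendsto_levelSize ha i.succ).div (tendsto_levelSize ha i.castSucc)
      (by exact_mod_cast (ha i.castSucc).ne')
    push_cast
    refine h1.congr' ?_
    filter_upwards [eventually_ne_atTop 0] with N hN
    have : (N : ℂ) ≠ 0 := by exact_mod_cast hN
    simp only [Pi.div_apply]
    rw [mul_div_mul_left _ _ (inv_ne_zero this)]

/-- Partial derivatives commute and the limits do not depend on which two variables are chosen. -/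
theorem HasLimits.two_indices_symm {m : ℕ → ℕ} {F : ∀ N, (Fin (m N) → ℂ) → ℂ} {c : ℕ → ℝ}
    {d : ℕ → ℕ → ℝ} (h : HasLimits m F c d) {k l : ℕ} (hk : 1 ≤ k) (hl : 1 ≤ l) :
    d k l = d l k := by
  have h1 := h.two_indices 0 1 k l (by norm_num) hk hl
  have h2 := h.two_indices 1 0 l k (by norm_num) hl hk
  have h3 := tendsto_nhds_unique h1 (h2.congr fun N =>
    (mixedPartial_perm List.perm_append_comm (h.holomorphic N)).eq_of_nhds)
  exact_mod_cast h3

end LevelFunctions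

/-! ### Contour integrals of Laurent series -/

section Contour

theorem hasSum_circleIntegral {J : Type*} [Countable J] {F : J → ℂ → ℂ} {f : ℂ → ℂ} {u : J → ℝ}
    {r : ℝ} (hr : 0 ≤ r) (hF : ∀ j, ContinuousOn (F j) (Metric.sphere 0 r)) (hu : Summable u)
    (hb : ∀ j, ∀ z ∈ Metric.sphere (0 : ℂ) r, ‖F j z‖ ≤ u j)
    (hs : ∀ z ∈ Metric.sphere (0 : ℂ) r, HasSum (fun j => F j z) (f z)) :
    HasSum (fun j => ∮ z in C(0, r), F j z) (∮ z in C(0, r), f z) := by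
  have hmem : ∀ θ, circleMap 0 r θ ∈ Metric.sphere (0 : ℂ) r := circleMap_mem_sphere 0 hr
  refine intervalIntegral.hasSum_integral_of_dominated_convergence (fun j _ => r * u j) ?_ ?_ ?_ ?_ ?_
  · intro j
    refine Continuous.aestronglyMeasurable ?_
    simp only [deriv_circleMap]
    exact ((continuous_circleMap 0 r).mul continuous_const).smul
      ((hF j).comp_continuous (continuous_circleMap 0 r) hmem)
  · intro j
    refine ae_of_all _ fun θ _ => ?_
    rw [norm_smul, deriv_circleMap]
    refine mul_le_mul (le_of_eq ?_) (hb j _ (hmem θ)) (norm_nonneg _) hr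
    simp [abs_of_nonneg hr]
  · exact ae_of_all _ fun θ _ => hu.mul_left r
  · exact intervalIntegrable_const
  · exact ae_of_all _ fun θ _ => (hs _ (hmem θ)).const_smul _

theorem circleIntegral_zpow {r : ℝ} (hr : 0 < r) (n : ℤ) :
    (∮ z in C(0, r), z ^ n) = if n = -1 then 2 * Real.pi * Complex.I else 0 := by
  split_ifs with h
  · rw [h]
    have := circleIntegral.integral_sub_center_inv 0 hr.ne'
    simpa [zpow_neg_one] using this
  · have := circleIntegral.integral_sub_zpow_of_ne h 0 0 r
    simpa using this

theorem continuousOn_zpow_sphere {r : ℝ} (hr : 0 < r) (n : ℤ) :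
    ContinuousOn (fun z : ℂ => z ^ n) (Metric.sphere 0 r) := fun z hz =>
  (continuousAt_zpow₀ z n (Or.inl (ne_zero_of_mem_sphere hr.ne' ⟨z, hz⟩))).continuousWithinAt

/-- The coefficient with an integer index, zero if the index is negative. -/
def intCoeff (f : PowerSeries ℂ) : ℤ → ℂ
  | (n : ℕ) => PowerSeries.coeff n f
  | Int.negSucc _ => 0

theorem circleIntegral_zpow_mul {r : ℝ} (hr : 0 < r) {f : PowerSeries ℂ} {b : ℂ → ℂ}
    (hf : Summable fun n => ‖PowerSeries.coeff n f‖ * r ^ n)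
    (hb : ∀ z ∈ Metric.sphere (0 : ℂ) r, HasSum (fun n => PowerSeries.coeff n f * z ^ n) (b z))
    (e : ℤ) : (∮ z in C(0, r), z ^ e * b z) = 2 * Real.pi * Complex.I * intCoeff f (-1 - e) := by
  have hz0 : ∀ z ∈ Metric.sphere (0 : ℂ) r, z ≠ 0 := fun z hz =>
    ne_zero_of_mem_sphere hr.ne' ⟨z, hz⟩
  have hzr : ∀ z ∈ Metric.sphere (0 : ℂ) r, ‖z‖ = r := fun z hz => by simpa using hz
  have h1 := hasSum_circleIntegral (F := fun n z => PowerSeries.coeff n f * z ^ (e + n))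
    (f := fun z => z ^ e * b z) (u := fun n => r ^ e * (‖PowerSeries.coeff n f‖ * r ^ n)) hr.le
    (fun n => continuousOn_const.mul (continuousOn_zpow_sphere hr _)) (hf.mul_left _)
    (fun n z hz => by
      rw [norm_mul, norm_zpow, hzr z hz, zpow_add₀ hr.ne', zpow_natCast]
      exact le_of_eq (by ring))
    (fun z hz => by
      have h2 := (hb z hz).mul_left (z ^ e)
      have h3 : (fun n : ℕ => z ^ e * (PowerSeries.coeff n f * z ^ n)) =
          fun n : ℕ => PowerSeries.coeff n f * z ^ (e + n) := funext fun n => by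
        rw [zpow_add₀ (hz0 z hz), zpow_natCast]
        ring
      rwa [h3] at h2)
  simp only [circleIntegral.integral_const_mul, circleIntegral_zpow hr] at h1
  rw [← h1.tsum_eq]
  rcases h : -1 - e with n | n
  · rw [tsum_eq_single n, if_pos, intCoeff, mul_comm]
    · simp only [Int.ofNat_eq_natCast] at h
      omega
    · intro k hk
      rw [if_neg, mul_zero]
      simp only [Int.ofNat_eq_natCast] at h
      omega
  · rw [intCoeff, mul_zero]
    convert tsum_zero with k
    rw [if_neg, mul_zero]
    omega

/-- A kernel given by an absolutely convergent double Laurent series on the two circles may be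
integrated termwise, and each term splits into a product of one-variable integrals. -/
theorem hasSum_circleIntegral_circleIntegral {J : Type*} [Countable J] {C : J → ℂ} {p q : J → ℤ}
    {r s : ℝ} (hr : 0 < r) (hs : 0 < s) (hC : Summable fun j => ‖C j‖ * r ^ p j * s ^ q j)
    {f g : ℂ → ℂ} {Q : ℂ → ℂ → ℂ} (hf : ContinuousOn f (Metric.sphere 0 r))
    (hg : ContinuousOn g (Metric.sphere 0 s))
    (hQ : ∀ z ∈ Metric.sphere (0 : ℂ) r, ∀ w ∈ Metric.sphere (0 : ℂ) s,
      HasSum (fun j => C j * z ^ p j * w ^ q j) (Q z w)) :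
    HasSum (fun j => C j * (∮ z in C(0, r), z ^ p j * f z) * ∮ w in C(0, s), w ^ q j * g w)
      (∮ z in C(0, r), ∮ w in C(0, s), f z * g w * Q z w) := by
  obtain ⟨A, hA⟩ := (isCompact_sphere (0 : ℂ) r).exists_bound_of_continuousOn hf
  obtain ⟨B, hB⟩ := (isCompact_sphere (0 : ℂ) s).exists_bound_of_continuousOn hg
  have hzr : ∀ {r : ℝ}, ∀ z ∈ Metric.sphere (0 : ℂ) r, ‖z‖ = r := fun z hz => by simpa using hz
  have hA0 : 0 ≤ A := (norm_nonneg _).trans (hA (r : ℂ) (by simp [abs_of_pos hr]))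
  have hB0 : 0 ≤ B := (norm_nonneg _).trans (hB (s : ℂ) (by simp [abs_of_pos hs]))
  have hin : ∀ z ∈ Metric.sphere (0 : ℂ) r,
      HasSum (fun j => C j * (∮ w in C(0, s), w ^ q j * g w) * (z ^ p j * f z))
        (∮ w in C(0, s), f z * g w * Q z w) := by
    intro z hz
    have h1 := hasSum_circleIntegral (F := fun j w => C j * (z ^ p j * f z) * (w ^ q j * g w))
      (f := fun w => f z * g w * Q z w) (u := fun j => A * B * (‖C j‖ * r ^ p j * s ^ q j)) hs.le
      (fun j => continuousOn_const.mul ((continuousOn_zpow_sphere hs _).mul hg)) (hC.mul_left _)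
      (fun j w hw => by
        rw [norm_mul, norm_mul, norm_mul, norm_mul, norm_zpow, norm_zpow, hzr z hz, hzr w hw]
        calc _ = ‖f z‖ * ‖g w‖ * (‖C j‖ * r ^ p j * s ^ q j) := by ring
          _ ≤ _ := mul_le_mul_of_nonneg_right
            (mul_le_mul (hA z hz) (hB w hw) (norm_nonneg _) hA0) (by positivity))
      (fun w hw => by
        have h2 := (hQ z hz w hw).mul_left (f z * g w)
        have e : (fun j => f z * g w * (C j * z ^ p j * w ^ q j)) =
            fun j => C j * (z ^ p j * f z) * (w ^ q j * g w) := funext fun j => by ring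
        rwa [e] at h2)
    simp only [circleIntegral.integral_const_mul] at h1
    simpa only [mul_right_comm] using h1
  have h1 := hasSum_circleIntegral
    (F := fun j z => C j * (∮ w in C(0, s), w ^ q j * g w) * (z ^ p j * f z))
    (f := fun z => ∮ w in C(0, s), f z * g w * Q z w)
    (u := fun j => 2 * Real.pi * s * B * A * (‖C j‖ * r ^ p j * s ^ q j)) hr.le
    (fun j => continuousOn_const.mul ((continuousOn_zpow_sphere hr _).mul hf)) (hC.mul_left _)
    (fun j z hz => by
      have h2 : ‖∮ w in C(0, s), w ^ q j * g w‖ ≤ 2 * Real.pi * s * (s ^ q j * B) := by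
        refine circleIntegral.norm_integral_le_of_norm_le_const hs.le fun w hw => ?_
        rw [norm_mul, norm_zpow, hzr w hw]
        exact mul_le_mul_of_nonneg_left (hB w hw) (by positivity)
      rw [norm_mul, norm_mul, norm_mul, norm_zpow, hzr z hz]
      calc _ ≤ ‖C j‖ * (2 * Real.pi * s * (s ^ q j * B)) * (r ^ p j * A) := by
            gcongr
            exact hA z hz
        _ = _ := by ring)
    hin
  simp only [circleIntegral.integral_const_mul] at h1
  simpa only [mul_right_comm] using h1

end Contour

/-! ### Absolutely convergent power series on a circle -/

section Evaluation

/-- The power series converges absolutely on the circle with radius `r`. -/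
def AbsConvergent (f : PowerSeries ℂ) (r : ℝ) : Prop :=
  Summable fun n => ‖PowerSeries.coeff n f‖ * r ^ n

/-- The sum of a power series. -/
def seriesValue (f : PowerSeries ℂ) (z : ℂ) : ℂ := ∑' n, PowerSeries.coeff n f * z ^ n

variable {f g : PowerSeries ℂ} {r : ℝ} {z : ℂ}

theorem AbsConvergent.norm (hf : AbsConvergent f r) (hz : ‖z‖ = r) :
    Summable fun n => ‖PowerSeries.coeff n f * z ^ n‖ := by
  simp only [norm_mul, norm_pow, hz]
  exact hf

theorem AbsConvergent.hasSum (hf : AbsConvergent f r) (hz : ‖z‖ = r) :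
    HasSum (fun n => PowerSeries.coeff n f * z ^ n) (seriesValue f z) :=
  (hf.norm hz).of_norm.hasSum

theorem coeff_mul_mul_pow (n : ℕ) : PowerSeries.coeff n (f * g) * z ^ n =
    ∑ x ∈ Finset.HasAntidiagonal.antidiagonal n, (PowerSeries.coeff x.1 f * z ^ x.1) *
      (PowerSeries.coeff x.2 g * z ^ x.2) := by
  rw [PowerSeries.coeff_mul, Finset.sum_mul]
  refine Finset.sum_congr rfl fun x hx => ?_
  rw [← Finset.HasAntidiagonal.mem_antidiagonal.1 hx, pow_add]
  ring

theorem AbsConvergent.mul (hr : 0 ≤ r) (hf : AbsConvergent f r) (hg : AbsConvergent g r) :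
    AbsConvergent (f * g) r := by
  have hr' : ‖(r : ℂ)‖ = r := by simp [abs_of_nonneg hr]
  have h := summable_norm_sum_mul_antidiagonal_of_summable_norm (hf.norm hr') (hg.norm hr')
  simp only [← coeff_mul_mul_pow, norm_mul, norm_pow, hr'] at h
  exact h

theorem seriesValue_mul (hz : ‖z‖ = r) (hf : AbsConvergent f r) (hg : AbsConvergent g r) :
    seriesValue (f * g) z = seriesValue f z * seriesValue g z := by
  rw [seriesValue, seriesValue, seriesValue,
    tsum_mul_tsum_eq_tsum_sum_antidiagonal_of_summable_norm (hf.norm hz) (hg.norm hz)]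
  exact tsum_congr fun n => coeff_mul_mul_pow n

theorem AbsConvergent.add (hf : AbsConvergent f r) (hr : 0 ≤ r) (hg : AbsConvergent g r) :
    AbsConvergent (f + g) r := by
  refine Summable.of_nonneg_of_le (fun n => by positivity) (fun n => ?_) (Summable.add hf hg)
  rw [map_add, ← add_mul]
  exact mul_le_mul_of_nonneg_right (norm_add_le _ _) (by positivity)

theorem seriesValue_add (hz : ‖z‖ = r) (hf : AbsConvergent f r) (hg : AbsConvergent g r) :
    seriesValue (f + g) z = seriesValue f z + seriesValue g z := by
  rw [← ((hf.hasSum hz).add (hg.hasSum hz)).tsum_eq, seriesValue]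
  exact tsum_congr fun n => by rw [map_add, add_mul]

theorem absConvergent_coe (p : Polynomial ℂ) (r : ℝ) : AbsConvergent (p : PowerSeries ℂ) r := by
  refine summable_of_ne_finset_zero (s := Finset.range (p.natDegree + 1)) fun n hn => ?_
  rw [Polynomial.coeff_coe, Polynomial.coeff_eq_zero_of_natDegree_lt, norm_zero, zero_mul]
  simpa using hn

theorem seriesValue_coe (p : Polynomial ℂ) (z : ℂ) : seriesValue (p : PowerSeries ℂ) z = p.eval z := by
  rw [seriesValue, tsum_eq_sum (s := Finset.range (p.natDegree + 1)), Polynomial.eval_eq_sum_range]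
  · simp only [Polynomial.coeff_coe]
  · intro n hn
    rw [Polynomial.coeff_coe, Polynomial.coeff_eq_zero_of_natDegree_lt, zero_mul]
    simpa using hn

theorem AbsConvergent.pow (hr : 0 ≤ r) (hf : AbsConvergent f r) (k : ℕ) :
    AbsConvergent (f ^ k) r := by
  induction k with
  | zero => simpa using absConvergent_coe 1 r
  | succ k ih => rw [pow_succ]; exact ih.mul hr hf

theorem seriesValue_pow (hz : ‖z‖ = r) (hr : 0 ≤ r) (hf : AbsConvergent f r) (k : ℕ) :
    seriesValue (f ^ k) z = seriesValue f z ^ k := by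
  induction k with
  | zero => simpa using seriesValue_coe 1 z
  | succ k ih => rw [pow_succ, seriesValue_mul hz (hf.pow hr k) hf, ih, pow_succ]

theorem AbsConvergent.continuousOn (hf : AbsConvergent f r) :
    ContinuousOn (seriesValue f) (Metric.sphere 0 r) := by
  refine continuousOn_tsum (fun n => by fun_prop) hf fun n z hz => ?_
  rw [norm_mul, norm_pow, show ‖z‖ = r by simpa using hz]

end Evaluation

/-! ### The covariance as a contour integral -/

section Covariance

/-- The power series of `F(1 + z)`. -/
def limitSeries (c : ℕ → ℝ) : PowerSeries ℂ :=
  PowerSeries.mk fun k => (c (k + 1) : ℂ) / (k.factorial : ℂ)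

/-- The power series `((1 + X) (a + a X F(1 + X))) ^ k`. -/
def symbolSeries (a : ℝ) (c : ℕ → ℝ) (k : ℕ) : PowerSeries ℂ :=
  (((1 + Polynomial.X : Polynomial ℂ) : PowerSeries ℂ) *
    (((Polynomial.C (a : ℂ) : Polynomial ℂ) : PowerSeries ℂ) +
      ((Polynomial.C (a : ℂ) * Polynomial.X : Polynomial ℂ) : PowerSeries ℂ) * limitSeries c)) ^ k

variable {a : ℝ} {c : ℕ → ℝ} {d : ℕ → ℕ → ℝ} {r : ℝ} {z : ℂ}

theorem seriesValue_limitSeries (c : ℕ → ℝ) (z : ℂ) :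
    seriesValue (limitSeries c) z = limitF c (1 + z) := by
  simp only [seriesValue, limitSeries, PowerSeries.coeff_mk, limitF, add_sub_cancel_left]

theorem absConvergent_symbolSeries (hr : 0 ≤ r) (hc : AbsConvergent (limitSeries c) r) (a : ℝ)
    (k : ℕ) : AbsConvergent (symbolSeries a c k) r :=
  ((absConvergent_coe _ r).mul hr ((absConvergent_coe _ r).add hr
    ((absConvergent_coe _ r).mul hr hc))).pow hr k

theorem seriesValue_symbolSeries (hr : 0 ≤ r) (hz : ‖z‖ = r) (hc : AbsConvergent (limitSeries c) r)
    (a : ℝ) (k : ℕ) : seriesValue (symbolSeries a c k) z =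
      ((1 + z) * (a + a * z * limitF c (1 + z))) ^ k := by
  have h1 : AbsConvergent (((Polynomial.C (a : ℂ) * Polynomial.X : Polynomial ℂ) :
      PowerSeries ℂ) * limitSeries c) r := (absConvergent_coe _ r).mul hr hc
  have h2 := (absConvergent_coe (Polynomial.C (a : ℂ)) r).add hr h1
  rw [symbolSeries, seriesValue_pow hz hr ((absConvergent_coe _ r).mul hr h2),
    seriesValue_mul hz (absConvergent_coe _ r) h2, seriesValue_add hz (absConvergent_coe _ r) h1,
    seriesValue_mul hz (absConvergent_coe _ r) hc, seriesValue_coe, seriesValue_coe, seriesValue_coe,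
    seriesValue_limitSeries]
  simp

/-- The truncated symbol differs from the full series by a multiple of X^D, since c_{k+1} / k! is
exactly (k + 1) c_{k+1} / (k + 1)!. -/
theorem coeff_symbolSeries {D n : ℕ} (hn : n < D) (a : ℝ) (c : ℕ → ℝ) (k : ℕ) :
    PowerSeries.coeff n (symbolSeries a c k) = (levelSymbol a c D k).coeff n := by
  have h1 : (PowerSeries.X : PowerSeries ℂ) ^ D ∣
      symbolSeries a c k - (levelSymbol a c D k : PowerSeries ℂ) := by
    have h2 : (PowerSeries.X : PowerSeries ℂ) ^ D ∣
        PowerSeries.C (a : ℂ) * limitSeries c - (limitAlpha a c D : PowerSeries ℂ) := by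
      rw [PowerSeries.X_pow_dvd_iff]
      intro m hm
      rw [map_sub, PowerSeries.coeff_C_mul, limitSeries, PowerSeries.coeff_mk, Polynomial.coeff_coe,
        limitAlpha, Polynomial.finsetSum_coeff, Finset.sum_eq_single m]
      · simp only [Polynomial.coeff_smul, Polynomial.coeff_X_pow_self, smul_eq_mul,
          Nat.factorial_succ]
        have : (m.factorial : ℂ) ≠ 0 := by exact_mod_cast m.factorial_ne_zero
        have h3 : (m : ℂ) + 1 ≠ 0 := by exact_mod_cast m.succ_ne_zero
        push_cast
        field_simp
        ring
      · intro i _ hi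
        simp [Polynomial.coeff_X_pow, hi.symm]
      · intro h
        exact absurd (Finset.mem_range.2 hm) h
    rw [symbolSeries, levelSymbol, limitSymbol, Polynomial.coe_pow]
    refine dvd_trans ?_ (sub_dvd_pow_sub_pow _ _ k)
    refine (h2.mul_left ((1 + PowerSeries.X) * PowerSeries.X)).trans (dvd_of_eq ?_)
    simp only [Polynomial.coe_mul, Polynomial.coe_add, Polynomial.coe_C, Polynomial.coe_X,
      Polynomial.coe_one]
    ring
  have h2 := PowerSeries.X_pow_dvd_iff.1 h1 n hn
  rwa [map_sub, sub_eq_zero, Polynomial.coeff_coe] at h2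

/-- Translates the residue index k - 1 - j, possibly negative, into a coefficient of the polynomial
shifted by X^j. Both conventions give zero when j ≥ k. -/
theorem intCoeff_symbolSeries {D k : ℕ} (hk : 0 < k) (hD : k ≤ D) (a : ℝ) (c : ℕ → ℝ) (K j : ℕ) :
    intCoeff (symbolSeries a c K) ((k : ℤ) - 1 - j) =
      (levelSymbol a c D K * Polynomial.X ^ j).coeff (k - 1) := by
  rw [Polynomial.coeff_mul_X_pow']
  split_ifs with h
  · have h1 : (k : ℤ) - 1 - j = ((k - 1 - j : ℕ) : ℤ) := by omega
    rw [h1]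
    exact coeff_symbolSeries (by omega) a c K
  · obtain ⟨m, hm⟩ : ∃ m : ℕ, (k : ℤ) - 1 - j = Int.negSucc m := ⟨j - k, by omega⟩
    rw [hm, intCoeff]

/-- The derivative of the geometric series in z / w. The condition is the reason for taking the
contour of w outside that of z. -/
theorem hasSum_inv_sub_sq {z w : ℂ} (hzw : ‖z‖ < ‖w‖) :
    HasSum (fun j : ℕ => ((j : ℂ) + 1) * z ^ (j : ℤ) * w ^ (-((j : ℤ) + 2))) (1 / (z - w) ^ 2) := by
  have hw : w ≠ 0 := by
    rintro rfl
    rw [norm_zero] at hzw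
    exact absurd hzw (not_lt.2 (norm_nonneg z))
  have h1 := (hasSum_choose_mul_geometric_of_norm_lt_one 1 (r := z / w) (by
    rw [norm_div, div_lt_one (norm_pos_iff.2 hw)]
    exact hzw)).mul_left (w ^ (-2 : ℤ))
  have hne : w - z ≠ 0 := by
    intro h
    rw [sub_eq_zero] at h
    rw [h] at hzw
    exact lt_irrefl _ hzw
  have e1 : w ^ (-2 : ℤ) * (1 / (1 - z / w) ^ (1 + 1)) = 1 / (z - w) ^ 2 := by
    have h2 : z - w ≠ 0 := by rw [← neg_sub]; exact neg_ne_zero.2 hne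
    have h3 : 1 - z / w = (w - z) / w := by field_simp
    rw [h3, zpow_neg]
    have h4 : (z - w) ^ 2 = (w - z) ^ 2 := by ring
    rw [h4]
    rw [show 1 + 1 = 2 from rfl, div_pow]
    norm_cast
    field_simp
  rw [e1] at h1
  refine Eq.mp (congrArg (fun f => HasSum f _) (funext fun j => ?_)) h1
  rw [Nat.choose_one_right, neg_add, zpow_add₀ hw, zpow_neg w j, zpow_natCast, zpow_natCast, div_pow]
  push_cast
  rw [div_eq_mul_inv]
  ring

/-- On the circle, a (1/z + 1 + (1+z) F(1+z)) = z⁻¹ (1+z) (a + a z F(1+z)), so the k-th power is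
z^(-k) times the full symbol. Expanding Q into its Laurent series and integrating termwise extracts
coefficients of the two symbols. The expansion of 1 / (z - w)² produces the first sum of `limitCov`
and G the second, after symmetrization by means of the symmetry of `d`. -/
theorem contourCov_eq_limitCov (a₁ a₂ : ℝ) (c₁ c₂ : ℕ → ℝ)
    (hd : ∀ k l, 1 ≤ k → 1 ≤ l → d k l = d l k) {ε : ℝ} (hε : 0 < ε)
    (h₁ : AbsConvergent (limitSeries c₁) ε) (h₂ : AbsConvergent (limitSeries c₂) (2 * ε))
    (h₃ : Summable fun q : ℕ × ℕ => ‖(d (q.1 + 1) (q.2 + 1) : ℂ) /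
      ((q.1.factorial : ℂ) * (q.2.factorial : ℂ))‖ * ε ^ q.1 * (2 * ε) ^ q.2)
    {k₁ k₂ D : ℕ} (hk₁ : 0 < k₁) (hk₂ : 0 < k₂) (hD : k₁ + k₂ < D) :
    contourCov a₁ a₂ k₁ k₂ (limitF c₁) (limitF c₂) (limitQ d) ε =
      limitCov (levelSymbol a₁ c₁ D k₁) (levelSymbol a₂ c₂ D k₂) d D k₁ k₂ := by
  have h2ε : 0 < 2 * ε := by positivity
  set g : ℕ × ℕ → ℂ := fun q => (d (q.1 + 1) (q.2 + 1) : ℂ) /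
      ((q.1.factorial : ℂ) * (q.2.factorial : ℂ)) with hg
  -- A single index set for Q: the left summand enumerates the terms of 1 / (z - w)², the right one
  -- those of G.
  set C : ℕ ⊕ ℕ × ℕ → ℂ := Sum.elim (fun j => (j : ℂ) + 1) g with hC
  set p : ℕ ⊕ ℕ × ℕ → ℤ := Sum.elim (fun j => (j : ℤ)) fun q => (q.1 : ℤ) with hp
  set q : ℕ ⊕ ℕ × ℕ → ℤ := Sum.elim (fun j => -((j : ℤ) + 2)) fun q => (q.2 : ℤ) with hq
  set f₁ : ℂ → ℂ := fun z => z ^ (-(k₁ : ℤ)) * seriesValue (symbolSeries a₁ c₁ k₁) z with hf₁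
  set f₂ : ℂ → ℂ := fun z => z ^ (-(k₂ : ℤ)) * seriesValue (symbolSeries a₂ c₂ k₂) z with hf₂
  have hs₁ := absConvergent_symbolSeries hε.le h₁ a₁ k₁
  have hs₂ := absConvergent_symbolSeries h2ε.le h₂ a₂ k₂
  have hnorm : ∀ {r : ℝ}, ∀ z ∈ Metric.sphere (0 : ℂ) r, ‖z‖ = r := fun z hz => by simpa using hz
  have hsumC : Summable fun j => ‖C j‖ * ε ^ p j * (2 * ε) ^ q j := by
    refine Summable.sum _ ?_ ?_
    · have := (hasSum_inv_sub_sq (z := (ε : ℂ)) (w := ((2 * ε : ℝ) : ℂ)) (by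
        rw [Complex.norm_real, Complex.norm_real, Real.norm_of_nonneg hε.le,
          Real.norm_of_nonneg h2ε.le]
        linarith)).summable.norm
      refine this.congr fun j => ?_
      rw [norm_mul, norm_mul, norm_zpow, norm_zpow, Complex.norm_real, Complex.norm_real,
        Real.norm_of_nonneg hε.le, Real.norm_of_nonneg h2ε.le]
      rfl
    · refine h₃.congr fun q => ?_
      simp only [hC, hp, hq, Function.comp_apply, Sum.elim_inr, zpow_natCast, hg]
  have hQ : ∀ z ∈ Metric.sphere (0 : ℂ) ε, ∀ w ∈ Metric.sphere (0 : ℂ) (2 * ε),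
      HasSum (fun j => C j * z ^ p j * w ^ q j) (limitQ d z w) := by
    intro z hz w hw
    rw [limitQ, add_comm]
    refine HasSum.sum ?_ ?_
    · exact hasSum_inv_sub_sq (by rw [hnorm z hz, hnorm w hw]; linarith)
    · have h4 : Summable fun q : ℕ × ℕ => g q * z ^ q.1 * w ^ q.2 := by
        refine Summable.of_norm (h₃.congr fun q => ?_)
        rw [norm_mul, norm_mul, norm_pow, norm_pow, hnorm z hz, hnorm w hw]
      have h5 := h4.hasSum
      simp only [limitG, add_sub_cancel_left]
      refine Eq.mp (congrArg (fun f => HasSum f _) (funext fun q => ?_)) h5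
      simp only [hC, hp, hq, Function.comp_apply, Sum.elim_inr, zpow_natCast]
  have hcont : ∀ {r : ℝ} {f : PowerSeries ℂ} (k : ℤ), 0 < r → AbsConvergent f r →
      ContinuousOn (fun z => z ^ k * seriesValue f z) (Metric.sphere 0 r) :=
    fun k hr hf => (continuousOn_zpow_sphere hr k).mul hf.continuousOn
  have hint := hasSum_circleIntegral_circleIntegral hε h2ε hsumC (hcont (-(k₁ : ℤ)) hε hs₁)
    (hcont (-(k₂ : ℤ)) h2ε hs₂) hQ
  have hcoef : ∀ {r : ℝ} {f : PowerSeries ℂ} (k e : ℤ), 0 < r → AbsConvergent f r →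
      (∮ z in C(0, r), z ^ e * (z ^ (-k) * seriesValue f z)) =
        2 * Real.pi * Complex.I * intCoeff f (k - 1 - e) := by
    intro r f k e hr hf
    rw [show k - 1 - e = -1 - (e - k) by ring, ← circleIntegral_zpow_mul hr hf
      (fun z hz => hf.hasSum (hnorm z hz))]
    refine circleIntegral.integral_congr hr.le fun z hz => ?_
    rw [← mul_assoc, ← zpow_add₀ (ne_zero_of_mem_sphere hr.ne' ⟨z, hz⟩), sub_eq_add_neg]
  simp only [hcoef _ _ hε hs₁, hcoef _ _ h2ε hs₂] at hint
  have hlhs : contourCov a₁ a₂ k₁ k₂ (limitF c₁) (limitF c₂) (limitQ d) ε =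
      1 / (2 * Real.pi * Complex.I) ^ 2 *
        ∮ z in C(0, ε), ∮ w in C(0, 2 * ε), f₁ z * f₂ w * limitQ d z w := by
    have hpow : ∀ {r : ℝ} {c : ℕ → ℝ} (a : ℝ) (k : ℕ), 0 < r → AbsConvergent (limitSeries c) r →
        ∀ z ∈ Metric.sphere (0 : ℂ) r, z ^ (-(k : ℤ)) * seriesValue (symbolSeries a c k) z =
          (a : ℂ) ^ k * (1 / z + 1 + (1 + z) * limitF c (1 + z)) ^ k := by
      intro r c a k hr hc z hz
      have hz0 : z ≠ 0 := ne_zero_of_mem_sphere hr.ne' ⟨z, hz⟩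
      rw [seriesValue_symbolSeries hr.le (hnorm z hz) hc, zpow_neg, zpow_natCast, ← inv_pow,
        ← mul_pow, ← mul_pow]
      congr 1
      field_simp
    rw [contourCov, div_mul_eq_mul_div, div_mul_eq_mul_div, one_mul]
    congr 1
    rw [← circleIntegral.integral_const_mul]
    refine circleIntegral.integral_congr hε.le fun z hz => ?_
    rw [← circleIntegral.integral_const_mul]
    refine circleIntegral.integral_congr h2ε.le fun w hw => ?_
    simp only [hf₁, hf₂]
    rw [hpow a₁ k₁ hε h₁ z hz, hpow a₂ k₂ h2ε h₂ w hw]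
    ring
  have hpi : (2 * Real.pi * Complex.I : ℂ) ≠ 0 := Complex.two_pi_I_ne_zero
  -- Only finitely many terms survive, as coefficients with negative index vanish: for the left part
  -- when j ≥ k₁, for the right part when either exponent reaches `D`.
  have hfin := hasSum_sum_of_ne_finset_zero (f := fun j => C j * (2 * Real.pi * Complex.I *
      intCoeff (symbolSeries a₁ c₁ k₁) (k₁ - 1 - p j)) * (2 * Real.pi * Complex.I *
      intCoeff (symbolSeries a₂ c₂ k₂) (k₂ - 1 - q j)))
      (s := (Finset.range k₁).disjSum (Finset.range D ×ˢ Finset.range D)) (L := .unconditional _) (by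
    rintro (j | ⟨k, l⟩) hj
    · simp only [Finset.inl_mem_disjSum, Finset.mem_range, not_lt] at hj
      simp only [hp, Sum.elim_inl]
      rw [intCoeff_symbolSeries (D := D) hk₁ (by omega), Polynomial.coeff_mul_X_pow',
        if_neg (by omega)]
      ring
    · simp only [Finset.inr_mem_disjSum, Finset.mem_product, Finset.mem_range, not_and_or,
        not_lt] at hj
      simp only [hp, hq, Sum.elim_inr]
      rw [intCoeff_symbolSeries (D := D) hk₁ (by omega),
        intCoeff_symbolSeries (D := D) hk₂ (by omega), Polynomial.coeff_mul_X_pow',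
        Polynomial.coeff_mul_X_pow']
      rcases hj with hj | hj
      · rw [if_neg (by omega)]
        ring
      · rw [if_neg (c := l ≤ k₂ - 1) (by omega)]
        ring)
  rw [hlhs, hint.unique hfin, Finset.sum_disjSum, limitCov, mul_add]
  congr 1
  · rw [Finset.mul_sum]
    refine Finset.sum_congr rfl fun j hj => ?_
    rw [Finset.mem_range] at hj
    simp only [hC, hp, hq, Sum.elim_inl]
    rw [intCoeff_symbolSeries (D := D) hk₁ (by omega)]
    -- The exponent -(j + 2) of w moves the residue index beyond k₂; this is the tail of the second
    -- symbol.
    have h5 : (k₂ : ℤ) - 1 - -((j : ℤ) + 2) = ((k₂ + 1 + j : ℕ) : ℤ) := by push_cast; ring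
    have h6 : intCoeff (symbolSeries a₂ c₂ k₂) ((k₂ + 1 + j : ℕ) : ℤ) =
        (levelSymbol a₂ c₂ D k₂).coeff (k₂ + 1 + j) := coeff_symbolSeries (by omega) a₂ c₂ k₂
    rw [h5, h6]
    field_simp
  · simp only [hC, hp, hq, Sum.elim_inr]
    rw [Finset.sum_product, Finset.mul_sum]
    simp only [intCoeff_symbolSeries (D := D) hk₁ (show k₁ ≤ D by omega),
      intCoeff_symbolSeries (D := D) hk₂ (show k₂ ≤ D by omega)]
    set u : ℕ → ℂ := fun k => (levelSymbol a₁ c₁ D k₁ * Polynomial.X ^ k).coeff (k₁ - 1)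
    set v : ℕ → ℂ := fun l => (levelSymbol a₂ c₂ D k₂ * Polynomial.X ^ l).coeff (k₂ - 1)
    -- The residues give the sum once, `limitCov` gives half of it plus half of its transpose.
    have hsymm : ∀ k l, g (k, l) = g (l, k) := by
      intro k l
      simp only [hg]
      rw [hd _ _ (by omega) (by omega), mul_comm]
    have e1 : ∀ k l : ℕ, (d (k + 1) (l + 1) : ℂ) / (((k + 1).factorial : ℂ) * ((l + 1).factorial : ℂ)) *
        (((l : ℂ) + 1) * (v l * (((k : ℂ) + 1) * u k)) +
          ((k : ℂ) + 1) * (v k * (((l : ℂ) + 1) * u l))) =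
        g (k, l) * u k * v l + g (k, l) * u l * v k := by
      intro k l
      have hk0 : (k.factorial : ℂ) ≠ 0 := by exact_mod_cast k.factorial_ne_zero
      have hl0 : (l.factorial : ℂ) ≠ 0 := by exact_mod_cast l.factorial_ne_zero
      have hk1 : (k : ℂ) + 1 ≠ 0 := by exact_mod_cast k.succ_ne_zero
      have hl1 : (l : ℂ) + 1 ≠ 0 := by exact_mod_cast l.succ_ne_zero
      simp only [hg, Nat.factorial_succ]
      push_cast
      field_simp
    have e2 : ∑ k ∈ Finset.range D, ∑ l ∈ Finset.range D, g (k, l) * u l * v k =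
        ∑ k ∈ Finset.range D, ∑ l ∈ Finset.range D, g (k, l) * u k * v l := by
      rw [Finset.sum_comm]
      refine Finset.sum_congr rfl fun k _ => Finset.sum_congr rfl fun l _ => ?_
      rw [hsymm]
    refine Eq.trans ?_ (congrArg (fun x => (2 : ℂ)⁻¹ * x) (Finset.sum_congr rfl fun k _ =>
      Finset.sum_congr rfl fun l _ => (e1 k l).symm))
    simp only [Finset.sum_add_distrib]
    rw [e2, ← two_mul, inv_mul_cancel_left₀ two_ne_zero]
    refine Finset.sum_congr rfl fun k _ => ?_
    rw [Finset.mul_sum]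
    refine Finset.sum_congr rfl fun l _ => ?_
    field_simp
    rfl

end Covariance

/-! ### A common radius of convergence -/

section Radius

theorem AbsConvergent.mono {f : PowerSeries ℂ} {r s : ℝ} (hs : AbsConvergent f s) (hr : 0 ≤ r)
    (h : r ≤ s) : AbsConvergent f r :=
  Summable.of_nonneg_of_le (fun n => by positivity) (fun n => by gcongr) hs

/-- Evaluation of both series at 1 + r with a small positive real r; in ℂ summability is absolute,
so the norms are summable there. -/
theorem HasLimits.exists_radius {m : ℕ → ℕ} {F : ∀ N, (Fin (m N) → ℂ) → ℂ} {c : ℕ → ℝ}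
    {d : ℕ → ℕ → ℝ} (h : HasLimits m F c d) : ∃ r > 0, AbsConvergent (limitSeries c) r ∧
      Summable fun q : ℕ × ℕ => ‖(d (q.1 + 1) (q.2 + 1) : ℂ) /
        ((q.1.factorial : ℂ) * (q.2.factorial : ℂ))‖ * r ^ q.1 * r ^ q.2 := by
  have h1 : Tendsto (fun r : ℝ => (1 + r : ℂ)) (𝓝[>] 0) (𝓝 1) := by
    have : Continuous fun r : ℝ => (1 + r : ℂ) := by fun_prop
    have h2 := (this.tendsto 0).mono_left (nhdsWithin_le_nhds (s := Set.Ioi 0))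
    simpa using h2
  obtain ⟨r, ⟨hr1, hr2⟩, hr⟩ := (((h1.eventually h.summable_one).and
    ((h1.prodMk_nhds h1).eventually h.summable_two)).and self_mem_nhdsWithin).exists
  have hr' : 0 < r := hr
  refine ⟨r, hr', ?_, ?_⟩
  · refine hr1.norm.congr fun k => ?_
    rw [add_sub_cancel_left, norm_mul, norm_pow, Complex.norm_real, Real.norm_of_nonneg hr'.le,
      limitSeries, PowerSeries.coeff_mk]
  · refine hr2.norm.congr fun q => ?_
    simp only [add_sub_cancel_left]
    rw [norm_mul, norm_mul, norm_pow, norm_pow, Complex.norm_real, Real.norm_of_nonneg hr'.le]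

end Radius

end SchurCLT

end

/-! ### Assembly of the theorem -/

theorem theorem2p6 (n : ℕ) (a : Fin (n + 1) → ℝ) (ha : ∀ t, 0 < a t) (hmono : Monotone a)
    (ρ : ∀ (N : ℕ) (t : Fin (n + 1)), PMF (Signature (levelSize a N t)))
    (hρ : ∀ t, IsAppropriateMeasure (fun N => levelSize a N t) (fun N => ρ N t)) :
    -- the chain is well defined, with the transition probabilities given by the expansion
    (∀ (N : ℕ) (i : Fin n) (l : Signature (levelSize a N i.succ)),
      IsTransition (schurGen (ρ N i.castSucc)) l (transition (schurGen (ρ N i.castSucc)) l)) ∧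
    (∀ N : ℕ, IsProbabilityMeasure (jointLaw (ρ N))) ∧
    -- the level functions `H_t` are appropriate, so that they have limit functions
    (∀ t, IsAppropriate (fun N => levelSize a N t) (fun N => levelFun (ρ N) t)) ∧
    -- the central limit theorem, in terms of the limit functions of the `H_t`
    ∀ (c : Fin (n + 1) → ℕ → ℝ) (d : Fin (n + 1) → ℕ → ℕ → ℝ),
      (∀ t, HasLimits (fun N => levelSize a N t) (fun N => levelFun (ρ N) t) (c t) (d t)) →
      ∃ C : Fin (n + 1) × ℕ+ → Fin (n + 1) × ℕ+ → ℝ,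
        AsymptoticallyGaussian (fun N => jointLaw (ρ N))
          (fun N q l => ((N : ℝ) ^ (q.2 : ℕ))⁻¹ *
            (powerSum q.1 q.2 l - ∫ l', powerSum q.1 q.2 l' ∂(jointLaw (ρ N)))) C ∧
        (∀ (t₁ t₂ : Fin (n + 1)) (k₁ k₂ : ℕ+),
          Tendsto (fun N : ℕ => cov[powerSum t₁ k₁, powerSum t₂ k₂; jointLaw (ρ N)] /
            (N : ℝ) ^ ((k₁ : ℕ) + (k₂ : ℕ))) atTop (𝓝 (C (t₁, k₁) (t₂, k₂)))) ∧
        ∃ ε₀ > 0, ∀ ε : ℝ, 0 < ε → ε < ε₀ → ∀ (t₁ t₂ : Fin (n + 1)) (k₁ k₂ : ℕ+), t₁ ≤ t₂ →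
          (C (t₁, k₁) (t₂, k₂) : ℂ) = contourCov (a t₁) (a t₂) k₁ k₂ (limitF (c t₁))
            (limitF (c t₂)) (limitQ (d t₂)) ε := by
  refine ⟨fun N i l => isTransition_transition
    (levelSize_monotone hmono N (Fin.castSucc_lt_succ).le) ((hρ _).1 N) l, fun N => ?_,
    fun t => isAppropriate_levelFun ha hmono hρ t, fun c d h => ?_⟩
  · refine isProbabilityMeasure_jointLaw (levelSize_monotone hmono N) (ρ N) (fun t => (hρ t).1 N)
      fun t => ?_
    obtain ⟨c', d', h'⟩ := (hρ t).2
    exact h'.analyticAt N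
  · obtain ⟨C, hC, hCL⟩ := exists_covariance ha hmono hρ h
    refine ⟨C, fun s idx => ?_, fun t₁ t₂ k₁ k₂ => ?_, ?_⟩
    · have hS := posSemidef_covariance hmono hρ hC idx
      refine ⟨hS, fun N => ?_, tendsto_integral_gaussian ha hmono hρ h hCL idx hS⟩
      have h1 := integrable_scaledSum_word hmono hρ N (List.ofFn idx)
      simp only [List.map_ofFn, List.prod_ofFn, Function.comp_apply] at h1
      exact h1
    · exact (hC (t₁, k₁) (t₂, k₂)).congr fun N => (covariance_powerSum N (t₁, k₁) (t₂, k₂)).symm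
    · choose r hr hr1 hr2 using fun t => (h t).exists_radius
      obtain ⟨t₀, ht₀⟩ := Finite.exists_min r
      -- Half of the smallest of the radii of the levels, because the outer contour has radius 2ε.
      refine ⟨r t₀ / 2, half_pos (hr t₀), fun ε hε hεr t₁ t₂ k₁ k₂ ht => ?_⟩
      have hε₂ : ∀ t, 2 * ε ≤ r t := fun t => by linarith [ht₀ t]
      rw [hCL (t₁, k₁) (t₂, k₂) _ ht (Nat.lt_succ_self _)]
      refine (contourCov_eq_limitCov _ _ _ _ (fun k l hk hl => (h t₂).two_indices_symm hk hl) hε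
        ((hr1 t₁).mono hε.le (by linarith [hε₂ t₁])) ((hr1 t₂).mono (by positivity) (hε₂ t₂)) ?_
        k₁.pos k₂.pos (Nat.lt_succ_self _)).symm
      refine Summable.of_nonneg_of_le (fun q => by positivity) (fun q => ?_) (hr2 t₂)
      have h1 : ε ≤ r t₂ := by linarith [hε₂ t₂]
      have h2 := hε₂ t₂
      have h3 : 0 ≤ r t₂ := (hr t₂).le
      gcongr
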